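/- Let $\Omega\subset\mathbb{R}^3$ be open and $g:\Omega\to\mathbb{R}$ smooth. For an open set $U\subset\subset\Omega$ (that is, $\overline U$ is compact and contained in $\Omega$) and a measurable set $C$ write $$\mathcal{E}_U(C)=\mathrm{Per}_U(C)+\int_{C\cap U}g\,d\mathcal{L}^3,\qquad \mathrm{Per}_U(C)=\sup\Big\{\int_C \mathrm{div}\,T:\ T\in C^1_c(U;\mathbb{R}^3),\ |T|\le 1\Big\}.$$ Let $E\subset\mathbb{R}^3$ be a set of locally finite perimeter that equals the set of its points of Lebesgue density $1$. Let $U\subset\subset\Omega$ be open such that $\partial E\cap U=D_1\cup D_2$, where $D_1,D_2$ are smooth open disks, properly embedded in $U$, with $D_1\cap D_2=\{p\}$ and with the same tangent plane $P$ at $p$. *Ambient stationarity.* Assume that $\frac{d}{dt}\big|_{t=0}\mathcal{E}_U(\psi_t(E))=0$ for every family $(\psi_t)_{t\in(-\varepsilon,\varepsilon)}$ of $C^1$ diffeomorphisms of $\mathbb{R}^3$ such that $\psi_0=\mathrm{Id}$, $\psi_t=\mathrm{Id}$ on $\mathbb{R}^3\setminus U$, $\psi_t(x)$ is $C^1$ in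 $(t,x)$, $\partial_t D_x\psi_t(x)$ exists and is continuous in $(t,x)$, the initial speed $\partial_t\psi_t|_{t=0}$ is in $C^1_c(U;\mathbb{R}^3)$, and $|\psi_t(E\cap K)|=|E\cap K|$ for all $t$ and every connected component $K$ of $\overline E\cap U$. *Coalescence/break-up deformations.* Such a deformation of $E$ in $U$ consists of a map $\Psi:[0,\varepsilon)\times(S^1\times(-1,1))\to U$, $\varepsilon>0$, and of sets $E_t$ of locally finite perimeter, $t\in[0,\varepsilon)$, such that, with $\psi^t=\Psi(t,\cdot)$: $\Psi$ is $C^1$ in $(t,x)$ and $C^2$ in $t$; $\psi^0$ is proper as a map to $U$, has image $\partial E\cap U$ and maps $S^1\times\{0\}$ to $p$; each $\psi^t$ restricted to $S^1\times((-1,0)\cup(0,1))$ is a $C^1$ embedding; there is an open ball $B\subset\subset U$ containing $p$ such that $\psi^t=\psi^0$ outside $(\psi^0)^{-1}(B)$ for all $t$; the initial speed $\partial_t\psi^t|_{t=0^+}$ is $C^1$ and bounded; $E_0=E$, $E_t\setminus U=E\setminus U$, $\partial E_t\cap U$ is the image of $\psi^t$, and $t\mapsto\chi_{E_t}$ is continuous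 in $L^1(U)$. It is volume-preserving if $|E_t\cap U|$ is constant in $t$. $E$ is *stable* in $U$ for these deformations if, along every volume-preserving one for which $\frac{d}{dt}\big|_{t=0^+}\mathcal{E}_U(E_t)=0$ and the second derivative at $0^+$ exists, $\frac{d^2}{dt^2}\big|_{t=0^+}\mathcal{E}_U(E_t)\ge 0$. Then $E$ is not stable in $U$ for volume-preserving coalescence/break-up deformations. Moreover, for every $\eta>0$ there is a volume-preserving coalescence/break-up deformation with $$\frac{d}{dt}\Big|_{t=0^+}\mathcal{E}_U(E_t)=0,\qquad \Big|\frac{d^2}{dt^2}\Big|_{t=0^+}\mathcal{E}_U(E_t)+4\pi\Big|<\eta,$$ which near $S^1\times\{0\}$ is the radial opening of a neck at $p$: for some orthonormal basis $e_1,e_2$ of $P$ and some $\delta>0$, and for all $\omega=e^{i\theta}\in S^1$, $|z|<\delta$, writing $\vec\omega=\cos\theta\,e_1+\sin\theta\,e_2$, the orthogonal projection of $\psi^0(\omega,z)-p$ to $P$ is a non-negative multiple of $\vec\omega$, and $\psi^t(\omega,z)=\psi^0(\omega,z)+t\,\vec\omega$ for all $t\in[0,\varepsilon)$. -/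

import Mathlib

open Set Filter Topology MeasureTheory Metric
open scoped ContDiff ENNReal

/-- Three-dimensional Euclidean space. -/
abbrev R3 : Type := EuclideanSpace ℝ (Fin 3)

/-- The Euclidean plane. -/
abbrev R2 : Type := EuclideanSpace ℝ (Fin 2)

noncomputable section

/-! ### Perimeter, Caccioppoli sets and the free energy -/

/-- Divergence of a vector field on `ℝ³`. -/
def divergence (T : R3 → R3) (x : R3) : ℝ :=
  ∑ i : Fin 3, (fderiv ℝ T x (EuclideanSpace.single i 1)) i

/-- `T ∈ C¹_c(U; ℝ³)`. -/
structure IsTestField (U : Set R3) (T : R3 → R3) : Prop where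
  contDiff : ContDiff ℝ 1 T
  hasCompactSupport : HasCompactSupport T
  tsupport_subset : tsupport T ⊆ U

/-- `Per_U(C) = sup { ∫_C div T : T ∈ C¹_c(U; ℝ³), sup |T| ≤ 1 }`. -/
def perimeter (U C : Set R3) : ℝ≥0∞ :=
  ⨆ (T : R3 → R3) (_ : IsTestField U T) (_ : ∀ x, ‖T x‖ ≤ 1),
    ENNReal.ofReal (∫ x in C, divergence T x)

/-- Sets of locally finite perimeter in `ℝ³`. -/
def IsCaccioppoli (C : Set R3) : Prop :=
  MeasurableSet C ∧
    ∀ V : Set R3, IsOpen V → Bornology.IsBounded V → perimeter V C ≠ ⊤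

/-- `E` is its own Lebesgue representative: it is the set of its points of density `1`. -/
def IsLebesgueRepresentative (E : Set R3) : Prop :=
  ∀ x, x ∈ E ↔
    Tendsto (fun r : ℝ => volume (E ∩ ball x r) / volume (ball x r)) (𝓝[>] 0) (𝓝 1)

/-- The free energy `𝓔_U(C) = Per_U(C) + ∫_{C ∩ U} g`. -/
def energy (g : R3 → ℝ) (U C : Set R3) : ℝ :=
  (perimeter U C).toReal + ∫ x in C ∩ U, g x

/-! ### Ambient deformations -/

/-- A one-parameter family `ψ_t`, `t ∈ (-ε, ε)`, of `C¹` diffeomorphisms of `ℝ³` that fix the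
complement of `U`, with `ψ_0 = Id`, depending in a `C¹` way on `t` (together with the spatial
differential), and with initial speed in `C¹_c(U; ℝ³)`. -/
structure IsAmbientDeformation (U : Set R3) (ε : ℝ) (ψ : ℝ → R3 → R3) : Prop where
  pos : 0 < ε
  contDiffOn : ContDiffOn ℝ 1 (fun q : ℝ × R3 => ψ q.1 q.2) (Ioo (-ε) ε ×ˢ univ)
  fderiv_contDiff : ∃ W : ℝ → R3 → (R3 →L[ℝ] R3),
    (∀ t ∈ Ioo (-ε) ε, ∀ x, HasDerivAt (fun s => fderiv ℝ (ψ s) x) (W t x) t) ∧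
    ContinuousOn (fun q : ℝ × R3 => W q.1 q.2) (Ioo (-ε) ε ×ˢ univ)
  diffeo : ∀ t ∈ Ioo (-ε) ε, ∃ σ : R3 → R3, ContDiff ℝ 1 σ ∧
    Function.LeftInverse σ (ψ t) ∧ Function.RightInverse σ (ψ t)
  zero : ∀ x, ψ 0 x = x
  fixes : ∀ t ∈ Ioo (-ε) ε, ∀ x, x ∉ U → ψ t x = x
  velocity : IsTestField U (fun x => deriv (fun t => ψ t x) 0)

/-- The deformation separately preserves the volume of each connected component of
`closure E ∩ U`. -/
def AmbientVolumePreserving (U E : Set R3) (ε : ℝ) (ψ : ℝ → R3 → R3) : Prop :=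
  ∀ t ∈ Ioo (-ε) ε, ∀ x ∈ closure E ∩ U,
    volume (ψ t '' (E ∩ connectedComponentIn (closure E ∩ U) x)) =
      volume (E ∩ connectedComponentIn (closure E ∩ U) x)

/-- Stationarity of `E` in `U` for ambient volume-preserving deformations. -/
def IsAmbientStationary (g : R3 → ℝ) (U E : Set R3) : Prop :=
  ∀ (ε : ℝ) (ψ : ℝ → R3 → R3), IsAmbientDeformation U ε ψ → AmbientVolumePreserving U E ε ψ →
    HasDerivAt (fun t => energy g U (ψ t '' E)) 0 0

/-! ### Two disks touching tangentially at a point -/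

/-- `φ` parametrizes `D` as a smooth open disk, properly embedded in the open set `U`. -/
structure IsDiskParam (U D : Set R3) (φ : R2 → R3) : Prop where
  smooth : ContDiffOn ℝ ∞ φ (ball 0 1)
  immersion : ∀ a ∈ ball (0 : R2) 1, Function.Injective (fderiv ℝ φ a)
  embedding : IsEmbedding ((ball (0 : R2) 1).domRestrict φ)
  image_eq : φ '' ball 0 1 = D
  subset : D ⊆ U
  closed : ∃ Z : Set R3, IsClosed Z ∧ D = Z ∩ U

/-- `S` is the union of two smooth disks, properly embedded in `U`, whose only common point is
`p`, where they have the same tangent plane `P`. -/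
def IsTouchingDisks (U S : Set R3) (p : R3) (P : Submodule ℝ R3) : Prop :=
  ∃ (D₁ D₂ : Set R3) (φ₁ φ₂ : R2 → R3),
    IsDiskParam U D₁ φ₁ ∧ IsDiskParam U D₂ φ₂ ∧ S = D₁ ∪ D₂ ∧ D₁ ∩ D₂ = {p} ∧
    (∃ a ∈ ball (0 : R2) 1, φ₁ a = p ∧ LinearMap.range (fderiv ℝ φ₁ a : R2 →ₗ[ℝ] R3) = P) ∧
    (∃ a ∈ ball (0 : R2) 1, φ₂ a = p ∧ LinearMap.range (fderiv ℝ φ₂ a : R2 →ₗ[ℝ] R3) = P)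

/-! ### Coalescence and break-up deformations -/

/-- The cylinder `S¹ × (-1, 1)`. -/
def openCyl : Set (Circle × ℝ) := univ ×ˢ Ioo (-1) 1

/-- The cylinder without its central circle, `S¹ × ((-1, 0) ∪ (0, 1))`. -/
def puncturedCyl : Set (Circle × ℝ) := univ ×ˢ (Ioo (-1) 0 ∪ Ioo 0 1)

/-- A map on `S¹ × ℝ` read through the covering `(θ, z) ↦ (e^{iθ}, z)`. -/
def cylLift (f : Circle × ℝ → R3) (q : ℝ × ℝ) : R3 := f (Circle.exp q.1, q.2)

/-- `Ψ : [0, ε) × (S¹ × (-1, 1)) → U` is a coalescence or break-up deformation (with bounded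
`C¹` initial speed) of `E`, where `∂E ∩ U` is a pair of disks touching at `p`; `F t` are the
associated deformed sets. -/
structure IsCoalescence (U E : Set R3) (p : R3) (ε : ℝ) (Ψ : ℝ → Circle × ℝ → R3)
    (F : ℝ → Set R3) : Prop where
  pos : 0 < ε
  mapsTo : ∀ t ∈ Ico 0 ε, MapsTo (Ψ t) openCyl U
  /-- `Ψ` is `C¹` as a function of `(t, x)`. -/
  contDiffOn : ContDiffOn ℝ 1 (fun q : ℝ × (ℝ × ℝ) => cylLift (Ψ q.1) q.2)
    (Ico 0 ε ×ˢ (univ ×ˢ Ioo (-1) 1))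
  /-- `Ψ` is `C²` as a function of `t`. -/
  contDiffOn_time : ∀ x ∈ openCyl, ContDiffOn ℝ 2 (fun t => Ψ t x) (Ico 0 ε)
  /-- `Ψ 0` is proper as a map from the cylinder to `U`. -/
  proper_zero : ∀ K ⊆ U, IsCompact K → IsCompact (openCyl ∩ Ψ 0 ⁻¹' K)
  image_zero : Ψ 0 '' openCyl = frontier E ∩ U
  circle_zero : ∀ w : Circle, Ψ 0 (w, 0) = p
  /-- Away from the central circle, each `Ψ t` is a `C¹` embedding. -/
  embedding : ∀ t ∈ Ico 0 ε, IsEmbedding (puncturedCyl.domRestrict (Ψ t))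
  immersion : ∀ t ∈ Ico 0 ε, ∀ θ : ℝ, ∀ z ∈ Ioo (-1 : ℝ) 0 ∪ Ioo 0 1,
    Function.Injective (fderiv ℝ (cylLift (Ψ t)) (θ, z))
  /-- The deformation only acts in a ball compactly contained in `U` and containing `p`. -/
  localized : ∃ (c : R3) (r : ℝ), closedBall c r ⊆ U ∧ p ∈ ball c r ∧
    ∀ t ∈ Ico 0 ε, ∀ x ∈ openCyl, Ψ 0 x ∉ ball c r → Ψ t x = Ψ 0 x
  /-- The initial speed is `C¹` and bounded. -/
  speed : ∃ v : Circle × ℝ → R3,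
    (∀ x ∈ openCyl, HasDerivWithinAt (fun t => Ψ t x) (v x) (Ici 0) 0) ∧
    ContDiffOn ℝ 1 (cylLift v) (univ ×ˢ Ioo (-1) 1) ∧
    ∃ C : ℝ, ∀ x ∈ openCyl, ‖v x‖ ≤ C
  /-- The deformed sets start from `E`, agree with `E` outside `U`, have in `U` the image of
  `Ψ t` as topological boundary, and vary continuously in `L¹(U)`. -/
  set_zero : F 0 = E
  set_outside : ∀ t ∈ Ico 0 ε, F t \ U = E \ U
  caccioppoli : ∀ t ∈ Ico 0 ε, IsCaccioppoli (F t)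
  frontier_eq : ∀ t ∈ Ico 0 ε, frontier (F t) ∩ U = Ψ t '' openCyl
  continuous_L1 : ∀ t₀ ∈ Ico 0 ε,
    Tendsto (fun t => volume (symmDiff (F t) (F t₀) ∩ U)) (𝓝[Ico 0 ε] t₀) (𝓝 0)

/-- `|F t ∩ U|` is constant on `[0, ε)`. -/
def IsVolumePreserving (U : Set R3) (ε : ℝ) (F : ℝ → Set R3) : Prop :=
  ∀ t ∈ Ico 0 ε, volume (F t ∩ U) = volume (F 0 ∩ U)

/-- `d` is the second derivative of `e` at `0⁺`. -/
def HasSecondRightDeriv (e : ℝ → ℝ) (d : ℝ) : Prop :=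
  ∃ e' : ℝ → ℝ, (∀ᶠ t in 𝓝[≥] (0 : ℝ), HasDerivWithinAt e (e' t) (Ici 0) t) ∧
    HasDerivWithinAt e' d (Ici 0) 0

/-- Stability of `E` in `U` for volume-preserving coalescence and break-up deformations: the
second variation at `0⁺` is non-negative whenever the first variation at `0⁺` vanishes. -/
def IsCoalescenceStable (g : R3 → ℝ) (U E : Set R3) (p : R3) : Prop :=
  ∀ (ε : ℝ) (Ψ : ℝ → Circle × ℝ → R3) (F : ℝ → Set R3),
    IsCoalescence U E p ε Ψ F → IsVolumePreserving U ε F →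
    HasDerivWithinAt (fun t => energy g U (F t)) 0 (Ici 0) 0 →
    ∀ d : ℝ, HasSecondRightDeriv (fun t => energy g U (F t)) d → 0 ≤ d

/-- Near the central circle, `Ψ` is the horizontal radial opening of a neck at `p`: in terms of an
orthonormal basis `e₁, e₂` of `P`, the point of parameters `(w, z)` starts over the ray from `p`
in direction `w`, and moves with unit speed in that direction. -/
def IsRadialNeckOpening (p : R3) (P : Submodule ℝ R3) (ε : ℝ) (Ψ : ℝ → Circle × ℝ → R3) : Prop :=
  ∃ e₁ ∈ P, ∃ e₂ ∈ P, ‖e₁‖ = 1 ∧ ‖e₂‖ = 1 ∧ inner ℝ e₁ e₂ = 0 ∧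
    ∃ δ : ℝ, 0 < δ ∧ ∀ (w : Circle) (z : ℝ), |z| < δ →
      (∃ ρ : ℝ, 0 ≤ ρ ∧
        Ψ 0 (w, z) - p - ρ • ((w : ℂ).re • e₁ + (w : ℂ).im • e₂) ∈ Pᗮ) ∧
      ∀ t ∈ Ico 0 ε, Ψ t (w, z) = Ψ 0 (w, z) + t • ((w : ℂ).re • e₁ + (w : ℂ).im • e₂)

end

noncomputable section

/-- Orthonormal bases of `ℝ³`. -/
abbrev Frame : Type := OrthonormalBasis (Fin 3) ℝ R3

/-! ### Orthonormal coordinates on `ℝ³` -/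

section Chart

variable (p : R3) (b : Frame)

/-- The affine isometric chart `(y, h) ↦ p + y.re b 0 + y.im b 1 + h b 2` of `ℝ³`. -/
def chart (q : ℂ × ℝ) : R3 := p + (q.1.re • b 0 + q.1.im • b 1 + q.2 • b 2)

/-- The inverse of `chart p b`. -/
def chartInv (x : R3) : ℂ × ℝ :=
  (⟨inner ℝ (b 0) (x - p), inner ℝ (b 1) (x - p)⟩, inner ℝ (b 2) (x - p))

lemma chartInv_chart (q : ℂ × ℝ) : chartInv p b (chart p b q) = q := by
  ext <;> simp [chartInv, chart, inner_add_right, inner_smul_right, b.inner_eq_ite]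

lemma chart_chartInv (x : R3) : chart p b (chartInv p b x) = x := by
  have := b.sum_repr' (x - p)
  simp only [Fin.sum_univ_three] at this
  simp [chart, chartInv, this]

/-- The linear part of `chart p b`, as a continuous linear map. -/
def frameMap : ℂ × ℝ →L[ℝ] R3 :=
  ((Complex.reCLM.comp (ContinuousLinearMap.fst ℝ ℂ ℝ)).smulRight (b 0) +
    (Complex.imCLM.comp (ContinuousLinearMap.fst ℝ ℂ ℝ)).smulRight (b 1)) +
    (ContinuousLinearMap.snd ℝ ℂ ℝ).smulRight (b 2)

lemma frameMap_apply (q : ℂ × ℝ) :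
    frameMap b q = q.1.re • b 0 + q.1.im • b 1 + q.2 • b 2 := by
  simp [frameMap]

lemma chart_eq (q : ℂ × ℝ) : chart p b q = p + frameMap b q := by
  rw [frameMap_apply]; rfl

lemma contDiff_chart {n : WithTop ℕ∞} : ContDiff ℝ n (chart p b) := by
  have : chart p b = fun q => p + frameMap b q := funext (chart_eq p b)
  rw [this]
  exact contDiff_const.add (frameMap b).contDiff

lemma hasFDerivAt_chart (q : ℂ × ℝ) :
    HasFDerivAt (chart p b) (frameMap b) q := by
  have : chart p b = fun q => p + frameMap b q := funext (chart_eq p b)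
  rw [this]
  exact (frameMap b).hasFDerivAt.const_add p

lemma contDiff_chartInv {n : WithTop ℕ∞} : ContDiff ℝ n (chartInv p b) := by
  have h : ∀ i, ContDiff ℝ n (fun x : R3 => inner ℝ (b i) (x - p)) := fun i =>
    contDiff_const.inner ℝ (contDiff_id.sub contDiff_const)
  have : chartInv p b = fun x => (((inner ℝ (b 0) (x - p) : ℝ) : ℂ) +
      ((inner ℝ (b 1) (x - p) : ℝ) : ℂ) * Complex.I, inner ℝ (b 2) (x - p)) := by
    funext x
    refine Prod.ext (Complex.ext ?_ ?_) ?_ <;> simp [chartInv]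
  rw [this]
  exact ((Complex.ofRealCLM.contDiff.comp (h 0)).add
    ((Complex.ofRealCLM.contDiff.comp (h 1)).mul contDiff_const)).prodMk (h 2)

/-- `chart p b` as a homeomorphism. -/
def chartHomeo : ℂ × ℝ ≃ₜ R3 where
  toFun := chart p b
  invFun := chartInv p b
  left_inv := chartInv_chart p b
  right_inv := chart_chartInv p b
  continuous_toFun := (contDiff_chart p b (n := 0)).continuous
  continuous_invFun := (contDiff_chartInv p b (n := 0)).continuous

lemma chart_injective :
    Function.Injective (chart p b) := (chartHomeo p b).injective

lemma mem_image_chart {p : R3} {b : Frame} {S : Set (ℂ × ℝ)} {x : R3} :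
    x ∈ chart p b '' S ↔ chartInv p b x ∈ S := by
  constructor
  · rintro ⟨q, hq, rfl⟩
    rwa [chartInv_chart]
  · intro h
    exact ⟨_, h, chart_chartInv p b x⟩

lemma norm_frameMap_sq (q : ℂ × ℝ) : ‖frameMap b q‖ ^ 2 = ‖q.1‖ ^ 2 + q.2 ^ 2 := by
  rw [frameMap_apply, ← b.sum_sq_norm_inner_right]
  simp [Fin.sum_univ_three, inner_add_right, inner_smul_right, b.inner_eq_ite,
    Complex.sq_norm, Complex.normSq_apply]
  ring

lemma chart_sub_chart (q q' : ℂ × ℝ) :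
    chart p b q - chart p b q' = frameMap b (q - q') := by
  rw [chart_eq, chart_eq, map_sub]; abel

lemma dist_chart_sq (q q' : ℂ × ℝ) :
    dist (chart p b q) (chart p b q') ^ 2 = ‖q.1 - q'.1‖ ^ 2 + (q.2 - q'.2) ^ 2 := by
  rw [dist_eq_norm, chart_sub_chart, norm_frameMap_sq]; rfl

lemma measurePreserving_chart :
    MeasurePreserving (chart p b) volume volume := by
  let e : WithLp 2 (ℂ × ℝ) →ₗᵢ[ℝ] R3 :=
    { toLinearMap := (frameMap b : ℂ × ℝ →ₗ[ℝ] R3).comp (WithLp.linearEquiv 2 ℝ (ℂ × ℝ)).toLinearMap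
      norm_map' := fun q => by
        rw [← sq_eq_sq₀ (norm_nonneg _) (norm_nonneg _)]
        simp only [LinearMap.coe_comp, Function.comp_apply]
        refine (norm_frameMap_sq b _).trans ?_
        rw [WithLp.prod_norm_sq_eq_of_L2]
        simp }
  have hdim : Module.finrank ℝ (WithLp 2 (ℂ × ℝ)) = Module.finrank ℝ R3 := by
    rw [(WithLp.linearEquiv 2 ℝ (ℂ × ℝ)).finrank_eq]
    simp
  let e' := LinearIsometry.toLinearIsometryEquiv e hdim
  have h1 := (LinearIsometryEquiv.measurePreserving e').comp (WithLp.volume_preserving_toLp ℂ ℝ)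
  have h2 := (measurePreserving_add_left (volume : Measure R3) p).comp h1
  have : chart p b = (fun x => p + x) ∘ (e' ∘ WithLp.toLp 2) := by
    funext q
    rw [chart_eq]
    rfl
  rw [this]
  exact h2

lemma measurableEmbedding_chart : MeasurableEmbedding (chart p b) :=
  (chartHomeo p b).measurableEmbedding

lemma setIntegral_image_chart (S : Set (ℂ × ℝ))
    (k : R3 → ℝ) : ∫ x in chart p b '' S, k x = ∫ q in S, k (chart p b q) :=
  (measurePreserving_chart p b).setIntegral_image_emb (measurableEmbedding_chart p b) k S

lemma volume_image_chart (S : Set (ℂ × ℝ)) :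
    volume (chart p b '' S) = volume S := by
  rw [← (measurePreserving_chart p b).measure_preimage_emb (measurableEmbedding_chart p b),
    preimage_image_eq _ (chart_injective p b)]

lemma divergence_chart {T : R3 → R3} (hT : Differentiable ℝ T) (q : ℂ × ℝ) :
    divergence T (chart p b q) = fderiv ℝ (fun q => inner ℝ (b 0) (T (chart p b q))) q (1, 0) +
      fderiv ℝ (fun q => inner ℝ (b 1) (T (chart p b q))) q (Complex.I, 0) +
      fderiv ℝ (fun q => inner ℝ (b 2) (T (chart p b q))) q (0, 1) := by
  have h : ∀ (i : Fin 3) (v : ℂ × ℝ), fderiv ℝ (fun q => inner ℝ (b i) (T (chart p b q))) q v =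
        inner ℝ (b i) (fderiv ℝ T (chart p b q) (frameMap b v)) := by
    intro i v
    have h1 := ((hT (chart p b q)).hasFDerivAt.comp q (hasFDerivAt_chart p b q))
    have h2 := (innerSL ℝ (b i)).hasFDerivAt.comp q h1
    rw [show (fun q => inner ℝ (b i) (T (chart p b q))) =
      (innerSL ℝ (b i)) ∘ (T ∘ chart p b) from rfl, h2.fderiv]
    rfl
  rw [h, h, h]
  have h1 := LinearMap.trace_eq_sum_inner (fderiv ℝ T (chart p b q) : R3 →ₗ[ℝ] R3) b
  have h2 := LinearMap.trace_eq_sum_inner (fderiv ℝ T (chart p b q) : R3 →ₗ[ℝ] R3)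
    (EuclideanSpace.basisFun (Fin 3) ℝ)
  rw [h1] at h2
  simp only [Fin.sum_univ_three] at h2
  simp only [divergence, Fin.sum_univ_three, frameMap_apply]
  simpa [EuclideanSpace.inner_single_left] using h2.symm

end Chart

/-! ### The Gauss–Green formula for subgraphs -/

/-- The part of a box lying below the graph of `W`. -/
def subgraph (W : ℂ → ℝ) : Set (ℂ × ℝ) := {q | q.2 < W q.1}

lemma measurableSet_subgraph {W : ℂ → ℝ} (hW : Continuous W) : MeasurableSet (subgraph W) :=
  (isOpen_lt continuous_snd (hW.comp continuous_fst)).measurableSet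

/-- The shear `(y, h) ↦ (y, h + W y)`. -/
def shear {W : ℂ → ℝ} (hW : Continuous W) : ℂ × ℝ ≃ₜ ℂ × ℝ where
  toFun q := (q.1, q.2 + W q.1)
  invFun q := (q.1, q.2 - W q.1)
  left_inv q := by simp
  right_inv q := by simp

lemma measurePreserving_shear {W : ℂ → ℝ} (hW : Continuous W) :
    MeasurePreserving (fun q : ℂ × ℝ => (q.1, q.2 + W q.1)) volume volume := by
  refine MeasurePreserving.skew_product (g := fun y h => h + W y) (MeasurePreserving.id volume)
    ?_ ?_
  · exact (continuous_snd.add (hW.comp continuous_fst)).measurable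
  · exact Eventually.of_forall fun y => (measurePreserving_add_right volume (W y)).map_eq

lemma setIntegral_subgraph {W : ℂ → ℝ} (hW : Continuous W) (k : ℂ × ℝ → ℝ) :
    ∫ q in subgraph W, k q = ∫ q in univ ×ˢ Iio 0, k (q.1, q.2 + W q.1) := by
  rw [← (measurePreserving_shear hW).setIntegral_preimage_emb (shear hW).measurableEmbedding]
  congr 2
  ext q
  simp [subgraph]

lemma hasCompactSupport_shear {A : ℂ × ℝ → ℝ} {W : ℂ → ℝ} (hW : Continuous W)
    (hA : HasCompactSupport A) : HasCompactSupport (fun q : ℂ × ℝ => A (q.1, q.2 + W q.1)) :=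
  hA.comp_homeomorph (shear hW)

lemma contDiff_shear {A : ℂ × ℝ → ℝ} {W : ℂ → ℝ} (hW : ContDiff ℝ 1 W) (hA : ContDiff ℝ 1 A) :
    ContDiff ℝ 1 (fun q : ℂ × ℝ => A (q.1, q.2 + W q.1)) :=
  hA.comp (contDiff_fst.prodMk (contDiff_snd.add (hW.comp contDiff_fst)))

lemma fderiv_shear {A : ℂ × ℝ → ℝ} {W : ℂ → ℝ} (hW : ContDiff ℝ 1 W) (hA : ContDiff ℝ 1 A)
    (q : ℂ × ℝ) (v : ℂ) (k : ℝ) :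
    fderiv ℝ (fun q : ℂ × ℝ => A (q.1, q.2 + W q.1)) q (v, k) =
      fderiv ℝ A (q.1, q.2 + W q.1) (v, k + fderiv ℝ W q.1 v) := by
  have h1 : HasFDerivAt A (fderiv ℝ A (q.1, q.2 + W q.1)) (q.1, q.2 + W q.1) :=
    (hA.differentiable one_ne_zero _).hasFDerivAt
  have h2 : HasFDerivAt W (fderiv ℝ W q.1) q.1 := (hW.differentiable one_ne_zero _).hasFDerivAt
  have h3 : HasFDerivAt (fun q : ℂ × ℝ => (q.1, q.2 + W q.1))
      ((ContinuousLinearMap.fst ℝ ℂ ℝ).prod ((ContinuousLinearMap.snd ℝ ℂ ℝ) +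
        (fderiv ℝ W q.1).comp (ContinuousLinearMap.fst ℝ ℂ ℝ))) q :=
    hasFDerivAt_fst.prodMk (hasFDerivAt_snd.add (h2.comp q hasFDerivAt_fst))
  have h4 := h1.comp q h3
  rw [show (fun q : ℂ × ℝ => A (q.1, q.2 + W q.1)) = A ∘ fun q : ℂ × ℝ => (q.1, q.2 + W q.1)
    from rfl, h4.fderiv]
  simp

lemma fderiv_slice_snd {A : ℂ × ℝ → ℝ} (hA : ContDiff ℝ 1 A) (y : ℂ) (h : ℝ) :
    HasDerivAt (fun h => A (y, h)) (fderiv ℝ A (y, h) (0, 1)) h := by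
  have h1 : HasFDerivAt A (fderiv ℝ A (y, h)) (y, h) :=
    (hA.differentiable one_ne_zero _).hasFDerivAt
  have h2 : HasDerivAt (fun h : ℝ => (y, h)) ((0 : ℂ), (1 : ℝ)) h :=
    (hasDerivAt_const h y).prodMk (hasDerivAt_id h)
  exact h1.comp_hasDerivAt h h2

lemma hasCompactSupport_slice_snd {A : ℂ × ℝ → ℝ} (hA : HasCompactSupport A) (y : ℂ) :
    HasCompactSupport (fun h => A (y, h)) := by
  refine hA.comp_isClosedEmbedding (g := fun h : ℝ => (y, h)) ?_
  exact Topology.IsClosedEmbedding.of_continuous_injective_isClosedMap (by fun_prop)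
    (fun a c h => (Prod.ext_iff.1 h).2) (isClosedMap_prodMk_left y)

lemma hasCompactSupport_slice_fst {A : ℂ × ℝ → ℝ} (hA : HasCompactSupport A) (h : ℝ) :
    HasCompactSupport (fun y => A (y, h)) := by
  refine hA.comp_isClosedEmbedding (g := fun y : ℂ => (y, h)) ?_
  exact Topology.IsClosedEmbedding.of_continuous_injective_isClosedMap (by fun_prop)
    (fun a c h => (Prod.ext_iff.1 h).1) (isClosedMap_prodMk_right h)

lemma continuous_fderiv_apply_one {A : ℂ × ℝ → ℝ} (hA : ContDiff ℝ 1 A) (v : ℂ × ℝ) :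
    Continuous fun q => fderiv ℝ A q v :=
  (hA.continuous_fderiv one_ne_zero).clm_apply continuous_const

lemma hasCompactSupport_fderiv_apply {A : ℂ × ℝ → ℝ} (hA : HasCompactSupport A) (v : ℂ × ℝ) :
    HasCompactSupport fun q => fderiv ℝ A q v :=
  (hA.fderiv ℝ).comp_left (g := fun L : ℂ × ℝ →L[ℝ] ℝ => L v) rfl

lemma integral_lowerHalf_vertical {A : ℂ × ℝ → ℝ} (hA : ContDiff ℝ 1 A)
    (hAc : HasCompactSupport A) {k : ℂ → ℝ} (hk : Continuous k) :
    ∫ q in univ ×ˢ Iio 0, k q.1 * fderiv ℝ A q (0, 1) = ∫ y, k y * A (y, 0) := by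
  have hc : HasCompactSupport fun q : ℂ × ℝ => k q.1 * fderiv ℝ A q (0, 1) :=
    (hasCompactSupport_fderiv_apply hAc (0, 1)).mul_left
  have hi : Integrable (fun q : ℂ × ℝ => k q.1 * fderiv ℝ A q (0, 1)) volume :=
    Continuous.integrable_of_hasCompactSupport
      ((hk.comp continuous_fst).mul (continuous_fderiv_apply_one hA _)) hc
  rw [Measure.volume_eq_prod, setIntegral_prod _ (by exact hi.integrableOn), setIntegral_univ]
  refine integral_congr_ae (Eventually.of_forall fun y => ?_)
  simp only
  rw [integral_const_mul]
  congr 1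
  have hd : ∀ h, deriv (fun h => A (y, h)) h = fderiv ℝ A (y, h) (0, 1) := fun h =>
    (fderiv_slice_snd hA y h).deriv
  have hA' : ContDiff ℝ 1 fun h => A (y, h) := hA.comp (contDiff_const.prodMk contDiff_id)
  have := (hasCompactSupport_slice_snd hAc y).integral_Iic_deriv_eq hA' 0
  rw [← integral_Iic_eq_integral_Iio]
  simpa only [hd] using this

lemma integral_lowerHalf_horizontal {A : ℂ × ℝ → ℝ} (hA : ContDiff ℝ 1 A)
    (hAc : HasCompactSupport A) (v : ℂ) :
    ∫ q in univ ×ˢ Iio 0, fderiv ℝ A q (v, 0) = 0 := by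
  have hi : Integrable (fun q : ℂ × ℝ => fderiv ℝ A q (v, 0)) volume :=
    Continuous.integrable_of_hasCompactSupport (continuous_fderiv_apply_one hA _)
      (hasCompactSupport_fderiv_apply hAc (v, 0))
  rw [Measure.volume_eq_prod, ← Measure.prod_restrict, integral_prod_symm]
  swap
  · rw [Measure.prod_restrict]; exact hi.integrableOn
  rw [Measure.restrict_univ]
  refine (integral_congr_ae (Eventually.of_forall fun h => ?_)).trans (integral_zero _ _)
  have hA' : ContDiff ℝ 1 fun y => A (y, h) := hA.comp (contDiff_id.prodMk contDiff_const)
  have hd : ∀ y, fderiv ℝ (fun y => A (y, h)) y v = fderiv ℝ A (y, h) (v, 0) := by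
    intro y
    have h1 : HasFDerivAt A (fderiv ℝ A (y, h)) (y, h) :=
      (hA.differentiable one_ne_zero _).hasFDerivAt
    have h2 : HasFDerivAt (fun y : ℂ => (y, h)) (ContinuousLinearMap.inl ℝ ℂ ℝ) y :=
      hasFDerivAt_prodMk_left y h
    rw [show (fun y => A (y, h)) = A ∘ fun y : ℂ => (y, h) from rfl, (h1.comp y h2).fderiv]
    simp
  have hc := hasCompactSupport_slice_fst hAc h
  have hci : Integrable (fun y => fderiv ℝ (fun y => A (y, h)) y v) volume :=
    ((hA'.continuous_fderiv one_ne_zero).clm_apply continuous_const).integrable_of_hasCompactSupport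
      ((hc.fderiv ℝ).comp_left (g := fun L : ℂ →L[ℝ] ℝ => L v) rfl)
  have key := integral_bilinear_hasFDerivAt_right_eq_neg_left_of_integrable
    (μ := (volume : Measure ℂ)) (f := fun _ : ℂ => (1 : ℝ)) (f' := fun _ => 0)
    (g := fun y => A (y, h)) (g' := fderiv ℝ (fun y => A (y, h))) (v := v)
    (B := ContinuousLinearMap.mul ℝ ℝ) (by simp) (by simpa using hci)
    (by simpa using hA'.continuous.integrable_of_hasCompactSupport hc)
    (fun _ _ => hasFDerivAt_const _ _)
    (fun y _ => (hA'.differentiable one_ne_zero y).hasFDerivAt)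
  simpa [hd] using key

/-- Gauss–Green on a subgraph, vertical derivative. -/
lemma integral_subgraph_vertical {A : ℂ × ℝ → ℝ} {W : ℂ → ℝ} (hW : ContDiff ℝ 1 W)
    (hA : ContDiff ℝ 1 A) (hAc : HasCompactSupport A) :
    ∫ q in subgraph W, fderiv ℝ A q (0, 1) = ∫ y, A (y, W y) := by
  rw [setIntegral_subgraph hW.continuous]
  have h1 := integral_lowerHalf_vertical (contDiff_shear hW hA)
    (hasCompactSupport_shear hW.continuous hAc) (k := fun _ => 1) continuous_const
  simp only [fderiv_shear hW hA] at h1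
  simpa using h1

/-- Gauss–Green on a subgraph, horizontal derivative. -/
lemma integral_subgraph_horizontal {A : ℂ × ℝ → ℝ} {W : ℂ → ℝ} (hW : ContDiff ℝ 1 W)
    (hA : ContDiff ℝ 1 A) (hAc : HasCompactSupport A) (v : ℂ) :
    ∫ q in subgraph W, fderiv ℝ A q (v, 0) = -∫ y, fderiv ℝ W y v * A (y, W y) := by
  have hA' := contDiff_shear hW hA
  have hAc' := hasCompactSupport_shear hW.continuous hAc
  have hWv : Continuous fun y => fderiv ℝ W y v :=
    (hW.continuous_fderiv one_ne_zero).clm_apply continuous_const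
  have h1 := integral_lowerHalf_vertical hA' hAc' hWv
  have h2 := integral_lowerHalf_horizontal hA' hAc' v
  have hi1 : Integrable (fun q : ℂ × ℝ =>
      fderiv ℝ W q.1 v * fderiv ℝ (fun q : ℂ × ℝ => A (q.1, q.2 + W q.1)) q (0, 1)) volume :=
    Continuous.integrable_of_hasCompactSupport
      ((hWv.comp continuous_fst).mul (continuous_fderiv_apply_one hA' _))
      (hasCompactSupport_fderiv_apply hAc' (0, 1)).mul_left
  have hi2 : Integrable (fun q : ℂ × ℝ =>
      fderiv ℝ (fun q : ℂ × ℝ => A (q.1, q.2 + W q.1)) q (v, 0)) volume :=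
    Continuous.integrable_of_hasCompactSupport (continuous_fderiv_apply_one hA' _)
      (hasCompactSupport_fderiv_apply hAc' (v, 0))
  rw [setIntegral_subgraph hW.continuous]
  have h3 : ∀ q : ℂ × ℝ, fderiv ℝ A (q.1, q.2 + W q.1) (v, 0) =
      fderiv ℝ (fun q : ℂ × ℝ => A (q.1, q.2 + W q.1)) q (v, 0) -
      fderiv ℝ W q.1 v * fderiv ℝ (fun q : ℂ × ℝ => A (q.1, q.2 + W q.1)) q (0, 1) := by
    intro q
    rw [fderiv_shear hW hA, fderiv_shear hW hA]
    have : ((v, 0 + fderiv ℝ W q.1 v) : ℂ × ℝ) =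
        (v, 0) + (fderiv ℝ W q.1 v) • ((0 : ℂ), (1 : ℝ) + fderiv ℝ W q.1 0) := by simp
    rw [this, map_add, map_smul]
    simp
  simp only [h3]
  rw [integral_sub hi2.integrableOn hi1.integrableOn, h1, h2]
  simp


/-! ### Flux through a pair of graphs -/

section Box

variable (p : R3) (b : Frame)

/-- The open box of radius `R` and half-height `H` in the chart. -/
def openBox (R H : ℝ) : Set R3 := chart p b '' (ball 0 R ×ˢ Ioo (-H) H)

/-- The closed box of radius `R` and half-height `H` in the chart. -/
def closedBox (R H : ℝ) : Set R3 := chart p b '' (closedBall 0 R ×ˢ Icc (-H) H)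

lemma isOpen_openBox (R H : ℝ) : IsOpen (openBox p b R H) :=
  (chartHomeo p b).isOpenMap _ (isOpen_ball.prod isOpen_Ioo)

lemma isCompact_closedBox (R H : ℝ) : IsCompact (closedBox p b R H) :=
  ((isCompact_closedBall _ _).prod isCompact_Icc).image (chartHomeo p b).continuous

lemma isClosed_closedBox (R H : ℝ) :
    IsClosed (closedBox p b R H) := (isCompact_closedBox p b R H).isClosed

lemma openBox_subset_closedBox (R H : ℝ) :
    openBox p b R H ⊆ closedBox p b R H :=
  image_mono (prod_mono ball_subset_closedBall Ioo_subset_Icc_self)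

lemma closedBox_subset_openBox {R R' H H' : ℝ}
    (hR : R' < R) (hH : H' < H) : closedBox p b R' H' ⊆ openBox p b R H :=
  image_mono (prod_mono (closedBall_subset_ball hR) (Icc_subset_Ioo (by linarith) hH))

end Box

/-- The region strictly between the graphs of `W2` and `W1`. -/
def midRegion (W1 W2 : ℂ → ℝ) : Set (ℂ × ℝ) := {q | W2 q.1 < q.2 ∧ q.2 < W1 q.1}

lemma measurableSet_midRegion {W1 W2 : ℂ → ℝ} (hW1 : Continuous W1) (hW2 : Continuous W2) :
    MeasurableSet (midRegion W1 W2) :=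
  ((isOpen_lt (hW2.comp continuous_fst) continuous_snd).inter
    (isOpen_lt continuous_snd (hW1.comp continuous_fst))).measurableSet

/-- In the box, up to null sets, `F` is the region between the two graphs (if `s = true`) or the
complement of that region (if `s = false`). -/
def FillsBox (p : R3) (b : Frame) (R H : ℝ) (s : Bool) (F : Set R3) (W1 W2 : ℂ → ℝ) : Prop :=
  ∀ᵐ q : ℂ × ℝ, q ∈ ball (0 : ℂ) R ×ˢ Ioo (-H) H →
    (chart p b q ∈ F ↔ (q ∈ midRegion W1 W2 ↔ s = true))

/-- The sign attached to a Boolean. -/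
def boolSign (s : Bool) : ℝ := if s then 1 else -1

/-- The upward normal `(-∇W, 1)` to the graph of `W`. -/
def graphNormal (b : Frame) (W : ℂ → ℝ) (y : ℂ) : R3 :=
  b 2 - fderiv ℝ W y 1 • b 0 - fderiv ℝ W y Complex.I • b 1

/-- The area density `√(1 + |∇W|²)` of the graph of `W`. -/
def areaDensity (W : ℂ → ℝ) (y : ℂ) : ℝ := √(1 + fderiv ℝ W y 1 ^ 2 + fderiv ℝ W y Complex.I ^ 2)

lemma norm_graphNormal (b : Frame) (W : ℂ → ℝ) (y : ℂ) : ‖graphNormal b W y‖ = areaDensity W y := by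
  rw [areaDensity, eq_comm, Real.sqrt_eq_iff_eq_sq (by positivity) (norm_nonneg _), eq_comm,
    ← b.sum_sq_norm_inner_right]
  simp [graphNormal, Fin.sum_univ_three, inner_sub_right, inner_smul_right, b.inner_eq_ite]
  ring

lemma one_le_areaDensity (W : ℂ → ℝ) (y : ℂ) : 1 ≤ areaDensity W y := by
  rw [areaDensity, Real.one_le_sqrt]
  nlinarith [sq_nonneg (fderiv ℝ W y 1), sq_nonneg (fderiv ℝ W y Complex.I)]

lemma continuous_graphNormal (b : Frame) {W : ℂ → ℝ}
    (hW : ContDiff ℝ 1 W) : Continuous (graphNormal b W) := by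
  have h : ∀ v, Continuous fun y => fderiv ℝ W y v := fun v =>
    (hW.continuous_fderiv one_ne_zero).clm_apply continuous_const
  exact (continuous_const.sub ((h 1).smul continuous_const)).sub
    ((h Complex.I).smul continuous_const)

lemma continuous_areaDensity {W : ℂ → ℝ} (hW : ContDiff ℝ 1 W) : Continuous (areaDensity W) := by
  have h : ∀ v, Continuous fun y => fderiv ℝ W y v := fun v =>
    (hW.continuous_fderiv one_ne_zero).clm_apply continuous_const
  exact Real.continuous_sqrt.comp ((continuous_const.add ((h 1).pow 2)).add ((h Complex.I).pow 2))

lemma measure_graph_eq_zero {W : ℂ → ℝ} (hW : Continuous W) :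
    volume {q : ℂ × ℝ | q.2 = W q.1} = 0 := by
  have hm : MeasurableSet {q : ℂ × ℝ | q.2 = W q.1} :=
    (isClosed_eq continuous_snd (hW.comp continuous_fst)).measurableSet
  rw [Measure.volume_eq_prod, Measure.measure_prod_null hm]
  refine Eventually.of_forall fun y => ?_
  have : Prod.mk y ⁻¹' {q : ℂ × ℝ | q.2 = W q.1} = {W y} := by ext; simp
  change volume (Prod.mk y ⁻¹' {q : ℂ × ℝ | q.2 = W q.1}) = 0
  rw [this]
  simp

/-- The flux of `T` through the graph of `W`. -/
def graphFlux (p : R3) (b : Frame) (T : R3 → R3) (W : ℂ → ℝ) (y : ℂ) :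
    ℝ := inner ℝ (graphNormal b W y) (T (chart p b (y, W y)))

lemma hasCompactSupport_comp_chart {p : R3} {b : Frame} {T : R3 → R3}
    (hT : HasCompactSupport T) (i : Fin 3) :
    HasCompactSupport fun q => inner ℝ (b i) (T (chart p b q)) :=
  (hT.comp_homeomorph (chartHomeo p b)).comp_left (g := fun v => inner ℝ (b i) v)
    (inner_zero_right _)

lemma contDiff_comp_chart {p : R3} {b : Frame} {T : R3 → R3} (hT : ContDiff ℝ 1 T) (i : Fin 3) :
    ContDiff ℝ 1 fun q => inner ℝ (b i) (T (chart p b q)) :=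
  contDiff_const.inner ℝ (hT.comp (contDiff_chart p b))

lemma hasCompactSupport_graph {A : ℂ × ℝ → ℝ} (hA : HasCompactSupport A) {W : ℂ → ℝ} :
    HasCompactSupport fun y => A (y, W y) := by
  refine HasCompactSupport.intro (hA.isCompact.image continuous_fst) fun y hy => ?_
  by_contra h
  exact hy ⟨(y, W y), subset_tsupport _ h, rfl⟩

lemma graphFlux_eq (p : R3) (b : Frame) (T : R3 → R3) (W : ℂ → ℝ) (y : ℂ) : graphFlux p b T W y =
      inner ℝ (b 2) (T (chart p b (y, W y))) -
        fderiv ℝ W y 1 * inner ℝ (b 0) (T (chart p b (y, W y))) -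
        fderiv ℝ W y Complex.I * inner ℝ (b 1) (T (chart p b (y, W y))) := by
  simp [graphFlux, graphNormal, inner_sub_left, inner_smul_left]

lemma continuous_graphFlux {p : R3} {b : Frame} {T : R3 → R3}
    (hT : Continuous T) {W : ℂ → ℝ} (hW : ContDiff ℝ 1 W) : Continuous (graphFlux p b T W) :=
  (continuous_graphNormal b hW).inner
    (hT.comp ((chartHomeo p b).continuous.comp (continuous_id.prodMk hW.continuous)))

lemma integrable_graphFlux {p : R3} {b : Frame} {T : R3 → R3}
    (hT : Continuous T) (hTc : HasCompactSupport T) {W : ℂ → ℝ} (hW : ContDiff ℝ 1 W) :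
    Integrable (graphFlux p b T W) := by
  refine (continuous_graphFlux hT hW).integrable_of_hasCompactSupport ?_
  refine HasCompactSupport.intro ((hTc.comp_homeomorph (chartHomeo p b)).isCompact.image
    continuous_fst) fun y hy => ?_
  have : T (chart p b (y, W y)) = 0 := by
    by_contra h
    exact hy ⟨(y, W y), subset_tsupport _ h, rfl⟩
  simp [graphFlux, this]

lemma integrable_divergence_chart {p : R3} {b : Frame} {T : R3 → R3}
    (hT : ContDiff ℝ 1 T) (hTc : HasCompactSupport T) :
    Integrable fun q => divergence T (chart p b q) := by
  simp only [divergence_chart p b (hT.differentiable one_ne_zero)]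
  have h : ∀ (i : Fin 3) (v : ℂ × ℝ), Integrable fun q =>
      fderiv ℝ (fun q => inner ℝ (b i) (T (chart p b q))) q v := fun i v =>
    (continuous_fderiv_apply_one (contDiff_comp_chart hT i) v).integrable_of_hasCompactSupport
      (hasCompactSupport_fderiv_apply (hasCompactSupport_comp_chart hTc i) v)
  exact ((h 0 _).add (h 1 _)).add (h 2 _)

lemma integral_subgraph_divergence {p : R3} {b : Frame} {T : R3 → R3}
    (hT : ContDiff ℝ 1 T) (hTc : HasCompactSupport T) {W : ℂ → ℝ} (hW : ContDiff ℝ 1 W) :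
    ∫ q in subgraph W, divergence T (chart p b q) = ∫ y, graphFlux p b T W y := by
  simp only [divergence_chart p b (hT.differentiable one_ne_zero), graphFlux_eq]
  have h : ∀ (i : Fin 3) (v : ℂ × ℝ), Integrable fun q =>
      fderiv ℝ (fun q => inner ℝ (b i) (T (chart p b q))) q v := fun i v =>
    (continuous_fderiv_apply_one (contDiff_comp_chart hT i) v).integrable_of_hasCompactSupport
      (hasCompactSupport_fderiv_apply (hasCompactSupport_comp_chart hTc i) v)
  have h' : ∀ (i : Fin 3), Continuous fun y => inner ℝ (b i) (T (chart p b (y, W y))) := fun i =>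
    continuous_const.inner (hT.continuous.comp
      ((chartHomeo p b).continuous.comp (continuous_id.prodMk hW.continuous)))
  have hc : ∀ (i : Fin 3), HasCompactSupport fun y => inner ℝ (b i) (T (chart p b (y, W y))) :=
    fun i => hasCompactSupport_graph (hasCompactSupport_comp_chart hTc i)
  have hk : ∀ (i : Fin 3) (v : ℂ), Integrable fun y =>
      fderiv ℝ W y v * inner ℝ (b i) (T (chart p b (y, W y))) := fun i v =>
    (((hW.continuous_fderiv one_ne_zero).clm_apply
      continuous_const).mul (h' i)).integrable_of_hasCompactSupport (hc i).mul_left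
  have h01 : Integrable fun q => fderiv ℝ (fun q => inner ℝ (b 0) (T (chart p b q))) q (1, 0) +
      fderiv ℝ (fun q => inner ℝ (b 1) (T (chart p b q))) q (Complex.I, 0) :=
    (h 0 _).add (h 1 _)
  have hi2 := (h' 2).integrable_of_hasCompactSupport (hc 2) (μ := volume)
  have hk0 : Integrable fun y => inner ℝ (b 2) (T (chart p b (y, W y))) -
      fderiv ℝ W y 1 * inner ℝ (b 0) (T (chart p b (y, W y))) := hi2.sub (hk 0 1)
  rw [integral_add h01.integrableOn (h 2 _).integrableOn,
    integral_add (h 0 _).integrableOn (h 1 _).integrableOn,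
    integral_subgraph_horizontal hW (contDiff_comp_chart hT 0) (hasCompactSupport_comp_chart hTc 0),
    integral_subgraph_horizontal hW (contDiff_comp_chart hT 1) (hasCompactSupport_comp_chart hTc 1),
    integral_subgraph_vertical hW (contDiff_comp_chart hT 2) (hasCompactSupport_comp_chart hTc 2),
    integral_sub hk0 (hk 1 _), integral_sub hi2 (hk 0 _)]
  ring

lemma divergence_eq_zero_of_notMem {T : R3 → R3} {x : R3} (hx : x ∉ tsupport T) :
    divergence T x = 0 := by
  have : fderiv ℝ T x = 0 := by
    by_contra h
    exact hx (support_fderiv_subset ℝ h)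
  simp [divergence, this]

/-- Gauss–Green in the box, for a set bounded by two graphs. -/
lemma integral_divergence_of_fillsBox {p : R3} {b : Frame} {R H : ℝ}
    {s : Bool} {F : Set R3} {W1 W2 : ℂ → ℝ} (hF : MeasurableSet F)
    (hfill : FillsBox p b R H s F W1 W2) (hW1 : ContDiff ℝ 1 W1) (hW2 : ContDiff ℝ 1 W2)
    (hle : ∀ y ∈ ball (0 : ℂ) R, W2 y ≤ W1 y) {T : R3 → R3} (hT : IsTestField (openBox p b R H) T) :
    ∫ x in F, divergence T x =
      boolSign s * ∫ y, (graphFlux p b T W1 y - graphFlux p b T W2 y) := by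
  have hcomp := (measurePreserving_chart p b).setIntegral_preimage_emb
    (measurableEmbedding_chart p b) (divergence T) F
  set D : ℂ × ℝ → ℝ := fun q => divergence T (chart p b q) with hD
  have hDi : Integrable D := integrable_divergence_chart hT.contDiff hT.hasCompactSupport
  have hD0 : ∀ q, q ∉ ball (0 : ℂ) R ×ˢ Ioo (-H) H → D q = 0 := by
    intro q hq
    refine divergence_eq_zero_of_notMem fun hx => hq ?_
    obtain ⟨q', hq', h⟩ := hT.tsupport_subset hx
    rwa [← chart_injective p b h]
  have hpre : MeasurableSet (chart p b ⁻¹' F) := (chartHomeo p b).continuous.measurable hF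
  have hm1 := measurableSet_subgraph hW1.continuous
  have hm2 := measurableSet_subgraph hW2.continuous
  have htotal : ∫ q, D q = 0 := by
    have h1 := integral_subgraph_divergence (p := p) (b := b) hT.contDiff hT.hasCompactSupport
      (W := fun _ => H) contDiff_const
    have h2 : ∀ y, graphFlux p b T (fun _ => H) y = 0 := by
      intro y
      have : T (chart p b (y, H)) = 0 := by
        by_contra h
        obtain ⟨q', hq', h⟩ := hT.tsupport_subset (subset_tsupport _ h)
        have := chart_injective p b h
        rw [this] at hq'
        exact lt_irrefl _ hq'.2.2
      simp [graphFlux, this]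
    rw [← integral_indicator (measurableSet_subgraph continuous_const)] at h1
    simp only [h2, integral_zero] at h1
    rw [← h1]
    congr 1
    funext q
    by_cases hq : q ∈ ball (0 : ℂ) R ×ˢ Ioo (-H) H
    · rw [indicator_of_mem (show q ∈ subgraph fun _ => H from hq.2.2)]
    · have h0 := hD0 q hq
      have h0' : divergence T (chart p b q) = 0 := h0
      simp [indicator, h0, h0']
  rw [integral_sub (integrable_graphFlux hT.contDiff.continuous hT.hasCompactSupport hW1)
    (integrable_graphFlux hT.contDiff.continuous hT.hasCompactSupport hW2), ← hcomp,
    ← integral_subgraph_divergence hT.contDiff hT.hasCompactSupport hW1,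
    ← integral_subgraph_divergence hT.contDiff hT.hasCompactSupport hW2]
  change ∫ q in chart p b ⁻¹' F, D q = _ * ((∫ q in subgraph W1, D q) - ∫ q in subgraph W2, D q)
  have hdiff : (∫ q in subgraph W1, D q) - ∫ q in subgraph W2, D q =
      ∫ q, ((subgraph W1).indicator D q - (subgraph W2).indicator D q) := by
    rw [integral_sub (hDi.indicator hm1) (hDi.indicator hm2), integral_indicator hm1,
      integral_indicator hm2]
  have hgr : ∀ᵐ q : ℂ × ℝ, q.2 ≠ W2 q.1 := by
    rw [ae_iff]
    simpa using measure_graph_eq_zero hW2.continuous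
  have key : ∀ᵐ q : ℂ × ℝ, (chart p b ⁻¹' F).indicator D q = (if s then 0 else D q) +
        boolSign s * ((subgraph W1).indicator D q - (subgraph W2).indicator D q) := by
    filter_upwards [hfill, hgr] with q h1 h2
    by_cases hq : q ∈ ball (0 : ℂ) R ×ˢ Ioo (-H) H
    · have h3 := h1 hq
      have h4 := hle q.1 hq.1
      simp only [indicator, mem_preimage, h3, midRegion, subgraph, mem_ofPred_eq]
      rcases lt_or_gt_of_ne h2 with h5 | h5
      · have : q.2 < W1 q.1 := h5.trans_le h4
        cases s <;> simp [h5, this, boolSign, not_lt.2 h5.le]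
      · by_cases h6 : q.2 < W1 q.1
        · cases s <;> simp [h5, h6, boolSign, not_lt.2 h5.le]
        · cases s <;> simp [h5, h6, boolSign, not_lt.2 h5.le]
    · have := hD0 q hq
      simp [indicator, this]
  rw [hdiff, ← integral_indicator hpre, integral_congr_ae key, integral_add _ _, integral_const_mul]
  · cases s <;> simp [htotal]
  · cases s
    · simpa using hDi
    · simp
  · exact ((hDi.indicator hm1).sub (hDi.indicator hm2)).const_mul _


/-! ### The perimeter of a set bounded by two graphs in a box -/

lemma graphFlux_eq_of_touching {p : R3} {b : Frame} {R : ℝ}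
    {W1 W2 : ℂ → ℝ} (hW1 : ContDiff ℝ 1 W1) (hW2 : ContDiff ℝ 1 W2)
    (hle : ∀ y ∈ ball (0 : ℂ) R, W2 y ≤ W1 y) {y : ℂ} (hy : y ∈ ball (0 : ℂ) R)
    (h : W1 y = W2 y) (T : R3 → R3) : graphFlux p b T W1 y = graphFlux p b T W2 y := by
  have hmin : IsLocalMin (fun z => W1 z - W2 z) y := by
    filter_upwards [isOpen_ball.mem_nhds hy] with z hz
    rw [h, sub_self]
    linarith [hle z hz]
  have h0 := hmin.fderiv_eq_zero
  have hd : fderiv ℝ W1 y = fderiv ℝ W2 y := by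
    rw [fderiv_fun_sub (hW1.differentiable one_ne_zero y) (hW2.differentiable one_ne_zero y)] at h0
    exact sub_eq_zero.1 h0
  simp [graphFlux, graphNormal, h, hd]

/-- The part of the disk of radius `R` over which the graphs are disjoint. -/
def gapDisk (W1 W2 : ℂ → ℝ) (R : ℝ) : Set ℂ := closedBall 0 R ∩ {y | W2 y < W1 y}

lemma measurableSet_gapDisk {W1 W2 : ℂ → ℝ} (hW1 : Continuous W1) (hW2 : Continuous W2) (R : ℝ) :
    MeasurableSet (gapDisk W1 W2 R) :=
  isClosed_closedBall.measurableSet.inter (isOpen_lt hW2 hW1).measurableSet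

/-- Total area of the two graphs over the disk, where they do not coincide. -/
def gapArea (W1 W2 : ℂ → ℝ) (R : ℝ) : ℝ :=
  ∫ y in gapDisk W1 W2 R, (areaDensity W1 y + areaDensity W2 y)

lemma integrableOn_areaDensity {W1 W2 : ℂ → ℝ} (hW1 : ContDiff ℝ 1 W1) (hW2 : ContDiff ℝ 1 W2)
    {R : ℝ} {S : Set ℂ} (hS : S ⊆ closedBall 0 R) :
    IntegrableOn (fun y => areaDensity W1 y + areaDensity W2 y) S :=
  (((continuous_areaDensity hW1).add (continuous_areaDensity hW2)).continuousOn.integrableOn_compact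
    (isCompact_closedBall 0 R)).mono_set hS

lemma gapArea_nonneg (W1 W2 : ℂ → ℝ) (R : ℝ) : 0 ≤ gapArea W1 W2 R := integral_nonneg fun y => by
    have h1 := one_le_areaDensity W1 y
    have h2 := one_le_areaDensity W2 y
    simp only [Pi.zero_apply]
    linarith

lemma abs_graphFlux_le (p : R3) (b : Frame) {T : R3 → R3} {c : ℝ}
    (hT : ∀ x, ‖T x‖ ≤ c) (W : ℂ → ℝ) (y : ℂ) :
    |graphFlux p b T W y| ≤ c * areaDensity W y := by
  rw [← norm_graphNormal b]
  refine (abs_real_inner_le_norm _ _).trans ?_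
  rw [mul_comm]
  exact mul_le_mul_of_nonneg_right (hT _) (norm_nonneg _)

lemma IsTestField.add {U : Set R3} {T S : R3 → R3} (hT : IsTestField U T) (hS : IsTestField U S) :
    IsTestField U (fun x => T x + S x) where
  contDiff := hT.contDiff.add hS.contDiff
  hasCompactSupport := hT.hasCompactSupport.add hS.hasCompactSupport
  tsupport_subset := (tsupport_add T S).trans (union_subset hT.tsupport_subset hS.tsupport_subset)

lemma IsTestField.mono {U V : Set R3} {T : R3 → R3} (hT : IsTestField U T) (h : U ⊆ V) :
    IsTestField V T := ⟨hT.contDiff, hT.hasCompactSupport, hT.tsupport_subset.trans h⟩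

lemma IsTestField.smul {U : Set R3} {T : R3 → R3} {κ : R3 → ℝ} (hT : IsTestField U T)
    (hκ : ContDiff ℝ 1 κ) : IsTestField U (fun x => κ x • T x) := by
  have h : tsupport (fun x => κ x • T x) ⊆ tsupport T := by
    refine closure_mono fun x hx h0 => hx ?_
    simp [h0]
  exact ⟨hκ.smul hT.contDiff, hT.hasCompactSupport.of_isClosed_subset (isClosed_tsupport _) h,
    h.trans hT.tsupport_subset⟩

lemma divergence_add {T S : R3 → R3} {x : R3} (hT : DifferentiableAt ℝ T x)
    (hS : DifferentiableAt ℝ S x) :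
    divergence (fun x => T x + S x) x = divergence T x + divergence S x := by
  simp [divergence, fderiv_fun_add hT hS, Finset.sum_add_distrib]

lemma integrable_divergence {T : R3 → R3} (hT : ContDiff ℝ 1 T) (hTc : HasCompactSupport T) :
    Integrable (divergence T) := by
  let b := EuclideanSpace.basisFun (Fin 3) ℝ
  have := integrable_divergence_chart (p := 0) (b := b) hT hTc
  exact ((measurePreserving_chart 0 b).integrable_comp_emb (measurableEmbedding_chart 0 b)).1 this

lemma setIntegral_divergence_add {T S : R3 → R3} {U V : Set R3} (hT : IsTestField U T)
    (hS : IsTestField V S) (F : Set R3) :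
    ∫ x in F, divergence (fun x => T x + S x) x =
      (∫ x in F, divergence T x) + ∫ x in F, divergence S x := by
  rw [← integral_add (integrable_divergence hT.contDiff hT.hasCompactSupport).integrableOn
    (integrable_divergence hS.contDiff hS.hasCompactSupport).integrableOn]
  congr 1
  funext x
  exact divergence_add (hT.contDiff.differentiable one_ne_zero x)
    (hS.contDiff.differentiable one_ne_zero x)

lemma le_perimeter {U F : Set R3} {T : R3 → R3} (hT : IsTestField U T) (h : ∀ x, ‖T x‖ ≤ 1) :
    ENNReal.ofReal (∫ x in F, divergence T x) ≤ perimeter U F :=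
  le_iSup₂_of_le T hT (le_iSup_of_le h le_rfl)

lemma perimeter_le {U F : Set R3} {a : ℝ≥0∞} (h : ∀ T, IsTestField U T → (∀ x, ‖T x‖ ≤ 1) →
      ENNReal.ofReal (∫ x in F, divergence T x) ≤ a) : perimeter U F ≤ a :=
  iSup₂_le fun T hT => iSup_le fun h1 => h T hT h1

lemma perimeter_mono {U V F : Set R3} (h : U ⊆ V) : perimeter U F ≤ perimeter V F :=
  perimeter_le fun _ hT h1 => le_perimeter (hT.mono h) h1

/-- The perimeter is superadditive on disjoint open sets. -/
lemma perimeter_add_le {U V1 V2 F : Set R3} (h1 : V1 ⊆ U) (h2 : V2 ⊆ U) (hd : Disjoint V1 V2) :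
    perimeter V1 F + perimeter V2 F ≤ perimeter U F := by
  have hpair : ∀ T S, IsTestField V1 T → (∀ x, ‖T x‖ ≤ 1) → IsTestField V2 S → (∀ x, ‖S x‖ ≤ 1) →
      ENNReal.ofReal (∫ x in F, divergence T x) + ENNReal.ofReal (∫ x in F, divergence S x) ≤
        perimeter U F := by
    intro T S hT hT1 hS hS1
    rcases le_total (∫ x in F, divergence T x) 0 with h | h
    · rw [ENNReal.ofReal_of_nonpos h, zero_add]
      exact le_perimeter (hS.mono h2) hS1
    rcases le_total (∫ x in F, divergence S x) 0 with h' | h'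
    · rw [ENNReal.ofReal_of_nonpos h', add_zero]
      exact le_perimeter (hT.mono h1) hT1
    rw [← ENNReal.ofReal_add h h', ← setIntegral_divergence_add hT hS]
    refine le_perimeter ((hT.mono h1).add (hS.mono h2)) fun x => ?_
    by_cases hx : x ∈ V1
    · have : S x = 0 := by
        by_contra h0
        exact disjoint_left.1 hd hx (hS.tsupport_subset (subset_tsupport _ h0))
      simpa [this] using hT1 x
    · have : T x = 0 := by
        by_contra h0
        exact hx (hT.tsupport_subset (subset_tsupport _ h0))
      simpa [this] using hS1 x
  have hz : ∀ V, IsTestField V (fun _ => 0) := fun V =>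
    ⟨contDiff_const, HasCompactSupport.zero, by simp [tsupport]⟩
  have step : ∀ T, IsTestField V1 T → (∀ x, ‖T x‖ ≤ 1) →
      ENNReal.ofReal (∫ x in F, divergence T x) + perimeter V2 F ≤ perimeter U F := by
    intro T hT hT1
    by_cases htop : perimeter U F = ⊤
    · simp [htop]
    have hfin : ENNReal.ofReal (∫ x in F, divergence T x) ≤ perimeter U F :=
      le_perimeter (hT.mono h1) hT1
    rw [add_comm]
    refine (ENNReal.le_sub_iff_add_le_right ENNReal.ofReal_ne_top hfin).1 ?_
    refine perimeter_le fun S hS hS1 => ?_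
    refine (ENNReal.le_sub_iff_add_le_right ENNReal.ofReal_ne_top hfin).2 ?_
    rw [add_comm]
    exact hpair T S hT hT1 hS hS1
  by_cases htop : perimeter U F = ⊤
  · simp [htop]
  have hfin : perimeter V2 F ≤ perimeter U F := perimeter_mono h2
  have hne : perimeter V2 F ≠ ⊤ := ne_top_of_le_ne_top htop hfin
  refine (ENNReal.le_sub_iff_add_le_right hne hfin).1 ?_
  refine perimeter_le fun T hT hT1 => ?_
  exact (ENNReal.le_sub_iff_add_le_right hne hfin).2 (step T hT hT1)

lemma exists_cutoff {E : Type*} [NormedAddCommGroup E] [NormedSpace ℝ E] [FiniteDimensional ℝ E]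
    {C D : Set E} (hC : IsClosed C) (hCD : C ⊆ interior D) :
    ∃ κ : E → ℝ, ContDiff ℝ ∞ κ ∧ (∃ N, IsOpen N ∧ C ⊆ N ∧ ∀ x ∈ N, κ x = 1) ∧
      (∀ x ∉ D, κ x = 0) ∧ ∀ x, κ x ∈ Icc (0 : ℝ) 1 := by
  obtain ⟨f, h1, h2, h3⟩ :=
    exists_contMDiffMap_one_nhds_of_subset_interior (modelWithCornersSelf ℝ E) hC hCD (n := (⊤ : ℕ∞))
  obtain ⟨N, hN, hCN, hN1⟩ := mem_nhdsSet_iff_exists.1 h1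
  exact ⟨f, f.contMDiff.contDiff, ⟨N, hN, hCN, fun x hx => hN1 hx⟩, h2, h3⟩

section
variable {p : R3} {b : Frame} {R H R' H' : ℝ} {s : Bool} {F : Set R3} {W1 W2 : ℂ → ℝ}

lemma integral_divergence_le_gapArea (hF : MeasurableSet F) (hfill : FillsBox p b R H s F W1 W2)
    (hW1 : ContDiff ℝ 1 W1) (hW2 : ContDiff ℝ 1 W2) (hle : ∀ y ∈ ball (0 : ℂ) R, W2 y ≤ W1 y)
    {R'' : ℝ} (hR'' : R'' < R) {T : R3 → R3} (hT : IsTestField (openBox p b R H) T)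
    (hT1 : ∀ x, ‖T x‖ ≤ 1) (hsupp : ∀ x ∉ closedBox p b R'' H, T x = 0) :
    ∫ x in F, divergence T x ≤ gapArea W1 W2 R'' := by
  rw [integral_divergence_of_fillsBox hF hfill hW1 hW2 hle hT]
  set f := fun y => graphFlux p b T W1 y - graphFlux p b T W2 y with hf
  have hmeas := measurableSet_gapDisk hW1.continuous hW2.continuous R''
  have hzero : ∀ y, y ∉ gapDisk W1 W2 R'' → f y = 0 := by
    intro y hy
    by_cases hyR : y ∈ closedBall (0 : ℂ) R''
    · have hyR' := closedBall_subset_ball hR'' hyR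
      have : ¬ W2 y < W1 y := fun h => hy ⟨hyR, h⟩
      exact sub_eq_zero.2 (graphFlux_eq_of_touching hW1 hW2 hle hyR'
        (le_antisymm (not_lt.1 this) (hle y hyR')) T)
    · have : ∀ h, T (chart p b (y, h)) = 0 := fun h => hsupp _ fun ⟨q, hq, hqe⟩ => by
        have := chart_injective p b hqe
        rw [this] at hq
        exact hyR hq.1
      simp [hf, graphFlux, this]
  have hs : |boolSign s| = 1 := by cases s <;> simp [boolSign]
  calc boolSign s * ∫ y, f y ≤ |boolSign s * ∫ y, f y| := le_abs_self _
    _ = |∫ y, f y| := by rw [abs_mul, hs, one_mul]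
    _ ≤ ∫ y, |f y| := abs_integral_le_integral_abs
    _ = ∫ y in gapDisk W1 W2 R'', |f y| := by
        rw [setIntegral_eq_integral_of_forall_compl_eq_zero]
        intro y hy
        rw [hzero y hy, abs_zero]
    _ ≤ gapArea W1 W2 R'' := by
        refine setIntegral_mono_on ?_ (integrableOn_areaDensity hW1 hW2 inter_subset_left)
          hmeas fun y _ => ?_
        · exact (((integrable_graphFlux hT.contDiff.continuous hT.hasCompactSupport hW1).sub
            (integrable_graphFlux hT.contDiff.continuous hT.hasCompactSupport hW2)).abs).integrableOn
        · have h1 := abs_graphFlux_le p b hT1 W1 y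
          have h2 := abs_graphFlux_le p b hT1 W2 y
          rw [one_mul] at h1 h2
          exact (abs_sub _ _).trans (add_le_add h1 h2)

lemma perimeter_le_add_gapArea_aux (hF : MeasurableSet F) (hfill : FillsBox p b R H s F W1 W2)
    (hW1 : ContDiff ℝ 1 W1) (hW2 : ContDiff ℝ 1 W2) (hle : ∀ y ∈ ball (0 : ℂ) R, W2 y ≤ W1 y)
    (hH : H' < H) {R'' : ℝ} (hR1 : R' < R'') (hR'' : R'' < R) (V : Set R3) :
    perimeter V F ≤ perimeter (V \ closedBox p b R' H') F +
      ENNReal.ofReal (gapArea W1 W2 R'') := by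
  obtain ⟨H'', hH1, hH2⟩ := exists_between hH
  obtain ⟨κ, hκ, ⟨N, hN, hCN, hN1⟩, hκ0, hκI⟩ := exists_cutoff
    (C := closedBox p b R' H') (D := closedBox p b R'' H'') (isClosed_closedBox p b R' H')
    ((closedBox_subset_openBox p b hR1 hH1).trans
      (interior_maximal (openBox_subset_closedBox p b R'' H'') (isOpen_openBox p b R'' H'')))
  have hκ1 : ContDiff ℝ 1 κ := hκ.of_le (mod_cast le_top)
  refine perimeter_le fun T hT hT1 => ?_
  have hA0 := hT.smul hκ1
  have hA : IsTestField (openBox p b R H) (fun x => κ x • T x) := by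
    refine ⟨hA0.contDiff, hA0.hasCompactSupport, ?_⟩
    refine (closure_minimal ?_ (isClosed_closedBox p b R'' H'')).trans
      (closedBox_subset_openBox p b hR'' hH2)
    intro x hx
    by_contra h
    exact hx (by simp [hκ0 x h])
  have hB0 := hT.smul (contDiff_const.sub hκ1 : ContDiff ℝ 1 fun x => 1 - κ x)
  have hB : IsTestField (V \ closedBox p b R' H') (fun x => (1 - κ x) • T x) := by
    refine ⟨hB0.contDiff, hB0.hasCompactSupport, fun x hx => ⟨hB0.tsupport_subset hx, fun hxC => ?_⟩⟩
    have : tsupport (fun x => (1 - κ x) • T x) ⊆ Nᶜ := by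
      refine closure_minimal (fun z hz hzN => hz ?_) hN.isClosed_compl
      simp [hN1 z hzN]
    exact this hx (hCN hxC)
  have hsum : (fun x => κ x • T x + (1 - κ x) • T x) = T := by
    funext x
    rw [← add_smul]
    simp
  have hdiv := setIntegral_divergence_add hA hB F
  rw [hsum] at hdiv
  rw [hdiv, add_comm]
  refine ENNReal.ofReal_add_le.trans (add_le_add ?_ (ENNReal.ofReal_le_ofReal ?_))
  · refine le_perimeter hB fun x => ?_
    rw [norm_smul, Real.norm_of_nonneg (by linarith [(hκI x).2])]
    nlinarith [hT1 x, norm_nonneg (T x), (hκI x).1, (hκI x).2]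
  · refine integral_divergence_le_gapArea hF hfill hW1 hW2 hle hR'' hA (fun x => ?_) fun x hx => ?_
    · rw [norm_smul, Real.norm_of_nonneg (hκI x).1]
      nlinarith [hT1 x, norm_nonneg (T x), (hκI x).1, (hκI x).2]
    · have : x ∉ closedBox p b R'' H'' := fun h => hx
        (image_mono (prod_mono subset_rfl (Icc_subset_Icc (by linarith) hH2.le)) h)
      simp [hκ0 x this]

lemma tendsto_gapArea (hW1 : ContDiff ℝ 1 W1) (hW2 : ContDiff ℝ 1 W2) (R' : ℝ) :
    Tendsto (gapArea W1 W2) (𝓝[>] R') (𝓝 (gapArea W1 W2 R')) := by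
  have hInter : ⋂ r ∈ Ioi R', gapDisk W1 W2 r = gapDisk W1 W2 R' := by
    ext y
    simp only [gapDisk, mem_iInter, mem_inter_iff, mem_closedBall, mem_Ioi]
    constructor
    · intro h
      exact ⟨le_of_forall_gt_imp_ge_of_dense fun r hr => (h r hr).1, (h (R' + 1) (by linarith)).2⟩
    · intro h r hr
      exact ⟨h.1.trans hr.le, h.2⟩
  have key := tendsto_setIntegral_of_antitone (ι := ℕ) (μ := volume)
    (f := fun y => areaDensity W1 y + areaDensity W2 y)
    (s := fun n => gapDisk W1 W2 (R' + 1 / (n + 1)))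
    (fun n => measurableSet_gapDisk hW1.continuous hW2.continuous _) ?_ ?_
  rotate_left
  · intro m n hmn
    refine inter_subset_inter_left _ (closedBall_subset_closedBall ?_)
    have : (1 : ℝ) / (n + 1) ≤ 1 / (m + 1) := Nat.one_div_le_one_div hmn
    linarith
  · exact ⟨0, integrableOn_areaDensity hW1 hW2 inter_subset_left⟩
  have hI : ⋂ n : ℕ, gapDisk W1 W2 (R' + 1 / (n + 1)) = gapDisk W1 W2 R' := by
    refine Subset.antisymm (fun y hy => ?_) (subset_iInter fun n => ?_)
    · rw [mem_iInter] at hy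
      refine ⟨?_, (hy 0).2⟩
      have h1 : Tendsto (fun n : ℕ => R' + 1 / ((n : ℝ) + 1)) atTop (𝓝 (R' + 0)) :=
        tendsto_const_nhds.add tendsto_one_div_add_atTop_nhds_zero_nat
      rw [add_zero] at h1
      exact ge_of_tendsto' h1 fun n => (hy n).1
    · refine inter_subset_inter_left _ (closedBall_subset_closedBall ?_)
      have : (0 : ℝ) ≤ 1 / (n + 1) := by positivity
      linarith
  rw [hI] at key
  have hmono : Monotone (gapArea W1 W2) := fun r r' hrr' => by
    refine setIntegral_mono_set (integrableOn_areaDensity hW1 hW2 inter_subset_left)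
      (Eventually.of_forall fun y => ?_)
      (inter_subset_inter_left _ (closedBall_subset_closedBall hrr')).eventuallyLE
    have h1 := one_le_areaDensity W1 y
    have h2 := one_le_areaDensity W2 y
    simp only [Pi.zero_apply]
    linarith
  refine tendsto_order.2 ⟨fun a ha => ?_, fun a ha => ?_⟩
  · filter_upwards [self_mem_nhdsWithin] with r hr
    exact ha.trans_le (hmono (le_of_lt hr))
  · obtain ⟨n, hn⟩ := ((tendsto_order.1 key).2 a ha).exists
    have : R' < R' + 1 / ((n : ℝ) + 1) := by
      have : (0 : ℝ) < 1 / (n + 1) := by positivity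
      linarith
    filter_upwards [Ioo_mem_nhdsGT this] with r hr
    exact (hmono hr.2.le).trans_lt hn

lemma perimeter_le_add_gapArea (hF : MeasurableSet F) (hfill : FillsBox p b R H s F W1 W2)
    (hW1 : ContDiff ℝ 1 W1) (hW2 : ContDiff ℝ 1 W2) (hle : ∀ y ∈ ball (0 : ℂ) R, W2 y ≤ W1 y)
    (hH : H' < H) (hR : R' < R) (V : Set R3) :
    perimeter V F ≤ perimeter (V \ closedBox p b R' H') F +
      ENNReal.ofReal (gapArea W1 W2 R') := by
  have h1 := (ENNReal.continuous_ofReal.tendsto _).comp (tendsto_gapArea hW1 hW2 R')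
  have h2 := tendsto_const_nhds (x := perimeter (V \ closedBox p b R' H') F) |>.add h1
  refine ge_of_tendsto h2 ?_
  filter_upwards [Ioo_mem_nhdsGT hR] with r hr
  exact perimeter_le_add_gapArea_aux hF hfill hW1 hW2 hle hH hr.1 hr.2 V

end


section
variable {p : R3} {b : Frame} {R H R' H' : ℝ} {s : Bool} {F : Set R3} {W1 W2 : ℂ → ℝ}

/-- Linear bump of half-width `m` around height `c`. -/
def tent (m c h : ℝ) : ℝ := max 0 (1 - |h - c| / m)

lemma tent_self {m : ℝ} (c : ℝ) : tent m c c = 1 := by simp [tent]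

lemma tent_nonneg (m c h : ℝ) : 0 ≤ tent m c h := le_max_left _ _

lemma tent_le_one {m : ℝ} (hm : 0 < m) (c h : ℝ) : tent m c h ≤ 1 :=
  max_le zero_le_one (by have := abs_nonneg (h - c); have : 0 ≤ |h - c| / m := by positivity
                         linarith)

lemma tent_eq_zero {m c h : ℝ} (hm : 0 < m) (hh : m ≤ |h - c|) : tent m c h = 0 := by
  rw [tent, max_eq_left]
  rw [sub_nonpos, le_div_iff₀ hm]
  linarith

/-- A continuous field of norm at most one, equal to the unit normals on the two graphs over the
set `{a = 1}`. -/
def normalField (p : R3) (b : Frame) (W1 W2 a : ℂ → ℝ) (m : ℝ) (x : R3) : R3 :=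
  let q := chartInv p b x
  a q.1 • ((tent m (W1 q.1) q.2 / areaDensity W1 q.1) • graphNormal b W1 q.1 -
    (tent m (W2 q.1) q.2 / areaDensity W2 q.1) • graphNormal b W2 q.1)

lemma continuous_normalField (hW1 : ContDiff ℝ 1 W1) (hW2 : ContDiff ℝ 1 W2) {a : ℂ → ℝ}
    (ha : Continuous a) (m : ℝ) : Continuous (normalField p b W1 W2 a m) := by
  have hc : Continuous (chartInv p b) := (chartHomeo p b).symm.continuous
  have hy := continuous_fst.comp hc
  have hh := continuous_snd.comp hc
  have ht : ∀ W : ℂ → ℝ, ContDiff ℝ 1 W →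
      Continuous fun x => tent m (W (chartInv p b x).1) (chartInv p b x).2 := fun W hW =>
    continuous_const.max (continuous_const.sub ((hh.sub (hW.continuous.comp hy)).abs.div_const m))
  have hterm : ∀ W : ℂ → ℝ, ContDiff ℝ 1 W → Continuous fun x =>
      (tent m (W (chartInv p b x).1) (chartInv p b x).2 / areaDensity W (chartInv p b x).1) •
        graphNormal b W (chartInv p b x).1 := fun W hW =>
    ((ht W hW).div ((continuous_areaDensity hW).comp hy)
      fun x => (zero_lt_one.trans_le (one_le_areaDensity W _)).ne').smul
      ((continuous_graphNormal b hW).comp hy)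
  exact (ha.comp hy).smul ((hterm W1 hW1).sub (hterm W2 hW2))

lemma norm_tent_smul (W : ℂ → ℝ) (m : ℝ) (y : ℂ) (h : ℝ) :
    ‖(tent m (W y) h / areaDensity W y) • graphNormal b W y‖ = tent m (W y) h := by
  have := zero_lt_one.trans_le (one_le_areaDensity W y)
  rw [norm_smul, norm_graphNormal, Real.norm_of_nonneg
    (div_nonneg (tent_nonneg _ _ _) this.le), div_mul_cancel₀ _ this.ne']

lemma norm_normalField_le {a : ℂ → ℝ} {m : ℝ} (hm : 0 < m) (ha0 : ∀ y, 0 ≤ a y)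
    (ha1 : ∀ y, a y ≤ 1) (hgap : ∀ y, a y ≠ 0 → 2 * m ≤ W1 y - W2 y) (x : R3) :
    ‖normalField p b W1 W2 a m x‖ ≤ 1 := by
  set q := chartInv p b x with hq
  have h : ‖normalField p b W1 W2 a m x‖ = a q.1 * ‖(tent m (W1 q.1) q.2 / areaDensity W1 q.1) •
      graphNormal b W1 q.1 - (tent m (W2 q.1) q.2 / areaDensity W2 q.1) •
      graphNormal b W2 q.1‖ := by
    simp only [normalField, ← hq]
    rw [norm_smul, Real.norm_of_nonneg (ha0 _)]
  rw [h]
  by_cases hy : a q.1 = 0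
  · simp [hy]
  have hg := hgap _ hy
  have hle : ‖(tent m (W1 q.1) q.2 / areaDensity W1 q.1) •
      graphNormal b W1 q.1 - (tent m (W2 q.1) q.2 / areaDensity W2 q.1) •
      graphNormal b W2 q.1‖ ≤ 1 := by
    by_cases h1 : m ≤ |q.2 - W1 q.1|
    · rw [tent_eq_zero hm h1, zero_div, zero_smul, zero_sub, norm_neg, norm_tent_smul]
      exact tent_le_one hm _ _
    · have h2 : m ≤ |q.2 - W2 q.1| := by
        rw [not_le, abs_lt] at h1
        rw [le_abs]
        left
        linarith [h1.1]
      rw [tent_eq_zero hm h2, zero_div, zero_smul, sub_zero, norm_tent_smul]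
      exact tent_le_one hm _ _
  exact mul_le_one₀ (ha1 _) (norm_nonneg _) hle

lemma graphFlux_normalField_upper {a : ℂ → ℝ} {m : ℝ} (hm : 0 < m)
    (hgap : ∀ y, a y ≠ 0 → 2 * m ≤ W1 y - W2 y) (y : ℂ) :
    graphFlux p b (normalField p b W1 W2 a m) W1 y = a y * areaDensity W1 y := by
  by_cases hy : a y = 0
  · simp [graphFlux, normalField, chartInv_chart, hy]
  have h2 : m ≤ |W1 y - W2 y| := by
    have := hgap y hy
    rw [le_abs]; left; linarith
  have hd := zero_lt_one.trans_le (one_le_areaDensity W1 y)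
  simp only [graphFlux, normalField, chartInv_chart, tent_self, tent_eq_zero hm h2]
  rw [zero_div, zero_smul, sub_zero, inner_smul_right, inner_smul_right,
    real_inner_self_eq_norm_sq, norm_graphNormal]
  field_simp

lemma graphFlux_normalField_lower {a : ℂ → ℝ} {m : ℝ} (hm : 0 < m)
    (hgap : ∀ y, a y ≠ 0 → 2 * m ≤ W1 y - W2 y) (y : ℂ) :
    graphFlux p b (normalField p b W1 W2 a m) W2 y = -(a y * areaDensity W2 y) := by
  by_cases hy : a y = 0
  · simp [graphFlux, normalField, chartInv_chart, hy]
  have h2 : m ≤ |W2 y - W1 y| := by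
    have := hgap y hy
    rw [le_abs]; right; linarith
  have hd := zero_lt_one.trans_le (one_le_areaDensity W2 y)
  simp only [graphFlux, normalField, chartInv_chart, tent_self, tent_eq_zero hm h2]
  rw [zero_div, zero_smul, zero_sub, smul_neg, inner_neg_right, inner_smul_right, inner_smul_right,
    real_inner_self_eq_norm_sq, norm_graphNormal]
  field_simp

lemma exists_uniform_gap {K : Set ℂ} (hK : IsCompact K) {f : ℂ → ℝ} (hf : Continuous f)
    (hpos : ∀ y ∈ K, 0 < f y) : ∃ m > 0, ∀ y ∈ K, m ≤ f y := by
  rcases K.eq_empty_or_nonempty with rfl | hne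
  · exact ⟨1, one_pos, by simp⟩
  · obtain ⟨y, hy, hmin⟩ := hK.exists_isMinOn hne hf.continuousOn
    exact ⟨f y, hpos y hy, fun z hz => hmin hz⟩

/-- Almost all of the area of the two graphs is seen by a compactly supported weight. -/
lemma exists_weight (hW1 : ContDiff ℝ 1 W1) (hW2 : ContDiff ℝ 1 W2) {ε : ℝ} (hε : 0 < ε) :
    ∃ a : ℂ → ℝ, Continuous a ∧ HasCompactSupport a ∧
      tsupport a ⊆ ball 0 R ∩ {y | W2 y < W1 y} ∧ (∀ y, 0 ≤ a y) ∧ (∀ y, a y ≤ 1) ∧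
      gapArea W1 W2 R - ε ≤ ∫ y, a y * (areaDensity W1 y + areaDensity W2 y) := by
  set O : Set ℂ := ball 0 R ∩ {y | W2 y < W1 y} with hO
  have hOo : IsOpen O := isOpen_ball.inter (isOpen_lt hW2.continuous hW1.continuous)
  set d := fun y => areaDensity W1 y + areaDensity W2 y with hd
  have hdc : Continuous d := (continuous_areaDensity hW1).add (continuous_areaDensity hW2)
  have hd0 : ∀ y, 0 ≤ d y := fun y => by
    have h1 := one_le_areaDensity W1 y
    have h2 := one_le_areaDensity W2 y
    simp only [hd]
    linarith
  obtain ⟨M, hM⟩ := (isCompact_closedBall (0 : ℂ) R).exists_bound_of_continuousOn hdc.continuousOn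
  have hM0 : 0 ≤ max M 0 := le_max_right _ _
  have hfin : volume O ≠ ⊤ := ((measure_mono inter_subset_left).trans_lt measure_ball_lt_top).ne
  obtain ⟨K, hKO, hK, hKμ⟩ := hOo.measurableSet.exists_isCompact_sdiff_lt hfin
    (ε := ENNReal.ofReal (ε / (max M 0 + 1))) (by
      rw [ne_eq, ENNReal.ofReal_eq_zero, not_le]; positivity)
  obtain ⟨L, hL, hKL, hLO⟩ := exists_compact_between hK hOo hKO
  obtain ⟨a, has, ⟨N, -, hKN, hN1⟩, ha0, haI⟩ := exists_cutoff hK.isClosed hKL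
  have haL : tsupport a ⊆ L := closure_minimal
    (fun y hy => by_contra fun h => hy (ha0 y h)) hL.isClosed
  have haO : tsupport a ⊆ O := haL.trans hLO
  have ha1 : ∀ y ∈ K, a y = 1 := fun y hy => hN1 y (hKN hy)
  have hac : Continuous a := has.continuous
  refine ⟨a, hac, hL.of_isClosed_subset (isClosed_tsupport _) haL, haO,
    fun y => (haI y).1, fun y => (haI y).2, ?_⟩
  have hint : IntegrableOn d O :=
    integrableOn_areaDensity hW1 hW2 (inter_subset_left.trans ball_subset_closedBall)
  have hA : gapArea W1 W2 R = ∫ y in O, d y := by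
    refine setIntegral_congr_set ?_
    refine (ae_eq_set_inter ?_ (ae_eq_refl _))
    rw [← ball_union_sphere]
    exact union_ae_eq_left_of_ae_eq_empty (by
      rw [ae_eq_empty]; exact Measure.addHaar_sphere volume 0 R)
  have hai : IntegrableOn (fun y => a y * d y) O :=
    (((hac.mul hdc).continuousOn.integrableOn_compact
      (isCompact_closedBall 0 R)).mono_set (inter_subset_left.trans ball_subset_closedBall))
  have h1 : ∫ y, a y * d y = ∫ y in O, a y * d y := by
    rw [setIntegral_eq_integral_of_forall_compl_eq_zero]
    intro y hy
    have : a y = 0 := by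
      by_contra h
      exact hy (haO (subset_tsupport _ h))
    rw [this, zero_mul]
  have h2 : (∫ y in O, d y) - ∫ y in O, a y * d y ≤ ε := by
    rw [← integral_sub hint hai]
    have hz : ∀ y ∈ O \ (O \ K), d y - a y * d y = 0 := by
      intro y hy
      have : y ∈ K := by_contra fun h => hy.2 ⟨hy.1, h⟩
      rw [ha1 y this]; ring
    rw [setIntegral_eq_of_subset_of_forall_sdiff_eq_zero hOo.measurableSet sdiff_subset hz]
    have hb : ∀ y ∈ O \ K, ‖d y - a y * d y‖ ≤ max M 0 := by
      intro y hy
      have h3 := hM y (ball_subset_closedBall hy.1.1)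
      rw [Real.norm_of_nonneg (hd0 y)] at h3
      have h4 : 0 ≤ d y - a y * d y := by nlinarith [hd0 y, (haI y).1, (haI y).2]
      rw [Real.norm_of_nonneg h4]
      have : d y ≤ max M 0 := h3.trans (le_max_left _ _)
      nlinarith [hd0 y, (haI y).1, (haI y).2]
    have h5 := norm_setIntegral_le_of_norm_le_const (μ := volume) (s := O \ K)
      (hKμ.trans ENNReal.ofReal_lt_top) hb
    have h6 : volume.real (O \ K) ≤ ε / (max M 0 + 1) :=
      ENNReal.toReal_le_of_le_ofReal (by positivity) hKμ.le
    calc ∫ y in O \ K, (d y - a y * d y) ≤ ‖∫ y in O \ K, (d y - a y * d y)‖ := le_abs_self _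
      _ ≤ max M 0 * volume.real (O \ K) := h5
      _ ≤ max M 0 * (ε / (max M 0 + 1)) := mul_le_mul_of_nonneg_left h6 hM0
      _ ≤ ε := by
        rw [mul_div_assoc', div_le_iff₀ (by positivity)]
        nlinarith
  rw [h1, hA]
  linarith

lemma ofReal_gapArea_le_perimeter (hF : MeasurableSet F) (hfill : FillsBox p b R H s F W1 W2)
    (hW1 : ContDiff ℝ 1 W1) (hW2 : ContDiff ℝ 1 W2) (hle : ∀ y ∈ ball (0 : ℂ) R, W2 y ≤ W1 y)
    (hb1 : ∀ y ∈ ball (0 : ℂ) R, |W1 y| < H) (hb2 : ∀ y ∈ ball (0 : ℂ) R, |W2 y| < H) :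
    ENNReal.ofReal (gapArea W1 W2 R) ≤ perimeter (openBox p b R H) F := by
  set A := gapArea W1 W2 R with hA
  set d := fun y => areaDensity W1 y + areaDensity W2 y with hd
  have hs : boolSign s * boolSign s = 1 := by cases s <;> simp [boolSign]
  have hs1 : |boolSign s| = 1 := by cases s <;> simp [boolSign]
  have key : ∀ ε > 0, ENNReal.ofReal ((A - ε - ε * A) / (1 + ε)) ≤
      perimeter (openBox p b R H) F := by
    intro ε hε
    obtain ⟨a, hac, hacs, haO, ha0, ha1, haA⟩ := exists_weight (R := R) hW1 hW2 hε
    obtain ⟨m₀, hm₀, hgap₀⟩ := exists_uniform_gap hacs.isCompact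
      (hW1.continuous.sub hW2.continuous) fun y hy => sub_pos.2 (haO hy).2
    obtain ⟨m1, hm1, hgap1⟩ := exists_uniform_gap hacs.isCompact
      (continuous_const.sub hW1.continuous.abs : Continuous fun y => H - |W1 y|)
      fun y hy => sub_pos.2 (hb1 y (haO hy).1)
    obtain ⟨m2, hm2, hgap2⟩ := exists_uniform_gap hacs.isCompact
      (continuous_const.sub hW2.continuous.abs : Continuous fun y => H - |W2 y|)
      fun y hy => sub_pos.2 (hb2 y (haO hy).1)
    set m := min (m₀ / 2) (min (m1 / 2) (m2 / 2)) with hm_def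
    have hm : 0 < m := by positivity
    have hmm₀ : m ≤ m₀ / 2 := min_le_left _ _
    have hmm1 : m ≤ m1 / 2 := (min_le_right _ _).trans (min_le_left _ _)
    have hmm2 : m ≤ m2 / 2 := (min_le_right _ _).trans (min_le_right _ _)
    have hgap : ∀ y, a y ≠ 0 → 2 * m ≤ W1 y - W2 y := fun y hy => by
      have : m₀ ≤ W1 y - W2 y := hgap₀ y (subset_tsupport _ hy)
      linarith
    set T := normalField p b W1 W2 a m with hT
    have hTc : Continuous T := continuous_normalField hW1 hW2 hac m
    obtain ⟨G, hG, hGT, hGs⟩ := hTc.exists_contDiff_approx (ε := fun _ => ε) 1 continuous_const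
      fun _ => hε
    have hTs : Function.support T ⊆ chart p b '' (tsupport a ×ˢ Icc (-(H - m)) (H - m)) := by
      intro x hx
      rw [mem_image_chart]
      set q := chartInv p b x with hq
      have hay : a q.1 ≠ 0 := fun h => hx (by simp [hT, normalField, ← hq, h])
      have hq1 := subset_tsupport _ hay
      refine ⟨hq1, ?_⟩
      rw [mem_Icc, ← abs_le]
      by_contra hlt
      rw [not_le] at hlt
      have h1 : m1 ≤ H - |W1 q.1| := hgap1 _ hq1
      have h2 : m2 ≤ H - |W2 q.1| := hgap2 _ hq1
      have e1 : m ≤ |q.2 - W1 q.1| := by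
        have := abs_sub_abs_le_abs_sub q.2 (W1 q.1)
        linarith
      have e2 : m ≤ |q.2 - W2 q.1| := by
        have := abs_sub_abs_le_abs_sub q.2 (W2 q.1)
        linarith
      exact hx (by simp [hT, normalField, ← hq, tent_eq_zero hm e1, tent_eq_zero hm e2])
    have hcpt : IsCompact (chart p b '' (tsupport a ×ˢ Icc (-(H - m)) (H - m))) :=
      (hacs.isCompact.prod isCompact_Icc).image (chartHomeo p b).continuous
    have htsub : tsupport G ⊆ chart p b '' (tsupport a ×ˢ Icc (-(H - m)) (H - m)) :=
      closure_minimal (hGs.trans hTs) hcpt.isClosed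
    have hGtest : IsTestField (openBox p b R H) G := by
      refine ⟨hG, HasCompactSupport.intro hcpt fun x hx => ?_, htsub.trans (image_mono
        (prod_mono (haO.trans inter_subset_left) (Icc_subset_Ioo (by linarith) (by linarith))))⟩
      by_contra h
      exact hx (htsub (subset_tsupport _ h))
    have hT1 : ∀ x, ‖T x‖ ≤ 1 := norm_normalField_le hm ha0 ha1 hgap
    have hG1 : ∀ x, ‖G x‖ ≤ 1 + ε := fun x => by
      have h1 := hGT x
      rw [dist_eq_norm] at h1
      have := norm_le_norm_add_norm_sub (T x) (G x)
      have h2 := norm_sub_rev (T x) (G x)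
      linarith [hT1 x]
    have hS : IsTestField (openBox p b R H) (fun x => (boolSign s / (1 + ε)) • G x) :=
      hGtest.smul contDiff_const
    have hS1 : ∀ x, ‖(boolSign s / (1 + ε)) • G x‖ ≤ 1 := fun x => by
      rw [norm_smul, Real.norm_eq_abs, abs_div, hs1, abs_of_pos (by linarith : (0 : ℝ) < 1 + ε),
        div_mul_eq_mul_div, one_mul, div_le_one (by linarith)]
      exact hG1 x
    refine le_trans (ENNReal.ofReal_le_ofReal ?_) (le_perimeter hS hS1)
    rw [integral_divergence_of_fillsBox hF hfill hW1 hW2 hle hS]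
    have hlin : ∀ W y, graphFlux p b (fun x => (boolSign s / (1 + ε)) • G x) W y =
        (boolSign s / (1 + ε)) * graphFlux p b G W y := fun W y => by
      simp [graphFlux, inner_smul_right]
    simp only [hlin, ← mul_sub]
    rw [integral_const_mul, ← mul_assoc, mul_div_assoc', hs, div_mul_eq_mul_div, one_mul]
    refine div_le_div_of_nonneg_right ?_ (by linarith)
    set O : Set ℂ := gapDisk W1 W2 R with hO
    have hzero : ∀ y, y ∉ O → graphFlux p b G W1 y - graphFlux p b G W2 y = 0 := by
      intro y hy
      have : ∀ h, G (chart p b (y, h)) = 0 := fun h => by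
        by_contra h0
        obtain ⟨q', hq', h⟩ := htsub (subset_tsupport _ h0)
        have := chart_injective p b h
        rw [this] at hq'
        exact hy ⟨ball_subset_closedBall (haO hq'.1).1, (haO hq'.1).2⟩
      simp [graphFlux, this]
    have haz : ∀ y, y ∉ O → a y * d y = 0 := by
      intro y hy
      have : a y = 0 := by
        by_contra h0
        exact hy ⟨ball_subset_closedBall (haO (subset_tsupport _ h0)).1,
          (haO (subset_tsupport _ h0)).2⟩
      rw [this, zero_mul]
    have hOm := measurableSet_gapDisk hW1.continuous hW2.continuous R
    rw [← setIntegral_eq_integral_of_forall_compl_eq_zero hzero]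
    rw [← setIntegral_eq_integral_of_forall_compl_eq_zero haz] at haA
    have hdi : IntegrableOn d O := integrableOn_areaDensity hW1 hW2 inter_subset_left
    have hdc : Continuous d := (continuous_areaDensity hW1).add (continuous_areaDensity hW2)
    have hadi : IntegrableOn (fun y => a y * d y) O :=
      ((hac.mul hdc).continuousOn.integrableOn_compact
        (isCompact_closedBall 0 R)).mono_set inter_subset_left
    have hmono : ∫ y in O, (a y * d y - ε * d y) ≤
        ∫ y in O, (graphFlux p b G W1 y - graphFlux p b G W2 y) := by
      refine setIntegral_mono_on (hadi.sub (hdi.const_mul ε)) ?_ hOm fun y _ => ?_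
      · exact ((integrable_graphFlux hG.continuous hGtest.hasCompactSupport hW1).sub
          (integrable_graphFlux hG.continuous hGtest.hasCompactSupport hW2)).integrableOn
      have e1 := graphFlux_normalField_upper (p := p) (b := b) hm hgap y
      have e2 := graphFlux_normalField_lower (p := p) (b := b) hm hgap y
      have hsub : ∀ W, graphFlux p b (fun x => G x - T x) W y =
          graphFlux p b G W y - graphFlux p b T W y := fun W => by
        simp [graphFlux, inner_sub_right]
      have hbd : ∀ x, ‖G x - T x‖ ≤ ε := fun x => by rw [← dist_eq_norm]; exact (hGT x).le
      have f1 := abs_le.1 (abs_graphFlux_le p b hbd W1 y)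
      have f2 := abs_le.1 (abs_graphFlux_le p b hbd W2 y)
      rw [hsub] at f1 f2
      simp only [hd]
      nlinarith [f1.1, f2.2]
    rw [integral_sub hadi (hdi.const_mul ε), integral_const_mul] at hmono
    have hAd : A = ∫ y in O, d y := rfl
    rw [← hAd] at hmono
    linarith
  have hlim : Tendsto (fun ε : ℝ => ENNReal.ofReal ((A - ε - ε * A) / (1 + ε))) (𝓝[>] 0)
      (𝓝 (ENNReal.ofReal A)) := by
    refine (ENNReal.continuous_ofReal.tendsto _).comp ?_
    have : ContinuousAt (fun ε : ℝ => (A - ε - ε * A) / (1 + ε)) 0 := by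
      refine ContinuousAt.div (by fun_prop) (by fun_prop) (by norm_num)
    have h := this.tendsto
    simp only [sub_zero, zero_mul, add_zero, div_one] at h
    exact h.mono_left nhdsWithin_le_nhds
  refine le_of_tendsto hlim ?_
  filter_upwards [self_mem_nhdsWithin] with ε hε
  exact key ε hε

lemma FillsBox.mono (h : FillsBox p b R H s F W1 W2) (hR : R' ≤ R) (hH : H' ≤ H) :
    FillsBox p b R' H' s F W1 W2 := by
  filter_upwards [h] with q hq hq'
  exact hq (prod_mono (ball_subset_ball hR) (Ioo_subset_Ioo (by linarith) hH) hq')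

/-- In the box, the perimeter of a set bounded by two graphs is the area of the graphs. -/
lemma perimeter_eq_add_gapArea (hF : MeasurableSet F) (hfill : FillsBox p b R H s F W1 W2)
    (hW1 : ContDiff ℝ 1 W1) (hW2 : ContDiff ℝ 1 W2) (hle : ∀ y ∈ ball (0 : ℂ) R, W2 y ≤ W1 y)
    (hb1 : ∀ y ∈ ball (0 : ℂ) R, |W1 y| < H') (hb2 : ∀ y ∈ ball (0 : ℂ) R, |W2 y| < H')
    (hH : H' < H) (hR : R' < R) {V : Set R3} (hV : openBox p b R H ⊆ V) :
    perimeter V F = perimeter (V \ closedBox p b R' H') F +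
      ENNReal.ofReal (gapArea W1 W2 R') := by
  refine le_antisymm (perimeter_le_add_gapArea hF hfill hW1 hW2 hle hH hR V) ?_
  have hsub := ball_subset_ball (x := (0 : ℂ)) hR.le
  refine (add_le_add le_rfl (ofReal_gapArea_le_perimeter hF (hfill.mono hR.le hH.le) hW1 hW2
    (fun y hy => hle y (hsub hy)) (fun y hy => hb1 y (hsub hy))
    fun y hy => hb2 y (hsub hy))).trans ?_
  refine perimeter_add_le sdiff_subset ((openBox_subset_closedBox p b R' H').trans
      ((closedBox_subset_openBox p b hR hH).trans hV)) ?_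
  exact disjoint_left.2 fun x hx hx' => hx.2 (openBox_subset_closedBox p b R' H' hx')

end


/-! ### Bulk integrals and the energy of a set bounded by two graphs in a box -/

/-- The average of `k` on the vertical segment from `(y, 0)` to `(y, h)`. -/
def vertAvg (k : ℂ × ℝ → ℝ) (q : ℂ × ℝ) : ℝ := ∫ r in (0 : ℝ)..1, k (q.1, r * q.2)

lemma mul_vertAvg (k : ℂ × ℝ → ℝ) (y : ℂ) (h : ℝ) :
    h * vertAvg k (y, h) = ∫ z in (0 : ℝ)..h, k (y, z) := by
  have := intervalIntegral.mul_integral_comp_mul_right (a := 0) (b := 1)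
    (f := fun z => k (y, z)) h
  simpa [vertAvg] using this

lemma vertAvg_one (q : ℂ × ℝ) : vertAvg (fun _ => 1) q = 1 := by simp [vertAvg]

lemma continuous_vertAvg {k : ℂ × ℝ → ℝ} (hk : Continuous k) : Continuous (vertAvg k) := by
  refine intervalIntegral.continuous_parametric_intervalIntegral_of_continuous' ?_ 0 1
  exact hk.comp ((continuous_fst.comp continuous_fst).prodMk
    (continuous_snd.mul (continuous_snd.comp continuous_fst)))

/-- The integral of `k` over the region between the graphs of `W2` and `W1`, over the disk of
radius `R`. -/
def bulk (k : ℂ × ℝ → ℝ) (W1 W2 : ℂ → ℝ) (R : ℝ) : ℝ := ∫ y in closedBall (0 : ℂ) R,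
    (W1 y * vertAvg k (y, W1 y) - W2 y * vertAvg k (y, W2 y))

section
variable {p : R3} {b : Frame} {R H R' H' : ℝ} {s : Bool} {F E U : Set R3} {W1 W2 : ℂ → ℝ}

lemma setIntegral_midRegion {k : ℂ × ℝ → ℝ} (hk : Continuous k) (hW1 : Continuous W1)
    (hW2 : Continuous W2) (hle : ∀ y ∈ closedBall (0 : ℂ) R', W2 y ≤ W1 y)
    (hb1 : ∀ y ∈ closedBall (0 : ℂ) R', |W1 y| < H')
    (hb2 : ∀ y ∈ closedBall (0 : ℂ) R', |W2 y| < H') :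
    ∫ q in (closedBall (0 : ℂ) R' ×ˢ Icc (-H') H') ∩ midRegion W1 W2, k q =
      bulk k W1 W2 R' := by
  have hm := measurableSet_midRegion hW1 hW2
  have hcpt : IsCompact (closedBall (0 : ℂ) R' ×ˢ Icc (-H') H') :=
    (isCompact_closedBall _ _).prod isCompact_Icc
  have hint : IntegrableOn ((midRegion W1 W2).indicator k)
      (closedBall (0 : ℂ) R' ×ˢ Icc (-H') H') :=
    (hk.continuousOn.integrableOn_compact hcpt).indicator hm
  rw [← setIntegral_indicator hm, Measure.volume_eq_prod, setIntegral_prod _ (by exact hint), bulk]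
  refine setIntegral_congr_fun isClosed_closedBall.measurableSet fun y hy => ?_
  have h1 := abs_lt.1 (hb1 y hy)
  have h2 := abs_lt.1 (hb2 y hy)
  have hkc : Continuous fun z => k (y, z) := hk.comp (continuous_const.prodMk continuous_id)
  have hsub : Ioo (W2 y) (W1 y) ⊆ Icc (-H') H' := fun z hz =>
    ⟨by linarith [hz.1, h2.1], by linarith [hz.2, h1.2]⟩
  have hind : ∀ z, (midRegion W1 W2).indicator k (y, z) =
      (Ioo (W2 y) (W1 y)).indicator (fun z => k (y, z)) z := fun z => rfl
  simp only [hind]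
  rw [setIntegral_indicator measurableSet_Ioo, inter_eq_right.2 hsub, ← integral_Ioc_eq_integral_Ioo,
    ← intervalIntegral.integral_of_le (hle y hy), mul_vertAvg, mul_vertAvg,
    intervalIntegral.integral_interval_sub_left (hkc.intervalIntegrable _ _)
      (hkc.intervalIntegrable _ _)]

/-- Integrals over the closed box of a set bounded by two graphs. -/
lemma setIntegral_inter_closedBox {k : R3 → ℝ} {kc : ℂ × ℝ → ℝ} (hkc : Continuous kc)
    (hk : ∀ q ∈ closedBall (0 : ℂ) R' ×ˢ Icc (-H') H', k (chart p b q) = kc q)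
    (hF : MeasurableSet F) (hfill : FillsBox p b R H s F W1 W2) (hW1 : Continuous W1)
    (hW2 : Continuous W2) (hle : ∀ y ∈ ball (0 : ℂ) R, W2 y ≤ W1 y)
    (hb1 : ∀ y ∈ ball (0 : ℂ) R, |W1 y| < H') (hb2 : ∀ y ∈ ball (0 : ℂ) R, |W2 y| < H')
    (hH : H' < H) (hR : R' < R) :
    ∫ x in F ∩ closedBox p b R' H', k x =
      (if s then 0 else ∫ x in closedBox p b R' H', k x) + boolSign s * bulk kc W1 W2 R' := by
  set S := closedBall (0 : ℂ) R' ×ˢ Icc (-H') H' with hS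
  have hSm : MeasurableSet S := isClosed_closedBall.measurableSet.prod measurableSet_Icc
  have hsub := closedBall_subset_ball (x := (0 : ℂ)) hR
  have hm := measurableSet_midRegion hW1 hW2
  have hmid := setIntegral_midRegion hkc hW1 hW2 (fun y hy => hle y (hsub hy))
    (fun y hy => hb1 y (hsub hy)) (fun y hy => hb2 y (hsub hy))
  have hFC : F ∩ closedBox p b R' H' = chart p b '' (chart p b ⁻¹' F ∩ S) := by
    rw [image_preimage_inter]; rfl
  have hpre : MeasurableSet (chart p b ⁻¹' F) := (chartHomeo p b).continuous.measurable hF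
  have hSbox : S ⊆ ball (0 : ℂ) R ×ˢ Ioo (-H) H := prod_mono hsub (Icc_subset_Ioo (by linarith) hH)
  have hcpt : IsCompact S := (isCompact_closedBall _ _).prod isCompact_Icc
  have hint : IntegrableOn kc S := hkc.continuousOn.integrableOn_compact hcpt
  have hbox : ∫ x in closedBox p b R' H', k x = ∫ q in S, kc q := by
    rw [closedBox, setIntegral_image_chart]
    exact setIntegral_congr_fun hSm fun q hq => hk q hq
  rw [hFC, setIntegral_image_chart]
  have h1 : ∫ q in chart p b ⁻¹' F ∩ S, k (chart p b q) = ∫ q in chart p b ⁻¹' F ∩ S, kc q :=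
    setIntegral_congr_fun (hpre.inter hSm) fun q hq => hk q hq.2
  rw [h1, hbox]
  cases s
  · have h2 : (chart p b ⁻¹' F ∩ S : Set (ℂ × ℝ)) =ᵐ[volume]
        (S \ (S ∩ midRegion W1 W2) : Set (ℂ × ℝ)) := by
      rw [eventuallyEq_set]
      filter_upwards [hfill] with q hq
      by_cases hqS : q ∈ S
      · have := hq (hSbox hqS)
        simp only [mem_inter_iff, mem_preimage, this, hqS, Set.mem_sdiff]
        simp
      · simp [hqS]
    rw [setIntegral_congr_set h2, setIntegral_sdiff (hSm.inter hm) hint inter_subset_left, hmid]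
    simp [boolSign, sub_eq_add_neg]
  · have h2 : (chart p b ⁻¹' F ∩ S : Set (ℂ × ℝ)) =ᵐ[volume]
        (S ∩ midRegion W1 W2 : Set (ℂ × ℝ)) := by
      rw [eventuallyEq_set]
      filter_upwards [hfill] with q hq
      by_cases hqS : q ∈ S
      · have := hq (hSbox hqS)
        simp only [mem_inter_iff, mem_preimage, this, hqS]
        simp
      · simp [hqS]
    rw [setIntegral_congr_set h2, hmid]
    simp [boolSign]

lemma perimeter_congr_off_closed {C V : Set R3} (hF : MeasurableSet F)
    (hE : MeasurableSet E) (hEF : F \ C = E \ C) : perimeter (V \ C) F = perimeter (V \ C) E := by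
  have key : ∀ T, IsTestField (V \ C) T →
      ∫ x in F, divergence T x = ∫ x in E, divergence T x := by
    intro T hT
    have h0 : ∀ x ∈ C, divergence T x = 0 := fun x hx =>
      divergence_eq_zero_of_notMem fun h => (hT.tsupport_subset h).2 hx
    have h1 : ∀ G : Set R3, MeasurableSet G →
        ∫ x in G, divergence T x = ∫ x in G \ C, divergence T x := fun G hG =>
      setIntegral_eq_of_subset_of_forall_sdiff_eq_zero hG sdiff_subset fun x hx =>
        h0 x (by_contra fun h => hx.2 ⟨hx.1, h⟩)
    rw [h1 F hF, h1 E hE, hEF]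
  refine le_antisymm (perimeter_le fun T hT h1 => ?_) (perimeter_le fun T hT h1 => ?_)
  · rw [key T hT]; exact le_perimeter hT h1
  · rw [← key T hT]; exact le_perimeter hT h1

lemma isCaccioppoli_of_fillsBox (hE : IsCaccioppoli E) (hF : MeasurableSet F)
    (hfill : FillsBox p b R H s F W1 W2) (hW1 : ContDiff ℝ 1 W1) (hW2 : ContDiff ℝ 1 W2)
    (hle : ∀ y ∈ ball (0 : ℂ) R, W2 y ≤ W1 y) (hH : H' < H) (hR : R' < R)
    (hEF : F \ closedBox p b R' H' = E \ closedBox p b R' H') : IsCaccioppoli F := by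
  refine ⟨hF, fun V hV hVb => ?_⟩
  refine ne_top_of_le_ne_top ?_ (perimeter_le_add_gapArea hF hfill hW1 hW2 hle hH hR V)
  rw [perimeter_congr_off_closed hF hE.1 hEF]
  exact ENNReal.add_ne_top.2 ⟨ne_top_of_le_ne_top (hE.2 V hV hVb) (perimeter_mono sdiff_subset),
    ENNReal.ofReal_ne_top⟩

/-- The part of the energy that does not depend on the graphs in the box. -/
def energyOutside (g : R3 → ℝ) (U E C : Set R3) (s : Bool) : ℝ :=
  (perimeter (U \ C) E).toReal + (∫ x in (E ∩ U) \ C, g x) + if s then 0 else ∫ x in C, g x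

lemma inter_sdiff_congr {C : Set R3} (hEF : F \ C = E \ C) : (F ∩ U) \ C = (E ∩ U) \ C := by
  ext x
  have := Set.ext_iff.1 hEF x
  simp only [Set.mem_sdiff] at this
  simp only [Set.mem_sdiff, mem_inter_iff]
  tauto

lemma closedBox_subset_of_openBox_subset (hU : openBox p b R H ⊆ U) (hH : H' < H) (hR : R' < R) :
    closedBox p b R' H' ⊆ U := (closedBox_subset_openBox p b hR hH).trans hU

/-- The energy of a set bounded by two graphs in a box. -/
lemma energy_of_fillsBox {g : R3 → ℝ} {kc : ℂ × ℝ → ℝ} (hkc : Continuous kc)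
    (hk : ∀ q ∈ closedBall (0 : ℂ) R' ×ˢ Icc (-H') H', g (chart p b q) = kc q)
    (hg : IntegrableOn g U) (hper : perimeter U E ≠ ⊤) (hE : MeasurableSet E)
    (hF : MeasurableSet F) (hfill : FillsBox p b R H s F W1 W2) (hW1 : ContDiff ℝ 1 W1)
    (hW2 : ContDiff ℝ 1 W2) (hle : ∀ y ∈ ball (0 : ℂ) R, W2 y ≤ W1 y)
    (hb1 : ∀ y ∈ ball (0 : ℂ) R, |W1 y| < H') (hb2 : ∀ y ∈ ball (0 : ℂ) R, |W2 y| < H')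
    (hH : H' < H) (hR : R' < R) (hU : openBox p b R H ⊆ U)
    (hEF : F \ closedBox p b R' H' = E \ closedBox p b R' H') :
    energy g U F = energyOutside g U E (closedBox p b R' H') s +
      (gapArea W1 W2 R' + boolSign s * bulk kc W1 W2 R') := by
  have hCU := closedBox_subset_of_openBox_subset hU hH hR
  have hCm := (isClosed_closedBox p b R' H').measurableSet
  rw [energy, perimeter_eq_add_gapArea hF hfill hW1 hW2 hle hb1 hb2 hH hR hU,
    perimeter_congr_off_closed hF hE hEF, ENNReal.toReal_add
      (ne_top_of_le_ne_top hper (perimeter_mono sdiff_subset)) ENNReal.ofReal_ne_top,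
    ENNReal.toReal_ofReal (gapArea_nonneg _ _ _),
    ← integral_inter_add_sdiff hCm (hg.mono_set inter_subset_right), inter_assoc,
    inter_eq_right.2 hCU, setIntegral_inter_closedBox hkc hk hF hfill hW1.continuous
      hW2.continuous hle hb1 hb2 hH hR, inter_sdiff_congr hEF, energyOutside]
  ring

lemma volume_inter_closedBox_congr {F' : Set R3} {W1' W2' : ℂ → ℝ} (hF : MeasurableSet F)
    (hfill : FillsBox p b R H s F W1 W2) (hW1 : Continuous W1)
    (hW2 : Continuous W2) (hle : ∀ y ∈ ball (0 : ℂ) R, W2 y ≤ W1 y)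
    (hb1 : ∀ y ∈ ball (0 : ℂ) R, |W1 y| < H') (hb2 : ∀ y ∈ ball (0 : ℂ) R, |W2 y| < H')
    (hF' : MeasurableSet F') (hfill' : FillsBox p b R H s F' W1' W2') (hW1' : Continuous W1')
    (hW2' : Continuous W2') (hle' : ∀ y ∈ ball (0 : ℂ) R, W2' y ≤ W1' y)
    (hb1' : ∀ y ∈ ball (0 : ℂ) R, |W1' y| < H') (hb2' : ∀ y ∈ ball (0 : ℂ) R, |W2' y| < H')
    (hH : H' < H) (hR : R' < R)
    (hbulk : bulk (fun _ => 1) W1 W2 R' = bulk (fun _ => 1) W1' W2' R') :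
    volume (F ∩ closedBox p b R' H') = volume (F' ∩ closedBox p b R' H') := by
  have h1 := setIntegral_inter_closedBox (k := fun _ => 1) (kc := fun _ => 1) (p := p) (b := b)
    continuous_const (fun _ _ => rfl) hF hfill hW1 hW2 hle hb1 hb2 hH hR
  have h2 := setIntegral_inter_closedBox (k := fun _ => 1) (kc := fun _ => 1) (p := p) (b := b)
    continuous_const (fun _ _ => rfl) hF' hfill' hW1' hW2' hle' hb1' hb2' hH hR
  rw [hbulk, ← h2] at h1
  simp only [setIntegral_const, smul_eq_mul, mul_one] at h1
  have hfin : ∀ G : Set R3, volume (G ∩ closedBox p b R' H') ≠ ⊤ := fun G =>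
    ((measure_mono inter_subset_right).trans_lt (isCompact_closedBox p b R' H').measure_lt_top).ne
  exact (measureReal_eq_measureReal_iff (hfin F) (hfin F')).1 h1

end


/-! ### Radial stretching of the plane -/

/-- The radial profile `ρ ↦ ρ + t χ(ρ)`. -/
def stretch (χ : ℝ → ℝ) (t ρ : ℝ) : ℝ := ρ + t * χ ρ

/-- The inverse of `stretch χ t`. -/
def shrink (χ : ℝ → ℝ) (t : ℝ) : ℝ → ℝ := Function.invFun (stretch χ t)

/-- `χ` is a smooth profile which is constant near `(-∞, 0]` and vanishes on `[R, ∞)`, and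
`M` bounds `χ` and its derivative. -/
structure IsProfile (χ : ℝ → ℝ) (R M : ℝ) : Prop where
  smooth : ContDiff ℝ ∞ χ
  eq_zero : ∀ ρ, R ≤ ρ → χ ρ = 0
  const_near : ∃ ρ₀ > 0, ∀ ρ ≤ ρ₀, χ ρ = χ 0
  pos : 0 < R
  bound : ∀ ρ, |χ ρ| ≤ M
  deriv_bound : ∀ ρ, |deriv χ ρ| ≤ M

namespace IsProfile

variable {χ : ℝ → ℝ} {R M t : ℝ} (h : IsProfile χ R M) (ht : |t| * M ≤ 1 / 2) (h0 : 0 ≤ t * χ 0)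

include h in
lemma hasDerivAt (ρ : ℝ) : HasDerivAt χ (deriv χ ρ) ρ :=
  (h.smooth.differentiable (by simp) ρ).hasDerivAt

include h in
lemma hasDerivAt_stretch (t ρ : ℝ) : HasDerivAt (stretch χ t) (1 + t * deriv χ ρ) ρ :=
  (hasDerivAt_id ρ).add ((h.hasDerivAt ρ).const_mul t)

include h in
lemma nonneg_bound : 0 ≤ M := (abs_nonneg _).trans (h.bound 0)

include h ht in
lemma abs_mul_deriv_le (ρ : ℝ) :
    |t * deriv χ ρ| ≤ 1 / 2 := by
  rw [abs_mul]
  exact (mul_le_mul_of_nonneg_left (h.deriv_bound ρ) (abs_nonneg t)).trans ht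

include h ht in
lemma half_le (ρ : ℝ) : 1 / 2 ≤ 1 + t * deriv χ ρ := by
  linarith [(abs_le.1 (h.abs_mul_deriv_le ht ρ)).1]

include h in
lemma contDiff_stretch (t : ℝ) : ContDiff ℝ ∞ (stretch χ t) :=
  contDiff_id.add (contDiff_const.mul h.smooth)

include h ht in
lemma stretch_sub_le {a c : ℝ} (hac : a ≤ c) : (c - a) / 2 ≤ stretch χ t c - stretch χ t a := by
  have hd : Differentiable ℝ (stretch χ t) := (h.contDiff_stretch t).differentiable (by simp)
  have := Convex.mul_sub_le_image_sub_of_le_deriv (convex_univ) hd.continuous.continuousOn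
    hd.differentiableOn (C := 1 / 2)
    (fun x _ => by rw [(h.hasDerivAt_stretch t x).deriv]; exact h.half_le ht x) a (mem_univ _)
    c (mem_univ _) hac
  linarith

include h ht in
lemma strictMono : StrictMono (stretch χ t) :=
  fun a c hac => by linarith [h.stretch_sub_le ht hac.le]

include h ht in
lemma surjective : Function.Surjective (stretch χ t) := by
  refine (h.contDiff_stretch t).continuous.surjective ?_ ?_
  · refine tendsto_atTop_mono' atTop (f₁ := fun ρ => stretch χ t 0 + ρ / 2) ?_
      (tendsto_atTop_add_const_left _ _ (tendsto_id.atTop_div_const (by norm_num)))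
    filter_upwards [eventually_ge_atTop 0] with ρ hρ
    linarith [h.stretch_sub_le ht hρ]
  · refine tendsto_atBot_mono' atBot (f₁ := fun ρ => stretch χ t 0 + ρ / 2) ?_
      (tendsto_atBot_add_const_left _ _ (tendsto_id.atBot_div_const (r := 2) (by norm_num)))
    filter_upwards [eventually_le_atBot 0] with ρ hρ
    linarith [h.stretch_sub_le ht hρ]

include h ht in
lemma shrink_stretch (ρ : ℝ) : shrink χ t (stretch χ t ρ) = ρ :=
  Function.leftInverse_invFun (h.strictMono ht).injective ρ

include h ht in
lemma stretch_shrink (r : ℝ) : stretch χ t (shrink χ t r) = r :=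
  Function.rightInverse_invFun (h.surjective ht) r

include h ht in
lemma contDiff_shrink : ContDiff ℝ ∞ (shrink χ t) := by
  let e := ((h.strictMono ht).orderIsoOfSurjective _ (h.surjective ht)).toHomeomorph
  have hs : ⇑e.symm = shrink χ t := by
    funext r
    apply e.injective
    rw [e.apply_symm_apply]
    exact (h.stretch_shrink ht r).symm
  rw [← hs]
  exact e.contDiff_symm_deriv (f' := fun ρ => 1 + t * deriv χ ρ)
    (fun x => by have := h.half_le ht x; positivity) (h.hasDerivAt_stretch t)
    (h.contDiff_stretch t)

include h ht in
lemma shrink_sub_le {a c : ℝ} (hac : a ≤ c) : shrink χ t c - shrink χ t a ≤ 2 * (c - a) := by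
  have hle : shrink χ t a ≤ shrink χ t c := by
    rw [← (h.strictMono ht).le_iff_le, h.stretch_shrink ht, h.stretch_shrink ht]
    exact hac
  have := h.stretch_sub_le ht hle
  rw [h.stretch_shrink ht, h.stretch_shrink ht] at this
  linarith

include h ht in
lemma shrink_le_iff {r ρ : ℝ} : shrink χ t r ≤ ρ ↔ r ≤ stretch χ t ρ := by
  rw [← (h.strictMono ht).le_iff_le, h.stretch_shrink ht]

include h ht in
lemma lt_shrink_iff {r ρ : ℝ} : ρ < shrink χ t r ↔ stretch χ t ρ < r := by
  rw [← (h.strictMono ht).lt_iff_lt, h.stretch_shrink ht]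

include h in
lemma stretch_of_ge (t : ℝ) {ρ : ℝ} (hρ : R ≤ ρ) : stretch χ t ρ = ρ := by
  simp [stretch, h.eq_zero ρ hρ]

include h ht in
lemma shrink_of_ge {r : ℝ} (hr : R ≤ r) : shrink χ t r = r := by
  conv_lhs => rw [← h.stretch_of_ge t hr]
  exact h.shrink_stretch ht r

include h ht h0 in
lemma stretch_pos {ρ : ℝ} (hρ : 0 ≤ ρ) : ρ / 2 ≤ stretch χ t ρ := by
  have := h.stretch_sub_le ht hρ
  simp only [stretch] at this ⊢
  linarith

end IsProfile

/-- The radial map of the plane which is inverse to `ρω ↦ stretch χ t ρ ω`, and collapses the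
disk of radius `t χ(0)` to the origin. -/
def collapse (χ : ℝ → ℝ) (t : ℝ) (y : ℂ) : ℂ := (max (shrink χ t ‖y‖) 0 / ‖y‖) • y

section collapse

variable {χ : ℝ → ℝ} {R M t : ℝ} (h : IsProfile χ R M) (ht : |t| * M ≤ 1 / 2) (h0 : 0 ≤ t * χ 0)

include h ht h0 in
lemma collapse_stretch {ρ : ℝ}
    (hρ : 0 ≤ ρ) {w : ℂ} (hw : ‖w‖ = 1) : collapse χ t (stretch χ t ρ • w) = ρ • w := by
  have h1 := h.stretch_pos ht h0 hρ
  have hn : ‖stretch χ t ρ • w‖ = stretch χ t ρ := by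
    rw [norm_smul, hw, mul_one, Real.norm_of_nonneg (by linarith)]
  rw [collapse, hn, h.shrink_stretch ht, max_eq_left hρ, smul_smul]
  rcases hρ.eq_or_lt with rfl | hρ
  · simp
  · rw [div_mul_cancel₀]
    have : 0 < stretch χ t ρ := by linarith
    exact this.ne'

include h ht in
lemma collapse_eq_zero {y : ℂ} (hy : ‖y‖ ≤ t * χ 0) : collapse χ t y = 0 := by
  have : shrink χ t ‖y‖ ≤ 0 := by
    rw [h.shrink_le_iff ht]
    simpa [stretch] using hy
  simp [collapse, max_eq_right this]

lemma norm_collapse_le (χ : ℝ → ℝ) (t : ℝ) (y : ℂ) : ‖collapse χ t y‖ ≤ max (shrink χ t ‖y‖) 0 := by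
  rcases eq_or_ne y 0 with rfl | hy
  · simp [collapse]
  · rw [collapse, norm_smul, Real.norm_of_nonneg (by positivity),
      div_mul_cancel₀ _ (norm_ne_zero_iff.2 hy)]

include h ht in
lemma collapse_of_ge {y : ℂ} (hy : R ≤ ‖y‖) : collapse χ t y = y := by
  have hpos := h.pos.trans_le hy
  rw [collapse, h.shrink_of_ge ht hy, max_eq_left hpos.le, div_self hpos.ne', one_smul]

include h ht in
lemma norm_collapse_le_of_le {y : ℂ}
    {r : ℝ} (hr : R ≤ r) (hy : ‖y‖ ≤ r) : ‖collapse χ t y‖ ≤ r := by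
  refine (norm_collapse_le χ t y).trans (max_le ?_ (h.pos.le.trans hr))
  rw [h.shrink_le_iff ht, h.stretch_of_ge t hr]
  exact hy

include h ht h0 in
lemma exists_polar {y : ℂ}
    (hy : t * χ 0 < ‖y‖) : ∃ ρ > 0, ∃ w : ℂ, ‖w‖ = 1 ∧ y = stretch χ t ρ • w ∧
      collapse χ t y = ρ • w ∧ ρ = shrink χ t ‖y‖ := by
  have hpos : 0 < ‖y‖ := h0.trans_lt hy
  have hρ : 0 < shrink χ t ‖y‖ := by
    rw [h.lt_shrink_iff ht]
    simpa [stretch] using hy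
  have hw : ‖(‖y‖⁻¹ : ℝ) • y‖ = 1 := by
    rw [norm_smul, norm_inv, norm_norm, inv_mul_cancel₀ hpos.ne']
  have hy' : y = stretch χ t (shrink χ t ‖y‖) • ((‖y‖⁻¹ : ℝ) • y) := by
    rw [h.stretch_shrink ht, smul_smul, mul_inv_cancel₀ hpos.ne', one_smul]
  refine ⟨_, hρ, _, hw, hy', ?_, rfl⟩
  conv_lhs => rw [hy']
  exact collapse_stretch h ht h0 hρ.le hw

include h ht h0 in
lemma contDiffOn_collapse : ContDiffOn ℝ 1 (collapse χ t) {y | t * χ 0 < ‖y‖} := by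
  intro y hy
  refine ContDiffAt.contDiffWithinAt ?_
  have hpos : 0 < ‖y‖ := h0.trans_lt hy
  have hne : y ≠ 0 := norm_pos_iff.1 hpos
  have hn : ContDiffAt ℝ 1 (fun y : ℂ => ‖y‖) y := contDiffAt_norm ℝ hne
  have hs : ContDiffAt ℝ 1 (fun y : ℂ => shrink χ t ‖y‖) y :=
    ((h.contDiff_shrink ht).of_le (mod_cast le_top)).contDiffAt.comp y hn
  have hc : ContDiffAt ℝ 1 (fun y : ℂ => (shrink χ t ‖y‖ / ‖y‖) • y) y :=
    (hs.div hn hpos.ne').smul contDiffAt_id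
  refine hc.congr_of_eventuallyEq ?_
  have hopen : IsOpen {y : ℂ | t * χ 0 < ‖y‖} := isOpen_lt continuous_const continuous_norm
  filter_upwards [hopen.mem_nhds hy] with z hz
  have : 0 < shrink χ t ‖z‖ := by
    rw [h.lt_shrink_iff ht]
    simpa [stretch] using hz
  rw [collapse, max_eq_left this.le]

variable {u : ℂ → ℝ} {K : ℝ}

include h ht h0 in
lemma differentiableAt_comp_collapse (hu : ContDiff ℝ 1 u) {y : ℂ} (hy : t * χ 0 < ‖y‖) :
    ContDiffAt ℝ 1 (fun z => u (collapse χ t z)) y := by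
  have hopen : IsOpen {y : ℂ | t * χ 0 < ‖y‖} := isOpen_lt continuous_const continuous_norm
  exact hu.contDiffAt.comp y ((contDiffOn_collapse h ht h0).contDiffAt (hopen.mem_nhds hy))

include h ht h0 in
/-- Radial and angular derivatives of `u ∘ collapse χ t`. -/
lemma fderiv_comp_collapse (hu : ContDiff ℝ 1 u) {ρ : ℝ} (hρ : 0 < ρ) {w : ℂ} (hw : ‖w‖ = 1) :
    fderiv ℝ (fun z => u (collapse χ t z)) (stretch χ t ρ • w) w * (1 + t * deriv χ ρ) =
        fderiv ℝ u (ρ • w) w ∧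
      fderiv ℝ (fun z => u (collapse χ t z)) (stretch χ t ρ • w) (Complex.I * w) *
        stretch χ t ρ = ρ * fderiv ℝ u (ρ • w) (Complex.I * w) := by
  have hmono := (h.strictMono ht) hρ
  have h00 : stretch χ t 0 = t * χ 0 := by simp [stretch]
  have hpos : 0 < stretch χ t ρ := by rw [h00] at hmono; linarith
  have hn : ‖stretch χ t ρ • w‖ = stretch χ t ρ := by
    rw [norm_smul, hw, mul_one, Real.norm_of_nonneg hpos.le]
  have hy : t * χ 0 < ‖stretch χ t ρ • w‖ := by rw [hn, ← h00]; exact hmono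
  have hW := ((differentiableAt_comp_collapse h ht h0 hu hy).differentiableAt
    one_ne_zero).hasFDerivAt
  have hU := (hu.differentiable one_ne_zero (ρ • w)).hasFDerivAt
  constructor
  · have h1 : HasDerivAt (fun a : ℝ => stretch χ t a • w) ((1 + t * deriv χ ρ) • w) ρ :=
      (h.hasDerivAt_stretch t ρ).smul_const w
    have h2 : HasDerivAt (fun a : ℝ => a • w) ((1 : ℝ) • w) ρ := (hasDerivAt_id ρ).smul_const w
    have h3 := hW.comp_hasDerivAt ρ h1
    have h4 := hU.comp_hasDerivAt ρ h2
    have heq : (fun z => u (collapse χ t z)) ∘ (fun a : ℝ => stretch χ t a • w) =ᶠ[𝓝 ρ]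
        u ∘ fun a : ℝ => a • w := by
      filter_upwards [Ioi_mem_nhds hρ] with a ha
      simp only [Function.comp_apply]
      rw [collapse_stretch h ht h0 (le_of_lt ha) hw]
    have h5 := (h4.congr_of_eventuallyEq heq).unique h3
    rw [one_smul, map_smul, smul_eq_mul] at h5
    rw [h5]; ring
  · have he : HasDerivAt (fun a : ℝ => Complex.exp (a * Complex.I) * w) (Complex.I * w) 0 := by
      have := ((Complex.ofRealCLM.hasDerivAt (x := (0 : ℝ))).mul_const Complex.I).cexp
      simpa using this.mul_const w
    have h1 : HasDerivAt (fun a : ℝ => stretch χ t ρ • (Complex.exp (a * Complex.I) * w))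
        (stretch χ t ρ • (Complex.I * w)) 0 := he.const_smul (stretch χ t ρ)
    have h2 : HasDerivAt (fun a : ℝ => ρ • (Complex.exp (a * Complex.I) * w))
        (ρ • (Complex.I * w)) 0 := he.const_smul ρ
    have e1 : Complex.exp ((0 : ℝ) * Complex.I) * w = w := by simp
    have h3 := HasFDerivAt.comp_hasDerivAt (0 : ℝ) (by simp only [e1]; exact hW) h1
    have h4 := HasFDerivAt.comp_hasDerivAt (0 : ℝ) (by simp only [e1]; exact hU) h2
    have heq : (fun z => u (collapse χ t z)) ∘
        (fun a : ℝ => stretch χ t ρ • (Complex.exp (a * Complex.I) * w)) =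
        u ∘ fun a : ℝ => ρ • (Complex.exp (a * Complex.I) * w) := by
      funext a
      simp only [Function.comp_apply]
      rw [collapse_stretch h ht h0 hρ.le (by rw [norm_mul, Complex.norm_exp_ofReal_mul_I, hw, one_mul])]
    rw [heq] at h3
    have h5 := h4.unique h3
    rw [map_smul, map_smul, smul_eq_mul, smul_eq_mul] at h5
    rw [h5]; ring

lemma norm_le_of_frame {L : ℂ →L[ℝ] ℝ} {w : ℂ} (hw : ‖w‖ = 1) {c : ℝ} (hc : 0 ≤ c)
    (h1 : |L w| ≤ c) (h2 : |L (Complex.I * w)| ≤ c) : ‖L‖ ≤ 2 * c := by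
  refine L.opNorm_le_bound (by linarith) fun v => ?_
  have hw0 : w ≠ 0 := by rintro rfl; simp at hw
  have hv : v = (v / w).re • w + (v / w).im • (Complex.I * w) := by
    have : v = (v / w) * w := by field_simp
    conv_lhs => rw [this, ← Complex.re_add_im (v / w)]
    simp only [Complex.real_smul]
    ring
  have hn : ‖v / w‖ = ‖v‖ := by rw [norm_div, hw, div_one]
  have e1 := Complex.abs_re_le_norm (v / w)
  have e2 := Complex.abs_im_le_norm (v / w)
  rw [hn] at e1 e2
  conv_lhs => rw [hv]
  rw [map_add, map_smul, map_smul, smul_eq_mul, smul_eq_mul, Real.norm_eq_abs]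
  refine (abs_add_le _ _).trans ?_
  rw [abs_mul, abs_mul]
  nlinarith [mul_le_mul e1 h1 (abs_nonneg _) (norm_nonneg v),
    mul_le_mul e2 h2 (abs_nonneg _) (norm_nonneg v)]

include h ht h0 in
lemma norm_fderiv_comp_collapse_le (hu : ContDiff ℝ 1 u) (hK : ∀ y, ‖fderiv ℝ u y‖ ≤ K * ‖y‖) {y : ℂ}
    (hy : t * χ 0 < ‖y‖) :
    ‖fderiv ℝ (fun z => u (collapse χ t z)) y‖ ≤ 4 * (K * shrink χ t ‖y‖) := by
  obtain ⟨ρ, hρ, w, hw, hyw, -, hρy⟩ := exists_polar h ht h0 hy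
  obtain ⟨h1, h2⟩ := fderiv_comp_collapse h ht h0 hu hρ hw
  rw [← hyw] at h1 h2
  rw [← hρy]
  have hb : ∀ v : ℂ, ‖v‖ = 1 → |fderiv ℝ u (ρ • w) v| ≤ K * ρ := fun v hv => by
    have := (fderiv ℝ u (ρ • w)).le_opNorm v
    rw [hv, mul_one, Real.norm_eq_abs] at this
    refine this.trans ((hK _).trans_eq ?_)
    rw [norm_smul, hw, mul_one, Real.norm_of_nonneg hρ.le]
  have hKρ : 0 ≤ K * ρ := (abs_nonneg _).trans (hb w hw)
  have hhalf := h.half_le ht ρ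
  have hst := h.stretch_pos ht h0 hρ.le
  have := norm_le_of_frame (L := fderiv ℝ (fun z => u (collapse χ t z)) y) hw
    (c := 2 * (K * ρ)) (by linarith) ?_ ?_
  · linarith
  · have h3 := hb w hw
    rw [← h1, abs_mul, abs_of_nonneg (by linarith : (0 : ℝ) ≤ 1 + t * deriv χ ρ)] at h3
    nlinarith [abs_nonneg (fderiv ℝ (fun z => u (collapse χ t z)) y w)]
  · have h3 := hb (Complex.I * w) (by rw [norm_mul, hw, Complex.norm_I, one_mul])
    have h4 : |ρ * fderiv ℝ u (ρ • w) (Complex.I * w)| ≤ ρ * (K * ρ) := by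
      rw [abs_mul, abs_of_pos hρ]
      exact mul_le_mul_of_nonneg_left h3 hρ.le
    rw [← h2, abs_mul, abs_of_nonneg (by linarith : (0 : ℝ) ≤ stretch χ t ρ)] at h4
    have h5 : |fderiv ℝ (fun z => u (collapse χ t z)) y (Complex.I * w)| * (ρ / 2) ≤
        ρ * (K * ρ) := (mul_le_mul_of_nonneg_left hst (abs_nonneg _)).trans h4
    nlinarith

include h ht in
lemma hasFDerivAt_comp_collapse_of_le
    (hu0 : ∀ y, |u y| ≤ K * ‖y‖ ^ 2) {y : ℂ} (hy : ‖y‖ ≤ t * χ 0) :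
    HasFDerivAt (fun z => u (collapse χ t z)) (0 : ℂ →L[ℝ] ℝ) y := by
  have hK : 0 ≤ K := by
    have := (abs_nonneg _).trans (hu0 1)
    simpa using this
  have hs : shrink χ t ‖y‖ ≤ 0 := by
    rw [h.shrink_le_iff ht]
    simpa [stretch] using hy
  have hval : u (collapse χ t y) = 0 := by
    rw [collapse_eq_zero h ht hy]
    have := hu0 0
    simpa using this
  have hbound : ∀ z, |u (collapse χ t z)| ≤ 4 * K * ‖z - y‖ ^ 2 := by
    intro z
    have h1 : ‖collapse χ t z‖ ≤ 2 * ‖z - y‖ := by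
      refine (norm_collapse_le χ t z).trans (max_le ?_ (by positivity))
      rcases le_total ‖z‖ ‖y‖ with hzy | hzy
      · have : shrink χ t ‖z‖ ≤ 0 := by
          rw [h.shrink_le_iff ht]
          simpa [stretch] using hzy.trans hy
        have := norm_nonneg (z - y)
        linarith
      · have h2 := h.shrink_sub_le ht hzy
        have h3 := norm_sub_norm_le z y
        linarith
    refine (hu0 _).trans ?_
    have := pow_le_pow_left₀ (norm_nonneg _) h1 2
    nlinarith
  refine HasFDerivAt.of_isLittleO ?_
  simp only [hval, sub_zero, zero_apply]
  refine Asymptotics.IsBigO.trans_isLittleO (g := fun z => ‖z - y‖ ^ 2)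
    (Asymptotics.IsBigO.of_bound (4 * K) (Eventually.of_forall fun z => ?_)) ?_
  · rw [Real.norm_eq_abs, Real.norm_of_nonneg (by positivity)]
    exact hbound z
  · have : Tendsto (fun z : ℂ => ‖z - y‖) (𝓝 y) (𝓝 0) := by
      have : ContinuousAt (fun z : ℂ => ‖z - y‖) y := by fun_prop
      simpa using this.tendsto
    have h2 := (Asymptotics.isLittleO_pow_id (𝕜 := ℝ) (n := 2) (by norm_num)).comp_tendsto this
    exact h2.trans_isBigO (Asymptotics.isBigO_refl _ _).norm_left

include h ht h0 in
/-- If `u` vanishes to second order at the origin then `u ∘ collapse χ t` is `C¹`. -/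
lemma contDiff_comp_collapse (hu : ContDiff ℝ 1 u) (hu0 : ∀ y, |u y| ≤ K * ‖y‖ ^ 2)
    (hK : ∀ y, ‖fderiv ℝ u y‖ ≤ K * ‖y‖) : ContDiff ℝ 1 (fun z => u (collapse χ t z)) := by
  have hK0 : 0 ≤ K := by
    have := (abs_nonneg _).trans (hu0 1)
    simpa using this
  have hopen : IsOpen {y : ℂ | t * χ 0 < ‖y‖} := isOpen_lt continuous_const continuous_norm
  rw [contDiff_one_iff_fderiv]
  refine ⟨fun y => ?_, continuous_iff_continuousAt.2 fun y => ?_⟩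
  · rcases le_or_gt ‖y‖ (t * χ 0) with hy | hy
    · exact (hasFDerivAt_comp_collapse_of_le h ht hu0 hy).differentiableAt
    · exact (differentiableAt_comp_collapse h ht h0 hu hy).differentiableAt one_ne_zero
  · rcases le_or_gt ‖y‖ (t * χ 0) with hy | hy
    · have hy0 := (hasFDerivAt_comp_collapse_of_le h ht hu0 hy).fderiv
      rw [ContinuousAt, hy0]
      have hs : shrink χ t ‖y‖ ≤ 0 := by
        rw [h.shrink_le_iff ht]
        simpa [stretch] using hy
      refine squeeze_zero_norm (a := fun z => 8 * K * ‖z - y‖) (fun z => ?_) ?_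
      · rcases le_or_gt ‖z‖ (t * χ 0) with hz | hz
        · rw [(hasFDerivAt_comp_collapse_of_le h ht hu0 hz).fderiv, norm_zero]
          positivity
        · refine (norm_fderiv_comp_collapse_le h ht h0 hu hK hz).trans ?_
          have h2 := h.shrink_sub_le ht (hy.trans hz.le)
          have h3 := norm_sub_norm_le z y
          have h4 : shrink χ t ‖z‖ ≤ 2 * ‖z - y‖ := by linarith
          nlinarith [mul_le_mul_of_nonneg_left h4 hK0]
      · have : ContinuousAt (fun z : ℂ => 8 * K * ‖z - y‖) y := by fun_prop
        simpa using this.tendsto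
    · have h1 : ContDiffOn ℝ 1 (fun z => u (collapse χ t z)) {y | t * χ 0 < ‖y‖} := fun z hz =>
        (differentiableAt_comp_collapse h ht h0 hu hz).contDiffWithinAt
      exact (h1.continuousOn_fderiv_of_isOpen hopen le_rfl).continuousAt (hopen.mem_nhds hy)

end collapse


/-! ### Integration in stretched polar coordinates -/

/-- The unit vector of angle `θ`. -/
def dir (θ : ℝ) : ℂ := Complex.exp (θ * Complex.I)

lemma norm_dir (θ : ℝ) : ‖dir θ‖ = 1 := Complex.norm_exp_ofReal_mul_I θ

lemma contDiff_dir {n : WithTop ℕ∞} : ContDiff ℝ n dir :=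
  (Complex.ofRealCLM.contDiff.mul contDiff_const).cexp

/-- The rectangle of polar coordinates `(ρ, θ)` for the disk of radius `R`. -/
def polarRect (R : ℝ) : Set (ℝ × ℝ) := Ioo 0 R ×ˢ Ioo (-Real.pi) Real.pi

lemma measurableSet_polarRect (R : ℝ) : MeasurableSet (polarRect R) :=
  measurableSet_Ioo.prod measurableSet_Ioo

lemma polarRect_subset (R : ℝ) : polarRect R ⊆ Icc 0 R ×ˢ Icc (-Real.pi) Real.pi :=
  prod_mono Ioo_subset_Icc_self Ioo_subset_Icc_self

lemma volume_polarRect_lt_top (R : ℝ) : volume (polarRect R) < ⊤ :=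
  (measure_mono (polarRect_subset R)).trans_lt (isCompact_Icc.prod isCompact_Icc).measure_lt_top

lemma polarCoord_symm_eq (x : ℝ × ℝ) : Complex.polarCoord.symm x = x.1 • dir x.2 := by
  rw [Complex.polarCoord_symm_apply, dir, Complex.exp_mul_I, Complex.real_smul]
  push_cast
  ring

lemma setIntegral_annulus_eq_polar (k : ℂ → ℝ) {a R : ℝ} (ha : 0 ≤ a) :
    ∫ y in closedBall (0 : ℂ) R ∩ {y | a < ‖y‖}, k y =
      ∫ x in Ioo a R ×ˢ Ioo (-Real.pi) Real.pi, x.1 * k (x.1 • dir x.2) := by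
  set S : Set ℂ := closedBall (0 : ℂ) R ∩ {y | a < ‖y‖} with hS
  have hSm : MeasurableSet S := isClosed_closedBall.measurableSet.inter
    (isOpen_lt continuous_const continuous_norm).measurableSet
  rw [← integral_indicator hSm, ← Complex.integral_comp_polarCoord_symm]
  simp only [polarCoord_symm_eq, smul_eq_mul]
  have hTm : MeasurableSet (Ioc a R ×ˢ Ioo (-Real.pi) Real.pi) :=
    measurableSet_Ioc.prod measurableSet_Ioo
  have hae : (Ioo a R ×ˢ Ioo (-Real.pi) Real.pi : Set (ℝ × ℝ)) =ᵐ[volume]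
      (Ioc a R ×ˢ Ioo (-Real.pi) Real.pi : Set (ℝ × ℝ)) := by
    rw [Measure.volume_eq_prod]
    exact Measure.set_prod_ae_eq Ioo_ae_eq_Ioc (ae_eq_refl _)
  rw [setIntegral_congr_set hae]
  have htarget : MeasurableSet polarCoord.target := polarCoord.open_target.measurableSet
  rw [← integral_indicator hTm, ← integral_indicator htarget]
  congr 1
  funext x
  by_cases hx : x ∈ polarCoord.target
  · have hx' : 0 < x.1 ∧ x.2 ∈ Ioo (-Real.pi) Real.pi := by
      rw [polarCoord_target] at hx; exact hx
    have hn : ‖x.1 • dir x.2‖ = x.1 := by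
      rw [norm_smul, norm_dir, mul_one, Real.norm_of_nonneg hx'.1.le]
    have hiff : x.1 • dir x.2 ∈ S ↔ x ∈ Ioc a R ×ˢ Ioo (-Real.pi) Real.pi := by
      simp only [hS, mem_inter_iff, mem_closedBall, dist_zero_right, hn, mem_ofPred_eq, mem_prod,
        mem_Ioc, hx'.2, and_true]
      tauto
    rw [indicator_of_mem hx]
    by_cases hxS : x.1 • dir x.2 ∈ S
    · rw [indicator_of_mem hxS, indicator_of_mem (hiff.1 hxS)]
    · rw [indicator_of_notMem hxS, indicator_of_notMem (fun h => hxS (hiff.2 h)), mul_zero]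
  · rw [indicator_of_notMem hx, indicator_of_notMem]
    intro h
    apply hx
    rw [polarCoord_target]
    exact ⟨ha.trans_lt h.1.1, h.2⟩

section

variable {χ : ℝ → ℝ} {R M t : ℝ} (h : IsProfile χ R M) (ht : |t| * M ≤ 1 / 2) (h0 : 0 ≤ t * χ 0)

include h ht in
lemma setIntegral_stretch (k : ℝ × ℝ → ℝ) : ∫ x in Ioo (t * χ 0) R ×ˢ Ioo (-Real.pi) Real.pi, k x =
      ∫ x in polarRect R, (1 + t * deriv χ x.1) * k (stretch χ t x.1, x.2) := by
  have himage : (fun x : ℝ × ℝ => (stretch χ t x.1, x.2)) '' polarRect R =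
      Ioo (t * χ 0) R ×ˢ Ioo (-Real.pi) Real.pi := by
    have h00 : stretch χ t 0 = t * χ 0 := by simp [stretch]
    have hRR : stretch χ t R = R := h.stretch_of_ge t le_rfl
    ext x
    constructor
    · rintro ⟨y, hy, rfl⟩
      refine ⟨⟨?_, ?_⟩, hy.2⟩
      · rw [← h00]; exact h.strictMono ht hy.1.1
      · conv_rhs => rw [← hRR]
        exact h.strictMono ht hy.1.2
    · intro hx
      refine ⟨(shrink χ t x.1, x.2), ⟨⟨?_, ?_⟩, hx.2⟩, ?_⟩
      · rw [h.lt_shrink_iff ht, h00]; exact hx.1.1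
      · change shrink χ t x.1 < R
        rw [← (h.strictMono ht).lt_iff_lt, h.stretch_shrink ht, hRR]; exact hx.1.2
      · simp [h.stretch_shrink ht]
  have hderiv : ∀ x ∈ polarRect R, HasFDerivWithinAt (fun x : ℝ × ℝ => (stretch χ t x.1, x.2))
      (((1 + t * deriv χ x.1) • ContinuousLinearMap.id ℝ ℝ).prodMap
        (ContinuousLinearMap.id ℝ ℝ)) (polarRect R) x := by
    intro x _
    have h1 : HasFDerivAt (stretch χ t) ((1 + t * deriv χ x.1) • ContinuousLinearMap.id ℝ ℝ)
        x.1 := by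
      have := (h.hasDerivAt_stretch t x.1).hasFDerivAt
      refine this.congr_fderiv ?_
      ext
      simp
    exact (h1.prodMap x (hasFDerivAt_id x.2)).hasFDerivWithinAt
  have hinj : InjOn (fun x : ℝ × ℝ => (stretch χ t x.1, x.2)) (polarRect R) := by
    intro x _ y _ hxy
    simp only [Prod.mk.injEq] at hxy
    exact Prod.ext ((h.strictMono ht).injective hxy.1) hxy.2
  have hdet : ∀ c : ℝ, (((c • ContinuousLinearMap.id ℝ ℝ).prodMap
      (ContinuousLinearMap.id ℝ ℝ) : ℝ × ℝ →L[ℝ] ℝ × ℝ)).det = c := by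
    intro c
    rw [ContinuousLinearMap.det, ContinuousLinearMap.coe_prodMap, LinearMap.det_prodMap]
    simp
  rw [← himage, integral_image_eq_integral_abs_det_fderiv_smul volume (measurableSet_polarRect R)
    hderiv hinj]
  refine setIntegral_congr_fun (measurableSet_polarRect R) fun x _ => ?_
  have := h.half_le ht x.1
  simp only [hdet, smul_eq_mul]
  rw [abs_of_nonneg (by linarith)]

include h ht h0 in
/-- Integration over a punctured disk, in stretched polar coordinates. -/
lemma setIntegral_annulus_eq_stretch (k : ℂ → ℝ) :
    ∫ y in closedBall (0 : ℂ) R ∩ {y | t * χ 0 < ‖y‖}, k y =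
      ∫ x in polarRect R, (1 + t * deriv χ x.1) *
        (stretch χ t x.1 * k (stretch χ t x.1 • dir x.2)) := by
  rw [setIntegral_annulus_eq_polar k h0, setIntegral_stretch h ht]

lemma sq_add_sq_of_frame (L : ℂ →L[ℝ] ℝ) {w : ℂ} (hw : ‖w‖ = 1) :
    L 1 ^ 2 + L Complex.I ^ 2 = L w ^ 2 + L (Complex.I * w) ^ 2 := by
  have hsq : w.re ^ 2 + w.im ^ 2 = 1 := by
    have := Complex.sq_norm w
    rw [hw, Complex.normSq_apply] at this
    nlinarith
  have h1 : w = w.re • (1 : ℂ) + w.im • Complex.I := by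
    conv_lhs => rw [← Complex.re_add_im w]
    simp
  have h2 : Complex.I * w = (-w.im) • (1 : ℂ) + w.re • Complex.I := by apply Complex.ext <;> simp
  have e1 : L w = w.re * L 1 + w.im * L Complex.I := by
    conv_lhs => rw [h1]
    rw [map_add, map_smul, map_smul, smul_eq_mul, smul_eq_mul]
  have e2 : L (Complex.I * w) = -w.im * L 1 + w.re * L Complex.I := by
    rw [h2, map_add, map_smul, map_smul, smul_eq_mul, smul_eq_mul]
  rw [e1, e2]
  linear_combination (-(L 1 ^ 2 + L Complex.I ^ 2)) * hsq

/-- The radial slope of `u` at polar coordinates `x`. -/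
def radialSlope (u : ℂ → ℝ) (x : ℝ × ℝ) : ℝ := fderiv ℝ u (x.1 • dir x.2) (dir x.2)

/-- The derivative of `u` with respect to the polar angle, at polar coordinates `x`. -/
def angularSlope (u : ℂ → ℝ) (x : ℝ × ℝ) : ℝ :=
  x.1 * fderiv ℝ u (x.1 • dir x.2) (Complex.I * dir x.2)

/-- The area element of a graph in stretched polar coordinates; `a, c` are the radial and angular
slopes, `r` is the stretched radius and `f` its derivative. -/
def areaElement (a c r f : ℝ) : ℝ := √((a * r) ^ 2 + (c * f) ^ 2 + (f * r) ^ 2)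

lemma areaDensity_comp_collapse {u : ℂ → ℝ} (h : IsProfile χ R M) (ht : |t| * M ≤ 1 / 2)
    (h0 : 0 ≤ t * χ 0) (hu : ContDiff ℝ 1 u) {x : ℝ × ℝ} (hx : 0 < x.1) :
    (1 + t * deriv χ x.1) * (stretch χ t x.1 *
      areaDensity (fun z => u (collapse χ t z)) (stretch χ t x.1 • dir x.2)) =
      areaElement (radialSlope u x) (angularSlope u x) (stretch χ t x.1)
        (1 + t * deriv χ x.1) := by
  obtain ⟨h1, h2⟩ := fderiv_comp_collapse h ht h0 hu hx (norm_dir x.2)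
  have hf := h.half_le ht x.1
  have hr := h.stretch_pos ht h0 hx.le
  set f := 1 + t * deriv χ x.1
  set r := stretch χ t x.1
  set L := fderiv ℝ (fun z => u (collapse χ t z)) (r • dir x.2) with hL
  rw [areaElement, radialSlope, angularSlope, ← h1, ← h2, areaDensity, add_assoc, ← hL,
    sq_add_sq_of_frame L (norm_dir x.2), ← mul_assoc]
  have hfr : 0 ≤ f * r := by
    have : 0 ≤ r := by linarith
    have : 0 ≤ f := by linarith
    positivity
  conv_lhs => rw [← Real.sqrt_sq hfr]
  rw [← Real.sqrt_mul (sq_nonneg _)]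
  congr 1
  ring

end


/-! ### Differentiation under the integral sign -/

section OneSided
variable {X : Type*} [MeasurableSpace X] {μ : Measure X} [IsFiniteMeasure μ]

/-- One-sided differentiation under the integral sign. -/
lemma hasDerivWithinAt_integral_Ici {f f' : ℝ → X → ℝ} {ε C : ℝ}
    (hd : ∀ᵐ x ∂μ, ∀ t ∈ Ico 0 ε, HasDerivWithinAt (fun t => f t x) (f' t x) (Ici 0) t)
    (hb : ∀ᵐ x ∂μ, ∀ t ∈ Ico 0 ε, |f' t x| ≤ C) (hf : ∀ t ∈ Ico 0 ε, Integrable (f t) μ)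
    {t₀ : ℝ} (ht₀ : t₀ ∈ Ico 0 ε) :
    HasDerivWithinAt (fun t => ∫ x, f t x ∂μ) (∫ x, f' t₀ x ∂μ) (Ici 0) t₀ := by
  rw [hasDerivWithinAt_iff_tendsto_slope]
  have hnear : ∀ᶠ t in 𝓝[Ici 0 \ {t₀}] t₀, t ∈ Ico 0 ε ∧ t ≠ t₀ := by
    have h1 : ∀ᶠ t in 𝓝[Ici 0 \ {t₀}] t₀, t < ε := mem_nhdsWithin_of_mem_nhds (Iio_mem_nhds ht₀.2)
    filter_upwards [h1, self_mem_nhdsWithin] with t h1 h2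
    exact ⟨⟨h2.1, h1⟩, h2.2⟩
  have heq : ∀ᶠ t in 𝓝[Ici 0 \ {t₀}] t₀,
      ∫ x, slope (fun t => f t x) t₀ t ∂μ = slope (fun t => ∫ x, f t x ∂μ) t₀ t := by
    filter_upwards [hnear] with t ht
    simp only [slope_def_field]
    rw [integral_div, integral_sub (hf t ht.1) (hf t₀ ht₀)]
  refine Tendsto.congr' heq ?_
  refine tendsto_integral_filter_of_dominated_convergence (fun _ => C) ?_ ?_ (integrable_const C) ?_
  · filter_upwards [hnear] with t ht
    simp only [slope_def_field]
    exact (((hf t ht.1).sub (hf t₀ ht₀)).div_const _).aestronglyMeasurable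
  · filter_upwards [hnear] with t ht
    filter_upwards [hd, hb] with x hx hbx
    have h1 := (convex_Ico 0 ε).norm_image_sub_le_of_norm_hasDerivWithin_le
      (f := fun t => f t x) (f' := fun t => f' t x) (C := C)
      (fun s hs => (hx s hs).mono Ico_subset_Ici_self) (fun s hs => hbx s hs) ht₀ ht.1
    rw [slope_def_field, norm_div]
    have : 0 < ‖t - t₀‖ := norm_pos_iff.2 (sub_ne_zero.2 ht.2)
    rw [div_le_iff₀ this]
    exact h1
  · filter_upwards [hd] with x hx
    exact hasDerivWithinAt_iff_tendsto_slope.1 (hx t₀ ht₀)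

/-- The second right derivative of an integral with bounded second derivatives. -/
lemma second_right_deriv_integral {f f1 f2 : ℝ → X → ℝ} {ε C : ℝ} (hε : 0 < ε)
    (hd : ∀ᵐ x ∂μ, ∀ t ∈ Ico 0 ε, HasDerivWithinAt (fun t => f t x) (f1 t x) (Ici 0) t)
    (hd1 : ∀ᵐ x ∂μ, ∀ t ∈ Ico 0 ε, HasDerivWithinAt (fun t => f1 t x) (f2 t x) (Ici 0) t)
    (hb1 : ∀ᵐ x ∂μ, |f1 0 x| ≤ C) (hb2 : ∀ᵐ x ∂μ, ∀ t ∈ Ico 0 ε, |f2 t x| ≤ C)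
    (hf : ∀ t ∈ Ico 0 ε, Integrable (f t) μ)
    (hf1 : ∀ t ∈ Ico 0 ε, AEStronglyMeasurable (f1 t) μ) :
    (∀ t ∈ Ico 0 ε, HasDerivWithinAt (fun t => ∫ x, f t x ∂μ) (∫ x, f1 t x ∂μ) (Ici 0) t) ∧
      HasDerivWithinAt (fun t => ∫ x, f1 t x ∂μ) (∫ x, f2 0 x ∂μ) (Ici 0) 0 := by
  have hb : ∀ᵐ x ∂μ, ∀ t ∈ Ico 0 ε, |f1 t x| ≤ C + C * ε := by
    filter_upwards [hd1, hb1, hb2] with x hx h1 h2 t ht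
    have h0 : (0 : ℝ) ∈ Ico 0 ε := ⟨le_rfl, hε⟩
    have h3 := (convex_Ico 0 ε).norm_image_sub_le_of_norm_hasDerivWithin_le
      (f := fun t => f1 t x) (f' := fun t => f2 t x) (C := C)
      (fun s hs => (hx s hs).mono Ico_subset_Ici_self) (fun s hs => h2 s hs) h0 ht
    rw [Real.norm_eq_abs, sub_zero, Real.norm_of_nonneg ht.1] at h3
    have h4 := abs_sub_abs_le_abs_sub (f1 t x) (f1 0 x)
    have hC : 0 ≤ C := (abs_nonneg _).trans h1
    have h5 := mul_le_mul_of_nonneg_left ht.2.le hC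
    linarith
  have hint : ∀ t ∈ Ico 0 ε, Integrable (f1 t) μ := fun t ht => by
    refine Integrable.of_bound (hf1 t ht) (C + C * ε) ?_
    filter_upwards [hb] with x hx
    exact hx t ht
  exact ⟨fun t ht => hasDerivWithinAt_integral_Ici hd hb hf ht,
    hasDerivWithinAt_integral_Ici hd1 hb2 hint ⟨le_rfl, hε⟩⟩

end OneSided

section Param
variable {E E' : Type} [NormedAddCommGroup E] [NormedSpace ℝ E] [FiniteDimensional ℝ E]
  [NormedAddCommGroup E'] [NormedSpace ℝ E'] [MeasurableSpace E'] [BorelSpace E']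
  [FiniteDimensional ℝ E'] {μ : Measure E'} [IsFiniteMeasureOnCompacts μ]

omit [FiniteDimensional ℝ E'] in
lemma hasFDerivAt_setIntegral_param {F : Type} [NormedAddCommGroup F] [NormedSpace ℝ F]
    [FiniteDimensional ℝ F] {K : E × E' → F} (hK : ContDiff ℝ 1 K) {S : Set E'} (hS : IsCompact S)
    (q : E) :
    HasFDerivAt (fun q => ∫ s in S, K (q, s) ∂μ)
      (∫ s in S, (fderiv ℝ K (q, s)).comp (ContinuousLinearMap.inl ℝ E E') ∂μ) q := by
  have hcomp : Continuous fun z : E × E' =>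
      (fderiv ℝ K z).comp (ContinuousLinearMap.inl ℝ E E') :=
    (hK.continuous_fderiv one_ne_zero).clm_comp continuous_const
  obtain ⟨C, hC⟩ := ((isCompact_closedBall q 1).prod hS).exists_bound_of_continuousOn
    hcomp.continuousOn
  have hSm : MeasurableSet S := hS.measurableSet
  have hcK : ∀ q : E, Continuous fun s => K (q, s) := fun q =>
    hK.continuous.comp (continuous_const.prodMk continuous_id)
  refine hasFDerivAt_integral_of_dominated_of_fderiv_le (𝕜 := ℝ) (bound := fun _ => C)
    (F := fun q s => K (q, s)) (s := ball q 1)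
    (F' := fun q s => (fderiv ℝ K (q, s)).comp (ContinuousLinearMap.inl ℝ E E'))
    (ball_mem_nhds q one_pos) ?_ ?_ ?_ ?_ ?_ ?_
  · exact Eventually.of_forall fun q => (hcK q).aestronglyMeasurable
  · exact (hcK q).continuousOn.integrableOn_compact hS
  · exact (hcomp.comp (continuous_const.prodMk continuous_id)).aestronglyMeasurable
  · filter_upwards [ae_restrict_mem hSm] with s hs x hx
    exact hC (x, s) ⟨ball_subset_closedBall hx, hs⟩
  · exact continuousOn_const.integrableOn_compact hS
  · refine Eventually.of_forall fun s x _ => ?_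
    have h1 := (hK.differentiable one_ne_zero (x, s)).hasFDerivAt
    exact h1.comp x (hasFDerivAt_prodMk_left x s)

/-- Parametric integrals over compact sets depend smoothly on the parameter. -/
lemma contDiff_setIntegral_param (n : ℕ) : ∀ {F : Type} [NormedAddCommGroup F] [NormedSpace ℝ F]
    [FiniteDimensional ℝ F] {K : E × E' → F}, ContDiff ℝ n K → ∀ {S : Set E'}, IsCompact S →
    ContDiff ℝ n (fun q => ∫ s in S, K (q, s) ∂μ) := by
  induction n with
  | zero =>
    intro F _ _ _ K hK S hS
    rw [Nat.cast_zero, contDiff_zero] at hK ⊢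
    exact continuous_parametric_integral_of_continuous (f := fun q s => K (q, s)) hK hS
  | succ n ih =>
    intro F _ _ _ K hK S hS
    have hK1 : ContDiff ℝ 1 K := hK.of_le (by exact_mod_cast Nat.succ_le_succ (Nat.zero_le n))
    have hd := fun q => hasFDerivAt_setIntegral_param (μ := μ) hK1 hS q
    have hfd : fderiv ℝ (fun q => ∫ s in S, K (q, s) ∂μ) = fun q =>
        ∫ s in S, (fderiv ℝ K (q, s)).comp (ContinuousLinearMap.inl ℝ E E') ∂μ :=
      funext fun q => (hd q).fderiv
    rw [Nat.cast_succ, contDiff_succ_iff_fderiv]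
    refine ⟨fun q => (hd q).differentiableAt, fun h => absurd h (by simp), ?_⟩
    rw [hfd]
    refine ih (K := fun z : E × E' => (fderiv ℝ K z).comp (ContinuousLinearMap.inl ℝ E E')) ?_ hS
    have h1 : ContDiff ℝ n (fderiv ℝ K) := hK.fderiv_right (m := n) (by simp)
    exact h1.clm_comp contDiff_const

end Param

lemma contDiff_vertAvg {k : ℂ × ℝ → ℝ} (n : ℕ) (hk : ContDiff ℝ n k) :
    ContDiff ℝ n (vertAvg k) := by
  have h := contDiff_setIntegral_param (μ := (volume : Measure ℝ)) n
    (K := fun z : (ℂ × ℝ) × ℝ => k (z.1.1, z.2 * z.1.2))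
    (hk.comp ((contDiff_fst.comp contDiff_fst).prodMk
      (contDiff_snd.mul (contDiff_snd.comp contDiff_fst)))) (isCompact_Icc (a := (0 : ℝ)) (b := 1))
  have heq : vertAvg k = fun q => ∫ r in Icc (0 : ℝ) 1, k (q.1, r * q.2) := by
    funext q
    rw [vertAvg, intervalIntegral.integral_of_le zero_le_one, integral_Icc_eq_integral_Ioc]
  rw [heq]
  exact h


/-! ### Derivatives of the area element along a radial stretching -/

/-- The square of the area element. -/
def areaSq (a c r f : ℝ) : ℝ := (a * r) ^ 2 + (c * f) ^ 2 + (f * r) ^ 2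

/-- First derivative of the area element when `r' = x` and `f' = x'`. -/
def areaElement1 (a c r f x x' : ℝ) : ℝ :=
  (a ^ 2 * r * x + c ^ 2 * f * x' + f * r * (x' * r + f * x)) / √(areaSq a c r f)

/-- Second derivative of the area element when `r' = x` and `f' = x'`. -/
def areaElement2 (a c r f x x' : ℝ) : ℝ := 2 * (x * x') * (f * r / √(areaSq a c r f)) +
    ((c * f ^ 2 * x) ^ 2 + (a * r ^ 2 * x') ^ 2 + (a * c * (r * x' - f * x)) ^ 2) /
      (areaSq a c r f * √(areaSq a c r f))

section
variable {a c r f x x' ρ t K L M R : ℝ}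

lemma hasDerivAt_affine (a x t : ℝ) : HasDerivAt (fun t => a + t * x) x t := by
  simpa using ((hasDerivAt_id t).mul_const x).const_add a

lemma areaSq_pos (hf : 0 < f) (hr : 0 < r) : 0 < areaSq a c r f := by
  have : 0 < (f * r) ^ 2 := by positivity
  unfold areaSq
  positivity

lemma le_sqrt_areaSq : f * r ≤ √(areaSq a c r f) := by
  refine Real.le_sqrt_of_sq_le ?_
  unfold areaSq
  nlinarith [sq_nonneg (a * r), sq_nonneg (c * f)]

lemma hasDerivAt_areaSq (a c ρ x x' t : ℝ) :
    HasDerivAt (fun t => areaSq a c (ρ + t * x) (1 + t * x'))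
      (2 * (a ^ 2 * (ρ + t * x) * x + c ^ 2 * (1 + t * x') * x' +
        (1 + t * x') * (ρ + t * x) * (x' * (ρ + t * x) + (1 + t * x') * x))) t := by
  have hr := hasDerivAt_affine ρ x t
  have hf := hasDerivAt_affine 1 x' t
  have := (((hr.const_mul a).pow 2).add ((hf.const_mul c).pow 2)).add ((hf.mul hr).pow 2)
  refine this.congr_deriv ?_
  simp only [Nat.cast_ofNat, Nat.add_one_sub_one, pow_one, Pi.mul_apply]
  ring

lemma hasDerivAt_areaElement (hf : 0 < 1 + t * x') (hr : 0 < ρ + t * x) :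
    HasDerivAt (fun t => areaElement a c (ρ + t * x) (1 + t * x'))
      (areaElement1 a c (ρ + t * x) (1 + t * x') x x') t := by
  have h := (hasDerivAt_areaSq a c ρ x x' t).sqrt (areaSq_pos hf hr).ne'
  refine h.congr_deriv ?_
  rw [areaElement1, mul_div_mul_left _ _ two_ne_zero]

lemma hasDerivAt_areaElement1 (hf : 0 < 1 + t * x') (hr : 0 < ρ + t * x) :
    HasDerivAt (fun t => areaElement1 a c (ρ + t * x) (1 + t * x') x x')
      (areaElement2 a c (ρ + t * x) (1 + t * x') x x') t := by
  have hQ := areaSq_pos (a := a) (c := c) hf hr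
  have hs : 0 < √(areaSq a c (ρ + t * x) (1 + t * x')) := Real.sqrt_pos.2 hQ
  have h := (hasDerivAt_areaSq a c ρ x x' t).sqrt hQ.ne'
  have hr' := hasDerivAt_affine ρ x t
  have hf' := hasDerivAt_affine 1 x' t
  have hn := (((hr'.const_mul (a ^ 2)).mul_const x).add ((hf'.const_mul (c ^ 2)).mul_const x')).add
    ((hf'.mul hr').mul ((hr'.const_mul x').add (hf'.mul_const x)))
  have hdiv := hn.div h hs.ne'
  refine hdiv.congr_deriv ?_
  have hss := Real.sq_sqrt hQ.le
  set S := √(areaSq a c (ρ + t * x) (1 + t * x')) with hS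
  rw [areaElement2, ← hS, ← hss]
  simp only [Pi.mul_apply, Pi.add_apply]
  field_simp
  rw [hss, areaSq]
  ring

lemma abs_areaElement2_le (hx : |x| ≤ M) (hx' : |x'| ≤ M) (hf : 1 / 2 ≤ f) (hf' : f ≤ 3 / 2)
    (hr : 0 < r) (hr' : r ≤ 1) (ha : |a| ≤ 2 * K * r) (hc : |c| ≤ 4 * K * r ^ 2) :
    |areaElement2 a c r f x x'| ≤
      2 * M ^ 2 + (24 * K ^ 2 * M ^ 2 + 64 * K ^ 2 * M ^ 2 + 6400 * K ^ 4 * M ^ 2) := by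
  have hM : 0 ≤ M := (abs_nonneg _).trans hx
  have hK : 0 ≤ K := by
    by_contra h
    have : 2 * K * r < 0 := by nlinarith
    linarith [abs_nonneg a]
  have hf0 : 0 < f := by linarith
  set D := f * r with hD
  have hD0 : 0 < D := mul_pos hf0 hr
  have hDS := le_sqrt_areaSq (a := a) (c := c) (f := f) (r := r)
  have hQ := areaSq_pos (a := a) (c := c) hf0 hr
  have hss := Real.sq_sqrt hQ.le
  set S := √(areaSq a c r f) with hS
  have hS0 : 0 < S := hD0.trans_le hDS
  have hrD : r ≤ 2 * D := by nlinarith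
  have hDB : D ≤ 3 / 2 := by nlinarith
  have hQS : areaSq a c r f * S = S ^ 3 := by rw [← hss]; ring
  have hDS3 : D ^ 3 ≤ S ^ 3 := pow_le_pow_left₀ hD0.le hDS 3
  have e1 : |2 * (x * x') * (D / S)| ≤ 2 * M ^ 2 := by
    have h1 : |D / S| ≤ 1 := by rw [abs_of_pos (by positivity), div_le_one hS0]; exact hDS
    have h2 : |x * x'| ≤ M * M := by rw [abs_mul]; exact mul_le_mul hx hx' (abs_nonneg _) hM
    rw [abs_mul, abs_mul, abs_two]
    have : 2 * |x * x'| * |D / S| ≤ 2 * (M * M) * 1 := by gcongr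
    linarith
  have hr3 : r ^ 3 ≤ 8 * D ^ 3 := by
    have := pow_le_pow_left₀ hr.le hrD 3
    linarith [mul_pow 2 D 3]
  have hr31 : r ^ 3 ≤ 1 := pow_le_one₀ hr.le hr'
  have e2 : (c * f ^ 2 * x) ^ 2 ≤ (24 * K ^ 2 * M ^ 2) * D ^ 3 := by
    have h1 : |c * f ^ 2 * x| ≤ 4 * K * r ^ 2 * f ^ 2 * M := by
      rw [abs_mul, abs_mul, abs_of_nonneg (sq_nonneg f)]
      gcongr
    have h2 := pow_le_pow_left₀ (abs_nonneg _) h1 2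
    rw [sq_abs] at h2
    have h3 : (4 * K * r ^ 2 * f ^ 2 * M) ^ 2 = 16 * K ^ 2 * M ^ 2 * D ^ 3 * D := by rw [hD]; ring
    have h4 : 16 * K ^ 2 * M ^ 2 * D ^ 3 * D ≤ 16 * K ^ 2 * M ^ 2 * D ^ 3 * (3 / 2) := by gcongr
    linarith
  have e3 : (a * r ^ 2 * x') ^ 2 ≤ (64 * K ^ 2 * M ^ 2) * D ^ 3 := by
    have h1 : |a * r ^ 2 * x'| ≤ 2 * K * r * r ^ 2 * M := by
      rw [abs_mul, abs_mul, abs_of_nonneg (sq_nonneg r)]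
      gcongr
    have h2 := pow_le_pow_left₀ (abs_nonneg _) h1 2
    rw [sq_abs] at h2
    have h3 : (2 * K * r * r ^ 2 * M) ^ 2 = 4 * K ^ 2 * M ^ 2 * (r ^ 3 * r ^ 3) := by ring
    have h4 : 4 * K ^ 2 * M ^ 2 * (r ^ 3 * r ^ 3) ≤ 4 * K ^ 2 * M ^ 2 * (8 * D ^ 3 * 1) := by gcongr
    nlinarith [h2, h3, h4, sq_nonneg (K * M), pow_pos hD0 3,
      mul_nonneg (sq_nonneg (K * M)) (pow_pos hD0 3).le]
  have e4 : (a * c * (r * x' - f * x)) ^ 2 ≤ (6400 * K ^ 4 * M ^ 2) * D ^ 3 := by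
    have h0 : |r * x' - f * x| ≤ 5 / 2 * M := by
      refine (abs_sub _ _).trans ?_
      rw [abs_mul, abs_mul, abs_of_pos hr, abs_of_pos hf0]
      have h1 : r * |x'| ≤ 1 * M := by gcongr
      have h2 : f * |x| ≤ 3 / 2 * M := by gcongr
      linarith
    have h1 : |a * c * (r * x' - f * x)| ≤ 2 * K * r * (4 * K * r ^ 2) * (5 / 2 * M) := by
      rw [abs_mul, abs_mul]
      gcongr
    have h2 := pow_le_pow_left₀ (abs_nonneg _) h1 2
    rw [sq_abs] at h2
    have h3 : (2 * K * r * (4 * K * r ^ 2) * (5 / 2 * M)) ^ 2 =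
        400 * K ^ 4 * M ^ 2 * (r ^ 3 * r ^ 3) := by ring
    have h4 : 400 * K ^ 4 * M ^ 2 * (r ^ 3 * r ^ 3) ≤ 400 * K ^ 4 * M ^ 2 * (8 * D ^ 3 * 1) := by
      gcongr
    have h5 : 0 ≤ K ^ 4 * M ^ 2 * D ^ 3 := by positivity
    nlinarith
  have e5 : |((c * f ^ 2 * x) ^ 2 + (a * r ^ 2 * x') ^ 2 + (a * c * (r * x' - f * x)) ^ 2) /
      (areaSq a c r f * S)| ≤ 24 * K ^ 2 * M ^ 2 + 64 * K ^ 2 * M ^ 2 + 6400 * K ^ 4 * M ^ 2 := by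
    rw [hQS, abs_of_nonneg (by positivity), div_le_iff₀ (by positivity)]
    have : (24 * K ^ 2 * M ^ 2 + 64 * K ^ 2 * M ^ 2 + 6400 * K ^ 4 * M ^ 2) * D ^ 3 ≤
        (24 * K ^ 2 * M ^ 2 + 64 * K ^ 2 * M ^ 2 + 6400 * K ^ 4 * M ^ 2) * S ^ 3 := by gcongr
    linarith
  rw [areaElement2]
  exact (abs_add_le _ _).trans (add_le_add e1 e5)

lemma abs_areaElement2_zero_le (hρ : 0 < ρ) (hρ1 : ρ ≤ 1) (hx : |x| ≤ L) (hx' : ρ * |x'| ≤ L)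
    (hK : 0 ≤ K) (ha : |a| ≤ K * ρ) (hc : |c| ≤ K * ρ ^ 2) :
    |areaElement2 a c ρ 1 x x' - 2 * (x * x')| ≤ (4 * K ^ 2 * L ^ 2 + 4 * K ^ 4 * L ^ 2) * ρ := by
  have hL : 0 ≤ L := (abs_nonneg _).trans hx
  have hDS := le_sqrt_areaSq (a := a) (c := c) (f := 1) (r := ρ)
  have hQ := areaSq_pos (a := a) (c := c) one_pos hρ
  have hss := Real.sq_sqrt hQ.le
  rw [areaElement2]
  rw [one_mul] at hDS ⊢
  set S := √(areaSq a c ρ 1) with hS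
  have hS0 : 0 < S := hρ.trans_le hDS
  have hQS : areaSq a c ρ 1 * S = S ^ 3 := by rw [← hss]; ring
  have hS3 : ρ ^ 3 ≤ S ^ 3 := pow_le_pow_left₀ hρ.le hDS 3
  have ha2 : a ^ 2 ≤ (K * ρ) ^ 2 := by rw [← sq_abs]; exact pow_le_pow_left₀ (abs_nonneg _) ha 2
  have hc2 : c ^ 2 ≤ (K * ρ ^ 2) ^ 2 := by rw [← sq_abs]; exact pow_le_pow_left₀ (abs_nonneg _) hc 2
  have hSρ : S - ρ ≤ K ^ 2 * ρ ^ 3 := by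
    have h1 : (S - ρ) * (S + ρ) ≤ K ^ 2 * ρ ^ 3 * (2 * ρ) := by
      have : (S - ρ) * (S + ρ) = (a * ρ) ^ 2 + (c * 1) ^ 2 := by
        have : (S - ρ) * (S + ρ) = S ^ 2 - ρ ^ 2 := by ring
        rw [this, hss, areaSq]; ring
      rw [this]
      have h2 : a ^ 2 * ρ ^ 2 ≤ (K * ρ) ^ 2 * ρ ^ 2 := by gcongr
      nlinarith
    have h2 : (S - ρ) * (2 * ρ) ≤ (S - ρ) * (S + ρ) :=
      mul_le_mul_of_nonneg_left (by linarith) (by linarith)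
    exact le_of_mul_le_mul_right (h2.trans h1) (by linarith)
  have e1 : |2 * (x * x') * (ρ / S) - 2 * (x * x')| ≤ 2 * K ^ 2 * L ^ 2 * ρ := by
    have h1 : 2 * (x * x') * (ρ / S) - 2 * (x * x') = -(2 * (x * x') * ((S - ρ) / S)) := by
      field_simp
      ring
    have h2 : |(S - ρ) / S| ≤ K ^ 2 * ρ ^ 2 := by
      rw [abs_of_nonneg (div_nonneg (by linarith) hS0.le), div_le_iff₀ hS0]
      have : K ^ 2 * ρ ^ 2 * ρ ≤ K ^ 2 * ρ ^ 2 * S := by gcongr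
      linarith
    rw [h1, abs_neg, abs_mul, abs_mul, abs_two, abs_mul]
    have h3 : |x| * (ρ * |x'|) ≤ L * L := mul_le_mul hx hx' (by positivity) hL
    calc 2 * (|x| * |x'|) * |(S - ρ) / S| ≤ 2 * (|x| * |x'|) * (K ^ 2 * ρ ^ 2) := by gcongr
      _ = 2 * K ^ 2 * ρ * (|x| * (ρ * |x'|)) := by ring
      _ ≤ 2 * K ^ 2 * ρ * (L * L) := by gcongr
      _ = 2 * K ^ 2 * L ^ 2 * ρ := by ring
  have f1 : (c * 1 ^ 2 * x) ^ 2 ≤ K ^ 2 * L ^ 2 * ρ ^ 4 := by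
    have h1 : |c * 1 ^ 2 * x| ≤ K * ρ ^ 2 * L := by rw [one_pow, mul_one, abs_mul]; gcongr
    have h2 := pow_le_pow_left₀ (abs_nonneg _) h1 2
    rw [sq_abs] at h2
    nlinarith
  have f2 : (a * ρ ^ 2 * x') ^ 2 ≤ K ^ 2 * L ^ 2 * ρ ^ 4 := by
    have h1 : |a * ρ ^ 2 * x'| ≤ K * ρ * ρ * L := by
      have : |a * ρ ^ 2 * x'| = |a| * ρ * (ρ * |x'|) := by
        rw [abs_mul, abs_mul, abs_of_nonneg (sq_nonneg ρ)]; ring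
      rw [this]
      gcongr
    have h2 := pow_le_pow_left₀ (abs_nonneg _) h1 2
    rw [sq_abs] at h2
    nlinarith
  have f3 : (a * c * (ρ * x' - 1 * x)) ^ 2 ≤ 4 * K ^ 4 * L ^ 2 * ρ ^ 4 := by
    have h0 : |ρ * x' - 1 * x| ≤ 2 * L := by
      refine (abs_sub _ _).trans ?_
      rw [abs_mul, abs_of_pos hρ, one_mul]
      linarith
    have h1 : |a * c * (ρ * x' - 1 * x)| ≤ K * ρ * (K * ρ ^ 2) * (2 * L) := by
      rw [abs_mul, abs_mul]
      gcongr
    have h2 := pow_le_pow_left₀ (abs_nonneg _) h1 2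
    rw [sq_abs] at h2
    have h3 : (K * ρ * (K * ρ ^ 2) * (2 * L)) ^ 2 = 4 * K ^ 4 * L ^ 2 * ρ ^ 4 * ρ ^ 2 := by ring
    have h4 : 4 * K ^ 4 * L ^ 2 * ρ ^ 4 * ρ ^ 2 ≤ 4 * K ^ 4 * L ^ 2 * ρ ^ 4 * 1 := by
      gcongr
      exact pow_le_one₀ hρ.le hρ1
    linarith
  have e2 : |((c * 1 ^ 2 * x) ^ 2 + (a * ρ ^ 2 * x') ^ 2 + (a * c * (ρ * x' - 1 * x)) ^ 2) /
      (areaSq a c ρ 1 * S)| ≤ (2 * K ^ 2 * L ^ 2 + 4 * K ^ 4 * L ^ 2) * ρ := by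
    rw [hQS, abs_of_nonneg (by positivity), div_le_iff₀ (by positivity)]
    have : (2 * K ^ 2 * L ^ 2 + 4 * K ^ 4 * L ^ 2) * ρ * ρ ^ 3 ≤
        (2 * K ^ 2 * L ^ 2 + 4 * K ^ 4 * L ^ 2) * ρ * S ^ 3 := by gcongr
    nlinarith
  rw [add_sub_right_comm]
  refine (abs_add_le _ _).trans ((add_le_add e1 e2).trans_eq ?_)
  ring

lemma abs_areaElement1_zero_le (hρ : 0 < ρ) (hρ1 : ρ ≤ 1) (hx : |x| ≤ L) (hx' : ρ * |x'| ≤ L)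
    (ha : |a| ≤ K * ρ) (hc : |c| ≤ K * ρ ^ 2) :
    |areaElement1 a c ρ 1 x x'| ≤ 2 * K ^ 2 * L + 2 * L := by
  have hL : 0 ≤ L := (abs_nonneg _).trans hx
  have hDS := le_sqrt_areaSq (a := a) (c := c) (f := 1) (r := ρ)
  rw [one_mul] at hDS
  rw [areaElement1]
  set S := √(areaSq a c ρ 1) with hS
  have hS0 : 0 < S := hρ.trans_le hDS
  have ha2 : a ^ 2 ≤ (K * ρ) ^ 2 := by rw [← sq_abs]; exact pow_le_pow_left₀ (abs_nonneg _) ha 2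
  have hc2 : c ^ 2 ≤ (K * ρ ^ 2) ^ 2 := by rw [← sq_abs]; exact pow_le_pow_left₀ (abs_nonneg _) hc 2
  have hρ2 : ρ ^ 2 ≤ 1 := pow_le_one₀ hρ.le hρ1
  rw [abs_div, abs_of_pos hS0, div_le_iff₀ hS0]
  have e1 : |a ^ 2 * ρ * x| ≤ K ^ 2 * L * ρ := by
    rw [abs_mul, abs_mul, abs_of_nonneg (sq_nonneg a), abs_of_pos hρ]
    calc a ^ 2 * ρ * |x| ≤ (K * ρ) ^ 2 * ρ * L := by gcongr
      _ = K ^ 2 * L * ρ * ρ ^ 2 := by ring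
      _ ≤ K ^ 2 * L * ρ * 1 := by gcongr
      _ = _ := by ring
  have e2 : |c ^ 2 * 1 * x'| ≤ K ^ 2 * L * ρ := by
    rw [mul_one, abs_mul, abs_of_nonneg (sq_nonneg c)]
    calc c ^ 2 * |x'| ≤ (K * ρ ^ 2) ^ 2 * |x'| := by gcongr
      _ = K ^ 2 * ρ * ρ ^ 2 * (ρ * |x'|) := by ring
      _ ≤ K ^ 2 * ρ * 1 * L := by gcongr
      _ = _ := by ring
  have e3 : |1 * ρ * (x' * ρ + 1 * x)| ≤ 2 * L * ρ := by
    rw [one_mul, one_mul, abs_mul, abs_of_pos hρ]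
    have : |x' * ρ + x| ≤ L + L := by
      refine (abs_add_le _ _).trans (add_le_add ?_ hx)
      rw [abs_mul, abs_of_pos hρ, mul_comm]; exact hx'
    nlinarith
  have h4 : |a ^ 2 * ρ * x + c ^ 2 * 1 * x' + 1 * ρ * (x' * ρ + 1 * x)| ≤
      (2 * K ^ 2 * L + 2 * L) * ρ := by
    refine (abs_add_le _ _).trans ?_
    have := abs_add_le (a ^ 2 * ρ * x) (c ^ 2 * 1 * x')
    linarith
  refine h4.trans ?_
  gcongr

end


/-! ### The contribution of one sheet to the energy -/

lemma continuous_dir : Continuous dir := contDiff_zero.1 contDiff_dir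

/-- The radial derivative of a function of `(r, θ, h)`. -/
def radialDeriv (F : ℝ × ℝ × ℝ → ℝ) (z : ℝ × ℝ × ℝ) : ℝ := fderiv ℝ F z (1, 0, 0)

lemma hasDerivAt_radialDeriv {F : ℝ × ℝ × ℝ → ℝ} (hF : Differentiable ℝ F) (r θ h : ℝ) :
    HasDerivAt (fun r => F (r, θ, h)) (radialDeriv F (r, θ, h)) r := by
  have h1 : HasDerivAt (fun r : ℝ => (r, θ, h)) (1, 0, 0) r :=
    (hasDerivAt_id r).prodMk (hasDerivAt_const r (θ, h))
  exact (hF (r, θ, h)).hasFDerivAt.comp_hasDerivAt r h1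

lemma contDiff_radialDeriv {F : ℝ × ℝ × ℝ → ℝ} {n : ℕ} (hF : ContDiff ℝ (n + 1 : ℕ) F) :
    ContDiff ℝ n (radialDeriv F) :=
  (hF.fderiv_right (m := n) (by simp)).clm_apply contDiff_const

/-- The vertical average of `k` in cylindrical coordinates `(r, θ, h)`. -/
def polarAvg (k : ℂ × ℝ → ℝ) (z : ℝ × ℝ × ℝ) : ℝ := vertAvg k (z.1 • dir z.2.1, z.2.2)

lemma contDiff_polarAvg {k : ℂ × ℝ → ℝ} (n : ℕ) (hk : ContDiff ℝ n k) : ContDiff ℝ n (polarAvg k) :=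
  (contDiff_vertAvg n hk).comp ((contDiff_fst.smul
    ((contDiff_dir).comp (contDiff_fst.comp contDiff_snd))).prodMk
    (contDiff_snd.comp contDiff_snd))

section BulkTerm

variable {v r f x x' ρ t γ γ1 γ2 : ℝ}

/-- First derivative of `f r v γ(r)` when `r' = x` and `f' = x'`. -/
def bulkTerm1 (v r f x x' γ γ1 : ℝ) : ℝ := v * ((x' * r + f * x) * γ + f * r * x * γ1)

/-- Second derivative of `f r v γ(r)` when `r' = x` and `f' = x'`. -/
def bulkTerm2 (v r f x x' γ γ1 γ2 : ℝ) : ℝ :=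
  v * (2 * (x * x') * γ + 2 * (x' * r + f * x) * x * γ1 + f * r * x ^ 2 * γ2)

lemma hasDerivAt_bulkTerm {Γ : ℝ → ℝ} (hΓ : HasDerivAt Γ γ1 (ρ + t * x)) :
    HasDerivAt (fun t => (1 + t * x') * (ρ + t * x) * (v * Γ (ρ + t * x)))
      (bulkTerm1 v (ρ + t * x) (1 + t * x') x x' (Γ (ρ + t * x)) γ1) t := by
  have hr := hasDerivAt_affine ρ x t
  have hf := hasDerivAt_affine 1 x' t
  have hg : HasDerivAt (fun t => Γ (ρ + t * x)) (γ1 * x) t := hΓ.comp t hr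
  refine ((hf.mul hr).mul (hg.const_mul v)).congr_deriv ?_
  simp only [bulkTerm1, Pi.mul_apply]
  ring

lemma hasDerivAt_bulkTerm1 {Γ Γ1 : ℝ → ℝ} (hΓ : HasDerivAt Γ (Γ1 (ρ + t * x)) (ρ + t * x))
    (hΓ1 : HasDerivAt Γ1 γ2 (ρ + t * x)) :
    HasDerivAt (fun t => bulkTerm1 v (ρ + t * x) (1 + t * x') x x' (Γ (ρ + t * x)) (Γ1 (ρ + t * x)))
      (bulkTerm2 v (ρ + t * x) (1 + t * x') x x' (Γ (ρ + t * x)) (Γ1 (ρ + t * x)) γ2) t := by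
  have hr := hasDerivAt_affine ρ x t
  have hf := hasDerivAt_affine 1 x' t
  have hg : HasDerivAt (fun t => Γ (ρ + t * x)) (Γ1 (ρ + t * x) * x) t := hΓ.comp t hr
  have hg1 : HasDerivAt (fun t => Γ1 (ρ + t * x)) (γ2 * x) t := hΓ1.comp t hr
  have := (((((hr.const_mul x').add (hf.mul_const x)).mul hg)).add
    (((hf.mul hr).mul_const x).mul hg1)).const_mul v
  refine this.congr_deriv ?_
  simp only [bulkTerm2, Pi.mul_apply, Pi.add_apply]
  ring

lemma abs_bulkTerm2_le {K G M : ℝ} (hv : |v| ≤ K) (hx : |x| ≤ M) (hx' : |x'| ≤ M) (hf : 0 ≤ f)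
    (hf' : f ≤ 3 / 2) (hr : 0 ≤ r) (hr' : r ≤ 1) (h0 : |γ| ≤ G) (h1 : |γ1| ≤ G) (h2 : |γ2| ≤ G) :
    |bulkTerm2 v r f x x' γ γ1 γ2| ≤ K * (9 * M ^ 2 * G) := by
  have hM : 0 ≤ M := (abs_nonneg _).trans hx
  have hK : 0 ≤ K := (abs_nonneg _).trans hv
  have hG : 0 ≤ G := (abs_nonneg _).trans h0
  rw [bulkTerm2, abs_mul]
  refine mul_le_mul hv ?_ (abs_nonneg _) hK
  have e1 : |2 * (x * x') * γ| ≤ 2 * (M * M) * G := by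
    rw [abs_mul, abs_mul, abs_mul, abs_two]
    gcongr
  have e2 : |2 * (x' * r + f * x) * x * γ1| ≤ 2 * (M * 1 + 3 / 2 * M) * M * G := by
    rw [abs_mul, abs_mul, abs_mul, abs_two]
    gcongr
    refine (abs_add_le _ _).trans ?_
    rw [abs_mul, abs_mul, abs_of_nonneg hr, abs_of_nonneg hf]
    gcongr
  have e3 : |f * r * x ^ 2 * γ2| ≤ 3 / 2 * 1 * M ^ 2 * G := by
    rw [abs_mul, abs_mul, abs_mul, abs_of_nonneg hr, abs_of_nonneg hf, abs_pow]
    gcongr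
  have hMG : 0 ≤ M ^ 2 * G := by positivity
  refine (abs_add_le _ _).trans ((add_le_add ((abs_add_le _ _).trans (add_le_add e1 e2)) e3).trans
    ?_)
  nlinarith

lemma abs_bulkTerm2_zero_le {K G L : ℝ} (hρ : 0 < ρ) (hρ1 : ρ ≤ 1) (hv : |v| ≤ K * ρ ^ 2)
    (hx : |x| ≤ L) (hx' : ρ * |x'| ≤ L) (h0 : |γ| ≤ G) (h1 : |γ1| ≤ G) (h2 : |γ2| ≤ G) :
    |bulkTerm2 v ρ 1 x x' γ γ1 γ2| ≤ 7 * K * L ^ 2 * G * ρ := by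
  have hL : 0 ≤ L := (abs_nonneg _).trans hx
  have hG : 0 ≤ G := (abs_nonneg _).trans h0
  have hK : 0 ≤ K := by
    have := (abs_nonneg _).trans hv
    exact nonneg_of_mul_nonneg_left this (by positivity)
  have hxx : ρ * |x * x'| ≤ L * L := by
    rw [abs_mul]
    calc ρ * (|x| * |x'|) = |x| * (ρ * |x'|) := by ring
      _ ≤ L * L := by gcongr
  have e1 : ρ * |2 * (x * x') * γ| ≤ 2 * (L * L) * G := by
    rw [abs_mul, abs_mul, abs_two]
    calc ρ * (2 * |x * x'| * |γ|) = 2 * (ρ * |x * x'|) * |γ| := by ring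
      _ ≤ _ := by gcongr
  have e2 : ρ * |2 * (x' * ρ + 1 * x) * x * γ1| ≤ 4 * (L * L) * G := by
    rw [abs_mul, abs_mul, abs_mul, abs_two]
    have : |x' * ρ + 1 * x| ≤ L + L := by
      refine (abs_add_le _ _).trans (add_le_add ?_ (by simpa using hx))
      rw [abs_mul, abs_of_pos hρ, mul_comm]
      exact hx'
    calc ρ * (2 * |x' * ρ + 1 * x| * |x| * |γ1|) ≤ 1 * (2 * (L + L) * L * G) := by gcongr
      _ = _ := by ring
  have e3 : ρ * |1 * ρ * x ^ 2 * γ2| ≤ L * L * G := by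
    rw [abs_mul, abs_mul, abs_mul, abs_of_pos hρ, abs_pow, abs_one]
    calc ρ * (1 * ρ * |x| ^ 2 * |γ2|) ≤ 1 * (1 * 1 * L ^ 2 * G) := by gcongr
      _ = _ := by ring
  have e4 : ρ * |2 * (x * x') * γ + 2 * (x' * ρ + 1 * x) * x * γ1 + 1 * ρ * x ^ 2 * γ2| ≤
      7 * L ^ 2 * G := by
    calc _ ≤ ρ * (|2 * (x * x') * γ| + |2 * (x' * ρ + 1 * x) * x * γ1| +
          |1 * ρ * x ^ 2 * γ2|) := by
          gcongr
          exact (abs_add_le _ _).trans (add_le_add (abs_add_le _ _) le_rfl)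
      _ = _ := by ring
      _ ≤ _ := add_le_add (add_le_add e1 e2) e3
      _ = _ := by ring
  rw [bulkTerm2, abs_mul]
  calc _ ≤ K * ρ ^ 2 * |2 * (x * x') * γ + 2 * (x' * ρ + 1 * x) * x * γ1 +
        1 * ρ * x ^ 2 * γ2| := by gcongr
    _ = K * ρ * (ρ * |2 * (x * x') * γ + 2 * (x' * ρ + 1 * x) * x * γ1 +
        1 * ρ * x ^ 2 * γ2|) := by ring
    _ ≤ K * ρ * (7 * L ^ 2 * G) := by gcongr
    _ = _ := by ring

lemma abs_bulkTerm1_zero_le {K G L : ℝ} (hρ : 0 < ρ) (hρ1 : ρ ≤ 1) (hv : |v| ≤ K * ρ ^ 2)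
    (hx : |x| ≤ L) (hx' : ρ * |x'| ≤ L) (h0 : |γ| ≤ G) (h1 : |γ1| ≤ G) :
    |bulkTerm1 v ρ 1 x x' γ γ1| ≤ 3 * K * L * G := by
  have hL : 0 ≤ L := (abs_nonneg _).trans hx
  have hG : 0 ≤ G := (abs_nonneg _).trans h0
  have hK : 0 ≤ K := by
    have := (abs_nonneg _).trans hv
    exact nonneg_of_mul_nonneg_left this (by positivity)
  have e1 : |(x' * ρ + 1 * x) * γ| ≤ (L + L) * G := by
    rw [abs_mul]
    gcongr
    refine (abs_add_le _ _).trans (add_le_add ?_ (by simpa using hx))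
    rw [abs_mul, abs_of_pos hρ, mul_comm]
    exact hx'
  have e2 : |1 * ρ * x * γ1| ≤ 1 * 1 * L * G := by
    rw [abs_mul, abs_mul, abs_mul, abs_of_pos hρ, abs_one]
    gcongr
  rw [bulkTerm1, abs_mul]
  calc _ ≤ (K * ρ ^ 2) * ((L + L) * G + 1 * 1 * L * G) := by
        gcongr
        exact (abs_add_le _ _).trans (add_le_add e1 e2)
    _ = 3 * K * L * G * ρ ^ 2 := by ring
    _ ≤ 3 * K * L * G * 1 := by
        gcongr
        exact pow_le_one₀ hρ.le hρ1
    _ = _ := by ring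

end BulkTerm

section Sheet

variable {k : ℂ × ℝ → ℝ} {u : ℂ → ℝ} {χ : ℝ → ℝ} {τ t R M K G L : ℝ} {x : ℝ × ℝ}
  (h : IsProfile χ R M)

/-- The energy density of the sheet `u`, with bulk weight `τ k`, in stretched polar
coordinates. -/
def sheet (k : ℂ × ℝ → ℝ) (u : ℂ → ℝ) (τ : ℝ) (χ : ℝ → ℝ) (t : ℝ) (x : ℝ × ℝ) : ℝ :=
  areaElement (radialSlope u x) (angularSlope u x) (x.1 + t * χ x.1) (1 + t * deriv χ x.1) +
    τ * ((1 + t * deriv χ x.1) * (x.1 + t * χ x.1) *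
      (u (x.1 • dir x.2) * polarAvg k (x.1 + t * χ x.1, x.2, u (x.1 • dir x.2))))

/-- First time derivative of `sheet`. -/
def sheet1 (k : ℂ × ℝ → ℝ) (u : ℂ → ℝ) (τ : ℝ) (χ : ℝ → ℝ) (t : ℝ) (x : ℝ × ℝ) : ℝ :=
  areaElement1 (radialSlope u x) (angularSlope u x) (x.1 + t * χ x.1) (1 + t * deriv χ x.1)
      (χ x.1) (deriv χ x.1) +
    τ * bulkTerm1 (u (x.1 • dir x.2)) (x.1 + t * χ x.1) (1 + t * deriv χ x.1) (χ x.1)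
      (deriv χ x.1) (polarAvg k (x.1 + t * χ x.1, x.2, u (x.1 • dir x.2)))
      (radialDeriv (polarAvg k) (x.1 + t * χ x.1, x.2, u (x.1 • dir x.2)))

/-- Second time derivative of `sheet`. -/
def sheet2 (k : ℂ × ℝ → ℝ) (u : ℂ → ℝ) (τ : ℝ) (χ : ℝ → ℝ) (t : ℝ) (x : ℝ × ℝ) : ℝ :=
  areaElement2 (radialSlope u x) (angularSlope u x) (x.1 + t * χ x.1) (1 + t * deriv χ x.1)
      (χ x.1) (deriv χ x.1) +
    τ * bulkTerm2 (u (x.1 • dir x.2)) (x.1 + t * χ x.1) (1 + t * deriv χ x.1) (χ x.1)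
      (deriv χ x.1) (polarAvg k (x.1 + t * χ x.1, x.2, u (x.1 • dir x.2)))
      (radialDeriv (polarAvg k) (x.1 + t * χ x.1, x.2, u (x.1 • dir x.2)))
      (radialDeriv (radialDeriv (polarAvg k)) (x.1 + t * χ x.1, x.2, u (x.1 • dir x.2)))

include h in
lemma hasDerivAt_sheet (hk : ContDiff ℝ 2 k) (ht : |t| * M ≤ 1 / 2)
    (h0 : 0 ≤ t * χ 0) (hx : 0 < x.1) :
    HasDerivAt (fun t => sheet k u τ χ t x) (sheet1 k u τ χ t x) t := by
  have hf := h.half_le ht x.1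
  have hr := h.stretch_pos ht h0 hx.le
  rw [stretch] at hr
  refine (hasDerivAt_areaElement (by linarith) (by linarith)).add
    ((hasDerivAt_bulkTerm (Γ := fun r => polarAvg k (r, x.2, u (x.1 • dir x.2))) ?_).const_mul τ)
  exact hasDerivAt_radialDeriv ((contDiff_polarAvg 2 hk).differentiable (by simp)) _ _ _

include h in
lemma hasDerivAt_sheet1 (hk : ContDiff ℝ 2 k) (ht : |t| * M ≤ 1 / 2)
    (h0 : 0 ≤ t * χ 0) (hx : 0 < x.1) :
    HasDerivAt (fun t => sheet1 k u τ χ t x) (sheet2 k u τ χ t x) t := by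
  have hf := h.half_le ht x.1
  have hr := h.stretch_pos ht h0 hx.le
  rw [stretch] at hr
  have hΓ := contDiff_polarAvg 2 hk
  have hΓ1 : ContDiff ℝ (1 : ℕ) (radialDeriv (polarAvg k)) := contDiff_radialDeriv hΓ
  refine (hasDerivAt_areaElement1 (by linarith) (by linarith)).add
    ((hasDerivAt_bulkTerm1 (Γ := fun r => polarAvg k (r, x.2, u (x.1 • dir x.2)))
      (Γ1 := fun r => radialDeriv (polarAvg k) (r, x.2, u (x.1 • dir x.2))) ?_ ?_).const_mul τ)
  · exact hasDerivAt_radialDeriv (hΓ.differentiable (by simp)) _ _ _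
  · exact hasDerivAt_radialDeriv (hΓ1.differentiable (by simp)) _ _ _

lemma continuous_radialSlope (hu : ContDiff ℝ 1 u) : Continuous (radialSlope u) := by
  have hd : Continuous dir := continuous_dir
  have : Continuous fun x : ℝ × ℝ => fderiv ℝ u (x.1 • dir x.2) :=
    (hu.continuous_fderiv one_ne_zero).comp (continuous_fst.smul (hd.comp continuous_snd))
  exact this.clm_apply (hd.comp continuous_snd)

lemma continuous_angularSlope (hu : ContDiff ℝ 1 u) : Continuous (angularSlope u) := by
  have hd : Continuous dir := continuous_dir
  have : Continuous fun x : ℝ × ℝ => fderiv ℝ u (x.1 • dir x.2) :=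
    (hu.continuous_fderiv one_ne_zero).comp (continuous_fst.smul (hd.comp continuous_snd))
  exact continuous_fst.mul (this.clm_apply (continuous_const.mul (hd.comp continuous_snd)))

include h in
lemma continuous_radius (t : ℝ) : Continuous fun x : ℝ × ℝ => x.1 + t * χ x.1 :=
  (h.contDiff_stretch t).continuous.comp continuous_fst

include h in
lemma continuous_radius_deriv (t : ℝ) : Continuous fun x : ℝ × ℝ => 1 + t * deriv χ x.1 :=
  continuous_const.add (continuous_const.mul
    ((h.smooth.continuous_deriv (by simp)).comp continuous_fst))

lemma continuous_height (hu : ContDiff ℝ 1 u) : Continuous fun x : ℝ × ℝ => u (x.1 • dir x.2) :=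
  hu.continuous.comp (continuous_fst.smul (continuous_dir.comp continuous_snd))

include h in
lemma continuous_sheet (hk : ContDiff ℝ 2 k) (hu : ContDiff ℝ 1 u) (t : ℝ) :
    Continuous (sheet k u τ χ t) := by
  have ha := continuous_radialSlope hu
  have hc := continuous_angularSlope hu
  have hr := continuous_radius h t
  have hf := continuous_radius_deriv h t
  have hv := continuous_height hu
  have hΓ := (contDiff_polarAvg 2 hk).continuous
  refine Continuous.add ?_ (continuous_const.mul ((hf.mul hr).mul (hv.mul
    (hΓ.comp (hr.prodMk (continuous_snd.prodMk hv))))))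
  exact Real.continuous_sqrt.comp
    ((((ha.mul hr).pow 2).add ((hc.mul hf).pow 2)).add ((hf.mul hr).pow 2))

include h in
lemma measurable_sheet1 (hk : ContDiff ℝ 2 k) (hu : ContDiff ℝ 1 u)
    (t : ℝ) : Measurable (sheet1 k u τ χ t) := by
  have ha := (continuous_radialSlope hu).measurable
  have hc := (continuous_angularSlope hu).measurable
  have hr := (continuous_radius h t).measurable
  have hf := (continuous_radius_deriv h t).measurable
  have hv := (continuous_height hu).measurable
  have hΓ := (contDiff_polarAvg 2 hk).continuous.measurable
  have hΓ1 : Measurable (radialDeriv (polarAvg k)) :=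
    (contDiff_radialDeriv (n := 1) (contDiff_polarAvg 2 hk)).continuous.measurable
  have hx : Measurable fun x : ℝ × ℝ => χ x.1 := h.smooth.continuous.measurable.comp measurable_fst
  have hx' : Measurable fun x : ℝ × ℝ => deriv χ x.1 :=
    (h.smooth.continuous_deriv (by simp)).measurable.comp measurable_fst
  have hz := hr.prodMk (measurable_snd.prodMk hv)
  refine Measurable.add ?_ (measurable_const.mul (hv.mul
    ((((hx'.mul hr).add (hf.mul hx)).mul (hΓ.comp hz)).add
      (((hf.mul hr).mul hx).mul (hΓ1.comp hz)))))
  refine Measurable.div (((((ha.pow_const 2).mul hr).mul hx).add (((hc.pow_const 2).mul hf).mul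
    hx')).add ((hf.mul hr).mul ((hx'.mul hr).add (hf.mul hx)))) (Measurable.sqrt ?_)
  exact (((ha.mul hr).pow_const 2).add ((hc.mul hf).pow_const 2)).add ((hf.mul hr).pow_const 2)

include h in
lemma measurable_sheet2 (hk : ContDiff ℝ 2 k) (hu : ContDiff ℝ 1 u)
    (t : ℝ) : Measurable (sheet2 k u τ χ t) := by
  have ha := (continuous_radialSlope hu).measurable
  have hc := (continuous_angularSlope hu).measurable
  have hr := (continuous_radius h t).measurable
  have hf := (continuous_radius_deriv h t).measurable
  have hv := (continuous_height hu).measurable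
  have hΓ := (contDiff_polarAvg 2 hk).continuous.measurable
  have hΓ1' : ContDiff ℝ (1 : ℕ) (radialDeriv (polarAvg k)) :=
    contDiff_radialDeriv (n := 1) (contDiff_polarAvg 2 hk)
  have hΓ1 := hΓ1'.continuous.measurable
  have hΓ2 : Measurable (radialDeriv (radialDeriv (polarAvg k))) :=
    (contDiff_radialDeriv (n := 0) hΓ1').continuous.measurable
  have hx : Measurable fun x : ℝ × ℝ => χ x.1 := h.smooth.continuous.measurable.comp measurable_fst
  have hx' : Measurable fun x : ℝ × ℝ => deriv χ x.1 :=
    (h.smooth.continuous_deriv (by simp)).measurable.comp measurable_fst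
  have hz := hr.prodMk (measurable_snd.prodMk hv)
  have hS : Measurable fun x : ℝ × ℝ => areaSq (radialSlope u x) (angularSlope u x)
      (x.1 + t * χ x.1) (1 + t * deriv χ x.1) :=
    (((ha.mul hr).pow_const 2).add ((hc.mul hf).pow_const 2)).add ((hf.mul hr).pow_const 2)
  refine Measurable.add (Measurable.add ?_ ?_) (measurable_const.mul (hv.mul
    ((((measurable_const.mul (hx.mul hx')).mul (hΓ.comp hz)).add
      ((((measurable_const.mul ((hx'.mul hr).add (hf.mul hx))).mul hx).mul (hΓ1.comp hz)))).add
      (((hf.mul hr).mul (hx.pow_const 2)).mul (hΓ2.comp hz)))))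
  · exact (measurable_const.mul (hx.mul hx')).mul ((hf.mul hr).div hS.sqrt)
  · exact Measurable.div (((((hc.mul (hf.pow_const 2)).mul hx).pow_const 2).add
      (((ha.mul (hr.pow_const 2)).mul hx').pow_const 2)).add
      (((ha.mul hc).mul ((hr.mul hx').sub (hf.mul hx))).pow_const 2)) (hS.mul hS.sqrt)

lemma abs_radialSlope_le (hK : ∀ y, ‖fderiv ℝ u y‖ ≤ K * ‖y‖) (hx : 0 < x.1) :
    |radialSlope u x| ≤ K * x.1 := by
  have h1 := (fderiv ℝ u (x.1 • dir x.2)).le_opNorm (dir x.2)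
  have h2 := hK (x.1 • dir x.2)
  rw [norm_smul, norm_dir, mul_one, Real.norm_of_nonneg hx.le] at h2
  rw [norm_dir, mul_one] at h1
  exact h1.trans h2

lemma abs_angularSlope_le (hK : ∀ y, ‖fderiv ℝ u y‖ ≤ K * ‖y‖) (hx : 0 < x.1) :
    |angularSlope u x| ≤ K * x.1 ^ 2 := by
  have h1 := (fderiv ℝ u (x.1 • dir x.2)).le_opNorm (Complex.I * dir x.2)
  have h2 := hK (x.1 • dir x.2)
  rw [norm_smul, norm_dir, mul_one, Real.norm_of_nonneg hx.le] at h2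
  rw [norm_mul, Complex.norm_I, norm_dir, mul_one, mul_one] at h1
  rw [angularSlope, abs_mul, abs_of_pos hx, pow_two, ← mul_assoc, mul_comm K, mul_assoc]
  exact mul_le_mul_of_nonneg_left (h1.trans h2) hx.le

lemma abs_height_le (hu0 : ∀ y, |u y| ≤ K * ‖y‖ ^ 2) (hx : 0 < x.1) :
    |u (x.1 • dir x.2)| ≤ K * x.1 ^ 2 := by
  have := hu0 (x.1 • dir x.2)
  rwa [norm_smul, norm_dir, mul_one, Real.norm_of_nonneg hx.le] at this

/-- The compact range of the cylindrical coordinates that matter. -/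
def cylRange (K : ℝ) : Set (ℝ × ℝ × ℝ) := Icc 0 1 ×ˢ Icc (-Real.pi) Real.pi ×ˢ Icc (-K) K

/-- `G` bounds the vertical average of `k` and its first two radial derivatives. -/
def IsAvgBound (k : ℂ × ℝ → ℝ) (K G : ℝ) : Prop :=
  ∀ z ∈ cylRange K, |polarAvg k z| ≤ G ∧ |radialDeriv (polarAvg k) z| ≤ G ∧
    |radialDeriv (radialDeriv (polarAvg k)) z| ≤ G

lemma exists_isAvgBound (hk : ContDiff ℝ 2 k) (K : ℝ) : ∃ G, IsAvgBound k K G := by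
  have hc : IsCompact (cylRange K) := isCompact_Icc.prod (isCompact_Icc.prod isCompact_Icc)
  have hΓ1' : ContDiff ℝ (1 : ℕ) (radialDeriv (polarAvg k)) :=
    contDiff_radialDeriv (n := 1) (contDiff_polarAvg 2 hk)
  obtain ⟨A, hA⟩ := hc.exists_bound_of_continuousOn (contDiff_polarAvg 2 hk).continuous.continuousOn
  obtain ⟨B, hB⟩ := hc.exists_bound_of_continuousOn hΓ1'.continuous.continuousOn
  obtain ⟨C, hC⟩ := hc.exists_bound_of_continuousOn
    (contDiff_radialDeriv (n := 0) hΓ1').continuous.continuousOn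
  exact ⟨max A (max B C), fun z hz => ⟨(hA z hz).trans (le_max_left _ _),
    (hB z hz).trans ((le_max_left _ _).trans (le_max_right _ _)),
    (hC z hz).trans ((le_max_right _ _).trans (le_max_right _ _))⟩⟩

include h in
lemma mem_cylRange (hR : R ≤ 1) (ht : |t| * M ≤ 1 / 2) (h0 : 0 ≤ t * χ 0)
    (hu0 : ∀ y, |u y| ≤ K * ‖y‖ ^ 2) (hx : x ∈ polarRect R) :
    (x.1 + t * χ x.1, x.2, u (x.1 • dir x.2)) ∈ cylRange K ∧ x.1 / 2 ≤ x.1 + t * χ x.1 ∧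
      |u (x.1 • dir x.2)| ≤ K := by
  have hK : 0 ≤ K := by simpa using (abs_nonneg _).trans (hu0 1)
  have hr := h.stretch_pos ht h0 hx.1.1.le
  have hr' := (h.strictMono ht) hx.1.2
  rw [h.stretch_of_ge t le_rfl] at hr'
  have hv : |u (x.1 • dir x.2)| ≤ K := by
    refine (abs_height_le hu0 hx.1.1).trans (mul_le_of_le_one_right hK ?_)
    exact pow_le_one₀ hx.1.1.le (hx.1.2.le.trans hR)
  rw [stretch] at hr hr'
  refine ⟨⟨⟨?_, ?_⟩, Ioo_subset_Icc_self hx.2, abs_le.1 hv⟩, hr, hv⟩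
  · exact le_trans (by linarith [hx.1.1]) hr
  · exact (hr'.trans_le hR).le

include h in
lemma abs_sheet2_le (hR : R ≤ 1) (ht : |t| * M ≤ 1 / 2)
    (h0 : 0 ≤ t * χ 0) (hu0 : ∀ y, |u y| ≤ K * ‖y‖ ^ 2) (hK : ∀ y, ‖fderiv ℝ u y‖ ≤ K * ‖y‖)
    (hG : IsAvgBound k K G) (hτ : |τ| ≤ 1) (hx : x ∈ polarRect R) :
    |sheet2 k u τ χ t x| ≤ 2 * M ^ 2 + (24 * K ^ 2 * M ^ 2 + 64 * K ^ 2 * M ^ 2 +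
      6400 * K ^ 4 * M ^ 2) + K * (9 * M ^ 2 * G) := by
  have hK0 : 0 ≤ K := by simpa using (abs_nonneg _).trans (hu0 1)
  obtain ⟨hz, hr, hv⟩ := mem_cylRange (u := u) h hR ht h0 hu0 hx
  obtain ⟨g0, g1, g2⟩ := hG _ hz
  have hf := h.half_le ht x.1
  have hf' := (abs_le.1 (h.abs_mul_deriv_le ht x.1)).2
  have hρ := hx.1.1
  refine (abs_add_le _ _).trans (add_le_add ?_ ?_)
  · refine abs_areaElement2_le (h.bound _) (h.deriv_bound _) hf (by linarith) (by linarith)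
      hz.1.2 ?_ ?_
    · refine (abs_radialSlope_le hK hρ).trans ?_
      nlinarith
    · refine (abs_angularSlope_le hK hρ).trans ?_
      have : x.1 ^ 2 ≤ 4 * (x.1 + t * χ x.1) ^ 2 := by nlinarith
      nlinarith
  · rw [abs_mul]
    refine (mul_le_of_le_one_left (abs_nonneg _) hτ).trans ?_
    exact abs_bulkTerm2_le hv (h.bound _) (h.deriv_bound _) (by linarith) (by linarith)
      (by linarith) hz.1.2 g0 g1 g2

include h in
lemma abs_sheet1_zero_le (hR : R ≤ 1)
    (hu0 : ∀ y, |u y| ≤ K * ‖y‖ ^ 2) (hK : ∀ y, ‖fderiv ℝ u y‖ ≤ K * ‖y‖)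
    (hG : IsAvgBound k K G) (hτ : |τ| ≤ 1) (hL : |χ x.1| ≤ L) (hL' : x.1 * |deriv χ x.1| ≤ L)
    (hx : x ∈ polarRect R) :
    |sheet1 k u τ χ 0 x| ≤ 2 * K ^ 2 * L + 2 * L + 3 * K * L * G := by
  have hK0 : 0 ≤ K := by simpa using (abs_nonneg _).trans (hu0 1)
  obtain ⟨hz, -, -⟩ := mem_cylRange (u := u) (t := 0) h hR (by simp) (by simp) hu0 hx
  obtain ⟨g0, g1, -⟩ := hG _ hz
  have hρ := hx.1.1
  have hρ1 := hx.1.2.le.trans hR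
  simp only [sheet1, zero_mul, add_zero] at g0 g1 ⊢
  refine (abs_add_le _ _).trans (add_le_add ?_ ?_)
  · exact abs_areaElement1_zero_le hρ hρ1 hL hL' (abs_radialSlope_le hK hρ)
      (abs_angularSlope_le hK hρ)
  · rw [abs_mul]
    refine (mul_le_of_le_one_left (abs_nonneg _) hτ).trans ?_
    exact abs_bulkTerm1_zero_le hρ hρ1 (abs_height_le hu0 hρ) hL hL' g0 g1

include h in
lemma abs_sheet2_zero_le (hR : R ≤ 1)
    (hu0 : ∀ y, |u y| ≤ K * ‖y‖ ^ 2) (hK : ∀ y, ‖fderiv ℝ u y‖ ≤ K * ‖y‖)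
    (hG : IsAvgBound k K G) (hτ : |τ| ≤ 1) (hL : |χ x.1| ≤ L) (hL' : x.1 * |deriv χ x.1| ≤ L)
    (hx : x ∈ polarRect R) :
    |sheet2 k u τ χ 0 x - 2 * (χ x.1 * deriv χ x.1)| ≤
      (4 * K ^ 2 * L ^ 2 + 4 * K ^ 4 * L ^ 2 + 7 * K * L ^ 2 * G) * x.1 := by
  have hK0 : 0 ≤ K := by simpa using (abs_nonneg _).trans (hu0 1)
  obtain ⟨hz, -, -⟩ := mem_cylRange (u := u) (t := 0) h hR (by simp) (by simp) hu0 hx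
  obtain ⟨g0, g1, g2⟩ := hG _ hz
  have hρ := hx.1.1
  have hρ1 := hx.1.2.le.trans hR
  simp only [sheet2, zero_mul, add_zero] at g0 g1 g2 ⊢
  rw [add_sub_right_comm, add_mul]
  refine (abs_add_le _ _).trans (add_le_add ?_ ?_)
  · exact abs_areaElement2_zero_le hρ hρ1 hL hL' hK0 (abs_radialSlope_le hK hρ)
      (abs_angularSlope_le hK hρ)
  · rw [abs_mul]
    refine (mul_le_of_le_one_left (abs_nonneg _) hτ).trans ?_
    exact abs_bulkTerm2_zero_le hρ hρ1 (abs_height_le hu0 hρ) hL hL' g0 g1 g2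

lemma sheet2_zero_of_eq_zero (h1 : χ x.1 = 0) (h2 : deriv χ x.1 = 0) : sheet2 k u τ χ 0 x = 0 := by
  simp [sheet2, areaElement2, bulkTerm2, h1, h2]

end Sheet


/-! ### The energy of two sheets along a radial stretching -/

/-- `u1` and `u2` are two graphs, tangent to the horizontal plane at `0`, with `u2 < u1` on the
punctured disk of radius `R`; `ζ` is a bump function supported in the annulus
`R1 < ‖y‖ < R'`. -/
structure TwoSheets (u1 u2 ζ : ℂ → ℝ) (R1 R' R K m : ℝ) : Prop where
  smooth1 : ContDiff ℝ ∞ u1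
  smooth2 : ContDiff ℝ ∞ u2
  smooth_bump : ContDiff ℝ ∞ ζ
  quad1 : ∀ y, |u1 y| ≤ K * ‖y‖ ^ 2
  quad2 : ∀ y, |u2 y| ≤ K * ‖y‖ ^ 2
  slope1 : ∀ y, ‖fderiv ℝ u1 y‖ ≤ K * ‖y‖
  slope2 : ∀ y, ‖fderiv ℝ u2 y‖ ≤ K * ‖y‖
  pos : 0 < R1
  le_one : R1 ≤ 1
  lt : R1 < R'
  lt' : R' < R
  lt_of_ne : ∀ y, y ≠ 0 → ‖y‖ < R → u2 y < u1 y
  gap_pos : 0 < m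
  gap : ∀ y, R1 ≤ ‖y‖ → ‖y‖ ≤ R' → m ≤ u1 y - u2 y
  bump_inner : ∀ y, ‖y‖ ≤ R1 → ζ y = 0
  bump_outer : ∀ y, R' ≤ ‖y‖ → ζ y = 0
  bump_le : ∀ y, |ζ y| ≤ 1
  bump_mass : ∫ y in closedBall (0 : ℂ) R' \ closedBall 0 R1, ζ y ≠ 0

/-- The upper graph, stretched by `χ` and corrected by `c ζ`. -/
def upperSheet (u ζ : ℂ → ℝ) (χ : ℝ → ℝ) (c t : ℝ) (y : ℂ) : ℝ := u (collapse χ t y) + c * ζ y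

/-- The lower graph, stretched by `χ`. -/
def lowerSheet (u : ℂ → ℝ) (χ : ℝ → ℝ) (t : ℝ) (y : ℂ) : ℝ := u (collapse χ t y)

/-- The energy density over `y` of the region between the graphs of `W2` and `W1`. -/
def energyDensity (k : ℂ × ℝ → ℝ) (σ : ℝ) (W1 W2 : ℂ → ℝ) (y : ℂ) : ℝ :=
  areaDensity W1 y + areaDensity W2 y +
    σ * (W1 y * vertAvg k (y, W1 y) - W2 y * vertAvg k (y, W2 y))

/-- The energy in the annulus outside the stretched disk, as a function of the correction. -/
def outerEnergy (k : ℂ × ℝ → ℝ) (σ : ℝ) (u1 u2 ζ : ℂ → ℝ) (R1 R' c : ℝ) : ℝ :=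
  ∫ y in closedBall (0 : ℂ) R' \ closedBall 0 R1, energyDensity k σ (fun y => u1 y + c * ζ y) u2 y

/-- The energy in the stretched disk. -/
def innerEnergy (k : ℂ × ℝ → ℝ) (σ : ℝ) (u1 u2 : ℂ → ℝ) (R1 : ℝ) (χ : ℝ → ℝ) (t : ℝ) : ℝ :=
  ∫ x in polarRect R1, (sheet k u1 σ χ t x + sheet k u2 (-σ) χ t x)

/-- The first order rate of change of the enclosed volume. -/
def volRate (u1 u2 : ℂ → ℝ) (R1 : ℝ) (χ : ℝ → ℝ) : ℝ :=
  ∫ x in polarRect R1, (u1 (x.1 • dir x.2) - u2 (x.1 • dir x.2)) * (χ x.1 + x.1 * deriv χ x.1)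

/-- The second order rate of change of the enclosed volume. -/
def volRate2 (u1 u2 : ℂ → ℝ) (R1 : ℝ) (χ : ℝ → ℝ) : ℝ :=
  ∫ x in polarRect R1, (u1 (x.1 • dir x.2) - u2 (x.1 • dir x.2)) * (χ x.1 * deriv χ x.1)

/-- The mass of the bump function. -/
def bumpMass (ζ : ℂ → ℝ) (R1 R' : ℝ) : ℝ := ∫ y in closedBall (0 : ℂ) R' \ closedBall 0 R1, ζ y

/-- The amount of bump that restores the enclosed volume. -/
def correction (u1 u2 ζ : ℂ → ℝ) (R1 R' : ℝ) (χ : ℝ → ℝ) (t : ℝ) : ℝ :=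
  -(volRate u1 u2 R1 χ * t + volRate2 u1 u2 R1 χ * t ^ 2) / bumpMass ζ R1 R'

/-- The energy along the stretching `χ`, with corrected volume. -/
def stretchedEnergy (k : ℂ × ℝ → ℝ) (σ : ℝ) (u1 u2 ζ : ℂ → ℝ) (R1 R' : ℝ) (χ : ℝ → ℝ) (t : ℝ) : ℝ :=
  innerEnergy k σ u1 u2 R1 χ t + outerEnergy k σ u1 u2 ζ R1 R' (correction u1 u2 ζ R1 R' χ t)

namespace TwoSheets

variable {k : ℂ × ℝ → ℝ} {σ : ℝ} {u1 u2 ζ : ℂ → ℝ} {R1 R' R K m M t c : ℝ} {χ : ℝ → ℝ}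
variable (h : TwoSheets u1 u2 ζ R1 R' R K m) (hχ : IsProfile χ R1 M)
  (ht : |t| * M ≤ 1 / 2) (h0 : 0 ≤ t * χ 0)

lemma radius_lt (hS : IsProfile χ R1 M) (ht : |t| * M ≤ 1 / 2) : t * χ 0 < R1 := by
  have := hS.strictMono ht hS.pos
  rw [hS.stretch_of_ge t le_rfl] at this
  simpa [stretch] using this

include h in
lemma contDiff : ContDiff ℝ 1 u1 ∧ ContDiff ℝ 1 u2 :=
  ⟨h.smooth1.of_le (mod_cast le_top), h.smooth2.of_le (mod_cast le_top)⟩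

include h hχ ht h0 in
lemma contDiff_upperSheet (c : ℝ) : ContDiff ℝ 1 (upperSheet u1 ζ χ c t) :=
  (contDiff_comp_collapse hχ ht h0 h.contDiff.1 h.quad1
    h.slope1).add (contDiff_const.mul (h.smooth_bump.of_le (mod_cast le_top)))

include h hχ ht h0 in
lemma contDiff_lowerSheet : ContDiff ℝ 1 (lowerSheet u2 χ t) :=
  contDiff_comp_collapse hχ ht h0 h.contDiff.2 h.quad2 h.slope2

include h in
lemma apply_zero1 : u1 0 = 0 := by simpa using h.quad1 0

include h in
lemma apply_zero2 : u2 0 = 0 := by simpa using h.quad2 0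

include h hχ ht in
lemma upperSheet_of_le {y : ℂ} (hy : ‖y‖ ≤ t * χ 0) : upperSheet u1 ζ χ c t y = 0 := by
  rw [upperSheet, collapse_eq_zero hχ ht hy, h.apply_zero1,
    h.bump_inner y (hy.trans (radius_lt hχ ht).le), mul_zero, zero_add]

include h hχ ht in
lemma lowerSheet_of_le {y : ℂ} (hy : ‖y‖ ≤ t * χ 0) : lowerSheet u2 χ t y = 0 := by
  rw [lowerSheet, collapse_eq_zero hχ ht hy, h.apply_zero2]

include hχ ht in
lemma upperSheet_of_ge {y : ℂ} (hy : R1 ≤ ‖y‖) : upperSheet u1 ζ χ c t y = u1 y + c * ζ y := by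
  rw [upperSheet, collapse_of_ge hχ ht hy]

include hχ ht in
lemma lowerSheet_of_ge {y : ℂ} (hy : R1 ≤ ‖y‖) : lowerSheet u2 χ t y = u2 y := by
  rw [lowerSheet, collapse_of_ge hχ ht hy]

include h hχ ht h0 in
lemma lowerSheet_lt_upperSheet (hc : |c| < m) {y : ℂ} (hy : t * χ 0 < ‖y‖)
    (hyR : ‖y‖ < R) : lowerSheet u2 χ t y < upperSheet u1 ζ χ c t y := by
  rcases le_total ‖y‖ R1 with hy1 | hy1
  · obtain ⟨ρ, hρ, w, hw, hyw, hcol, hρy⟩ := exists_polar hχ ht h0 hy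
    rw [lowerSheet, upperSheet, h.bump_inner y hy1, mul_zero, add_zero]
    refine h.lt_of_ne _ ?_ ?_
    · rw [hcol]
      refine smul_ne_zero hρ.ne' ?_
      rintro rfl
      simp at hw
    · exact (norm_collapse_le_of_le hχ ht le_rfl hy1).trans_lt (h.lt.trans h.lt')
  · rw [upperSheet_of_ge hχ ht hy1, lowerSheet_of_ge hχ ht hy1]
    rcases le_total ‖y‖ R' with hy2 | hy2
    · have h1 := h.gap y hy1 hy2
      have h2 : |c * ζ y| < m := by
        rw [abs_mul]
        exact (mul_le_of_le_one_right (abs_nonneg _) (h.bump_le y)).trans_lt hc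
      linarith [(abs_lt.1 h2).1]
    · rw [h.bump_outer y hy2, mul_zero, add_zero]
      refine h.lt_of_ne y ?_ hyR
      rintro rfl
      simp at hy1
      linarith [h.pos]

include h hχ ht h0 in
lemma lowerSheet_le_upperSheet (hc : |c| < m) {y : ℂ} (hyR : ‖y‖ < R) :
    lowerSheet u2 χ t y ≤ upperSheet u1 ζ χ c t y := by
  rcases le_or_gt ‖y‖ (t * χ 0) with hy | hy
  · rw [h.upperSheet_of_le hχ ht hy, h.lowerSheet_of_le hχ ht hy]
  · exact (h.lowerSheet_lt_upperSheet hχ ht h0 hc hy hyR).le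

include hχ ht in
lemma setIntegral_annulus_split (hR : R1 < R') {D : ℂ → ℝ} (hD : Continuous D) :
    ∫ y in closedBall (0 : ℂ) R' ∩ {y | t * χ 0 < ‖y‖}, D y =
      (∫ y in closedBall (0 : ℂ) R1 ∩ {y | t * χ 0 < ‖y‖}, D y) +
        ∫ y in closedBall (0 : ℂ) R' \ closedBall 0 R1, D y := by
  have hlt := radius_lt hχ ht
  have hset : closedBall (0 : ℂ) R' ∩ {y | t * χ 0 < ‖y‖} =
      (closedBall (0 : ℂ) R1 ∩ {y | t * χ 0 < ‖y‖}) ∪ (closedBall (0 : ℂ) R' \ closedBall 0 R1) := by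
    ext y
    simp only [mem_inter_iff, mem_closedBall, dist_zero_right, mem_ofPred_eq, mem_union,
      Set.mem_sdiff, not_le]
    constructor
    · rintro ⟨h1, h2⟩
      rcases le_or_gt ‖y‖ R1 with h3 | h3
      · exact Or.inl ⟨h3, h2⟩
      · exact Or.inr ⟨h1, h3⟩
    · rintro (⟨h1, h2⟩ | ⟨h1, h2⟩)
      · exact ⟨h1.trans hR.le, h2⟩
      · exact ⟨h1, hlt.trans h2⟩
  have hint := hD.continuousOn.integrableOn_compact (μ := volume) (isCompact_closedBall (0 : ℂ) R')
  rw [hset, setIntegral_union]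
  · exact disjoint_left.2 fun y h1 h2 => h2.2 h1.1
  · exact isClosed_closedBall.measurableSet.diff isClosed_closedBall.measurableSet
  · exact hint.mono_set (inter_subset_left.trans (closedBall_subset_closedBall hR.le))
  · exact hint.mono_set sdiff_subset

lemma energyDensity_congr {W1 W2 V1 V2 : ℂ → ℝ} {y : ℂ} (h1 : W1 =ᶠ[𝓝 y] V1)
    (h2 : W2 =ᶠ[𝓝 y] V2) : energyDensity k σ W1 W2 y = energyDensity k σ V1 V2 y := by
  simp only [energyDensity, areaDensity, h1.fderiv_eq, h2.fderiv_eq, h1.eq_of_nhds, h2.eq_of_nhds]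

lemma continuous_energyDensity (hk : Continuous k) {W1 W2 : ℂ → ℝ} (hW1 : ContDiff ℝ 1 W1)
    (hW2 : ContDiff ℝ 1 W2) : Continuous (energyDensity k σ W1 W2) :=
  ((continuous_areaDensity hW1).add (continuous_areaDensity hW2)).add
    (continuous_const.mul ((hW1.continuous.mul ((continuous_vertAvg hk).comp
      (continuous_id.prodMk hW1.continuous))).sub (hW2.continuous.mul ((continuous_vertAvg hk).comp
      (continuous_id.prodMk hW2.continuous)))))

lemma areaDensity_congr {W V : ℂ → ℝ} {y : ℂ} (h : W =ᶠ[𝓝 y] V) :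
    areaDensity W y = areaDensity V y := by
  simp only [areaDensity, h.fderiv_eq]

include h hχ in
/-- The area and bulk terms over the box, in stretched polar coordinates. -/
lemma gapArea_add_bulk
    (hk : Continuous k) (ht : |t| * M ≤ 1 / 2) (h0 : 0 ≤ t * χ 0) (hc : |c| < m) :
    gapArea (upperSheet u1 ζ χ c t) (lowerSheet u2 χ t) R' +
        σ * bulk k (upperSheet u1 ζ χ c t) (lowerSheet u2 χ t) R' =
      innerEnergy k σ u1 u2 R1 χ t + outerEnergy k σ u1 u2 ζ R1 R' c := by
  set W1 := upperSheet u1 ζ χ c t with hW1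
  set W2 := lowerSheet u2 χ t with hW2
  have hd1 : ContDiff ℝ 1 W1 := h.contDiff_upperSheet hχ ht h0 c
  have hd2 : ContDiff ℝ 1 W2 := h.contDiff_lowerSheet hχ ht h0
  obtain ⟨hu1, hu2⟩ := h.contDiff
  have hopen : IsOpen {y : ℂ | t * χ 0 < ‖y‖} := isOpen_lt continuous_const continuous_norm
  have hset : gapDisk W1 W2 R' = closedBall (0 : ℂ) R' ∩ {y | t * χ 0 < ‖y‖} := by
    ext y
    simp only [gapDisk, mem_inter_iff, mem_closedBall, dist_zero_right, mem_ofPred_eq]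
    refine and_congr_right fun hy => ⟨fun hlt => ?_, fun hlt =>
      h.lowerSheet_lt_upperSheet hχ ht h0 hc hlt (hy.trans_lt h.lt')⟩
    by_contra hle
    rw [hW1, hW2, h.upperSheet_of_le hχ ht (not_lt.1 hle), h.lowerSheet_of_le hχ ht (not_lt.1 hle)] at hlt
    exact lt_irrefl _ hlt
  have hbulk : bulk k W1 W2 R' = ∫ y in closedBall (0 : ℂ) R' ∩ {y | t * χ 0 < ‖y‖},
      (W1 y * vertAvg k (y, W1 y) - W2 y * vertAvg k (y, W2 y)) := by
    refine setIntegral_eq_of_subset_of_forall_sdiff_eq_zero isClosed_closedBall.measurableSet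
      inter_subset_left fun y hy => ?_
    have hle : ‖y‖ ≤ t * χ 0 := by
      by_contra hlt
      exact hy.2 ⟨hy.1, not_le.1 hlt⟩
    rw [hW1, hW2, h.upperSheet_of_le hχ ht hle, h.lowerSheet_of_le hχ ht hle]
    simp
  have hc1 := continuous_energyDensity (σ := σ) hk hd1 hd2
  have hint : ∀ {D : ℂ → ℝ}, Continuous D →
      IntegrableOn D (closedBall (0 : ℂ) R' ∩ {y | t * χ 0 < ‖y‖}) := fun hD =>
    (hD.continuousOn.integrableOn_compact (isCompact_closedBall (0 : ℂ) R')).mono_set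
      inter_subset_left
  have hcb : Continuous fun y => W1 y * vertAvg k (y, W1 y) - W2 y * vertAvg k (y, W2 y) :=
    (hd1.continuous.mul ((continuous_vertAvg hk).comp
      (continuous_id.prodMk hd1.continuous))).sub (hd2.continuous.mul ((continuous_vertAvg hk).comp
      (continuous_id.prodMk hd2.continuous)))
  rw [gapArea, hset, hbulk, ← integral_const_mul]
  refine (integral_add (hint ((continuous_areaDensity hd1).add (continuous_areaDensity hd2)))
    (hint (continuous_const.mul hcb))).symm.trans ?_
  change ∫ y in closedBall (0 : ℂ) R' ∩ {y | t * χ 0 < ‖y‖}, energyDensity k σ W1 W2 y = _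
  rw [setIntegral_annulus_split hχ ht h.lt hc1, setIntegral_annulus_eq_stretch hχ ht h0]
  congr 1
  · refine setIntegral_congr_fun (measurableSet_polarRect R1) fun x hx => ?_
    have hρ := hx.1.1
    have hr := hχ.stretch_pos ht h0 hρ.le
    have hr' := (hχ.strictMono ht) hx.1.2
    rw [hχ.stretch_of_ge t le_rfl] at hr'
    have hn : ‖stretch χ t x.1 • dir x.2‖ = stretch χ t x.1 := by
      rw [norm_smul, norm_dir, mul_one, Real.norm_of_nonneg (by linarith)]
    have hloc : W1 =ᶠ[𝓝 (stretch χ t x.1 • dir x.2)] fun z => u1 (collapse χ t z) := by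
      have : {z : ℂ | ‖z‖ < R1} ∈ 𝓝 (stretch χ t x.1 • dir x.2) :=
        (isOpen_lt continuous_norm continuous_const).mem_nhds (by rw [mem_ofPred_eq, hn]; exact hr')
      filter_upwards [this] with z hz
      rw [hW1, upperSheet, h.bump_inner z (le_of_lt hz), mul_zero, add_zero]
    have e1 := areaDensity_comp_collapse hχ ht h0 hu1 hρ
    have e2 := areaDensity_comp_collapse hχ ht h0 hu2 hρ
    have hcol := collapse_stretch hχ ht h0 hρ.le (norm_dir x.2)
    have hv1 : W1 (stretch χ t x.1 • dir x.2) = u1 (x.1 • dir x.2) := by rw [hloc.eq_of_nhds, hcol]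
    have hv2 : W2 (stretch χ t x.1 • dir x.2) = u2 (x.1 • dir x.2) := by rw [hW2, lowerSheet, hcol]
    rw [← areaDensity_congr hloc] at e1
    simp only [energyDensity, sheet, hv1, hv2]
    change _ = areaElement _ _ (stretch χ t x.1) _ + σ * (_ * stretch χ t x.1 * (_ *
      vertAvg k (stretch χ t x.1 • dir x.2, u1 (x.1 • dir x.2)))) +
      (areaElement _ _ (stretch χ t x.1) _ + -σ * (_ * stretch χ t x.1 * (_ *
      vertAvg k (stretch χ t x.1 • dir x.2, u2 (x.1 • dir x.2)))))
    rw [← e1, ← e2]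
    change (1 + t * deriv χ x.1) * (stretch χ t x.1 * (areaDensity W1 (stretch χ t x.1 • dir x.2) +
      areaDensity W2 (stretch χ t x.1 • dir x.2) + _)) = (1 + t * deriv χ x.1) *
        (stretch χ t x.1 * areaDensity W1 (stretch χ t x.1 • dir x.2)) + _ +
      ((1 + t * deriv χ x.1) * (stretch χ t x.1 * areaDensity W2 (stretch χ t x.1 • dir x.2)) + _)
    ring
  · refine setIntegral_congr_fun (isClosed_closedBall.measurableSet.diff
      isClosed_closedBall.measurableSet) fun y hy => ?_
    have hy1 : R1 < ‖y‖ := by simpa using hy.2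
    have hnhds : {z : ℂ | R1 < ‖z‖} ∈ 𝓝 y :=
      (isOpen_lt continuous_const continuous_norm).mem_nhds hy1
    refine energyDensity_congr ?_ ?_
    · filter_upwards [hnhds] with z hz
      exact upperSheet_of_ge hχ ht (le_of_lt hz)
    · filter_upwards [hnhds] with z hz
      exact lowerSheet_of_ge hχ ht (le_of_lt hz)

include h in
lemma continuous_gap : Continuous fun x : ℝ × ℝ => u1 (x.1 • dir x.2) - u2 (x.1 • dir x.2) :=
  (continuous_height h.contDiff.1).sub
    (continuous_height h.contDiff.2)

lemma integrableOn_polarRect {f : ℝ × ℝ → ℝ} (hf : Continuous f) (r : ℝ) :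
    IntegrableOn f (polarRect r) :=
  (hf.continuousOn.integrableOn_compact (isCompact_Icc.prod isCompact_Icc)).mono_set
    (prod_mono Ioo_subset_Icc_self Ioo_subset_Icc_self)

include h hχ ht h0 in
lemma bulk_one (c : ℝ) : bulk (fun _ => 1) (upperSheet u1 ζ χ c t) (lowerSheet u2 χ t) R' =
      (∫ x in polarRect R1, (u1 (x.1 • dir x.2) - u2 (x.1 • dir x.2)) * x.1) +
        volRate u1 u2 R1 χ * t + volRate2 u1 u2 R1 χ * t ^ 2 +
        (∫ y in closedBall (0 : ℂ) R' \ closedBall 0 R1, (u1 y - u2 y)) +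
        c * bumpMass ζ R1 R' := by
  have hd1 := (h.contDiff_upperSheet hχ ht h0 c).continuous
  have hd2 := (h.contDiff_lowerSheet hχ ht h0).continuous
  have hχ' : Continuous fun x : ℝ × ℝ => deriv χ x.1 :=
    (hχ.smooth.continuous_deriv (by simp)).comp continuous_fst
  have hχ0 : Continuous fun x : ℝ × ℝ => χ x.1 := hχ.smooth.continuous.comp continuous_fst
  have hbulk : bulk (fun _ => 1) (upperSheet u1 ζ χ c t) (lowerSheet u2 χ t) R' =
      ∫ y in closedBall (0 : ℂ) R' ∩ {y | t * χ 0 < ‖y‖},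
        (upperSheet u1 ζ χ c t y - lowerSheet u2 χ t y) := by
    simp only [bulk, vertAvg_one, mul_one]
    refine setIntegral_eq_of_subset_of_forall_sdiff_eq_zero isClosed_closedBall.measurableSet
      inter_subset_left fun y hy => ?_
    have hle : ‖y‖ ≤ t * χ 0 := by
      by_contra hlt
      exact hy.2 ⟨hy.1, not_le.1 hlt⟩
    rw [h.upperSheet_of_le hχ ht hle, h.lowerSheet_of_le hχ ht hle, sub_zero]
  have hinner : ∫ y in closedBall (0 : ℂ) R1 ∩ {y | t * χ 0 < ‖y‖},
      (upperSheet u1 ζ χ c t y - lowerSheet u2 χ t y) =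
      (∫ x in polarRect R1, (u1 (x.1 • dir x.2) - u2 (x.1 • dir x.2)) * x.1) +
        (volRate u1 u2 R1 χ * t + volRate2 u1 u2 R1 χ * t ^ 2) := by
    have hi0 := integrableOn_polarRect (h.continuous_gap.mul continuous_fst) R1
    have hi1 := (integrableOn_polarRect (h.continuous_gap.mul
      (hχ0.add (continuous_fst.mul hχ'))) R1).mul_const t
    have hi2 := (integrableOn_polarRect (h.continuous_gap.mul (hχ0.mul hχ')) R1).mul_const (t ^ 2)
    have e2 : (∫ x in polarRect R1, (u1 (x.1 • dir x.2) - u2 (x.1 • dir x.2)) * x.1) +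
        (volRate u1 u2 R1 χ * t + volRate2 u1 u2 R1 χ * t ^ 2) = ∫ x in polarRect R1,
          ((u1 (x.1 • dir x.2) - u2 (x.1 • dir x.2)) * x.1 +
          ((u1 (x.1 • dir x.2) - u2 (x.1 • dir x.2)) * (χ x.1 + x.1 * deriv χ x.1) * t +
          (u1 (x.1 • dir x.2) - u2 (x.1 • dir x.2)) * (χ x.1 * deriv χ x.1) * t ^ 2)) := by
      rw [volRate, volRate2, ← integral_mul_const, ← integral_mul_const]
      exact (congrArg _ (integral_add hi1 hi2).symm).trans (integral_add hi0 (hi1.add hi2)).symm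
    rw [setIntegral_annulus_eq_stretch hχ ht h0, e2]
    refine setIntegral_congr_fun (measurableSet_polarRect R1) fun x hx => ?_
    have hρ := hx.1.1
    have hr := hχ.stretch_pos ht h0 hρ.le
    have hr' := (hχ.strictMono ht) hx.1.2
    rw [hχ.stretch_of_ge t le_rfl] at hr'
    have hn : ‖stretch χ t x.1 • dir x.2‖ = stretch χ t x.1 := by
      rw [norm_smul, norm_dir, mul_one, Real.norm_of_nonneg (by linarith)]
    have hcol := collapse_stretch hχ ht h0 hρ.le (norm_dir x.2)
    simp only [upperSheet, lowerSheet, hcol, h.bump_inner _ (hn.trans_le hr'.le)]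
    rw [stretch]
    ring
  have houter : ∫ y in closedBall (0 : ℂ) R' \ closedBall 0 R1,
      (upperSheet u1 ζ χ c t y - lowerSheet u2 χ t y) =
      (∫ y in closedBall (0 : ℂ) R' \ closedBall 0 R1, (u1 y - u2 y)) +
        c * bumpMass ζ R1 R' := by
    have hio : ∀ {D : ℂ → ℝ}, Continuous D →
        IntegrableOn D (closedBall (0 : ℂ) R' \ closedBall 0 R1) := fun hD =>
      (hD.continuousOn.integrableOn_compact (isCompact_closedBall (0 : ℂ) R')).mono_set sdiff_subset
    rw [bumpMass, ← integral_const_mul]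
    refine Eq.trans ?_ (integral_add (hio (h.smooth1.continuous.sub h.smooth2.continuous))
      (hio (continuous_const.mul h.smooth_bump.continuous)))
    refine setIntegral_congr_fun (isClosed_closedBall.measurableSet.diff
      isClosed_closedBall.measurableSet) fun y hy => ?_
    have hy1 : R1 < ‖y‖ := by simpa using hy.2
    simp only [upperSheet_of_ge hχ ht hy1.le, lowerSheet_of_ge hχ ht hy1.le]
    ring
  have hsplit := setIntegral_annulus_split hχ ht h.lt (hd1.sub hd2)
  simp only [Pi.sub_apply] at hsplit
  rw [hbulk, hsplit, hinner, houter]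
  ring

include h hχ ht h0 in
/-- The corrected stretching preserves the enclosed volume. -/
lemma bulk_one_correction :
    bulk (fun _ => 1) (upperSheet u1 ζ χ (correction u1 u2 ζ R1 R' χ t) t) (lowerSheet u2 χ t) R' =
      bulk (fun _ => 1) (upperSheet u1 ζ χ 0 0) (lowerSheet u2 χ 0) R' := by
  have hm : bumpMass ζ R1 R' ≠ 0 := h.bump_mass
  rw [h.bulk_one hχ ht h0, h.bulk_one hχ (by simp) (by simp), correction, div_mul_cancel₀ _ hm]
  ring

end TwoSheets


/-! ### First and second variation of the energy of two sheets -/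

lemma two_le_infty : (2 : WithTop ℕ∞) ≤ (⊤ : ℕ∞) := WithTop.coe_le_coe.2 le_top

section Profile

/-- A smooth step equal to `1` for `ρ ≤ δ / 2` and to `0` for `ρ ≥ δ`. -/
def stepProfile (δ ρ : ℝ) : ℝ := Real.smoothTransition (2 - 2 * (ρ / δ))

variable {δ : ℝ}

lemma contDiff_stepProfile (δ : ℝ) : ContDiff ℝ ∞ (stepProfile δ) :=
  Real.smoothTransition.contDiff.comp
    (contDiff_const.sub (contDiff_const.mul (contDiff_id.div_const δ)))

lemma stepProfile_of_le (hδ : 0 < δ) {ρ : ℝ} (hρ : ρ ≤ δ / 2) : stepProfile δ ρ = 1 := by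
  refine Real.smoothTransition.one_of_one_le ?_
  have : ρ / δ ≤ 1 / 2 := by rw [div_le_iff₀ hδ]; linarith
  linarith

lemma stepProfile_of_ge (hδ : 0 < δ) {ρ : ℝ} (hρ : δ ≤ ρ) : stepProfile δ ρ = 0 := by
  refine Real.smoothTransition.zero_of_nonpos ?_
  have : 1 ≤ ρ / δ := by rwa [le_div_iff₀ hδ, one_mul]
  linarith

lemma abs_stepProfile_le (δ ρ : ℝ) : |stepProfile δ ρ| ≤ 1 := by
  rw [stepProfile, abs_of_nonneg (Real.smoothTransition.nonneg _)]
  exact Real.smoothTransition.le_one _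

lemma stepProfile_eq (δ ρ : ℝ) : stepProfile δ ρ = stepProfile 1 (ρ / δ) := by simp [stepProfile]

lemma deriv_stepProfile (δ ρ : ℝ) : deriv (stepProfile δ) ρ = deriv (stepProfile 1) (ρ / δ) / δ := by
  have h1 : HasDerivAt (stepProfile 1) (deriv (stepProfile 1) (ρ / δ)) (ρ / δ) :=
    ((contDiff_stepProfile 1).differentiable (by simp) _).hasDerivAt
  have h2 : HasDerivAt (fun ρ : ℝ => ρ / δ) (1 / δ) ρ := (hasDerivAt_id ρ).div_const δ
  have h3 : HasDerivAt (stepProfile δ) (deriv (stepProfile 1) (ρ / δ) * (1 / δ)) ρ := by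
    refine (h1.comp ρ h2).congr_of_eventuallyEq (Eventually.of_forall fun x => ?_)
    exact stepProfile_eq δ x
  rw [h3.deriv]
  ring

lemma deriv_stepProfile_of_lt (hδ : 0 < δ) {ρ : ℝ} (hρ : ρ < δ / 2) :
    deriv (stepProfile δ) ρ = 0 := by
  have : stepProfile δ =ᶠ[𝓝 ρ] fun _ => 1 := by
    filter_upwards [Iio_mem_nhds hρ] with x hx using stepProfile_of_le hδ (le_of_lt hx)
  rw [this.deriv_eq, deriv_const]

lemma deriv_stepProfile_of_gt (hδ : 0 < δ) {ρ : ℝ} (hρ : δ < ρ) : deriv (stepProfile δ) ρ = 0 := by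
  have : stepProfile δ =ᶠ[𝓝 ρ] fun _ => 0 := by
    filter_upwards [Ioi_mem_nhds hρ] with x hx using stepProfile_of_ge hδ (le_of_lt hx)
  rw [this.deriv_eq, deriv_const]

lemma exists_deriv_stepProfile_bound : ∃ L, 1 ≤ L ∧ ∀ ρ, |deriv (stepProfile 1) ρ| ≤ L := by
  have hcont : Continuous (deriv (stepProfile 1)) :=
    (contDiff_stepProfile 1).continuous_deriv (by simp)
  obtain ⟨C, hC⟩ := (isCompact_Icc (a := (0 : ℝ)) (b := 1)).exists_bound_of_continuousOn
    hcont.continuousOn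
  refine ⟨max 1 C, le_max_left _ _, fun ρ => ?_⟩
  rcases lt_or_ge ρ 0 with h | h
  · rw [deriv_stepProfile_of_lt one_pos (by linarith), abs_zero]
    exact zero_le_one.trans (le_max_left _ _)
  rcases lt_or_ge 1 ρ with h' | h'
  · rw [deriv_stepProfile_of_gt one_pos h', abs_zero]
    exact zero_le_one.trans (le_max_left _ _)
  · exact (hC ρ ⟨h, h'⟩).trans (le_max_right _ _)

lemma mul_abs_deriv_stepProfile_le {L : ℝ} (hL : ∀ ρ, |deriv (stepProfile 1) ρ| ≤ L) (hδ : 0 < δ)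
    (ρ : ℝ) : ρ * |deriv (stepProfile δ) ρ| ≤ L := by
  have hL0 : 0 ≤ L := (abs_nonneg _).trans (hL 0)
  rcases lt_or_ge δ ρ with h | h
  · rw [deriv_stepProfile_of_gt hδ h, abs_zero, mul_zero]
    exact hL0
  · rw [deriv_stepProfile, abs_div, abs_of_pos hδ, mul_div_left_comm]
    refine (mul_le_of_le_one_right (abs_nonneg _) ?_).trans (hL _)
    rwa [div_le_one hδ]

lemma isProfile_stepProfile {L R : ℝ} (hL : ∀ ρ, |deriv (stepProfile 1) ρ| ≤ L) (hδ : 0 < δ)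
    (hR : δ ≤ R) : IsProfile (stepProfile δ) R (1 + L / δ) where
  smooth := contDiff_stepProfile δ
  eq_zero ρ hρ := stepProfile_of_ge hδ (hR.trans hρ)
  const_near := ⟨δ / 2, by positivity, fun ρ hρ => by
    rw [stepProfile_of_le hδ hρ, stepProfile_of_le hδ (by positivity)]⟩
  pos := hδ.trans_le hR
  bound ρ := (abs_stepProfile_le δ ρ).trans
    (le_add_of_nonneg_right (div_nonneg ((abs_nonneg _).trans (hL 0)) hδ.le))
  deriv_bound ρ := by
    rw [deriv_stepProfile, abs_div, abs_of_pos hδ]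
    have := div_le_div_of_nonneg_right (hL (ρ / δ)) hδ.le
    linarith

lemma IsProfile.sub {χ χ' : ℝ → ℝ} {R M M' : ℝ} (h : IsProfile χ R M) (h' : IsProfile χ' R M') :
    IsProfile (fun ρ => χ ρ - χ' ρ) R (M + M') where
  smooth := h.smooth.sub h'.smooth
  eq_zero ρ hρ := by rw [h.eq_zero ρ hρ, h'.eq_zero ρ hρ, sub_zero]
  const_near := by
    obtain ⟨a, ha, ha'⟩ := h.const_near
    obtain ⟨b, hb, hb'⟩ := h'.const_near
    exact ⟨min a b, lt_min ha hb, fun ρ hρ => by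
      rw [ha' ρ (hρ.trans (min_le_left _ _)), hb' ρ (hρ.trans (min_le_right _ _))]⟩
  pos := h.pos
  bound ρ := (abs_sub _ _).trans (add_le_add (h.bound ρ) (h'.bound ρ))
  deriv_bound ρ := by
    rw [((h.hasDerivAt ρ).fun_sub (h'.hasDerivAt ρ)).deriv]
    exact (abs_sub _ _).trans (add_le_add (h.deriv_bound ρ) (h'.deriv_bound ρ))

end Profile

namespace TwoSheets

variable {k : ℂ × ℝ → ℝ} {σ : ℝ} {u1 u2 ζ : ℂ → ℝ} {R1 R' R K m M G t c : ℝ} {χ : ℝ → ℝ}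
variable (h : TwoSheets u1 u2 ζ R1 R' R K m) (hχ : IsProfile χ R1 M)

include h in
lemma contDiff_outerEnergy (hk : ContDiff ℝ 2 k) :
    ContDiff ℝ 2 (outerEnergy k σ u1 u2 ζ R1 R') := by
  have hd : ∀ {u : ℂ → ℝ}, ContDiff ℝ ∞ u → ∀ v : ℂ, ContDiff ℝ 2 fun y => fderiv ℝ u y v :=
    fun hu v => ((hu.fderiv_right (m := ∞) (by simp)).clm_apply contDiff_const).of_le two_le_infty
  have hΓ := contDiff_vertAvg 2 hk
  have hu1 : ContDiff ℝ 2 u1 := h.smooth1.of_le two_le_infty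
  have hu2 : ContDiff ℝ 2 u2 := h.smooth2.of_le two_le_infty
  have hζ : ContDiff ℝ 2 ζ := h.smooth_bump.of_le two_le_infty
  have harea : ∀ {u : ℂ → ℝ}, ContDiff ℝ ∞ u → ContDiff ℝ 2 (areaDensity u) := fun hu => by
    refine ContDiff.sqrt (((contDiff_const.add ((hd hu 1).pow 2))).add ((hd hu Complex.I).pow 2))
      fun y => ?_
    positivity
  have hK : ContDiff ℝ 2 fun z : ℝ × ℂ => energyDensity k σ (fun y => u1 y + z.1 * ζ y) u2 z.2 := by
    have hW : ContDiff ℝ 2 fun z : ℝ × ℂ => u1 z.2 + z.1 * ζ z.2 :=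
      (hu1.comp contDiff_snd).add (contDiff_fst.mul (hζ.comp contDiff_snd))
    refine ContDiff.add (ContDiff.add ?_ ((harea h.smooth2).comp contDiff_snd))
      (contDiff_const.mul ((hW.mul (hΓ.comp (contDiff_snd.prodMk hW))).sub
        ((hu2.comp contDiff_snd).mul (hΓ.comp (contDiff_snd.prodMk (hu2.comp contDiff_snd))))))
    have hfd : ∀ (z : ℝ × ℂ) (v : ℂ), fderiv ℝ (fun y => u1 y + z.1 * ζ y) z.2 v =
        fderiv ℝ u1 z.2 v + z.1 * fderiv ℝ ζ z.2 v := by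
      intro z v
      have h1 := (hu1.differentiable (by simp) z.2).hasFDerivAt
      have h2 := (hζ.differentiable (by simp) z.2).hasFDerivAt
      rw [(h1.fun_add (h2.const_mul z.1)).fderiv]
      simp
    simp only [areaDensity, hfd]
    have hl : ∀ v : ℂ, ContDiff ℝ 2 fun z : ℝ × ℂ =>
        fderiv ℝ u1 z.2 v + z.1 * fderiv ℝ ζ z.2 v := fun v =>
      ((hd h.smooth1 v).comp contDiff_snd).add
        (contDiff_fst.mul ((hd h.smooth_bump v).comp contDiff_snd))
    refine ContDiff.sqrt ((contDiff_const.add ((hl 1).pow 2)).add ((hl Complex.I).pow 2))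
      fun y => ?_
    positivity
  have heq : outerEnergy k σ u1 u2 ζ R1 R' = fun c =>
      (∫ y in closedBall (0 : ℂ) R', energyDensity k σ (fun y => u1 y + c * ζ y) u2 y) -
        ∫ y in closedBall (0 : ℂ) R1, energyDensity k σ (fun y => u1 y + c * ζ y) u2 y := by
    funext c
    refine setIntegral_sdiff isClosed_closedBall.measurableSet ?_
      (closedBall_subset_closedBall h.lt.le)
    exact (hK.continuous.comp (continuous_const.prodMk
      continuous_id)).continuousOn.integrableOn_compact (isCompact_closedBall (0 : ℂ) R')
  rw [heq]
  exact (contDiff_setIntegral_param (μ := volume) 2 hK (isCompact_closedBall (0 : ℂ) R')).sub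
    (contDiff_setIntegral_param (μ := volume) 2 hK (isCompact_closedBall (0 : ℂ) R1))

/-- The derivative of the corrected energy along the stretching `χ`. -/
def energyRate (k : ℂ × ℝ → ℝ) (σ : ℝ) (u1 u2 ζ : ℂ → ℝ) (R1 R' : ℝ) (χ : ℝ → ℝ) (t : ℝ) : ℝ :=
  (∫ x in polarRect R1, (sheet1 k u1 σ χ t x + sheet1 k u2 (-σ) χ t x)) +
    deriv (outerEnergy k σ u1 u2 ζ R1 R') (correction u1 u2 ζ R1 R' χ t) *
      (-(volRate u1 u2 R1 χ + volRate2 u1 u2 R1 χ * (2 * t)) / bumpMass ζ R1 R')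

/-- The second derivative at time `0` of the corrected energy along the stretching `χ`. -/
def energyRate2 (k : ℂ × ℝ → ℝ) (σ : ℝ) (u1 u2 ζ : ℂ → ℝ) (R1 R' : ℝ) (χ : ℝ → ℝ) : ℝ :=
  (∫ x in polarRect R1, (sheet2 k u1 σ χ 0 x + sheet2 k u2 (-σ) χ 0 x)) +
    (deriv (deriv (outerEnergy k σ u1 u2 ζ R1 R')) 0 *
        (-volRate u1 u2 R1 χ / bumpMass ζ R1 R') ^ 2 +
      deriv (outerEnergy k σ u1 u2 ζ R1 R') 0 * (-(2 * volRate2 u1 u2 R1 χ) / bumpMass ζ R1 R'))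

lemma hasDerivAt_correction (t : ℝ) : HasDerivAt (correction u1 u2 ζ R1 R' χ)
    (-(volRate u1 u2 R1 χ + volRate2 u1 u2 R1 χ * (2 * t)) / bumpMass ζ R1 R') t := by
  have h := ((((hasDerivAt_id t).const_mul (volRate u1 u2 R1 χ)).add
    (((hasDerivAt_id t).pow 2).const_mul (volRate2 u1 u2 R1 χ))).neg).div_const (bumpMass ζ R1 R')
  refine h.congr_deriv ?_
  simp

lemma isFiniteMeasure_polarRect (r : ℝ) :
    IsFiniteMeasure ((volume : Measure (ℝ × ℝ)).restrict (polarRect r)) :=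
  ⟨by rw [Measure.restrict_apply_univ]; exact volume_polarRect_lt_top r⟩

include h hχ in
lemma hasDerivWithinAt_stretchedEnergy (hk : ContDiff ℝ 2 k) (hσ : |σ| ≤ 1) (h0 : 0 ≤ χ 0) {ε : ℝ}
    (hε : 0 < ε) (hεM : ε * M ≤ 1 / 2) :
    (∀ t ∈ Ico 0 ε, HasDerivWithinAt (stretchedEnergy k σ u1 u2 ζ R1 R' χ)
      (energyRate k σ u1 u2 ζ R1 R' χ t) (Ici 0) t) ∧
    HasDerivWithinAt (energyRate k σ u1 u2 ζ R1 R' χ) (energyRate2 k σ u1 u2 ζ R1 R' χ)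
      (Ici 0) 0 := by
  obtain ⟨hu1, hu2⟩ := h.contDiff
  obtain ⟨G, hG⟩ := exists_isAvgBound hk K
  have hM := hχ.nonneg_bound
  have hσ' : |-σ| ≤ 1 := by rwa [abs_neg]
  have htM : ∀ t ∈ Ico 0 ε, |t| * M ≤ 1 / 2 := fun t ht => by
    rw [abs_of_nonneg ht.1]
    exact (mul_le_mul_of_nonneg_right ht.2.le hM).trans hεM
  have ht0 : ∀ t ∈ Ico 0 ε, 0 ≤ t * χ 0 := fun t ht => mul_nonneg ht.1 h0
  have := isFiniteMeasure_polarRect R1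
  set C1 := 2 * K ^ 2 * M + 2 * M + 3 * K * M * G with hC1
  set C2 := 2 * M ^ 2 + (24 * K ^ 2 * M ^ 2 + 64 * K ^ 2 * M ^ 2 +
      6400 * K ^ 4 * M ^ 2) + K * (9 * M ^ 2 * G) with hC2
  have hmem : ∀ᵐ x ∂((volume : Measure (ℝ × ℝ)).restrict (polarRect R1)), x ∈ polarRect R1 :=
    ae_restrict_mem (measurableSet_polarRect R1)
  obtain ⟨hI, hI1⟩ := second_right_deriv_integral
    (μ := (volume : Measure (ℝ × ℝ)).restrict (polarRect R1))
    (f := fun t x => sheet k u1 σ χ t x + sheet k u2 (-σ) χ t x)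
    (f1 := fun t x => sheet1 k u1 σ χ t x + sheet1 k u2 (-σ) χ t x)
    (f2 := fun t x => sheet2 k u1 σ χ t x + sheet2 k u2 (-σ) χ t x)
    (C := max (C1 + C1) (C2 + C2)) hε
    (by
      filter_upwards [hmem] with x hx t ht
      exact ((hasDerivAt_sheet hχ hk (htM t ht) (ht0 t ht) hx.1.1).add
        (hasDerivAt_sheet hχ hk (htM t ht) (ht0 t ht) hx.1.1)).hasDerivWithinAt)
    (by
      filter_upwards [hmem] with x hx t ht
      exact ((hasDerivAt_sheet1 hχ hk (htM t ht) (ht0 t ht) hx.1.1).add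
        (hasDerivAt_sheet1 hχ hk (htM t ht) (ht0 t ht) hx.1.1)).hasDerivWithinAt)
    (by
      filter_upwards [hmem] with x hx
      have hL' : x.1 * |deriv χ x.1| ≤ M :=
        (mul_le_of_le_one_left (abs_nonneg _) (hx.1.2.le.trans h.le_one)).trans (hχ.deriv_bound _)
      refine ((abs_add_le _ _).trans (add_le_add ?_ ?_)).trans (le_max_left _ _)
      · exact abs_sheet1_zero_le hχ h.le_one h.quad1 h.slope1 hG hσ (hχ.bound _) hL' hx
      · exact abs_sheet1_zero_le hχ h.le_one h.quad2 h.slope2 hG hσ' (hχ.bound _) hL' hx)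
    (by
      filter_upwards [hmem] with x hx t ht
      refine ((abs_add_le _ _).trans (add_le_add ?_ ?_)).trans (le_max_right _ _)
      · exact abs_sheet2_le hχ h.le_one (htM t ht) (ht0 t ht) h.quad1 h.slope1 hG hσ hx
      · exact abs_sheet2_le hχ h.le_one (htM t ht) (ht0 t ht) h.quad2 h.slope2 hG hσ' hx)
    (fun t ht => integrableOn_polarRect
      ((continuous_sheet hχ hk hu1 t).add (continuous_sheet hχ hk hu2 t)) R1)
    (fun t ht => ((measurable_sheet1 hχ hk hu1 t).add
      (measurable_sheet1 hχ hk hu2 t)).aestronglyMeasurable)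
  have hout := h.contDiff_outerEnergy (σ := σ) hk
  have hout1 : ContDiff ℝ 1 (deriv (outerEnergy k σ u1 u2 ζ R1 R')) :=
    (contDiff_succ_iff_deriv.1 (by exact_mod_cast hout)).2.2
  have hO : ∀ c, HasDerivAt (outerEnergy k σ u1 u2 ζ R1 R')
      (deriv (outerEnergy k σ u1 u2 ζ R1 R') c) c := fun c =>
    (hout.differentiable (by simp) c).hasDerivAt
  refine ⟨fun t ht => (hI t ht).add ((hO _).comp t (hasDerivAt_correction t)).hasDerivWithinAt, ?_⟩
  refine hI1.add ?_
  have hc0 : correction u1 u2 ζ R1 R' χ 0 = 0 := by simp [correction]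
  have h1 : HasDerivAt (fun t => deriv (outerEnergy k σ u1 u2 ζ R1 R')
      (correction u1 u2 ζ R1 R' χ t)) (deriv (deriv (outerEnergy k σ u1 u2 ζ R1 R')) 0 *
        (-volRate u1 u2 R1 χ / bumpMass ζ R1 R')) 0 := by
    have ha : HasDerivAt (deriv (outerEnergy k σ u1 u2 ζ R1 R'))
        (deriv (deriv (outerEnergy k σ u1 u2 ζ R1 R')) 0) (correction u1 u2 ζ R1 R' χ 0) := by
      rw [hc0]
      exact (hout1.differentiable (by simp) 0).hasDerivAt
    have hb := hasDerivAt_correction (u1 := u1) (u2 := u2) (ζ := ζ) (R1 := R1) (R' := R')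
      (χ := χ) 0
    refine (ha.comp 0 hb).congr_deriv ?_
    simp
  have h2 : HasDerivAt (fun t : ℝ =>
      -(volRate u1 u2 R1 χ + volRate2 u1 u2 R1 χ * (2 * t)) / bumpMass ζ R1 R')
      (-(2 * volRate2 u1 u2 R1 χ) / bumpMass ζ R1 R') 0 := by
    have := ((((hasDerivAt_id (0 : ℝ)).const_mul 2).const_mul
      (volRate2 u1 u2 R1 χ)).const_add (volRate u1 u2 R1 χ)).neg.div_const (bumpMass ζ R1 R')
    refine this.congr_deriv ?_
    ring
  refine ((h1.mul h2).hasDerivWithinAt).congr_deriv ?_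
  simp only [hc0, mul_zero, add_zero]
  ring

end TwoSheets


lemma inv_two_mul_mul_le {M : ℝ} (hM : 0 < M) : 1 / (2 * M) * M ≤ 1 / 2 := by
  field_simp
  rfl

namespace TwoSheets

variable {k : ℂ × ℝ → ℝ} {σ : ℝ} {u1 u2 ζ : ℂ → ℝ} {R1 R' R K m M L δ : ℝ} {χ : ℝ → ℝ}
variable (h : TwoSheets u1 u2 ζ R1 R' R K m) (hχ : IsProfile χ R1 M)

include h in
lemma abs_gap_le {x : ℝ × ℝ} (hx : 0 < x.1) :
    |u1 (x.1 • dir x.2) - u2 (x.1 • dir x.2)| ≤ 2 * K * x.1 ^ 2 := by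
  refine (abs_sub _ _).trans ((add_le_add (abs_height_le h.quad1 hx)
    (abs_height_le h.quad2 hx)).trans_eq ?_)
  ring

include h in
lemma nonneg : 0 ≤ K := by simpa using (abs_nonneg _).trans (h.quad1 1)

include h in
lemma tendsto_energyRate (hk : ContDiff ℝ 2 k) (hσ : |σ| ≤ 1)
    {χs : ℕ → ℝ → ℝ} {Ms : ℕ → ℝ} (hs : ∀ n, IsProfile (χs n) R1 (Ms n))
    (hL : ∀ n ρ, |χs n ρ| ≤ L) (hL' : ∀ n ρ, ρ * |deriv (χs n) ρ| ≤ L)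
    (hlim : ∀ ρ > 0, ∀ᶠ n in atTop, χs n ρ = χ ρ ∧ deriv (χs n) ρ = deriv χ ρ) :
    Tendsto (fun n => energyRate k σ u1 u2 ζ R1 R' (χs n) 0) atTop
      (𝓝 (energyRate k σ u1 u2 ζ R1 R' χ 0)) := by
  obtain ⟨hu1, hu2⟩ := h.contDiff
  obtain ⟨G, hG⟩ := exists_isAvgBound hk K
  have hσ' : |-σ| ≤ 1 := by rwa [abs_neg]
  have hK := h.nonneg
  have hL0 : 0 ≤ L := (abs_nonneg _).trans (hL 0 0)
  have := isFiniteMeasure_polarRect R1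
  have hmem : ∀ᵐ x ∂((volume : Measure (ℝ × ℝ)).restrict (polarRect R1)), x ∈ polarRect R1 :=
    ae_restrict_mem (measurableSet_polarRect R1)
  have hA : Tendsto (fun n => ∫ x in polarRect R1,
      (sheet1 k u1 σ (χs n) 0 x + sheet1 k u2 (-σ) (χs n) 0 x)) atTop
      (𝓝 (∫ x in polarRect R1, (sheet1 k u1 σ χ 0 x + sheet1 k u2 (-σ) χ 0 x))) := by
    refine tendsto_integral_of_dominated_convergence (fun _ =>
      (2 * K ^ 2 * L + 2 * L + 3 * K * L * G) + (2 * K ^ 2 * L + 2 * L + 3 * K * L * G))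
      (fun n => ((measurable_sheet1 (hs n) hk hu1 0).add
        (measurable_sheet1 (hs n) hk hu2 0)).aestronglyMeasurable) (integrable_const _)
      (fun n => ?_) ?_
    · filter_upwards [hmem] with x hx
      refine (abs_add_le _ _).trans (add_le_add ?_ ?_)
      · exact abs_sheet1_zero_le (hs n) h.le_one h.quad1 h.slope1 hG hσ (hL n _) (hL' n _) hx
      · exact abs_sheet1_zero_le (hs n) h.le_one h.quad2 h.slope2 hG hσ' (hL n _) (hL' n _) hx
    · filter_upwards [hmem] with x hx
      refine tendsto_const_nhds.congr' ?_
      filter_upwards [hlim x.1 hx.1.1] with n hn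
      simp only [sheet1, hn.1, hn.2]
  have hB : Tendsto (fun n => volRate u1 u2 R1 (χs n)) atTop (𝓝 (volRate u1 u2 R1 χ)) := by
    refine tendsto_integral_of_dominated_convergence (fun _ => 2 * K * (L + L))
      (fun n => ?_) (integrable_const _) (fun n => ?_) ?_
    · have hχ0 : Continuous fun x : ℝ × ℝ => χs n x.1 :=
        (hs n).smooth.continuous.comp continuous_fst
      have hχ' : Continuous fun x : ℝ × ℝ => deriv (χs n) x.1 :=
        ((hs n).smooth.continuous_deriv (by simp)).comp continuous_fst
      exact (h.continuous_gap.mul (hχ0.add (continuous_fst.mul hχ'))).aestronglyMeasurable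
    · filter_upwards [hmem] with x hx
      rw [Real.norm_eq_abs, abs_mul]
      refine mul_le_mul ?_ ?_ (abs_nonneg _) (by positivity)
      · refine (h.abs_gap_le hx.1.1).trans (mul_le_of_le_one_right (by positivity) ?_)
        exact pow_le_one₀ hx.1.1.le (hx.1.2.le.trans h.le_one)
      · refine (abs_add_le _ _).trans (add_le_add (hL n _) ?_)
        rw [abs_mul, abs_of_pos hx.1.1]
        exact hL' n _
    · filter_upwards [hmem] with x hx
      refine tendsto_const_nhds.congr' ?_
      filter_upwards [hlim x.1 hx.1.1] with n hn
      simp only [hn.1, hn.2]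
  have hc0 : ∀ χ, correction u1 u2 ζ R1 R' χ 0 = 0 := fun χ => by simp [correction]
  simp only [energyRate, hc0, mul_zero, add_zero]
  exact hA.add (tendsto_const_nhds.mul (hB.neg.div_const _))

include h in
/-- If the energy is stationary along stretchings that fix a neighbourhood of the origin, it is
stationary also along step profiles. -/
lemma energyRate_stepProfile_eq_zero (hk : ContDiff ℝ 2 k) (hσ : |σ| ≤ 1)
    (hstat : ∀ χ M, IsProfile χ R1 M → χ 0 = 0 →
      HasDerivWithinAt (stretchedEnergy k σ u1 u2 ζ R1 R' χ) 0 (Ici 0) 0)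
    (hδ : 0 < δ) (hδR : δ ≤ R1) : energyRate k σ u1 u2 ζ R1 R' (stepProfile δ) 0 = 0 := by
  obtain ⟨L, hL1, hL⟩ := exists_deriv_stepProfile_bound
  have hpos : ∀ n : ℕ, 0 < δ / (n + 1) := fun n => by positivity
  have hle : ∀ n : ℕ, δ / (n + 1) ≤ δ := fun n =>
    div_le_self hδ.le (le_add_of_nonneg_left (Nat.cast_nonneg n))
  have hs : ∀ n : ℕ, IsProfile (fun ρ => stepProfile δ ρ - stepProfile (δ / (n + 1)) ρ) R1
      ((1 + L / δ) + (1 + L / (δ / (n + 1)))) := fun n =>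
    (isProfile_stepProfile hL hδ hδR).sub (isProfile_stepProfile hL (hpos n) ((hle n).trans hδR))
  have hderiv : ∀ (n : ℕ) ρ, deriv (fun ρ => stepProfile δ ρ - stepProfile (δ / (n + 1)) ρ) ρ =
      deriv (stepProfile δ) ρ - deriv (stepProfile (δ / (n + 1))) ρ := fun n ρ =>
    deriv_fun_sub ((contDiff_stepProfile _).differentiable (by simp) ρ)
      ((contDiff_stepProfile _).differentiable (by simp) ρ)
  have hT := h.tendsto_energyRate (L := L + L) (χ := stepProfile δ) hk hσ hs
    (fun n ρ => (abs_sub _ _).trans (add_le_add ((abs_stepProfile_le _ _).trans hL1)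
      ((abs_stepProfile_le _ _).trans hL1)))
    (fun n ρ => by
      rw [hderiv]
      rcases le_total 0 ρ with hρ | hρ
      · refine (mul_le_mul_of_nonneg_left (abs_sub _ _) hρ).trans ?_
        rw [mul_add]
        exact add_le_add (mul_abs_deriv_stepProfile_le hL hδ ρ)
          (mul_abs_deriv_stepProfile_le hL (hpos n) ρ)
      · exact (mul_nonpos_of_nonpos_of_nonneg hρ (abs_nonneg _)).trans (by linarith))
    (fun ρ hρ => by
      have hlim : Tendsto (fun n : ℕ => δ / ((n : ℝ) + 1)) atTop (𝓝 0) :=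
        tendsto_const_nhds.div_atTop (tendsto_atTop_add_const_right _ _ tendsto_natCast_atTop_atTop)
      filter_upwards [hlim.eventually_lt_const hρ] with n hn
      rw [hderiv, stepProfile_of_ge (hpos n) hn.le, deriv_stepProfile_of_gt (hpos n) hn]
      simp)
  refine tendsto_nhds_unique hT (tendsto_const_nhds.congr fun n => ?_)
  set χ := fun ρ => stepProfile δ ρ - stepProfile (δ / (n + 1)) ρ with hχ
  have h0 : χ 0 = 0 := by
    have e1 := stepProfile_of_le hδ (ρ := 0) (by positivity)
    have e2 := stepProfile_of_le (hpos n) (ρ := 0) (by have := hpos n; positivity)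
    simp only [hχ, e1, e2, sub_self]
  set M := (1 + L / δ) + (1 + L / (δ / (n + 1))) with hM
  have hMpos : 0 < M := by
    have := hpos n
    have : 0 < L := by linarith
    positivity
  have h1 := (h.hasDerivWithinAt_stretchedEnergy (M := M) (hs n) hk hσ h0.ge (ε := 1 / (2 * M))
    (by positivity) (inv_two_mul_mul_le hMpos)).1 0 ⟨le_rfl, by positivity⟩
  exact (uniqueDiffWithinAt_Ici (0 : ℝ)).eq_deriv _ (hstat χ M (hs n) h0) h1

include hχ in
lemma integral_profile_mul_deriv (h1 : χ 0 = 1) :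
    ∫ x in polarRect R1, 2 * (χ x.1 * deriv χ x.1) = -(2 * Real.pi) := by
  have hp := setIntegral_prod_mul (μ := (volume : Measure ℝ)) (ν := (volume : Measure ℝ))
    (fun ρ => 2 * (χ ρ * deriv χ ρ)) (fun _ => (1 : ℝ)) (Ioo 0 R1) (Ioo (-Real.pi) Real.pi)
  simp only [mul_one, ← Measure.volume_eq_prod] at hp
  rw [polarRect, hp]
  have hd : ∀ ρ ∈ uIcc 0 R1, HasDerivAt (fun ρ => χ ρ ^ 2) (2 * (χ ρ * deriv χ ρ)) ρ := by
    intro ρ _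
    refine ((hχ.hasDerivAt ρ).pow 2).congr_deriv ?_
    simp
    ring
  have hi := intervalIntegral.integral_eq_sub_of_hasDerivAt hd
    ((continuous_const.mul (hχ.smooth.continuous.mul
      (hχ.smooth.continuous_deriv (by simp)))).intervalIntegrable _ _)
  rw [intervalIntegral.integral_of_le hχ.pos.le, integral_Ioc_eq_integral_Ioo, h1,
    hχ.eq_zero _ le_rfl] at hi
  rw [hi]
  simp [Real.pi_pos.le]
  ring

lemma abs_setIntegral_polarRect_le {f : ℝ × ℝ → ℝ} {C r : ℝ} (hf : ∀ x ∈ polarRect r, |f x| ≤ C) :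
    |∫ x in polarRect r, f x| ≤ C * volume.real (polarRect r) := by
  rw [← Real.norm_eq_abs]
  exact norm_setIntegral_le_of_norm_le_const (volume_polarRect_lt_top r) hf

include h in
/-- The second variation along a step profile of small width is close to `-4π`. -/
lemma exists_abs_energyRate2_le (hk : ContDiff ℝ 2 k) (hσ : |σ| ≤ 1) : ∃ C, ∀ δ, 0 < δ → δ ≤ R1 →
      |energyRate2 k σ u1 u2 ζ R1 R' (stepProfile δ) + 4 * Real.pi| ≤ C * δ := by
  obtain ⟨L, hL1, hL⟩ := exists_deriv_stepProfile_bound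
  obtain ⟨G, hG⟩ := exists_isAvgBound hk K
  have hσ' : |-σ| ≤ 1 := by rwa [abs_neg]
  have hK := h.nonneg
  obtain ⟨hu1, hu2⟩ := h.contDiff
  have := isFiniteMeasure_polarRect R1
  set V := volume.real (polarRect R1) with hV
  have hV0 : 0 ≤ V := measureReal_nonneg
  set B := 4 * K ^ 2 * L ^ 2 + 4 * K ^ 4 * L ^ 2 + 7 * K * L ^ 2 * G with hB
  set O1 := deriv (outerEnergy k σ u1 u2 ζ R1 R') 0
  set O2 := deriv (deriv (outerEnergy k σ u1 u2 ζ R1 R')) 0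
  set z := bumpMass ζ R1 R'
  set A := 2 * K * (L + L) * V with hA
  have hG0 : 0 ≤ G := (abs_nonneg _).trans (hG (0, 0, 0)
    ⟨⟨le_rfl, zero_le_one⟩, ⟨by simp [Real.pi_pos.le], Real.pi_pos.le⟩, ⟨by simpa using hK, hK⟩⟩).1
  have hL0 : 0 ≤ L := by linarith
  have hB0 : 0 ≤ B := by positivity
  have hA0 : 0 ≤ A := by positivity
  refine ⟨(B + B) * V + (|O2| * (A / |z|) ^ 2 + |O1| * (2 * A / |z|)), fun δ hδ hδR => ?_⟩
  have hδ1 : δ ≤ 1 := hδR.trans h.le_one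
  set χ := stepProfile δ with hχdef
  have hχ : IsProfile χ R1 (1 + L / δ) := isProfile_stepProfile hL hδ hδR
  have h1 : χ 0 = 1 := stepProfile_of_le hδ (by positivity)
  have hbd : ∀ ρ, |χ ρ| ≤ L := fun ρ => (abs_stepProfile_le δ ρ).trans hL1
  have hbd' : ∀ ρ, ρ * |deriv χ ρ| ≤ L := fun ρ => mul_abs_deriv_stepProfile_le hL hδ ρ
  have hvan : ∀ ρ, δ < ρ → χ ρ = 0 ∧ deriv χ ρ = 0 := fun ρ hρ =>
    ⟨stepProfile_of_ge hδ hρ.le, deriv_stepProfile_of_gt hδ hρ⟩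
  have hcχ : Continuous fun x : ℝ × ℝ => 2 * (χ x.1 * deriv χ x.1) :=
    continuous_const.mul ((hχ.smooth.continuous.comp continuous_fst).mul
      ((hχ.smooth.continuous_deriv (by simp)).comp continuous_fst))
  have hone : ∀ (u : ℂ → ℝ) (τ : ℝ), ContDiff ℝ 1 u → (∀ y, |u y| ≤ K * ‖y‖ ^ 2) →
      (∀ y, ‖fderiv ℝ u y‖ ≤ K * ‖y‖) → |τ| ≤ 1 →
      IntegrableOn (sheet2 k u τ χ 0) (polarRect R1) ∧
      |(∫ x in polarRect R1, sheet2 k u τ χ 0 x) + 2 * Real.pi| ≤ B * δ * V := by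
    intro u τ hu hu0 huK hτ
    have hI : IntegrableOn (sheet2 k u τ χ 0) (polarRect R1) := by
      refine Integrable.of_bound (measurable_sheet2 hχ hk hu 0).aestronglyMeasurable
        (2 * (1 + L / δ) ^ 2 + (24 * K ^ 2 * (1 + L / δ) ^ 2 + 64 * K ^ 2 * (1 + L / δ) ^ 2 +
          6400 * K ^ 4 * (1 + L / δ) ^ 2) + K * (9 * (1 + L / δ) ^ 2 * G)) ?_
      filter_upwards [ae_restrict_mem (measurableSet_polarRect R1)] with x hx
      exact abs_sheet2_le hχ h.le_one (by simp) (by simp) hu0 huK hG hτ hx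
    refine ⟨hI, ?_⟩
    rw [← sub_neg_eq_add, ← integral_profile_mul_deriv hχ h1,
      ← integral_sub hI (integrableOn_polarRect hcχ R1)]
    refine abs_setIntegral_polarRect_le fun x hx => ?_
    rcases le_or_gt x.1 δ with hx' | hx'
    · exact (abs_sheet2_zero_le hχ h.le_one hu0 huK hG hτ (hbd _) (hbd' _) hx).trans
        (mul_le_mul_of_nonneg_left hx' hB0)
    · rw [sheet2_zero_of_eq_zero (hvan _ hx').1 (hvan _ hx').2, (hvan _ hx').1]
      simpa using mul_nonneg hB0 hδ.le
  have hα : |volRate u1 u2 R1 χ| ≤ A * δ := by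
    have : ∀ x ∈ polarRect R1, |(u1 (x.1 • dir x.2) - u2 (x.1 • dir x.2)) *
        (χ x.1 + x.1 * deriv χ x.1)| ≤ 2 * K * δ * (L + L) := by
      intro x hx
      rcases le_or_gt x.1 δ with hx' | hx'
      · rw [abs_mul]
        refine mul_le_mul ?_ ?_ (abs_nonneg _) (by positivity)
        · refine (h.abs_gap_le hx.1.1).trans ?_
          have : x.1 ^ 2 ≤ δ := by nlinarith [hx.1.1]
          gcongr
        · refine (abs_add_le _ _).trans (add_le_add (hbd _) ?_)
          rw [abs_mul, abs_of_pos hx.1.1]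
          exact hbd' _
      · rw [(hvan _ hx').1, (hvan _ hx').2]
        simp
        positivity
    refine (abs_setIntegral_polarRect_le this).trans_eq ?_
    rw [hA]
    ring
  have hβ : |volRate2 u1 u2 R1 χ| ≤ A * δ := by
    have : ∀ x ∈ polarRect R1, |(u1 (x.1 • dir x.2) - u2 (x.1 • dir x.2)) *
        (χ x.1 * deriv χ x.1)| ≤ 2 * K * δ * (L + L) := by
      intro x hx
      rcases le_or_gt x.1 δ with hx' | hx'
      · rw [abs_mul, abs_mul]
        have e1 := h.abs_gap_le hx.1.1
        calc |u1 (x.1 • dir x.2) - u2 (x.1 • dir x.2)| * (|χ x.1| * |deriv χ x.1|)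
            ≤ 2 * K * x.1 ^ 2 * (1 * |deriv χ x.1|) := by
              gcongr
              exact abs_stepProfile_le δ _
          _ = 2 * K * x.1 * (x.1 * |deriv χ x.1|) := by ring
          _ ≤ 2 * K * δ * (L + L) := by
              have := hx.1.1
              gcongr
              exact (hbd' _).trans (by linarith)
      · rw [(hvan _ hx').1, (hvan _ hx').2]
        simp
        positivity
    refine (abs_setIntegral_polarRect_le this).trans_eq ?_
    rw [hA]
    ring
  obtain ⟨i1, b1⟩ := hone u1 σ hu1 h.quad1 h.slope1 hσ
  obtain ⟨i2, b2⟩ := hone u2 (-σ) hu2 h.quad2 h.slope2 hσ'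
  have b3 : |O2 * (-volRate u1 u2 R1 χ / z) ^ 2| ≤ |O2| * (A / |z|) ^ 2 * δ := by
    rw [abs_mul, abs_pow, abs_div, abs_neg, mul_assoc]
    refine mul_le_mul_of_nonneg_left ?_ (abs_nonneg _)
    calc (|volRate u1 u2 R1 χ| / |z|) ^ 2 ≤ (A * δ / |z|) ^ 2 := by gcongr
      _ = (A / |z|) ^ 2 * (δ * δ) := by ring
      _ ≤ (A / |z|) ^ 2 * (1 * δ) := by gcongr
      _ = _ := by ring
  have b4 : |O1 * (-(2 * volRate2 u1 u2 R1 χ) / z)| ≤ |O1| * (2 * A / |z|) * δ := by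
    rw [abs_mul, abs_div, abs_neg, abs_mul, abs_two, mul_assoc]
    refine mul_le_mul_of_nonneg_left ?_ (abs_nonneg _)
    calc 2 * |volRate2 u1 u2 R1 χ| / |z| ≤ 2 * (A * δ) / |z| := by gcongr
      _ = _ := by ring
  rw [energyRate2, integral_add i1 i2]
  have e : ∀ a b c d : ℝ, a + b + (c + d) + 4 * Real.pi =
      (a + 2 * Real.pi) + (b + 2 * Real.pi) + (c + d) := fun a b c d => by ring
  rw [e]
  refine ((abs_add_le _ _).trans (add_le_add ((abs_add_le _ _).trans (add_le_add b1 b2))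
    ((abs_add_le _ _).trans (add_le_add b3 b4)))).trans_eq ?_
  ring

include h in
/-- There are step profiles along which the energy is stationary, with second variation as close
to `-4π` as desired. -/
theorem exists_profile (hk : ContDiff ℝ 2 k) (hσ : |σ| ≤ 1)
    (hstat : ∀ χ M, IsProfile χ R1 M → χ 0 = 0 →
      HasDerivWithinAt (stretchedEnergy k σ u1 u2 ζ R1 R' χ) 0 (Ici 0) 0)
    {η : ℝ} (hη : 0 < η) : ∃ χ M, IsProfile χ R1 M ∧ χ 0 = 1 ∧
      HasDerivWithinAt (stretchedEnergy k σ u1 u2 ζ R1 R' χ) 0 (Ici 0) 0 ∧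
      ∃ d, HasSecondRightDeriv (stretchedEnergy k σ u1 u2 ζ R1 R' χ) d ∧
        |d + 4 * Real.pi| < η := by
  obtain ⟨C, hC⟩ := h.exists_abs_energyRate2_le (σ := σ) hk hσ
  obtain ⟨L, hL1, hL⟩ := exists_deriv_stepProfile_bound
  set δ := min R1 (η / (2 * (|C| + 1))) with hδdef
  have hδ : 0 < δ := lt_min h.pos (by positivity)
  have hδR : δ ≤ R1 := min_le_left _ _
  have hχ : IsProfile (stepProfile δ) R1 (1 + L / δ) := isProfile_stepProfile hL hδ hδR
  have h1 : stepProfile δ 0 = 1 := stepProfile_of_le hδ (by positivity)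
  set M := 1 + L / δ with hM
  have hMpos : 0 < M := by
    have : 0 < L := by linarith
    positivity
  have hε : 0 < 1 / (2 * M) := by positivity
  obtain ⟨d1, d2⟩ := h.hasDerivWithinAt_stretchedEnergy hχ hk hσ (h1.symm ▸ zero_le_one)
    (ε := 1 / (2 * M)) hε (inv_two_mul_mul_le hMpos)
  have h0 := h.energyRate_stepProfile_eq_zero hk hσ hstat hδ hδR
  refine ⟨stepProfile δ, M, hχ, h1, ?_, energyRate2 k σ u1 u2 ζ R1 R' (stepProfile δ),
    ⟨energyRate k σ u1 u2 ζ R1 R' (stepProfile δ), ?_, d2⟩, ?_⟩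
  · have := d1 0 ⟨le_rfl, hε⟩
    rwa [h0] at this
  · filter_upwards [Ico_mem_nhdsGE hε] with t ht using d1 t ht
  · have hle : C * δ ≤ (|C| + 1) * (η / (2 * (|C| + 1))) := by
      have h2 : δ ≤ η / (2 * (|C| + 1)) := min_le_right _ _
      have h3 : C ≤ |C| + 1 := (le_abs_self C).trans (by linarith)
      gcongr
    have he : (|C| + 1) * (η / (2 * (|C| + 1))) = η / 2 := by
      have : |C| + 1 ≠ 0 := by positivity
      field_simp
    linarith [hC δ hδ hδR]

end TwoSheets


/-! ### Reparametrization of an embedded disk as a graph over its tangent plane -/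

section Extension

variable {F : Type*} [NormedAddCommGroup F] [NormedSpace ℝ F]

/-- A map vanishing to second order at `0` coincides near `0` with a globally defined smooth map
of small derivative. -/
lemma exists_small_extension {q : ℂ → F} (hq : ∀ᶠ y in 𝓝 0, ContDiffAt ℝ ∞ q y) (h0 : q 0 = 0)
    (h1 : fderiv ℝ q 0 = 0) {c : ℝ} (hc : 0 < c) :
    ∃ (e : ℂ → F) (s K : ℝ), 0 < s ∧ ContDiff ℝ ∞ e ∧ (∀ y, ‖y‖ < s → e y = q y) ∧
      (∀ y, ‖fderiv ℝ e y‖ ≤ c) ∧ (∀ y, ‖fderiv ℝ e y‖ ≤ K * ‖y‖) ∧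
      ∀ y, ‖e y‖ ≤ K * ‖y‖ ^ 2 := by
  obtain ⟨r1, hr1, hq1⟩ := Metric.eventually_nhds_iff_ball.1 hq
  have hq0 : ContDiffAt ℝ 1 (fderiv ℝ q) 0 :=
    (hq1 0 (mem_ball_self hr1)).fderiv_right (m := 1) two_le_infty
  obtain ⟨C, T, hT, hlip⟩ := hq0.exists_lipschitzOnWith
  obtain ⟨r2, hr2, hT'⟩ := Metric.mem_nhds_iff.1 hT
  set r := min r1 r2 with hr
  have hr0 : 0 < r := lt_min hr1 hr2
  have hqr : ∀ y, ‖y‖ < r → ContDiffAt ℝ ∞ q y := fun y hy =>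
    hq1 y (by simpa using hy.trans_le (min_le_left _ _))
  have hd : ∀ y, ‖y‖ < r → ‖fderiv ℝ q y‖ ≤ C * ‖y‖ := fun y hy => by
    have := hlip.dist_le_mul y (hT' (by simpa using hy.trans_le (min_le_right _ _))) 0
      (hT' (mem_ball_self hr2))
    simpa [h1] using this
  have hv : ∀ y, ‖y‖ < r → ‖q y‖ ≤ C * ‖y‖ ^ 2 := fun y hy => by
    have := (convex_closedBall (0 : ℂ) ‖y‖).norm_image_sub_le_of_norm_fderiv_le (𝕜 := ℝ) (f := q)
      (C := C * ‖y‖) (x := 0) (y := y)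
      (fun z hz => (hqr z (lt_of_le_of_lt (by simpa using hz) hy)).differentiableAt (by simp))
      (fun z hz => (hd z (lt_of_le_of_lt (by simpa using hz) hy)).trans
        (mul_le_mul_of_nonneg_left (by simpa using hz) C.2))
      (by simp) (by simp)
    rw [h0, sub_zero, sub_zero] at this
    rwa [pow_two, ← mul_assoc]
  let f : ContDiffBump (0 : ℂ) := ⟨1, 2, one_pos, one_lt_two⟩
  have hf : ContDiff ℝ ∞ f := f.contDiff
  obtain ⟨B, hB⟩ := (f.hasCompactSupport.fderiv ℝ).exists_bound_of_continuous
    (hf.continuous_fderiv (by simp))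
  have hB0 : 0 ≤ B := (norm_nonneg _).trans (hB 0)
  set K := (1 + 2 * B) * C with hK
  have hK0 : 0 ≤ K := by positivity
  set s := min (r / 4) (c / (2 * (K + 1))) with hs
  have hs0 : 0 < s := lt_min (by positivity) (by positivity)
  have hsr : 2 * s < r := by linarith [min_le_left (r / 4) (c / (2 * (K + 1)))]
  set κ : ℂ → ℝ := fun y => f (s⁻¹ • y) with hκ
  have hκs : ContDiff ℝ ∞ κ := hf.comp (contDiff_const_smul s⁻¹)
  have hκ1 : ∀ y, ‖y‖ ≤ s → κ y = 1 := fun y hy => by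
    refine f.one_of_mem_closedBall ?_
    rw [mem_closedBall_zero_iff, norm_smul, norm_inv, Real.norm_of_nonneg hs0.le,
      inv_mul_le_iff₀ hs0]
    change ‖y‖ ≤ s * 1
    simpa using hy
  have hκ0 : ∀ y, 2 * s ≤ ‖y‖ → κ y = 0 := fun y hy => by
    refine f.zero_of_le_dist ?_
    rw [dist_zero_right, norm_smul, norm_inv, Real.norm_of_nonneg hs0.le, le_inv_mul_iff₀ hs0]
    change s * 2 ≤ ‖y‖
    linarith
  have hκb : ∀ y, ‖κ y‖ ≤ 1 := fun y => by
    rw [Real.norm_of_nonneg f.nonneg]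
    exact f.le_one
  have hκd : ∀ y, ‖fderiv ℝ κ y‖ ≤ B / s := fun y => by
    have h2 : HasFDerivAt κ ((fderiv ℝ f (s⁻¹ • y)).comp
        (s⁻¹ • ContinuousLinearMap.id ℝ ℂ)) y :=
      (hf.differentiable (by simp) _).hasFDerivAt.comp y ((hasFDerivAt_id y).const_smul s⁻¹)
    rw [h2.fderiv, ContinuousLinearMap.comp_smul, norm_smul, ContinuousLinearMap.comp_id, norm_inv,
      Real.norm_of_nonneg hs0.le, div_eq_inv_mul]
    exact mul_le_mul_of_nonneg_left (hB _) (by positivity)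
  have hfar : ∀ y, 2 * s < ‖y‖ → (fun y => κ y • q y) =ᶠ[𝓝 y] fun _ => 0 := fun y hy => by
    have : {z : ℂ | 2 * s < ‖z‖} ∈ 𝓝 y := (isOpen_lt continuous_const continuous_norm).mem_nhds hy
    filter_upwards [this] with z hz
    rw [hκ0 z (le_of_lt hz), zero_smul]
  have hfd : ∀ y, ‖fderiv ℝ (fun y => κ y • q y) y‖ ≤ K * ‖y‖ ∧
      (2 * s < ‖y‖ → fderiv ℝ (fun y => κ y • q y) y = 0) := by
    intro y
    have hz : 2 * s < ‖y‖ → fderiv ℝ (fun y => κ y • q y) y = 0 := fun hy => by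
      rw [(hfar y hy).fderiv_eq]
      simp
    refine ⟨?_, hz⟩
    rcases lt_or_ge (2 * s) ‖y‖ with hy | hy
    · rw [hz hy, norm_zero]
      positivity
    · have hyr : ‖y‖ < r := hy.trans_lt hsr
      have e1 := (hκs.differentiable (by simp) y).hasFDerivAt
      have e2 := ((hqr y hyr).differentiableAt (by simp)).hasFDerivAt
      rw [(e1.fun_smul e2).fderiv]
      refine (norm_add_le _ _).trans ?_
      rw [norm_smul, ContinuousLinearMap.norm_smulRight_apply]
      have b1 : ‖κ y‖ * ‖fderiv ℝ q y‖ ≤ 1 * (C * ‖y‖) :=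
        mul_le_mul (hκb y) (hd y hyr) (norm_nonneg _) zero_le_one
      have b2 : ‖fderiv ℝ κ y‖ * ‖q y‖ ≤ B / s * (C * ‖y‖ ^ 2) :=
        mul_le_mul (hκd y) (hv y hyr) (norm_nonneg _) (by positivity)
      have b3 : B / s * (C * ‖y‖ ^ 2) ≤ B / s * (C * (‖y‖ * (2 * s))) := by
        rw [pow_two]
        gcongr
      have b4 : B / s * (C * (‖y‖ * (2 * s))) = 2 * B * C * ‖y‖ := by field_simp
      rw [hK]
      linarith
  refine ⟨fun y => κ y • q y, s, K, hs0, ?_, fun y hy => by simp [hκ1 y hy.le], fun y => ?_,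
    fun y => (hfd y).1, fun y => ?_⟩
  · rw [contDiff_iff_contDiffAt]
    intro y
    rcases lt_or_ge (2 * s) ‖y‖ with hy | hy
    · exact contDiffAt_const.congr_of_eventuallyEq (hfar y hy)
    · exact hκs.contDiffAt.smul (hqr y (hy.trans_lt hsr))
  · rcases lt_or_ge (2 * s) ‖y‖ with hy | hy
    · rw [(hfd y).2 hy, norm_zero]
      exact hc.le
    · refine (hfd y).1.trans ?_
      have e1 : s ≤ c / (2 * (K + 1)) := min_le_right _ _
      rw [le_div_iff₀ (by positivity)] at e1
      nlinarith
  · rcases lt_or_ge ‖y‖ (2 * s) with hy | hy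
    · rw [norm_smul]
      have : (C : ℝ) ≤ K := by
        rw [hK]
        nlinarith [C.2, mul_nonneg hB0 C.2]
      calc ‖κ y‖ * ‖q y‖ ≤ 1 * (C * ‖y‖ ^ 2) :=
            mul_le_mul (hκb y) (hv y (hy.trans hsr)) (norm_nonneg _) zero_le_one
        _ ≤ K * ‖y‖ ^ 2 := by rw [one_mul]; gcongr
    · change ‖κ y • q y‖ ≤ _
      rw [hκ0 y hy, zero_smul, norm_zero]
      positivity

/-- The identity plus a contraction is a homeomorphism. -/
lemma exists_homeomorph_id_add {E : Type*} [NormedAddCommGroup E] [NormedSpace ℝ E]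
    [CompleteSpace E] [Nontrivial E] {e : E → E} (hd : Differentiable ℝ e)
    (hb : ∀ y, ‖fderiv ℝ e y‖ ≤ 1 / 2) :
    (∃ k : E ≃ₜ E, ∀ y, k y = y + e y) ∧
      ∀ y, Function.Injective (fderiv ℝ (fun y => y + e y) y) := by
  have hlip : ∀ x y, ‖e x - e y‖ ≤ 1 / 2 * ‖x - y‖ := fun x y =>
    convex_univ.norm_image_sub_le_of_norm_fderiv_le (𝕜 := ℝ) (fun z _ => hd z)
      (fun z _ => hb z) (mem_univ y) (mem_univ x)
  constructor
  · have happ : ApproximatesLinearOn (fun y => y + e y)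
        ((ContinuousLinearEquiv.refl ℝ E : E ≃L[ℝ] E) : E →L[ℝ] E) univ (1 / 2) := by
      intro x _ y _
      have : x + e x - (y + e y) - (x - y) = e x - e y := by abel
      simpa [this] using hlip x y
    have hN : (1 / 2 : NNReal) < ‖((ContinuousLinearEquiv.refl ℝ E).symm : E →L[ℝ] E)‖₊⁻¹ := by
      have : ‖((ContinuousLinearEquiv.refl ℝ E).symm : E →L[ℝ] E)‖₊ = 1 := by
        ext
        exact ContinuousLinearMap.norm_id
      rw [this, inv_one]
      exact NNReal.half_lt_self one_ne_zero
    exact ⟨happ.toHomeomorph _ (Or.inr hN), fun y => rfl⟩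
  · intro y
    have h1 : HasFDerivAt (fun y => y + e y) (ContinuousLinearMap.id ℝ E + fderiv ℝ e y) y :=
      (hasFDerivAt_id y).fun_add (hd y).hasFDerivAt
    rw [h1.fderiv, injective_iff_map_eq_zero]
    intro v hv
    have h2 : ‖v‖ ≤ 1 / 2 * ‖v‖ := by
      have : v = -(fderiv ℝ e y v) := eq_neg_of_add_eq_zero_left (by simpa using hv)
      calc ‖v‖ = ‖fderiv ℝ e y v‖ := by conv_lhs => rw [this, norm_neg]
        _ ≤ ‖fderiv ℝ e y‖ * ‖v‖ := (fderiv ℝ e y).le_opNorm v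
        _ ≤ 1 / 2 * ‖v‖ := mul_le_mul_of_nonneg_right (hb y) (norm_nonneg _)
    exact norm_le_zero_iff.1 (by linarith)

/-- Smooth local inverse of a map tangent to the identity at `0`. -/
lemma exists_smooth_local_inverse {Q : ℂ → ℂ} (hQ : ContDiff ℝ ∞ Q) (h0 : Q 0 = 0)
    (h1 : HasFDerivAt Q (ContinuousLinearMap.id ℝ ℂ) 0) :
    ∃ q : ℂ → ℂ, (∀ᶠ y in 𝓝 0, ContDiffAt ℝ ∞ q y) ∧ q 0 = 0 ∧
      HasFDerivAt q (ContinuousLinearMap.id ℝ ℂ) 0 ∧ ∀ᶠ y in 𝓝 0, Q (q y) = y := by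
  have h1' : HasFDerivAt Q ((ContinuousLinearEquiv.refl ℝ ℂ : ℂ ≃L[ℝ] ℂ) : ℂ →L[ℝ] ℂ) 0 := h1
  let f := hQ.contDiffAt.toOpenPartialHomeomorph Q h1' (by simp)
  have hf : (f : ℂ → ℂ) = Q := rfl
  have hs : (0 : ℂ) ∈ f.source := hQ.contDiffAt.mem_toOpenPartialHomeomorph_source h1' (by simp)
  have ht : (0 : ℂ) ∈ f.target := by
    have := f.map_source hs
    rwa [hf, h0] at this
  have hq0 : f.symm 0 = 0 := by
    have := f.left_inv hs
    rwa [hf, h0] at this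
  have hcont : ContinuousAt f.symm 0 := f.continuousAt_symm ht
  have hequiv : ∀ᶠ y in 𝓝 (0 : ℂ), fderiv ℝ Q (f.symm y) ∈
      range ((↑) : (ℂ ≃L[ℝ] ℂ) → ℂ →L[ℝ] ℂ) := by
    have hc2 : ContinuousAt (fun y => fderiv ℝ Q (f.symm y)) 0 :=
      ((hQ.continuous_fderiv (by simp)).continuousAt).comp hcont
    refine hc2.eventually ?_
    beta_reduce
    rw [hq0, h1'.fderiv]
    exact ContinuousLinearEquiv.nhds (ContinuousLinearEquiv.refl ℝ ℂ)
  refine ⟨f.symm, ?_, hq0, ?_, ?_⟩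
  · filter_upwards [hequiv, f.open_target.mem_nhds ht] with y ⟨L, hL⟩ hy
    refine f.contDiffAt_symm (f₀' := L) hy ?_ hQ.contDiffAt
    rw [hL]
    exact (hQ.differentiable (by simp) _).hasFDerivAt
  · have := f.hasFDerivAt_symm (f' := ContinuousLinearEquiv.refl ℝ ℂ) ht (by rw [hq0]; exact h1')
    exact this
  · filter_upwards [f.open_target.mem_nhds ht] with y hy
    exact f.right_inv hy

end Extension


lemma exists_frame {P : Submodule ℝ R3} (hP : Module.finrank ℝ P = 2) :
    ∃ b : Frame, b 0 ∈ P ∧ b 1 ∈ P ∧ b 2 ∈ Pᗮ := by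
  let e : OrthonormalBasis (Fin 2) ℝ P := (stdOrthonormalBasis ℝ P).reindex (finCongr hP)
  let v : Fin 3 → R3 := ![(e 0 : R3), (e 1 : R3), 0]
  have hv : Orthonormal ℝ (({0, 1} : Set (Fin 3)).domRestrict v) := by
    have he : ∀ i j, inner ℝ (e i : R3) (e j : R3) = if i = j then 1 else 0 := fun i j =>
      (orthonormal_iff_ite.1 e.orthonormal) i j
    rw [orthonormal_iff_ite]
    rintro ⟨i, hi⟩ ⟨j, hj⟩
    rcases hi with rfl | rfl <;> rcases hj with rfl | rfl
    · simpa [v] using he 0 0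
    · simpa [v, Subtype.ext_iff] using he 0 1
    · simpa [v, Subtype.ext_iff] using he 1 0
    · simpa [v] using he 1 1
  obtain ⟨b, hb⟩ := hv.exists_orthonormalBasis_extension_of_card_eq (by simp)
  have h0 : b 0 = e 0 := hb 0 (by simp)
  have h1 : b 1 = e 1 := hb 1 (by simp)
  refine ⟨b, h0 ▸ (e 0).2, h1 ▸ (e 1).2, ?_⟩
  rw [Submodule.mem_orthogonal]
  intro x hx
  have hx' : (⟨x, hx⟩ : P) = ∑ i, e.repr ⟨x, hx⟩ i • e i := (e.sum_repr _).symm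
  have hx'' : x = e.repr ⟨x, hx⟩ 0 • b 0 + e.repr ⟨x, hx⟩ 1 • b 1 := by
    have := congrArg (Subtype.val) hx'
    rw [h0, h1]
    simpa [Fin.sum_univ_two] using this
  rw [hx'', inner_add_left, inner_smul_left, inner_smul_left, b.inner_eq_ite, b.inner_eq_ite]
  simp

/-- `ϕ` parametrizes `D` by the plane `ℂ`, as the graph of `u` for `‖y‖ < s`. -/
structure GraphDisk (p : R3) (b : Frame) (D : Set R3) (ϕ : ℂ → R3)
    (u : ℂ → ℝ) (s K : ℝ) : Prop where
  smooth : ContDiff ℝ ∞ ϕ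
  immersion : ∀ y, Function.Injective (fderiv ℝ ϕ y)
  embedding : IsEmbedding ϕ
  range_eq : range ϕ = D
  pos : 0 < s
  graph : ∀ y, ‖y‖ < s → ϕ y = chart p b (y, u y)
  smooth_height : ContDiff ℝ ∞ u
  quad : ∀ y, |u y| ≤ K * ‖y‖ ^ 2
  slope : ∀ y, ‖fderiv ℝ u y‖ ≤ K * ‖y‖

section

open OpenPartialHomeomorph

variable {U D : Set R3} {φ : R2 → R3} {p : R3} {b : Frame}

lemma injective_fderiv_univUnitBall (x : R2) :
    Function.Injective (fderiv ℝ (univUnitBall : R2 → R2) x) := by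
  have h1 : DifferentiableAt ℝ (univUnitBall : R2 → R2) x :=
    (contDiff_univUnitBall (n := 1)).differentiable (by simp) x
  have hmem : univUnitBall x ∈ ball (0 : R2) 1 :=
    (univUnitBall : OpenPartialHomeomorph R2 R2).map_source (mem_univ x)
  have h2 : DifferentiableAt ℝ (univUnitBall.symm : R2 → R2) (univUnitBall x) :=
    ((contDiffOn_univUnitBall_symm (n := 1)).contDiffAt (isOpen_ball.mem_nhds hmem)).differentiableAt
      (by simp)
  have h3 : HasFDerivAt (fun x : R2 => univUnitBall.symm (univUnitBall x))
      ((fderiv ℝ (univUnitBall.symm : R2 → R2) (univUnitBall x)).comp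
        (fderiv ℝ (univUnitBall : R2 → R2) x)) x := h2.hasFDerivAt.comp x h1.hasFDerivAt
  have h4 : (fun x : R2 => univUnitBall.symm (univUnitBall x)) = id :=
    funext fun x => (univUnitBall : OpenPartialHomeomorph R2 R2).left_inv (mem_univ x)
  rw [h4] at h3
  have h5 := h3.unique (hasFDerivAt_id x)
  refine Function.LeftInverse.injective (g := fderiv ℝ univUnitBall.symm (univUnitBall x))
    fun v => ?_
  exact congrArg (fun L : R2 →L[ℝ] R2 => L v) h5

/-- A disk, reparametrized by the plane with prescribed differential at the origin. -/
lemma exists_plane_param (hφ : IsDiskParam U D φ) {P : Submodule ℝ R3}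
    {a : R2} (ha : a ∈ ball (0 : R2) 1) (hpa : φ a = p)
    (hP : LinearMap.range (fderiv ℝ φ a : R2 →ₗ[ℝ] R3) = P) (hb0 : b 0 ∈ P) (hb1 : b 1 ∈ P) :
    ∃ f : ℂ → R3, ContDiff ℝ ∞ f ∧ (∀ w, Function.Injective (fderiv ℝ f w)) ∧ IsEmbedding f ∧
      range f = D ∧ f 0 = p ∧ ∀ w, fderiv ℝ f 0 w = w.re • b 0 + w.im • b 1 := by
  set β : OpenPartialHomeomorph R2 R2 := univUnitBall with hβ
  have hβs : ContDiff ℝ ∞ (β : R2 → R2) := contDiff_univUnitBall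
  have hmem : ∀ x, β x ∈ ball (0 : R2) 1 := fun x => β.map_source (mem_univ x)
  set a' := β.symm a with ha'
  have hβa : β a' = a := β.right_inv ha
  have hφd : ∀ x, HasFDerivAt φ (fderiv ℝ φ (β x)) (β x) := fun x =>
    ((hφ.smooth.contDiffAt (isOpen_ball.mem_nhds (hmem x))).differentiableAt (by simp)).hasFDerivAt
  have hβd : ∀ x, HasFDerivAt (β : R2 → R2) (fderiv ℝ (β : R2 → R2) x) x := fun x =>
    (hβs.differentiable (by simp) x).hasFDerivAt
  have hsurj : Function.Surjective (fderiv ℝ (β : R2 → R2) a') :=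
    LinearMap.injective_iff_surjective.1 (injective_fderiv_univUnitBall a')
  have hex : ∀ v ∈ P, ∃ x, fderiv ℝ φ a (fderiv ℝ (β : R2 → R2) a' x) = v := by
    intro v hv
    rw [← hP] at hv
    obtain ⟨x, hx⟩ := hv
    obtain ⟨y, hy⟩ := hsurj x
    exact ⟨y, by rw [hy]; exact hx⟩
  obtain ⟨v₀, hv₀⟩ := hex _ hb0
  obtain ⟨v1, hv1⟩ := hex _ hb1
  let T₀ : ℂ →ₗ[ℝ] R2 := Complex.reLm.smulRight v₀ + Complex.imLm.smulRight v1
  have hT₀ : ∀ w, T₀ w = w.re • v₀ + w.im • v1 := fun w => rfl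
  have hT₀f : ∀ w, fderiv ℝ φ a (fderiv ℝ (β : R2 → R2) a' (T₀ w)) = w.re • b 0 + w.im • b 1 :=
    fun w => by rw [hT₀, map_add, map_smul, map_smul, map_add, map_smul, map_smul, hv₀, hv1]
  have hT₀i : Function.Injective T₀ := by
    rw [injective_iff_map_eq_zero]
    intro w hw
    have h1 := hT₀f w
    rw [hw, map_zero, map_zero] at h1
    have hn := norm_frameMap_sq b (w, 0)
    rw [frameMap_apply] at hn
    simp only [zero_smul, add_zero] at hn
    rw [← h1] at hn
    simpa using hn.symm
  let T1 : ℂ ≃ₗ[ℝ] R2 := T₀.linearEquivOfInjective hT₀i (by simp [Complex.finrank_real_complex])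
  let T : ℂ ≃L[ℝ] R2 := T1.toContinuousLinearEquiv
  have hT : ∀ w, T w = T₀ w := fun w => rfl
  have hTd : ∀ w, HasFDerivAt (fun w => a' + T w) (T : ℂ →L[ℝ] R2) w := fun w =>
    T.hasFDerivAt.const_add a'
  have hfd : ∀ w, HasFDerivAt (fun w => φ (β (a' + T w)))
      ((fderiv ℝ φ (β (a' + T w))).comp ((fderiv ℝ (β : R2 → R2) (a' + T w)).comp
        (T : ℂ →L[ℝ] R2))) w := fun w =>
    (hφd (a' + T w)).comp w ((hβd (a' + T w)).comp w (hTd w))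
  refine ⟨fun w => φ (β (a' + T w)), ?_, fun w => ?_, ?_, ?_, ?_, fun w => ?_⟩
  · exact hφ.smooth.comp_contDiff (hβs.comp (contDiff_const.add T.contDiff)) fun w => hmem _
  · rw [(hfd w).fderiv]
    exact (hφ.immersion _ (hmem _)).comp ((injective_fderiv_univUnitBall _).comp T.injective)
  · have h1 : IsEmbedding fun w => β (a' + T w) := (β.isOpenEmbedding rfl).isEmbedding.comp
        (((Homeomorph.addLeft a').isEmbedding).comp T.toHomeomorph.isEmbedding)
    have h2 : IsEmbedding fun w => (⟨β (a' + T w), hmem _⟩ : ball (0 : R2) 1) :=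
      h1.codRestrict (ball (0 : R2) 1) fun w => hmem _
    exact hφ.embedding.comp h2
  · rw [← hφ.image_eq]
    ext x
    constructor
    · rintro ⟨w, rfl⟩
      exact ⟨_, hmem _, rfl⟩
    · rintro ⟨z, hz, rfl⟩
      refine ⟨T.symm (β.symm z - a'), ?_⟩
      simp only [ContinuousLinearEquiv.apply_symm_apply, add_sub_cancel]
      rw [β.right_inv hz]
  · simp [hβa, hpa]
  · rw [(hfd 0).fderiv]
    simp only [map_zero, add_zero, hβa, ContinuousLinearMap.comp_apply]
    exact hT₀f w

lemma exists_graphDisk (hφ : IsDiskParam U D φ) {P : Submodule ℝ R3}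
    {a : R2} (ha : a ∈ ball (0 : R2) 1) (hpa : φ a = p)
    (hP : LinearMap.range (fderiv ℝ φ a : R2 →ₗ[ℝ] R3) = P) (hb0 : b 0 ∈ P) (hb1 : b 1 ∈ P) :
    ∃ ϕ u s K, GraphDisk p b D ϕ u s K := by
  obtain ⟨f, hf, hfi, hfe, hfr, hf0, hfd⟩ := exists_plane_param hφ ha hpa hP hb0 hb1
  have hci : ContDiff ℝ ∞ (chartInv p b) := contDiff_chartInv p b
  have hg : ContDiff ℝ ∞ fun w => chartInv p b (f w) := hci.comp hf
  have hgd : HasFDerivAt (fun w => chartInv p b (f w))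
      (ContinuousLinearMap.inl ℝ ℂ ℝ) 0 := by
    have h1 := (hg.differentiable (by simp) 0).hasFDerivAt
    have h2 : HasFDerivAt (fun w => chart p b (chartInv p b (f w)))
        ((frameMap b).comp (fderiv ℝ (fun w => chartInv p b (f w)) 0)) 0 :=
      (hasFDerivAt_chart p b _).comp 0 h1
    simp only [chart_chartInv] at h2
    have h3 := (hf.differentiable (by simp) 0).hasFDerivAt.unique h2
    have h4 : fderiv ℝ (fun w => chartInv p b (f w)) 0 = ContinuousLinearMap.inl ℝ ℂ ℝ := by
      ext1 w
      have h5 : frameMap b (fderiv ℝ (fun w => chartInv p b (f w)) 0 w) = frameMap b (w, 0) := by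
        rw [← ContinuousLinearMap.comp_apply, ← h3, hfd, frameMap_apply]
        simp
      have hn := norm_frameMap_sq b (fderiv ℝ (fun w => chartInv p b (f w)) 0 w - (w, 0))
      rw [map_sub, h5, sub_self, norm_zero] at hn
      have e1 : ‖(fderiv ℝ (fun w => chartInv p b (f w)) 0 w - (w, (0 : ℝ))).1‖ = 0 := by
        nlinarith [sq_nonneg (fderiv ℝ (fun w => chartInv p b (f w)) 0 w - (w, (0 : ℝ))).2,
          norm_nonneg (fderiv ℝ (fun w => chartInv p b (f w)) 0 w - (w, (0 : ℝ))).1]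
      have e2 : (fderiv ℝ (fun w => chartInv p b (f w)) 0 w - (w, (0 : ℝ))).2 = 0 := by
        nlinarith [sq_nonneg (fderiv ℝ (fun w => chartInv p b (f w)) 0 w - (w, (0 : ℝ))).2,
          norm_nonneg (fderiv ℝ (fun w => chartInv p b (f w)) 0 w - (w, (0 : ℝ))).1]
      exact sub_eq_zero.1 (Prod.ext (norm_eq_zero.1 e1) e2)
    rwa [h4] at h1
  have hci0 : chartInv p b p = 0 := by
    have : chart p b 0 = p := by simp [chart]
    have h2 := chartInv_chart p b 0
    rwa [this] at h2
  have hQ : ContDiff ℝ ∞ fun w => (chartInv p b (f w)).1 := contDiff_fst.comp hg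
  have hQd : HasFDerivAt (fun w => (chartInv p b (f w)).1) (ContinuousLinearMap.id ℝ ℂ) 0 := by
    have := (hasFDerivAt_fst (𝕜 := ℝ) (E := ℂ) (F := ℝ) (p := chartInv p b (f 0))).comp 0 hgd
    exact this
  obtain ⟨q, hq, hq0, hqd, hQq⟩ := exists_smooth_local_inverse hQ (by simp [hf0, hci0]) hQd
  obtain ⟨e, s1, K1, hs1, hes, heq, heb, hek, -⟩ := exists_small_extension
    (q := fun y => q y - y) (hq.mono fun y hy => hy.sub contDiffAt_id) (by simp [hq0])
    (by
      have := hqd.fun_sub (hasFDerivAt_id (0 : ℂ))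
      rw [sub_self] at this
      exact this.fderiv) (c := 1 / 2) (by norm_num)
  obtain ⟨⟨k, hk⟩, hki⟩ := exists_homeomorph_id_add (hes.differentiable (by simp)) heb
  have hks : ContDiff ℝ ∞ fun y => y + e y := contDiff_id.add hes
  have he0 : e 0 = 0 := by rw [heq 0 (by simpa using hs1), hq0, sub_zero]
  have hϕs : ContDiff ℝ ∞ fun y => f (y + e y) := hf.comp hks
  have hkd0 : HasFDerivAt (fun y => y + e y) (ContinuousLinearMap.id ℝ ℂ) 0 := by
    have h1 := (hasFDerivAt_id (0 : ℂ)).fun_add (hes.differentiable (by simp) 0).hasFDerivAt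
    have h2 : fderiv ℝ e 0 = 0 := norm_le_zero_iff.1 (by simpa using hek 0)
    rw [h2, add_zero] at h1
    exact h1
  have hu : ContDiff ℝ ∞ fun y => (chartInv p b (f (y + e y))).2 := contDiff_snd.comp (hci.comp hϕs)
  have hud : fderiv ℝ (fun y => (chartInv p b (f (y + e y))).2) 0 = 0 := by
    have hgd' : HasFDerivAt (fun w => chartInv p b (f w))
        (ContinuousLinearMap.inl ℝ ℂ ℝ) (0 + e 0) := by rwa [he0, add_zero]
    have h1 := (hasFDerivAt_snd (𝕜 := ℝ) (E := ℂ) (F := ℝ)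
      (p := chartInv p b (f (0 + e 0)))).comp 0 (hgd'.comp 0 hkd0)
    refine h1.fderiv.trans ?_
    ext w
    simp
  obtain ⟨u, s2, K2, hs2, hus, hueq, -, huk, hu2⟩ := exists_small_extension
    (q := fun y => (chartInv p b (f (y + e y))).2)
    (Eventually.of_forall fun y => hu.contDiffAt) (by simp [he0, hf0, hci0]) hud
    (c := 1) one_pos
  obtain ⟨s₃, hs₃, hs₃'⟩ := Metric.eventually_nhds_iff_ball.1 hQq
  refine ⟨fun y => f (y + e y), u, min s1 (min s2 s₃), K2, hϕs, fun y => ?_, ?_, ?_,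
    lt_min hs1 (lt_min hs2 hs₃), fun y hy => ?_, hus, fun y => ?_, huk⟩
  · have h1 : HasFDerivAt (fun y => f (y + e y))
        ((fderiv ℝ f (y + e y)).comp (fderiv ℝ (fun y => y + e y) y)) y :=
      (hf.differentiable (by simp) _).hasFDerivAt.comp y
        (hks.differentiable (by simp) y).hasFDerivAt
    rw [h1.fderiv]
    exact (hfi _).comp (hki y)
  · have : (fun y => f (y + e y)) = f ∘ k := funext fun y => by simp [hk]
    rw [this]
    exact hfe.comp k.isEmbedding
  · have : (fun y => f (y + e y)) = f ∘ k := funext fun y => by simp [hk]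
    rw [this, range_comp, k.surjective.range_eq, image_univ, hfr]
  · have hy1 : ‖y‖ < s1 := hy.trans_le (min_le_left _ _)
    have hy2 : ‖y‖ < s2 := hy.trans_le ((min_le_right _ _).trans (min_le_left _ _))
    have hy3 : ‖y‖ < s₃ := hy.trans_le ((min_le_right _ _).trans (min_le_right _ _))
    have e1 : y + e y = q y := by rw [heq y hy1, add_sub_cancel]
    have e2 := hs₃' y (by simpa using hy3)
    rw [← e1] at e2
    rw [hueq y hy2]
    conv_lhs => rw [← chart_chartInv p b (f (y + e y))]
    congr 1
    exact Prod.ext e2 rfl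
  · simpa using hu2 y

end


/-! ### The local picture: a set bounded by two touching graphs -/

/-- Near `p`, in a box of radius `R` and half-height `H`, the set `E` is bounded by the graphs of
`u2 < u1`, which are the central parts of two disks `ϕ1`, `ϕ2` that make up the boundary of `E`
in `U`. -/
structure LocalModel (U E : Set R3) (p : R3) (b : Frame)
    (ϕ1 ϕ2 : ℂ → R3) (u1 u2 : ℂ → ℝ) (R H K : ℝ) (s : Bool) : Prop where
  disk1 : GraphDisk p b (range ϕ1) ϕ1 u1 R K
  disk2 : GraphDisk p b (range ϕ2) ϕ2 u2 R K
  frontier_eq : frontier E ∩ U = range ϕ1 ∪ range ϕ2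
  inter : ∀ y y', ϕ1 y = ϕ2 y' → y = 0 ∧ y' = 0
  proper1 : ∀ C ⊆ U, IsCompact C → IsCompact (ϕ1 ⁻¹' C)
  proper2 : ∀ C ⊆ U, IsCompact C → IsCompact (ϕ2 ⁻¹' C)
  outside1 : ∀ y, R ≤ ‖y‖ → ϕ1 y ∉ openBox p b R H
  outside2 : ∀ y, R ≤ ‖y‖ → ϕ2 y ∉ openBox p b R H
  box_subset : openBox p b R H ⊆ U
  closedBall_subset : closedBall p (3 * H / 4) ⊆ U
  le_half_height : R ≤ H / 2
  le_one : R ≤ 1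
  height_pos : 0 < H
  height : K * R ^ 2 < H / 4
  lt_of_ne : ∀ y, y ≠ 0 → ‖y‖ < R → u2 y < u1 y
  fill : ∀ q ∈ ball (0 : ℂ) R ×ˢ Ioo (-H) H, q.2 ≠ u1 q.1 → q.2 ≠ u2 q.1 →
    (chart p b q ∈ E ↔ (q ∈ midRegion u1 u2 ↔ s = true))

section Lebesgue

variable {E V N : Set R3}

lemma IsLebesgueRepresentative.subset_of_sdiff (hE : IsLebesgueRepresentative E) (hV : IsOpen V)
    (hN : volume N = 0) (h : V \ N ⊆ E) : V ⊆ E := by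
  intro x hx
  rw [hE x]
  obtain ⟨ε, hε, hball⟩ := Metric.isOpen_iff.1 hV x hx
  refine tendsto_const_nhds.congr' ?_
  filter_upwards [Ioo_mem_nhdsGT hε] with r hr
  have h1 : volume (E ∩ ball x r) = volume (ball x r) := by
    refine le_antisymm (measure_mono inter_subset_right) ?_
    rw [← measure_sdiff_null hN]
    exact measure_mono fun z hz => ⟨h ⟨hball (ball_subset_ball hr.2.le hz.1), hz.2⟩, hz.1⟩
  rw [h1, ENNReal.div_self (measure_ball_pos _ _ hr.1).ne' measure_ball_lt_top.ne]

lemma IsLebesgueRepresentative.disjoint_of_sdiff (hE : IsLebesgueRepresentative E)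
    (hV : IsOpen V) (hN : volume N = 0) (h : V \ N ⊆ Eᶜ) : V ⊆ Eᶜ := by
  intro x hx hxE
  obtain ⟨ε, hε, hball⟩ := Metric.isOpen_iff.1 hV x hx
  have h0 : Tendsto (fun r : ℝ => volume (E ∩ ball x r) / volume (ball x r)) (𝓝[>] 0) (𝓝 0) := by
    refine tendsto_const_nhds.congr' ?_
    filter_upwards [Ioo_mem_nhdsGT hε] with r hr
    have h1 : volume (E ∩ ball x r) = 0 := by
      refine measure_mono_null (fun z hz => ?_) hN
      by_contra hzN
      exact h ⟨hball (ball_subset_ball hr.2.le hz.2), hzN⟩ hz.1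
    rw [h1, ENNReal.zero_div]
  exact zero_ne_one (tendsto_nhds_unique h0 ((hE x).1 hxE))

lemma IsPreconnected.subset_or_subset_compl_of_frontier {S : Set R3} (hS : IsPreconnected S)
    (h : Disjoint S (frontier E)) : S ⊆ E ∨ S ⊆ Eᶜ := by
  by_contra hcon
  rw [not_or, not_subset, not_subset] at hcon
  obtain ⟨⟨x, hx, hxE⟩, y, hy, hyE⟩ := hcon
  have hf : ∀ z ∈ S, z ∉ frontier E := fun z hz hz' => h.le_bot ⟨hz, hz'⟩
  obtain ⟨z, -, hz, hz'⟩ := hS (interior E) (closure E)ᶜ isOpen_interior isClosed_closure.isOpen_compl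
    (fun z hz => by_contra fun hcon => hf z hz ⟨not_not.1 fun h' => hcon (Or.inr h'),
      fun h' => hcon (Or.inl h')⟩)
    ⟨y, hy, not_not.1 fun h' => hf y hy ⟨subset_closure (not_not.1 hyE), h'⟩⟩
    ⟨x, hx, fun h' => hf x hx ⟨h', fun h'' => hxE (interior_subset h'')⟩⟩
  exact hz' (subset_closure (interior_subset hz))

end Lebesgue

lemma isPreconnected_puncturedBall (R : ℝ) : IsPreconnected (ball (0 : ℂ) R \ {0}) := by
  have h : ball (0 : ℂ) R \ {0} = (fun x : ℝ × ℝ => x.1 • dir x.2) '' (Ioo 0 R ×ˢ univ) := by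
    ext y
    constructor
    · rintro ⟨hy, hy0⟩
      have hy0' : 0 < ‖y‖ := norm_pos_iff.2 hy0
      refine ⟨(‖y‖, y.arg), ⟨⟨hy0', by simpa using hy⟩, mem_univ _⟩, ?_⟩
      simp [dir, Complex.norm_mul_exp_arg_mul_I]
    · rintro ⟨x, hx, rfl⟩
      have hn : ‖x.1 • dir x.2‖ = x.1 := by
        rw [norm_smul, norm_dir, mul_one, Real.norm_of_nonneg hx.1.1.le]
      refine ⟨by rw [mem_ball_zero_iff, hn]; exact hx.1.2, fun h0 => ?_⟩
      have h0' : x.1 • dir x.2 = 0 := h0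
      rw [h0', norm_zero] at hn
      exact hx.1.1.ne hn
  rw [h]
  exact (isPreconnected_Ioo.prod isPreconnected_univ).image _
    (continuous_fst.smul (continuous_dir.comp continuous_snd)).continuousOn

/-- The region between two continuous graphs over a preconnected set is preconnected. -/
lemma isPreconnected_between {S : Set ℂ} (hS : IsPreconnected S) {f g : ℂ → ℝ}
    (hf : Continuous f) (hg : Continuous g) (hlt : ∀ y ∈ S, f y < g y) :
    IsPreconnected {q : ℂ × ℝ | q.1 ∈ S ∧ f q.1 < q.2 ∧ q.2 < g q.1} := by
  have h : {q : ℂ × ℝ | q.1 ∈ S ∧ f q.1 < q.2 ∧ q.2 < g q.1} =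
      (fun q : ℂ × ℝ => (q.1, f q.1 + q.2 * (g q.1 - f q.1))) '' (S ×ˢ Ioo 0 1) := by
    ext ⟨y, z⟩
    constructor
    · rintro ⟨hy, h1, h2⟩
      have hp : 0 < g y - f y := sub_pos.2 (hlt y hy)
      simp only at h1 h2
      refine ⟨(y, (z - f y) / (g y - f y)), ⟨hy, div_pos (by linarith) hp, ?_⟩, ?_⟩
      · rw [div_lt_one hp]
        linarith
      · simp only [Prod.mk.injEq, true_and]
        field_simp
        ring
    · rintro ⟨⟨y', τ⟩, ⟨hy, h1, h2⟩, heq⟩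
      simp only [Prod.mk.injEq] at heq
      obtain ⟨rfl, rfl⟩ := heq
      have hp : 0 < g y' - f y' := sub_pos.2 (hlt y' hy)
      exact ⟨hy, by simp only; nlinarith, by simp only; nlinarith⟩
  rw [h]
  exact (hS.prod isPreconnected_Ioo).image _ (continuous_fst.prodMk ((hf.comp continuous_fst).add
    (continuous_snd.mul ((hg.comp continuous_fst).sub (hf.comp continuous_fst))))).continuousOn

/-- Two graphs which bound `E` in a box separate `E` from its complement. -/
lemma exists_fill {E : Set R3} {p : R3} {b : Frame} {u1 u2 : ℂ → ℝ}
    {R H : ℝ} (hEL : IsLebesgueRepresentative E) (hu1 : Continuous u1) (hu2 : Continuous u2)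
    (hR : 0 < R) (hb1 : ∀ y, ‖y‖ < R → |u1 y| < H) (hb2 : ∀ y, ‖y‖ < R → |u2 y| < H)
    (hlt : ∀ y, y ≠ 0 → ‖y‖ < R → u2 y < u1 y) (h0 : u1 0 = u2 0)
    (hfr : ∀ q ∈ ball (0 : ℂ) R ×ˢ Ioo (-H) H,
      (chart p b q ∈ frontier E ↔ q.2 = u1 q.1 ∨ q.2 = u2 q.1)) :
    ∃ s : Bool, ∀ q ∈ ball (0 : ℂ) R ×ˢ Ioo (-H) H, q.2 ≠ u1 q.1 → q.2 ≠ u2 q.1 →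
      (chart p b q ∈ E ↔ (q ∈ midRegion u1 u2 ↔ s = true)) := by
  set B := ball (0 : ℂ) R ×ˢ Ioo (-H) H with hB
  have hle : ∀ y, ‖y‖ < R → u2 y ≤ u1 y := fun y hy => by
    rcases eq_or_ne y 0 with rfl | hy0
    exacts [h0.ge, (hlt y hy0 hy).le]
  have hregion : ∀ T : Set (ℂ × ℝ), IsPreconnected T → T ⊆ B →
      (∀ q ∈ T, q.2 ≠ u1 q.1 ∧ q.2 ≠ u2 q.1) →
      (∀ q ∈ T, chart p b q ∈ E) ∨ ∀ q ∈ T, chart p b q ∈ Eᶜ := by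
    intro T hT hTb hTu
    have := (hT.image (chart p b) (chartHomeo p b).continuous.continuousOn
      ).subset_or_subset_compl_of_frontier (E := E) (by
      rw [disjoint_left]
      rintro _ ⟨q, hq, rfl⟩ hx
      exact ((hfr q (hTb hq)).1 hx).elim (hTu q hq).1 (hTu q hq).2)
    exact this.imp (fun h q hq => h ⟨q, hq, rfl⟩) (fun h q hq => h ⟨q, hq, rfl⟩)
  set A1 := {q : ℂ × ℝ | q.1 ∈ ball (0 : ℂ) R ∧ u1 q.1 < q.2 ∧ q.2 < H}
  set A2 := {q : ℂ × ℝ | q.1 ∈ ball (0 : ℂ) R \ {0} ∧ u2 q.1 < q.2 ∧ q.2 < u1 q.1}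
  set A3 := {q : ℂ × ℝ | q.1 ∈ ball (0 : ℂ) R ∧ -H < q.2 ∧ q.2 < u2 q.1}
  have htop := hregion A1
    (isPreconnected_between (convex_ball _ _).isPreconnected hu1 continuous_const
      fun y hy => (abs_lt.1 (hb1 y (by simpa using hy))).2)
    (fun q hq => ⟨hq.1, (abs_lt.1 (hb1 q.1 (by simpa using hq.1))).1.trans hq.2.1, hq.2.2⟩)
    (fun q hq => ⟨hq.2.1.ne', ((hle q.1 (by simpa using hq.1)).trans_lt hq.2.1).ne'⟩)
  have hbot := hregion A3
    (isPreconnected_between (convex_ball _ _).isPreconnected continuous_const hu2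
      fun y hy => (abs_lt.1 (hb2 y (by simpa using hy))).1)
    (fun q hq => ⟨hq.1, hq.2.1, hq.2.2.trans (abs_lt.1 (hb2 q.1 (by simpa using hq.1))).2⟩)
    (fun q hq => ⟨(hq.2.2.trans_le (hle q.1 (by simpa using hq.1))).ne, hq.2.2.ne⟩)
  have hmid := hregion A2
    (isPreconnected_between (isPreconnected_puncturedBall R) hu2 hu1
      fun y hy => hlt y hy.2 (by simpa using hy.1))
    (fun q hq => ⟨hq.1.1, (abs_lt.1 (hb2 q.1 (by simpa using hq.1.1))).1.trans hq.2.1,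
      hq.2.2.trans (abs_lt.1 (hb1 q.1 (by simpa using hq.1.1))).2⟩)
    (fun q hq => ⟨hq.2.2.ne, hq.2.1.ne'⟩)
  have hcross : ∀ G, G = E ∨ G = Eᶜ → ∀ u : ℂ → ℝ, Continuous u → ∀ T : Set (ℂ × ℝ), IsOpen T →
      (∃ y, (y, u y) ∈ B ∩ T ∧ (u y = u1 y ∨ u y = u2 y)) →
      ¬ ∀ q ∈ B ∩ T, q.2 ≠ u q.1 → chart p b q ∈ G := by
    intro G hG u hu T hT ⟨y, hyT, hy⟩ hA
    have hN : volume (chart p b '' {q : ℂ × ℝ | q.2 = u q.1}) = 0 := by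
      rw [volume_image_chart]
      exact measure_graph_eq_zero hu
    have hV : IsOpen (chart p b '' (B ∩ T)) :=
      (chartHomeo p b).isOpenMap _ ((isOpen_ball.prod isOpen_Ioo).inter hT)
    have hf : chart p b (y, u y) ∈ frontier E := (hfr _ hyT.1).2 hy
    have hsd : chart p b '' (B ∩ T) \ chart p b '' {q : ℂ × ℝ | q.2 = u q.1} ⊆ G := by
      rintro _ ⟨⟨q, hq, rfl⟩, hq'⟩
      exact hA q hq fun h => hq' ⟨q, h, rfl⟩
    rcases hG with rfl | rfl
    · exact hf.2 (interior_maximal (hEL.subset_of_sdiff hV hN hsd) hV ⟨_, hyT, rfl⟩)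
    · rw [← frontier_compl] at hf
      exact hf.2 (interior_maximal (hEL.disjoint_of_sdiff hV hN hsd) hV ⟨_, hyT, rfl⟩)
  obtain ⟨y₀, hy₀, hy₀R⟩ : ∃ y : ℂ, y ≠ 0 ∧ ‖y‖ < R := ⟨((R / 2 : ℝ) : ℂ), by simp [hR.ne'], by
      rw [Complex.norm_real, Real.norm_of_nonneg (by linarith)]; linarith⟩
  have hup : ∀ G, G = E ∨ G = Eᶜ → (∀ q ∈ A1, chart p b q ∈ G) → ¬ ∀ q ∈ A2, chart p b q ∈ G :=
    fun G hG h1 h2 => hcross G hG u1 hu1 {q | q.1 ≠ 0 ∧ u2 q.1 < q.2}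
      ((isOpen_ne.preimage continuous_fst).inter
        (isOpen_lt (hu2.comp continuous_fst) continuous_snd))
      ⟨y₀, ⟨⟨by simpa using hy₀R, abs_lt.1 (hb1 y₀ hy₀R)⟩, hy₀, hlt y₀ hy₀ hy₀R⟩, Or.inl rfl⟩
      fun q hq hne => (lt_or_gt_of_ne hne).elim (fun h => h2 q ⟨⟨hq.1.1, hq.2.1⟩, hq.2.2, h⟩)
        fun h => h1 q ⟨hq.1.1, h, hq.1.2.2⟩
  have hdown : ∀ G, G = E ∨ G = Eᶜ → (∀ q ∈ A3, chart p b q ∈ G) → ¬ ∀ q ∈ A2, chart p b q ∈ G :=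
    fun G hG h1 h2 => hcross G hG u2 hu2 {q | q.1 ≠ 0 ∧ q.2 < u1 q.1}
      ((isOpen_ne.preimage continuous_fst).inter
        (isOpen_lt continuous_snd (hu1.comp continuous_fst)))
      ⟨y₀, ⟨⟨by simpa using hy₀R, abs_lt.1 (hb2 y₀ hy₀R)⟩, hy₀, hlt y₀ hy₀ hy₀R⟩, Or.inr rfl⟩
      fun q hq hne => (lt_or_gt_of_ne hne).elim (fun h => h1 q ⟨hq.1.1, hq.1.2.1, h⟩)
        fun h => h2 q ⟨⟨hq.1.1, hq.2.1⟩, h, hq.2.2⟩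
  have key : ∀ q ∈ B, q.2 ≠ u1 q.1 → q.2 ≠ u2 q.1 → q ∈ A1 ∧ q ∉ midRegion u1 u2 ∨
      q ∈ A3 ∧ q ∉ midRegion u1 u2 ∨ q ∈ A2 ∧ q ∈ midRegion u1 u2 := by
    intro q hq h1 h2
    rcases lt_or_gt_of_ne h1 with h1 | h1
    · rcases lt_or_gt_of_ne h2 with h2 | h2
      · exact Or.inr (Or.inl ⟨⟨hq.1, hq.2.1, h2⟩, fun h => lt_asymm h2 h.1⟩)
      · refine Or.inr (Or.inr ⟨⟨⟨hq.1, fun h => ?_⟩, h2, h1⟩, h2, h1⟩)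
        rw [mem_singleton_iff.1 h] at h1 h2
        linarith
    · exact Or.inl ⟨⟨hq.1, h1, hq.2.2⟩, fun h => lt_asymm h1 h.2⟩
  rcases hmid with hm | hm
  · have ht := htop.resolve_left fun ht => hup E (Or.inl rfl) ht hm
    have hb := hbot.resolve_left fun hb => hdown E (Or.inl rfl) hb hm
    refine ⟨true, fun q hq h1 h2 => ?_⟩
    rcases key q hq h1 h2 with ⟨a, n⟩ | ⟨a, n⟩ | ⟨a, n⟩
    exacts [by simpa [n] using ht q a, by simpa [n] using hb q a, by simpa [n] using hm q a]
  · have ht := htop.resolve_right fun ht => hup Eᶜ (Or.inr rfl) ht hm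
    have hb := hbot.resolve_right fun hb => hdown Eᶜ (Or.inr rfl) hb hm
    refine ⟨false, fun q hq h1 h2 => ?_⟩
    rcases key q hq h1 h2 with ⟨a, n⟩ | ⟨a, n⟩ | ⟨a, n⟩
    exacts [by simpa [n] using ht q a, by simpa [n] using hb q a, by simpa [n] using hm q a]


variable {U E D : Set R3} {p : R3} {b : Frame} {ϕ ϕ1 ϕ2 : ℂ → R3}
  {u u1 u2 : ℂ → ℝ} {R H K : ℝ} {s : Bool}

lemma chart_zero (p : R3) (b : Frame) : chart p b 0 = p := by simp [chart]

lemma chart_mem_openBox {q : ℂ × ℝ} :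
    chart p b q ∈ openBox p b R H ↔ ‖q.1‖ < R ∧ -H < q.2 ∧ q.2 < H := by
  rw [openBox, (chart_injective p b).mem_set_image]
  simp

lemma GraphDisk.apply_zero {r : ℝ} (h : GraphDisk p b D ϕ u r K) : ϕ 0 = p := by
  have h0 : u 0 = 0 := by simpa using h.quad 0
  rw [h.graph 0 (by simpa using h.pos), h0]
  exact chart_zero p b

lemma GraphDisk.mono {r r' K' : ℝ} (h : GraphDisk p b D ϕ u r K) (hr : 0 < r') (hr' : r' ≤ r)
    (hK : K ≤ K') : GraphDisk p b (range ϕ) ϕ u r' K' where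
  smooth := h.smooth
  immersion := h.immersion
  embedding := h.embedding
  range_eq := rfl
  pos := hr
  graph y hy := h.graph y (hy.trans_le hr')
  smooth_height := h.smooth_height
  quad y := (h.quad y).trans (by gcongr)
  slope y := (h.slope y).trans (by gcongr)

lemma GraphDisk.proper {r : ℝ} (h : GraphDisk p b D ϕ u r K)
    (hD : ∃ Z : Set R3, IsClosed Z ∧ D = Z ∩ U) {C : Set R3} (hC : C ⊆ U) (hCc : IsCompact C) :
    IsCompact (ϕ ⁻¹' C) := by
  obtain ⟨Z, hZ, hDZ⟩ := hD
  have h1 : ϕ ⁻¹' C = ϕ ⁻¹' (C ∩ Z) := by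
    ext y
    have : ϕ y ∈ Z := (hDZ ▸ h.range_eq ▸ mem_range_self y : ϕ y ∈ Z ∩ U).1
    simp [this]
  rw [h1, h.embedding.isInducing.isCompact_preimage_iff]
  · exact hCc.inter_right hZ
  · rw [h.range_eq, hDZ]
    exact fun x hx => ⟨hx.2, hC hx.1⟩

/-- Two disks touching at `p` bound the set `E` in the way described by `LocalModel`. -/
theorem exists_localModel {P : Submodule ℝ R3} (hU : IsOpen U) (hEL : IsLebesgueRepresentative E)
    (hdisks : IsTouchingDisks U (frontier E ∩ U) p P) :
    ∃ b ϕ1 ϕ2 u1 u2 R H K s, b 0 ∈ P ∧ b 1 ∈ P ∧ b 2 ∈ Pᗮ ∧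
      LocalModel U E p b ϕ1 ϕ2 u1 u2 R H K s := by
  obtain ⟨D1, D2, φ1, φ2, hφ1, hφ2, hS, hinter, ⟨a1, ha1, hp1, hP1⟩, a2, ha2, hp2, hP2⟩ := hdisks
  have hfin : Module.finrank ℝ P = 2 := by
    rw [← hP1, LinearMap.finrank_range_of_inj (hφ1.immersion a1 ha1)]
    simp
  obtain ⟨b, hb0, hb1, hb2⟩ := exists_frame hfin
  obtain ⟨ϕ1, u1, s1, K1, g1⟩ := exists_graphDisk hφ1 ha1 hp1 hP1 hb0 hb1
  obtain ⟨ϕ2, u2, s2, K2, g2⟩ := exists_graphDisk hφ2 ha2 hp2 hP2 hb0 hb1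
  obtain ⟨O1, hO1, hO1'⟩ := g1.embedding.isInducing.isOpen_iff.1 (isOpen_ball (x := 0) (ε := s1))
  obtain ⟨O2, hO2, hO2'⟩ := g2.embedding.isInducing.isOpen_iff.1 (isOpen_ball (x := 0) (ε := s2))
  have hpU : p ∈ U := hφ1.subset (hinter.ge (mem_singleton p)).1
  have hpO1 : p ∈ O1 := by
    have : (0 : ℂ) ∈ ϕ1 ⁻¹' O1 := hO1' ▸ mem_ball_self g1.pos
    rwa [mem_preimage, g1.apply_zero] at this
  have hpO2 : p ∈ O2 := by
    have : (0 : ℂ) ∈ ϕ2 ⁻¹' O2 := hO2' ▸ mem_ball_self g2.pos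
    rwa [mem_preimage, g2.apply_zero] at this
  have hO : IsOpen (chart p b ⁻¹' (O1 ∩ O2 ∩ U)) :=
    ((hO1.inter hO2).inter hU).preimage (chartHomeo p b).continuous
  obtain ⟨H, hH, hHO⟩ := Metric.isOpen_iff.1 hO 0
    (by rw [mem_preimage, chart_zero]; exact ⟨⟨hpO1, hpO2⟩, hpU⟩)
  set K := max (max K1 K2) 0 with hK
  have hK0 : 0 ≤ K := le_max_right _ _
  set R := min (min (min s1 s2) (min H 1)) (H / (4 * (K + 1)) / 2) with hR
  have hR0 : 0 < R := lt_min (lt_min (lt_min g1.pos g2.pos) (lt_min hH one_pos)) (by positivity)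
  have hR1 : R ≤ min (min s1 s2) (min H 1) := min_le_left _ _
  have hRs1 : R ≤ s1 := hR1.trans ((min_le_left _ _).trans (min_le_left _ _))
  have hRs2 : R ≤ s2 := hR1.trans ((min_le_left _ _).trans (min_le_right _ _))
  have hRH : R ≤ H := hR1.trans ((min_le_right _ _).trans (min_le_left _ _))
  have hRone : R ≤ 1 := hR1.trans ((min_le_right _ _).trans (min_le_right _ _))
  have hheight : K * R ^ 2 < H / 4 := by
    have h1 : R ≤ H / (4 * (K + 1)) / 2 := min_le_right _ _
    rw [div_div, le_div_iff₀ (by positivity)] at h1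
    have h2 : R ^ 2 ≤ R := by nlinarith
    nlinarith
  have hRH2 : R ≤ H / 2 := by
    have h1 : R ≤ H / (4 * (K + 1)) / 2 := min_le_right _ _
    rw [div_div, le_div_iff₀ (by positivity)] at h1
    nlinarith
  have hcb : closedBall p (3 * H / 4) ⊆ U := by
    intro x hx
    rw [← chart_chartInv p b x]
    refine (hHO ?_).2
    rw [mem_closedBall] at hx
    have h1 := dist_chart_sq p b (chartInv p b x) 0
    simp only [Prod.fst_zero, Prod.snd_zero, sub_zero, chart_zero, chart_chartInv] at h1
    rw [mem_ball_zero_iff, Prod.norm_def, Real.norm_eq_abs]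
    have h2 : dist x p ^ 2 ≤ (3 * H / 4) ^ 2 := by gcongr
    exact max_lt (lt_of_pow_lt_pow_left₀ 2 hH.le (by nlinarith [sq_nonneg (chartInv p b x).2]))
      (abs_lt_of_sq_lt_sq (by nlinarith [sq_nonneg ‖(chartInv p b x).1‖]) hH.le)
  have hbox : openBox p b R H ⊆ O1 ∩ O2 ∩ U := by
    rintro _ ⟨q, hq, rfl⟩
    refine hHO ?_
    rw [mem_ball_zero_iff, Prod.norm_def]
    exact max_lt ((mem_ball_zero_iff.1 hq.1).trans_le hRH) (abs_lt.2 hq.2)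
  have hg1 : GraphDisk p b (range ϕ1) ϕ1 u1 R K :=
    g1.mono hR0 hRs1 ((le_max_left _ _).trans (le_max_left _ _))
  have hg2 : GraphDisk p b (range ϕ2) ϕ2 u2 R K :=
    g2.mono hR0 hRs2 ((le_max_right _ _).trans (le_max_left _ _))
  have hout : ∀ {D ϕ u r K O}, GraphDisk p b D ϕ u r K → ϕ ⁻¹' O = ball 0 r →
      openBox p b R H ⊆ O → ∀ y, R ≤ ‖y‖ → ϕ y ∉ openBox p b R H := by
    intro D ϕ u r K O g hO hbO y hy hbox
    have hyr : ‖y‖ < r := by simpa using (hO ▸ hbO hbox : y ∈ ball (0 : ℂ) r)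
    rw [g.graph y hyr, chart_mem_openBox] at hbox
    exact absurd hbox.1 (not_lt.2 hy)
  have hout1 := hout g1 hO1' (hbox.trans (inter_subset_left.trans inter_subset_left))
  have hout2 := hout g2 hO2' (hbox.trans (inter_subset_left.trans inter_subset_right))
  have hmeet : ∀ y y', ϕ1 y = ϕ2 y' → y = 0 ∧ y' = 0 := by
    intro y y' h
    have h1 : ϕ1 y = p := by
      have : ϕ1 y ∈ D1 ∩ D2 := ⟨g1.range_eq ▸ mem_range_self y, g2.range_eq ▸ h ▸ mem_range_self y'⟩
      rw [hinter] at this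
      exact this
    exact ⟨g1.embedding.injective (h1.trans g1.apply_zero.symm),
      g2.embedding.injective (h.symm.trans (h1.trans g2.apply_zero.symm))⟩
  have hne : ∀ y, y ≠ 0 → ‖y‖ < R → u1 y - u2 y ≠ 0 := fun y hy0 hy h => by
    refine hy0 (hmeet y y ?_).1
    rw [hg1.graph y hy, hg2.graph y hy, sub_eq_zero.1 h]
  have hbd : ∀ {ϕ u}, GraphDisk p b (range ϕ) ϕ u R K → ∀ y, ‖y‖ < R → |u y| < H := by
    intro ϕ u g y hy
    refine (g.quad y).trans_lt (lt_of_le_of_lt ?_ (hheight.trans (by linarith)))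
    gcongr
  have build : ∀ {ϕ ϕ' u u'}, GraphDisk p b (range ϕ) ϕ u R K →
      GraphDisk p b (range ϕ') ϕ' u' R K → frontier E ∩ U = range ϕ ∪ range ϕ' →
      (∀ y, R ≤ ‖y‖ → ϕ y ∉ openBox p b R H) → (∀ y, R ≤ ‖y‖ → ϕ' y ∉ openBox p b R H) →
      (∀ y, y ≠ 0 → ‖y‖ < R → u' y < u y) →
      ∃ s : Bool, ∀ q ∈ ball (0 : ℂ) R ×ˢ Ioo (-H) H, q.2 ≠ u q.1 → q.2 ≠ u' q.1 →
        (chart p b q ∈ E ↔ (q ∈ midRegion u u' ↔ s = true)) := by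
    intro ϕ ϕ' u u' g g' hfr ho ho' hlt
    have h0 : u 0 = 0 := by simpa using g.quad 0
    have h0' : u' 0 = 0 := by simpa using g'.quad 0
    refine exists_fill hEL g.smooth_height.continuous g'.smooth_height.continuous hR0 (hbd g)
      (hbd g') hlt (h0.trans h0'.symm) fun q hq => ?_
    have hqb : chart p b q ∈ openBox p b R H := ⟨q, hq, rfl⟩
    have hqU : chart p b q ∈ U := (hbox hqb).2
    have hqR : ‖q.1‖ < R := by simpa using hq.1
    have hone : ∀ {ϕ u}, GraphDisk p b (range ϕ) ϕ u R K →
        (∀ y, R ≤ ‖y‖ → ϕ y ∉ openBox p b R H) → (chart p b q ∈ range ϕ ↔ q.2 = u q.1) := by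
      intro ϕ u g ho
      constructor
      · rintro ⟨y, hy⟩
        have hyR : ‖y‖ < R := by
          by_contra h
          exact ho y (not_lt.1 h) (hy ▸ hqb)
        rw [g.graph y hyR] at hy
        have := chart_injective p b hy
        rw [← this]
      · intro h
        exact ⟨q.1, by rw [g.graph _ hqR, ← h]⟩
    rw [← hone g ho, ← hone g' ho', ← mem_union, ← hfr]
    exact ⟨fun h => ⟨h, hqU⟩, fun h => h.1⟩
  have hfr : frontier E ∩ U = range ϕ1 ∪ range ϕ2 := by rw [hS, g1.range_eq, g2.range_eq]
  have hsign : (∀ y, y ≠ 0 → ‖y‖ < R → u2 y < u1 y) ∨ ∀ y, y ≠ 0 → ‖y‖ < R → u1 y < u2 y := by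
    by_contra hcon
    rw [not_or] at hcon
    push Not at hcon
    obtain ⟨⟨y, hy0, hyR, hy⟩, z, hz0, hzR, hz⟩ := hcon
    obtain ⟨w, hw, hw'⟩ := (isPreconnected_puncturedBall R).intermediate_value
      (f := fun y => u1 y - u2 y) (a := y) (b := z) ⟨by simpa using hyR, hy0⟩
      ⟨by simpa using hzR, hz0⟩
      (hg1.smooth_height.continuous.sub hg2.smooth_height.continuous).continuousOn
      ⟨sub_nonpos.2 hy, sub_nonneg.2 hz⟩
    exact hne w hw.2 (by simpa using hw.1) hw'
  rcases hsign with hlt | hlt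
  · obtain ⟨s, hs⟩ := build hg1 hg2 hfr hout1 hout2 hlt
    exact ⟨b, ϕ1, ϕ2, u1, u2, R, H, K, s, hb0, hb1, hb2, hg1, hg2, hfr, hmeet,
      fun C hC hCc => g1.proper hφ1.closed hC hCc, fun C hC hCc => g2.proper hφ2.closed hC hCc,
      hout1, hout2, hbox.trans inter_subset_right, hcb, hRH2, hRone, hH, hheight, hlt, hs⟩
  · have hfr' : frontier E ∩ U = range ϕ2 ∪ range ϕ1 := by rw [hfr, union_comm]
    obtain ⟨s, hs⟩ := build hg2 hg1 hfr' hout2 hout1 hlt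
    exact ⟨b, ϕ2, ϕ1, u2, u1, R, H, K, s, hb0, hb1, hb2, hg2, hg1, hfr',
      fun y y' h => (hmeet y' y h.symm).symm,
      fun C hC hCc => g2.proper hφ2.closed hC hCc, fun C hC hCc => g1.proper hφ1.closed hC hCc,
      hout2, hout1, hbox.trans inter_subset_right, hcb, hRH2, hRone, hH, hheight, hlt, hs⟩

/-- A local model provides two sheets and a bump function in an annulus. -/
lemma LocalModel.exists_twoSheets (h : LocalModel U E p b ϕ1 ϕ2 u1 u2 R H K s) :
    ∃ ζ m, TwoSheets u1 u2 ζ (R / 4) (R / 2) R K m := by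
  have hR := h.disk1.pos
  have hu1 := h.disk1.smooth_height
  have hu2 := h.disk2.smooth_height
  let c₀ : ℂ := ((3 * R / 8 : ℝ) : ℂ)
  have hc₀ : ‖c₀‖ = 3 * R / 8 := by rw [Complex.norm_real, Real.norm_of_nonneg (by positivity)]
  let ζ : ContDiffBump c₀ := ⟨R / 32, R / 16, by positivity, by linarith⟩
  have hvan : ∀ y : ℂ, (‖y‖ ≤ R / 4 ∨ R / 2 ≤ ‖y‖) → ζ y = 0 := by
    intro y hy
    refine ζ.zero_of_le_dist ?_
    change R / 16 ≤ dist y c₀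
    have h1 := abs_norm_sub_norm_le y c₀
    rw [hc₀] at h1
    rw [dist_eq_norm]
    rcases hy with hy | hy
    · linarith [(abs_le.1 h1).1]
    · linarith [(abs_le.1 h1).2]
  have hcpt : IsCompact (closedBall (0 : ℂ) (R / 2) ∩ {y | R / 4 ≤ ‖y‖}) :=
    (isCompact_closedBall _ _).inter_right (isClosed_le continuous_const continuous_norm)
  have hne : (closedBall (0 : ℂ) (R / 2) ∩ {y | R / 4 ≤ ‖y‖}).Nonempty :=
    ⟨c₀, by simp only [mem_closedBall, dist_zero_right, hc₀]; linarith, by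
      simp only [mem_ofPred_eq, hc₀]; linarith⟩
  obtain ⟨y₀, hy₀, hmin⟩ := hcpt.exists_isMinOn hne (hu1.continuous.sub hu2.continuous).continuousOn
  have hy₀R : ‖y₀‖ < R := by
    have := hy₀.1
    rw [mem_closedBall, dist_zero_right] at this
    linarith
  have hy₀0 : y₀ ≠ 0 := fun h0 => by
    have := hy₀.2
    rw [h0, mem_ofPred_eq, norm_zero] at this
    linarith
  refine ⟨ζ, u1 y₀ - u2 y₀, hu1, hu2, ζ.contDiff, h.disk1.quad, h.disk2.quad, h.disk1.slope,
    h.disk2.slope, by positivity, by linarith [h.le_one], by linarith, by linarith, h.lt_of_ne,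
    sub_pos.2 (h.lt_of_ne y₀ hy₀0 hy₀R), fun y h1 h2 => ?_, fun y hy => hvan y (Or.inl hy),
    fun y hy => hvan y (Or.inr hy), fun y => ?_, ?_⟩
  · exact hmin (show y ∈ closedBall (0 : ℂ) (R / 2) ∩ {y | R / 4 ≤ ‖y‖} from
      ⟨by simpa using h2, h1⟩)
  · rw [abs_of_nonneg ζ.nonneg]
    exact ζ.le_one
  · rw [setIntegral_eq_integral_of_forall_compl_eq_zero]
    · exact ζ.integral_pos.ne'
    · intro y hy
      refine hvan y ?_
      by_contra hcon
      rw [not_or, not_le, not_le] at hcon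
      exact hy ⟨by simpa using hcon.2.le, by simpa using hcon.1⟩


/-! ### Ambient deformations of the form `x ↦ x + t X(x) + c(t) Y(x)` -/

section Ambient

variable {X Y : R3 → R3} {c : ℝ → ℝ} {C U : Set R3}

/-- The displacement of a point by two vector fields. -/
def displace (X Y : R3 → R3) (c : ℝ → ℝ) (t : ℝ) (x : R3) : R3 := x + (t • X x + c t • Y x)

lemma exists_fderiv_bound {T : R3 → R3} (hT : ContDiff ℝ 1 T) (hC : IsCompact C)
    (h0 : ∀ x ∉ C, T x = 0) : ∃ B, 0 < B ∧ ∀ x, ‖fderiv ℝ T x‖ ≤ B := by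
  obtain ⟨B, hB⟩ := ((HasCompactSupport.intro hC h0).fderiv ℝ).exists_bound_of_continuous
    (hT.continuous_fderiv one_ne_zero)
  exact ⟨max B 1, by positivity, fun x => (hB x).trans (le_max_left _ _)⟩

lemma exists_isAmbientDeformation (hX : ContDiff ℝ 1 X) (hY : ContDiff ℝ 1 Y)
    (hc : ContDiff ℝ 1 c) (hc0 : c 0 = 0) (hC : IsCompact C) (hCU : C ⊆ U)
    (hXC : ∀ x ∉ C, X x = 0) (hYC : ∀ x ∉ C, Y x = 0) :
    ∃ ε₀ > 0, ∀ ε, 0 < ε → ε ≤ ε₀ → IsAmbientDeformation U ε (displace X Y c) := by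
  obtain ⟨A, hA, hXA⟩ := exists_fderiv_bound hX hC hXC
  obtain ⟨B, hB, hYB⟩ := exists_fderiv_bound hY hC hYC
  have hsmall : ∀ᶠ t in 𝓝 (0 : ℝ), |t| < 1 / (4 * A) ∧ |c t| < 1 / (4 * B) := by
    refine (continuous_abs.tendsto' 0 0 abs_zero |>.eventually_lt_const (by positivity)).and ?_
    have : Tendsto (fun t => |c t|) (𝓝 0) (𝓝 0) := by
      have := hc.continuous.abs.tendsto 0
      simpa [hc0] using this
    exact this.eventually_lt_const (by positivity)
  obtain ⟨ε₀, hε₀, hε₀'⟩ := Metric.eventually_nhds_iff_ball.1 hsmall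
  refine ⟨ε₀, hε₀, fun ε hε hεε₀ => ?_⟩
  have hXd := fun x => (hX.differentiable one_ne_zero x).hasFDerivAt
  have hYd := fun x => (hY.differentiable one_ne_zero x).hasFDerivAt
  have hed : ∀ t x, HasFDerivAt (fun x => t • X x + c t • Y x)
      (t • fderiv ℝ X x + c t • fderiv ℝ Y x) x := fun t x =>
    ((hXd x).const_smul t).add ((hYd x).const_smul (c t))
  have hfd : ∀ t x, HasFDerivAt (displace X Y c t)
      (ContinuousLinearMap.id ℝ R3 + (t • fderiv ℝ X x + c t • fderiv ℝ Y x)) x := fun t x =>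
    (hasFDerivAt_id x).add (hed t x)
  have htime : ∀ t x, HasDerivAt (fun t => displace X Y c t x) (X x + deriv c t • Y x) t := by
    intro t x
    have h1 := ((hasDerivAt_id t).smul_const (X x)).add
      (((hc.differentiable one_ne_zero t).hasDerivAt).smul_const (Y x))
    have h2 := h1.const_add x
    simp only [one_smul] at h2
    exact h2
  have hbound : ∀ t ∈ Ioo (-ε) ε, ∀ x, ‖t • fderiv ℝ X x + c t • fderiv ℝ Y x‖ ≤ 1 / 2 := by
    intro t ht x
    obtain ⟨h1, h2⟩ := hε₀' t (by
      rw [mem_ball_zero_iff, Real.norm_eq_abs, abs_lt]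
      exact ⟨by linarith [ht.1], by linarith [ht.2]⟩)
    refine (norm_add_le _ _).trans ?_
    rw [norm_smul, norm_smul, Real.norm_eq_abs, Real.norm_eq_abs]
    have e1 : |t| * ‖fderiv ℝ X x‖ ≤ 1 / (4 * A) * A :=
      mul_le_mul h1.le (hXA x) (norm_nonneg _) (by positivity)
    have e2 : |c t| * ‖fderiv ℝ Y x‖ ≤ 1 / (4 * B) * B :=
      mul_le_mul h2.le (hYB x) (norm_nonneg _) (by positivity)
    have e3 : 1 / (4 * A) * A = 1 / 4 := by field_simp
    have e4 : 1 / (4 * B) * B = 1 / 4 := by field_simp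
    linarith
  have hzero : ∀ x ∉ C, ∀ t, displace X Y c t x = x := fun x hx t => by
    simp [displace, hXC x hx, hYC x hx]
  refine ⟨hε, ?_, ⟨fun t x => fderiv ℝ X x + deriv c t • fderiv ℝ Y x, ?_, ?_⟩, fun t ht => ?_,
    fun x => by simp [displace, hc0], fun t _ x hx => hzero x (fun h => hx (hCU h)) t, ?_⟩
  · refine ContDiff.contDiffOn ?_
    exact contDiff_snd.add ((contDiff_fst.smul (hX.comp contDiff_snd)).add
      ((hc.comp contDiff_fst).smul (hY.comp contDiff_snd)))
  · intro t _ x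
    have h1 : (fun s => fderiv ℝ (displace X Y c s) x) = fun s =>
        ContinuousLinearMap.id ℝ R3 + (s • fderiv ℝ X x + c s • fderiv ℝ Y x) :=
      funext fun s => (hfd s x).fderiv
    rw [h1]
    have h2 := ((hasDerivAt_id t).smul_const (fderiv ℝ X x)).add
      (((hc.differentiable one_ne_zero t).hasDerivAt).smul_const (fderiv ℝ Y x))
    simpa using h2.const_add (ContinuousLinearMap.id ℝ R3)
  · refine Continuous.continuousOn ?_
    exact ((hX.continuous_fderiv one_ne_zero).comp continuous_snd).add
      (((hc.continuous_deriv le_rfl).comp continuous_fst).smul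
        ((hY.continuous_fderiv one_ne_zero).comp continuous_snd))
  · obtain ⟨⟨k, hk⟩, hinj⟩ := exists_homeomorph_id_add (E := R3)
      (e := fun x => t • X x + c t • Y x)
      (fun x => (hed t x).differentiableAt) (fun x => by
        rw [(hed t x).fderiv]
        exact hbound t ht x)
    have hkψ : ⇑k = displace X Y c t := funext hk
    let L : R3 → R3 ≃L[ℝ] R3 := fun x => (LinearEquiv.ofInjectiveEndo
      (fderiv ℝ (displace X Y c t) x : R3 →ₗ[ℝ] R3) (hinj x)).toContinuousLinearEquiv
    refine ⟨k.symm, k.contDiff_symm (f₀' := L) (fun x => ?_) ?_, fun x => ?_, fun x => ?_⟩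
    · have : ((L x : R3 ≃L[ℝ] R3) : R3 →L[ℝ] R3) = fderiv ℝ (displace X Y c t) x := by
        ext1 v
        rfl
      rw [this, hkψ]
      exact (hfd t x).differentiableAt.hasFDerivAt
    · rw [hkψ]
      exact contDiff_id.add ((hX.const_smul t).add (hY.const_smul (c t)))
    · rw [← hkψ]
      exact k.symm_apply_apply x
    · rw [← hkψ]
      exact k.apply_symm_apply x
  · have hv : (fun x => deriv (fun t => displace X Y c t x) 0) = fun x => X x + deriv c 0 • Y x :=
      funext fun x => (htime 0 x).deriv
    have hv0 : ∀ x ∉ C, X x + deriv c 0 • Y x = 0 := fun x hx => by simp [hXC x hx, hYC x hx]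
    rw [hv]
    refine ⟨hX.add (hY.const_smul (deriv c 0)), HasCompactSupport.intro hC hv0, ?_⟩
    refine (closure_minimal (fun x hx => ?_) hC.isClosed).trans hCU
    by_contra hxC
    exact hx (hv0 x hxC)

end Ambient


/-! ### Energy and volume of sets bounded by stretched sheets -/

/-- Smallness conditions on the time `t` and the correction `c`. -/
structure Admissible (χ : ℝ → ℝ) (M m H t c : ℝ) : Prop where
  time : |t| * M ≤ 1 / 2
  sign : 0 ≤ t * χ 0
  lt_gap : |c| < m
  lt_height : |c| < H / 4

lemma collapse_zero_time {χ : ℝ → ℝ} {R M : ℝ} (h : IsProfile χ R M) (y : ℂ) :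
    collapse χ 0 y = y := by
  rcases eq_or_ne y 0 with rfl | hy
  · simp [collapse]
  · have hy' : ‖y‖ ≠ 0 := norm_ne_zero_iff.2 hy
    have h1 := collapse_stretch h (t := 0) (by simp) (by simp) (norm_nonneg y)
      (w := (‖y‖⁻¹ : ℝ) • y) (by rw [norm_smul, norm_inv, norm_norm, inv_mul_cancel₀ hy'])
    have h2 : ‖y‖ • (‖y‖⁻¹ : ℝ) • y = y := by rw [smul_smul, mul_inv_cancel₀ hy', one_smul]
    have h3 : stretch χ 0 ‖y‖ = ‖y‖ := by simp [stretch]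
    rwa [h3, h2] at h1

lemma admissible_zero {χ : ℝ → ℝ} {M m H : ℝ} (hm : 0 < m) (hH : 0 < H) : Admissible χ M m H 0 0 :=
  ⟨by simp, by simp, by simpa using hm, by simpa using by linarith⟩

/-- Small times are admissible for the volume correction. -/
lemma eventually_admissible {u1 u2 ζ χ : _} {R1 R' M m H : ℝ} (hm : 0 < m) (hH : 0 < H) :
    ∀ᶠ t in 𝓝 (0 : ℝ), 0 ≤ t * χ 0 →
      Admissible χ M m H t (correction u1 u2 ζ R1 R' χ t) := by
  have h1 : Tendsto (fun t : ℝ => |t| * M) (𝓝 0) (𝓝 0) := by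
    have : Continuous fun t : ℝ => |t| * M := continuous_abs.mul continuous_const
    simpa using this.tendsto 0
  have h2 : Tendsto (fun t => |correction u1 u2 ζ R1 R' χ t|) (𝓝 0) (𝓝 0) := by
    have hc : Continuous (correction u1 u2 ζ R1 R' χ) :=
      continuous_iff_continuousAt.2 fun t => (TwoSheets.hasDerivAt_correction t).continuousAt
    have := hc.abs.tendsto 0
    simpa [correction] using this
  filter_upwards [h1.eventually_le_const (show (0 : ℝ) < 1 / 2 by norm_num),
    h2.eventually_lt_const hm, h2.eventually_lt_const (show 0 < H / 4 by linarith)]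
    with t a1 a2 a3 a0 using ⟨a1, a0, a2, a3⟩

variable {U E F : Set R3} {p : R3} {b : Frame} {ϕ1 ϕ2 : ℂ → R3} {u1 u2 ζ : ℂ → ℝ}
  {R H K m M t c r L ε : ℝ} {s : Bool} {χ : ℝ → ℝ} {k : ℂ × ℝ → ℝ} {g : R3 → ℝ} {P : Submodule ℝ R3}
  (h : LocalModel U E p b ϕ1 ϕ2 u1 u2 R H K s) (T : TwoSheets u1 u2 ζ (R / 4) (R / 2) R K m)
  (hχ : IsProfile χ (R / 4) M) (ha : Admissible χ M m H t c)

namespace LocalModel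

include h in
lemma abs_height_lt1 {y : ℂ} (hy : ‖y‖ < R) :
    |u1 y| < H / 4 := by
  have hK : 0 ≤ K := by simpa using (abs_nonneg _).trans (h.disk1.quad 1)
  refine (h.disk1.quad y).trans_lt (lt_of_le_of_lt ?_ h.height)
  gcongr

include h in
lemma abs_height_lt2 {y : ℂ} (hy : ‖y‖ < R) :
    |u2 y| < H / 4 := by
  have hK : 0 ≤ K := by simpa using (abs_nonneg _).trans (h.disk1.quad 1)
  refine (h.disk2.quad y).trans_lt (lt_of_le_of_lt ?_ h.height)
  gcongr

include h hχ in
lemma norm_collapse_lt (ht : |t| * M ≤ 1 / 2) {y : ℂ} (hy : ‖y‖ < R) : ‖collapse χ t y‖ < R := by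
  have hR := h.disk1.pos
  rcases le_total ‖y‖ (R / 4) with h1 | h1
  · exact (norm_collapse_le_of_le hχ ht le_rfl h1).trans_lt (by linarith)
  · rwa [collapse_of_ge hχ ht h1]

include h hχ in
lemma abs_lowerSheet_lt (ht : |t| * M ≤ 1 / 2) {y : ℂ} (hy : ‖y‖ < R) :
    |lowerSheet u2 χ t y| < H / 4 :=
  h.abs_height_lt2 (h.norm_collapse_lt hχ ht hy)

include h T hχ ha in
lemma abs_upperSheet_lt {y : ℂ} (hy : ‖y‖ < R) : |upperSheet u1 ζ χ c t y| < H / 2 := by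
  have h1 := h.abs_height_lt1 (h.norm_collapse_lt hχ ha.time hy)
  have h2 : |c * ζ y| < H / 4 := by
    rw [abs_mul]
    exact (mul_le_of_le_one_right (abs_nonneg _) (T.bump_le y)).trans_lt ha.lt_height
  have := abs_add_le (u1 (collapse χ t y)) (c * ζ y)
  rw [upperSheet]
  linarith

include h hχ in
lemma fillsBox_self : FillsBox p b R H s E (upperSheet u1 ζ χ 0 0) (lowerSheet u2 χ 0) := by
  have e1 : upperSheet u1 ζ χ 0 0 = u1 := funext fun y => by
    simp [upperSheet, collapse_zero_time hχ]
  have e2 : lowerSheet u2 χ 0 = u2 := funext fun y => by simp [lowerSheet, collapse_zero_time hχ]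
  rw [e1, e2]
  have n1 := measure_graph_eq_zero h.disk1.smooth_height.continuous
  have n2 := measure_graph_eq_zero h.disk2.smooth_height.continuous
  filter_upwards [measure_eq_zero_iff_ae_notMem.1 n1, measure_eq_zero_iff_ae_notMem.1 n2]
    with q h1 h2 hq using h.fill q hq h1 h2

include h T hχ in
/-- The energy of a set bounded by the stretched sheets. -/
lemma energy_eq
    (hk : Continuous k) (hgk : ∀ q ∈ closedBall (0 : ℂ) (R / 2) ×ˢ Icc (-(H / 2)) (H / 2),
      g (chart p b q) = k q) (hg : IntegrableOn g U) (hper : perimeter U E ≠ ⊤)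
    (hE : MeasurableSet E) (hF : MeasurableSet F)
    (ha : Admissible χ M m H t (correction u1 u2 ζ (R / 4) (R / 2) χ t))
    (hfill : FillsBox p b R H s F
      (upperSheet u1 ζ χ (correction u1 u2 ζ (R / 4) (R / 2) χ t) t) (lowerSheet u2 χ t))
    (hEF : F \ closedBox p b (R / 2) (H / 2) = E \ closedBox p b (R / 2) (H / 2)) :
    energy g U F = energyOutside g U E (closedBox p b (R / 2) (H / 2)) s +
      stretchedEnergy k (boolSign s) u1 u2 ζ (R / 4) (R / 2) χ t := by
  have hR := h.disk1.pos
  have hH := h.height_pos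
  rw [energy_of_fillsBox hk hgk hg hper hE hF hfill (T.contDiff_upperSheet hχ ha.time ha.sign _)
    (T.contDiff_lowerSheet hχ ha.time ha.sign)
    (fun y hy => T.lowerSheet_le_upperSheet hχ ha.time ha.sign ha.lt_gap (by simpa using hy))
    (fun y hy => h.abs_upperSheet_lt T hχ ha (by simpa using hy))
    (fun y hy => (h.abs_lowerSheet_lt hχ ha.time (by simpa using hy)).trans (by linarith))
    (by linarith) (by linarith) h.box_subset hEF,
    T.gapArea_add_bulk hχ hk ha.time ha.sign ha.lt_gap, stretchedEnergy]

include h T hχ in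
/-- The volume of a set bounded by the stretched sheets. -/
lemma volume_eq (hE : MeasurableSet E) (hF : MeasurableSet F)
    (ha : Admissible χ M m H t (correction u1 u2 ζ (R / 4) (R / 2) χ t))
    (hfill : FillsBox p b R H s F
      (upperSheet u1 ζ χ (correction u1 u2 ζ (R / 4) (R / 2) χ t) t) (lowerSheet u2 χ t)) :
    volume (F ∩ closedBox p b (R / 2) (H / 2)) = volume (E ∩ closedBox p b (R / 2) (H / 2)) := by
  have hR := h.disk1.pos
  have hH := h.height_pos
  have ha0 := admissible_zero (χ := χ) (M := M) T.gap_pos hH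
  exact volume_inter_closedBox_congr hF hfill
    (T.contDiff_upperSheet hχ ha.time ha.sign _).continuous
    (T.contDiff_lowerSheet hχ ha.time ha.sign).continuous
    (fun y hy => T.lowerSheet_le_upperSheet hχ ha.time ha.sign ha.lt_gap (by simpa using hy))
    (fun y hy => h.abs_upperSheet_lt T hχ ha (by simpa using hy))
    (fun y hy => (h.abs_lowerSheet_lt hχ ha.time (by simpa using hy)).trans (by linarith))
    hE (h.fillsBox_self hχ)
    (T.contDiff_upperSheet hχ ha0.time ha0.sign _).continuous
    (T.contDiff_lowerSheet hχ ha0.time ha0.sign).continuous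
    (fun y hy => T.lowerSheet_le_upperSheet hχ ha0.time ha0.sign ha0.lt_gap (by simpa using hy))
    (fun y hy => h.abs_upperSheet_lt T hχ ha0 (by simpa using hy))
    (fun y hy => (h.abs_lowerSheet_lt hχ ha0.time (by simpa using hy)).trans (by linarith))
    (by linarith) (by linarith) (T.bulk_one_correction hχ ha.time ha.sign)

include h in
/-- The part of `E` in the box lies in one connected component of `closure E ∩ U`. -/
lemma exists_preconnected :
    ∃ S : Set R3, IsPreconnected S ∧ S ⊆ closure E ∩ U ∧ E ∩ openBox p b R H ⊆ S := by
  have hR := h.disk1.pos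
  have hH := h.height_pos
  have hc := (chartHomeo p b).continuous
  have hu1 := h.disk1.smooth_height.continuous
  have hu2 := h.disk2.smooth_height.continuous
  have h01 : u1 0 = 0 := by simpa using h.disk1.quad 0
  have h02 : u2 0 = 0 := by simpa using h.disk2.quad 0
  have hle : ∀ y, ‖y‖ < R → u2 y ≤ u1 y := fun y hy => by
    rcases eq_or_ne y 0 with rfl | hy0
    · rw [h01, h02]
    · exact (h.lt_of_ne y hy0 hy).le
  have hcl : ∀ q ∈ ball (0 : ℂ) R ×ˢ Ioo (-H) H,
      (q.2 ≠ u1 q.1 → q.2 ≠ u2 q.1 → (q ∈ midRegion u1 u2 ↔ s = true)) →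
      chart p b q ∈ closure E ∩ U := by
    intro q hq hmid
    have hqR : ‖q.1‖ < R := by simpa using hq.1
    refine ⟨?_, h.box_subset ⟨q, hq, rfl⟩⟩
    by_cases h1 : q.2 = u1 q.1
    · have : chart p b q ∈ frontier E ∩ U := by
        rw [h.frontier_eq]
        exact Or.inl ⟨q.1, by rw [h.disk1.graph _ hqR, ← h1]⟩
      exact this.1.1
    by_cases h2 : q.2 = u2 q.1
    · have : chart p b q ∈ frontier E ∩ U := by
        rw [h.frontier_eq]
        exact Or.inr ⟨q.1, by rw [h.disk2.graph _ hqR, ← h2]⟩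
      exact this.1.1
    exact subset_closure ((h.fill q hq h1 h2).2 (hmid h1 h2))
  have hpre : ∀ r : ℂ × ℝ → ℝ, Continuous r → IsPreconnected
      ((fun q => (q.1, r q)) '' (ball (0 : ℂ) R ×ˢ Ioo (-H) H)) := fun r hr =>
    ((convex_ball (0 : ℂ) R).isPreconnected.prod isPreconnected_Ioo).image _
      (continuous_fst.prodMk hr).continuousOn
  have c1 := hu1.comp (continuous_fst (Y := ℝ))
  have c2 := hu2.comp (continuous_fst (Y := ℝ))
  have hb1 : ∀ q ∈ ball (0 : ℂ) R ×ˢ Ioo (-H) H, |u1 q.1| < H / 4 := fun q hq =>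
    h.abs_height_lt1 (by simpa using hq.1)
  have hb2 : ∀ q ∈ ball (0 : ℂ) R ×ˢ Ioo (-H) H, |u2 q.1| < H / 4 := fun q hq =>
    h.abs_height_lt2 (by simpa using hq.1)
  have h0 : (0 : ℂ × ℝ) ∈ ball (0 : ℂ) R ×ˢ Ioo (-H) H := by simp [hR, hH]
  cases s
  · refine ⟨chart p b '' (_ ∪ _), (IsPreconnected.union 0 (by exact ⟨0, h0, by simp [h01]⟩)
      (by exact ⟨0, h0, by simp [h02]⟩) (hpre _ (continuous_snd.max c1)) (hpre _ (continuous_snd.min c2))).image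
        _ hc.continuousOn, ?_, ?_⟩
    · rintro _ ⟨_, ⟨q, hq, rfl⟩ | ⟨q, hq, rfl⟩, rfl⟩
      · refine hcl _ ⟨hq.1, lt_max_of_lt_left hq.2.1, max_lt hq.2.2 ?_⟩ fun _ _ => ?_
        · have := abs_lt.1 (hb1 q hq)
          simp only [Function.comp]
          linarith
        · simp [midRegion]
      · refine hcl _ ⟨hq.1, lt_min hq.2.1 ?_, min_lt_of_left_lt hq.2.2⟩ fun _ _ => ?_
        · have := abs_lt.1 (hb2 q hq)
          simp only [Function.comp]
          linarith
        · simp [midRegion]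
    · rintro _ ⟨hxE, q, hq, rfl⟩
      refine ⟨q, ?_, rfl⟩
      rcases le_or_gt (u1 q.1) q.2 with a1 | a1
      · exact Or.inl ⟨q, hq, Prod.ext rfl (max_eq_left a1)⟩
      rcases le_or_gt q.2 (u2 q.1) with a2 | a2
      · exact Or.inr ⟨q, hq, Prod.ext rfl (min_eq_left a2)⟩
      · simpa using ((h.fill q hq a1.ne a2.ne').1 hxE).1 ⟨a2, a1⟩
  · refine ⟨chart p b '' _, (hpre _ ((continuous_snd.min c1).max c2)).image _ hc.continuousOn, ?_, ?_⟩
    · rintro _ ⟨_, ⟨q, hq, rfl⟩, rfl⟩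
      have b1 := abs_lt.1 (hb1 q hq)
      have b2 := abs_lt.1 (hb2 q hq)
      refine hcl _ ⟨hq.1, lt_max_of_lt_right (by simp only [Function.comp]; linarith),
        max_lt (min_lt_of_left_lt hq.2.2) (by simp only [Function.comp]; linarith)⟩ fun n1 n2 => ?_
      exact iff_of_true ⟨lt_of_le_of_ne (le_max_right _ _) (Ne.symm n2), lt_of_le_of_ne
        (max_le (min_le_right _ _) (hle q.1 (by simpa using hq.1))) n1⟩ rfl
    · rintro _ ⟨hxE, q, hq, rfl⟩
      have hl := hle q.1 (by simpa using hq.1)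
      have hmem : u2 q.1 ≤ q.2 ∧ q.2 ≤ u1 q.1 := by
        by_cases h1 : q.2 = u1 q.1
        · exact ⟨h1 ▸ hl, h1.le⟩
        by_cases h2 : q.2 = u2 q.1
        · exact ⟨h2.ge, h2 ▸ hl⟩
        have := ((h.fill q hq h1 h2).1 hxE).2 rfl
        exact ⟨this.1.le, this.2.le⟩
      refine ⟨q, ⟨q, hq, Prod.ext rfl ?_⟩, rfl⟩
      simp [hmem.1, hmem.2]

end LocalModel


/-! ### The ambient flow that stretches the sheets -/

/-- A smooth even function equal to `1` on `[-r/2, r/2]` and to `0` outside `(-r, r)`. -/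
def vertCut (r τ : ℝ) : ℝ := stepProfile (r ^ 2) (τ ^ 2)

lemma contDiff_vertCut (r : ℝ) : ContDiff ℝ ∞ (vertCut r) :=
  (contDiff_stepProfile _).comp (contDiff_id.pow 2)

lemma vertCut_of_le {r τ : ℝ} (hr : 0 < r) (h : |τ| ≤ r / 2) : vertCut r τ = 1 := by
  refine stepProfile_of_le (by positivity) ?_
  rw [← sq_abs τ]
  nlinarith [abs_nonneg τ]

lemma vertCut_of_ge {r τ : ℝ} (hr : 0 < r) (h : r ≤ |τ|) : vertCut r τ = 0 := by
  refine stepProfile_of_ge (by positivity) ?_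
  rw [← sq_abs τ]
  gcongr

lemma vertCut_mem (r τ : ℝ) : vertCut r τ ∈ Icc (0 : ℝ) 1 :=
  ⟨Real.smoothTransition.nonneg _, Real.smoothTransition.le_one _⟩

lemma exists_lipschitz_vertCut {r : ℝ} (hr : 0 < r) :
    ∃ L, 0 < L ∧ ∀ a c, |vertCut r a - vertCut r c| ≤ L * |a - c| := by
  have hs : HasCompactSupport (vertCut r) := HasCompactSupport.intro (isCompact_Icc (a := -r) (b := r))
    fun τ hτ => vertCut_of_ge hr (le_of_not_gt fun hlt => hτ ⟨(abs_lt.1 hlt).1.le, (abs_lt.1 hlt).2.le⟩)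
  obtain ⟨L, hL⟩ := ContDiff.lipschitzWith_of_hasCompactSupport hs (contDiff_vertCut r) (by simp)
  refine ⟨L + 1, by positivity, fun a c => ?_⟩
  have := hL.dist_le_mul a c
  rw [Real.dist_eq, Real.dist_eq] at this
  nlinarith [abs_nonneg (a - c)]

/-- The radial vector field of size `χ(‖y‖)`. -/
def radialField (χ : ℝ → ℝ) (y : ℂ) : ℂ := (χ ‖y‖ / ‖y‖) • y

lemma contDiff_radialField {χ : ℝ → ℝ} {R M : ℝ} (h : IsProfile χ R M) (h0 : χ 0 = 0) :
    ContDiff ℝ ∞ (radialField χ) := by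
  rw [contDiff_iff_contDiffAt]
  intro y
  rcases eq_or_ne y 0 with rfl | hy
  · obtain ⟨ρ₀, hρ₀, hc⟩ := h.const_near
    refine (contDiffAt_const (c := (0 : ℂ))).congr_of_eventuallyEq ?_
    filter_upwards [ball_mem_nhds (0 : ℂ) hρ₀] with z hz
    rw [mem_ball_zero_iff] at hz
    simp [radialField, hc _ hz.le, h0]
  · have hn : ContDiffAt ℝ ∞ (fun y : ℂ => ‖y‖) y := contDiffAt_norm ℝ hy
    exact ((h.smooth.contDiffAt.comp y hn).div hn (norm_ne_zero_iff.2 hy)).smul contDiffAt_id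

lemma radialField_smul {χ : ℝ → ℝ} {ρ : ℝ} (hρ : 0 < ρ) {w : ℂ} (hw : ‖w‖ = 1) :
    radialField χ (ρ • w) = χ ρ • w := by
  have : ‖ρ • w‖ = ρ := by rw [norm_smul, hw, mul_one, Real.norm_of_nonneg hρ.le]
  rw [radialField, this, smul_smul, div_mul_cancel₀ _ hρ.ne']

/-- The flow that stretches the plane radially by `χ` and moves the graph of `u` up by `c ζ`. -/
def flowMap (χ : ℝ → ℝ) (ζ u : ℂ → ℝ) (r H c t : ℝ) (q : ℂ × ℝ) : ℂ × ℝ :=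
  (q.1 + (t * vertCut (H / 2) q.2) • radialField χ q.1, q.2 + c * (ζ q.1 * vertCut r (q.2 - u q.1)))

lemma cmp_eq_cmp_of_abs_lt {h a a' d : ℝ} (ha : |a| < d) (ha' : |a'| < d) (hd : d ≤ |h|) :
    cmp h a = cmp h a' := by
  rw [abs_lt] at ha ha'
  rcases le_abs.1 hd with hd | hd
  · rw [(cmp_eq_gt_iff _ _).2 (by linarith : a < h), (cmp_eq_gt_iff _ _).2 (by linarith : a' < h)]
  · rw [(cmp_eq_lt_iff _ _).2 (by linarith : h < a), (cmp_eq_lt_iff _ _).2 (by linarith : h < a')]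

namespace LocalModel

include h T hχ in
lemma cmp_flowMap (hχ0 : χ 0 = 0) (ha : Admissible χ M m H t c) (hr : 0 < r) (hrm : r ≤ m)
    (hL : ∀ a c, |vertCut r a - vertCut r c| ≤ L * |a - c|) (hcL : |c| * L < 1)
    {q : ℂ × ℝ} (hq : ‖q.1‖ < R) :
    cmp q.2 (u1 q.1) = cmp (flowMap χ ζ u1 r H c t q).2
        (upperSheet u1 ζ χ c t (flowMap χ ζ u1 r H c t q).1) ∧
      cmp q.2 (u2 q.1) = cmp (flowMap χ ζ u1 r H c t q).2
        (lowerSheet u2 χ t (flowMap χ ζ u1 r H c t q).1) := by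
  obtain ⟨y, z⟩ := q
  simp only at hq
  have hR := h.disk1.pos
  have hH := h.height_pos
  rcases lt_or_ge ‖y‖ (R / 4) with hy | hy
  · have hz0 : ζ y = 0 := T.bump_inner y hy.le
    set v := vertCut (H / 2) z with hv
    have hv01 : v ∈ Icc (0 : ℝ) 1 := vertCut_mem _ _
    obtain ⟨ρ, hρ, w, hw, rfl⟩ : ∃ ρ : ℝ, 0 ≤ ρ ∧ ∃ w : ℂ, ‖w‖ = 1 ∧ y = ρ • w := by
      rcases eq_or_ne y 0 with rfl | hy0
      · exact ⟨0, le_rfl, 1, by simp, by simp⟩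
      · have hn := norm_ne_zero_iff.2 hy0
        exact ⟨‖y‖, norm_nonneg _, (‖y‖⁻¹ : ℝ) • y,
          by rw [norm_smul, norm_inv, norm_norm, inv_mul_cancel₀ hn],
          by rw [smul_smul, mul_inv_cancel₀ hn, one_smul]⟩
    have hn : ‖ρ • w‖ = ρ := by rw [norm_smul, hw, mul_one, Real.norm_of_nonneg hρ]
    rw [hn] at hy hq
    have hrad : radialField χ (ρ • w) = χ ρ • w := by
      rcases hρ.eq_or_lt with rfl | hρ'
      · simp [radialField, hχ0]
      · exact radialField_smul hρ' hw
    have hf : flowMap χ ζ u1 r H c t (ρ • w, z) = ((ρ + t * v * χ ρ) • w, z) := by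
      simp only [flowMap, hrad, hz0, ← hv, smul_smul, add_smul, zero_mul, mul_zero, add_zero]
    rw [hf]
    have hs0 : 0 ≤ stretch χ t ρ := by linarith [hχ.stretch_pos ha.time ha.sign hρ]
    have hs1 : stretch χ t ρ < R / 4 := by
      rw [← hχ.stretch_of_ge t le_rfl]
      exact hχ.strictMono ha.time hy
    have hval : ρ + t * v * χ ρ = (1 - v) * ρ + v * stretch χ t ρ := by rw [stretch]; ring
    have hn' : ‖(ρ + t * v * χ ρ) • w‖ ≤ R / 4 := by
      rw [norm_smul, hw, mul_one, Real.norm_eq_abs, hval, abs_of_nonneg]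
      · nlinarith [hv01.1, hv01.2]
      · have := hv01.1
        have := sub_nonneg.2 hv01.2
        positivity
    have hup : upperSheet u1 ζ χ c t ((ρ + t * v * χ ρ) • w) =
        u1 (collapse χ t ((ρ + t * v * χ ρ) • w)) := by
      rw [upperSheet, T.bump_inner _ hn', mul_zero, add_zero]
    simp only [hup, lowerSheet]
    rcases le_total |z| (H / 4) with hz | hz
    · have hv1 : v = 1 := vertCut_of_le (by positivity) (by linarith)
      have : (ρ + t * v * χ ρ) • w = stretch χ t ρ • w := by rw [hv1, mul_one, stretch]
      rw [this, collapse_stretch hχ ha.time ha.sign hρ hw]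
      exact ⟨rfl, rfl⟩
    · have hlt : ‖(ρ + t * v * χ ρ) • w‖ < R := hn'.trans_lt (by linarith)
      have hcl := h.norm_collapse_lt hχ ha.time hlt
      exact ⟨cmp_eq_cmp_of_abs_lt (h.abs_height_lt1 (by rwa [hn])) (h.abs_height_lt1 hcl) hz,
        cmp_eq_cmp_of_abs_lt (h.abs_height_lt2 (by rwa [hn])) (h.abs_height_lt2 hcl) hz⟩
  · have hrad : radialField χ y = 0 := by simp [radialField, hχ.eq_zero _ hy]
    set θ : ℝ → ℝ := fun z => z + c * (ζ y * vertCut r (z - u1 y)) with hθ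
    have hf : flowMap χ ζ u1 r H c t (y, z) = (y, θ z) := by simp [flowMap, hrad, hθ]
    have hmono : StrictMono θ := by
      intro a d had
      have h1 := hL (d - u1 y) (a - u1 y)
      have e1 : d - u1 y - (a - u1 y) = d - a := by ring
      rw [e1, abs_of_pos (sub_pos.2 had)] at h1
      have h2 : |c * (ζ y * (vertCut r (d - u1 y) - vertCut r (a - u1 y)))| < d - a := by
        rw [abs_mul, abs_mul]
        calc |c| * (|ζ y| * |vertCut r (d - u1 y) - vertCut r (a - u1 y)|)
            ≤ |c| * (1 * (L * (d - a))) := by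
              gcongr
              exact T.bump_le y
          _ = |c| * L * (d - a) := by ring
          _ < 1 * (d - a) := by gcongr
          _ = d - a := one_mul _
      have h3 := (abs_lt.1 h2).1
      simp only [hθ]
      linarith
    have hcoll : collapse χ t y = y := collapse_of_ge hχ ha.time hy
    have e1 : upperSheet u1 ζ χ c t y = θ (u1 y) := by
      simp only [upperSheet, hcoll, hθ, sub_self]
      rw [vertCut_of_le hr (by simpa using by positivity), mul_one]
    have e2 : lowerSheet u2 χ t y = θ (u2 y) := by
      simp only [lowerSheet, hcoll, hθ]
      rcases lt_or_ge ‖y‖ (R / 2) with hy2 | hy2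
      · have := T.gap y hy hy2.le
        rw [vertCut_of_ge hr, mul_zero, mul_zero, add_zero]
        rw [abs_sub_comm]
        exact (hrm.trans this).trans (le_abs_self _)
      · simp [T.bump_outer y hy2]
    rw [hf]
    simp only [e1, e2, hmono.cmp_map_eq, and_self]

end LocalModel


section Supported

variable {f : R3 → R3} {C A : Set R3}

lemma apply_mem_iff_of_eq_off (hf : Function.Injective f) (hC : ∀ x ∉ C, f x = x) (x : R3) :
    f x ∈ C ↔ x ∈ C := by
  by_cases hx : x ∈ C
  · refine iff_of_true (by_contra fun hfx => ?_) hx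
    exact hfx (by rwa [hf (hC _ hfx)])
  · rw [hC x hx]

lemma image_sdiff_of_eq_off (hf : Function.Injective f) (hC : ∀ x ∉ C, f x = x) :
    f '' A \ C = A \ C := by
  ext x
  constructor
  · rintro ⟨⟨y, hy, rfl⟩, hx⟩
    rw [apply_mem_iff_of_eq_off hf hC] at hx
    rw [hC y hx]
    exact ⟨hy, hx⟩
  · rintro ⟨hx, hxC⟩
    exact ⟨⟨x, hx, hC x hxC⟩, hxC⟩

lemma image_inter_of_eq_off (hf : Function.Injective f) (hC : ∀ x ∉ C, f x = x) :
    f '' A ∩ C = f '' (A ∩ C) := by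
  ext x
  constructor
  · rintro ⟨⟨y, hy, rfl⟩, hx⟩
    exact ⟨y, ⟨hy, (apply_mem_iff_of_eq_off hf hC y).1 hx⟩, rfl⟩
  · rintro ⟨y, ⟨hy, hyC⟩, rfl⟩
    exact ⟨⟨y, hy, rfl⟩, (apply_mem_iff_of_eq_off hf hC y).2 hyC⟩

end Supported

/-- The horizontal vector field of the stretching flow. -/
def stretchField (p : R3) (b : Frame) (χ : ℝ → ℝ) (H : ℝ) (x : R3) : R3 :=
  frameMap b (vertCut (H / 2) (chartInv p b x).2 • radialField χ (chartInv p b x).1, 0)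

/-- The vertical vector field of the stretching flow. -/
def liftField (p : R3) (b : Frame) (ζ u : ℂ → ℝ) (r : ℝ) (x : R3) : R3 :=
  frameMap b (0, ζ (chartInv p b x).1 * vertCut r ((chartInv p b x).2 - u (chartInv p b x).1))

lemma displace_chart (p : R3) (b : Frame) (χ : ℝ → ℝ) (ζ u : ℂ → ℝ)
    (r H : ℝ) (c : ℝ → ℝ) (t : ℝ) (q : ℂ × ℝ) :
    displace (stretchField p b χ H) (liftField p b ζ u r) c t (chart p b q) =
      chart p b (flowMap χ ζ u r H (c t) t q) := by
  rw [displace, stretchField, liftField, chartInv_chart, chart_eq, chart_eq, ← map_smul, ← map_smul,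
    ← map_add, add_assoc, ← map_add]
  congr 2
  ext <;> simp [flowMap, mul_assoc]

lemma contDiff_stretchField {p : R3} {b : Frame} {χ : ℝ → ℝ} {H R M : ℝ}
    (h : IsProfile χ R M) (h0 : χ 0 = 0) : ContDiff ℝ 1 (stretchField p b χ H) := by
  have hi := contDiff_chartInv p b (n := 1)
  have h1 := ((contDiff_vertCut (H / 2)).of_le (mod_cast le_top)).comp hi.snd
  have h2 := ((contDiff_radialField h h0).of_le (mod_cast le_top)).comp hi.fst
  exact (frameMap b).contDiff.comp ((h1.smul h2).prodMk contDiff_const)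

lemma contDiff_liftField {p : R3} {b : Frame} {ζ u : ℂ → ℝ} {r : ℝ}
    (hζ : ContDiff ℝ 1 ζ) (hu : ContDiff ℝ 1 u) : ContDiff ℝ 1 (liftField p b ζ u r) := by
  have hi := contDiff_chartInv p b (n := 1)
  refine (frameMap b).contDiff.comp (contDiff_const.prodMk (ContDiff.mul (hζ.comp hi.fst) ?_))
  exact ((contDiff_vertCut _).of_le (mod_cast le_top)).comp (hi.snd.sub (hu.comp hi.fst))

lemma contDiff_correction {u1 u2 ζ : ℂ → ℝ} {R1 R' : ℝ} {χ : ℝ → ℝ} {n : WithTop ℕ∞} :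
    ContDiff ℝ n (correction u1 u2 ζ R1 R' χ) :=
  (((contDiff_const.mul contDiff_id).add (contDiff_const.mul (contDiff_id.pow 2))).neg).div_const _

lemma correction_zero {u1 u2 ζ : ℂ → ℝ} {R1 R' : ℝ} {χ : ℝ → ℝ} :
    correction u1 u2 ζ R1 R' χ 0 = 0 := by simp [correction]

namespace LocalModel

include h hχ in
lemma stretchField_eq_zero {x : R3} (hx : x ∉ closedBox p b (R / 2) (H / 2)) :
    stretchField p b χ H x = 0 := by
  have hR := h.disk1.pos
  have hH := h.height_pos
  rw [closedBox, mem_image_chart, mem_prod, not_and_or, mem_closedBall_zero_iff, not_le, mem_Icc,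
    ← abs_le, not_le] at hx
  rw [stretchField]
  rcases hx with hx | hx
  · simp [frameMap_apply, radialField, hχ.eq_zero _ (by linarith : R / 4 ≤ ‖(chartInv p b x).1‖)]
  · simp [frameMap_apply, vertCut_of_ge (by linarith) hx.le]

include h T in
lemma liftField_eq_zero (hr : 0 < r) (hrH : r ≤ H / 4) {x : R3}
    (hx : x ∉ closedBox p b (R / 2) (H / 2)) : liftField p b ζ u1 r x = 0 := by
  have hR := h.disk1.pos
  rw [closedBox, mem_image_chart, mem_prod, not_and_or, mem_closedBall_zero_iff, not_le, mem_Icc,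
    ← abs_le, not_le] at hx
  rw [liftField]
  rcases le_or_gt (R / 2) ‖(chartInv p b x).1‖ with h1 | h1
  · simp [frameMap_apply, T.bump_outer _ h1]
  · have h2 := hx.resolve_left (not_lt.2 h1.le)
    have h3 := h.abs_height_lt1 (h1.trans (by linarith))
    have h4 := abs_sub_abs_le_abs_sub (chartInv p b x).2 (u1 (chartInv p b x).1)
    simp [frameMap_apply, vertCut_of_ge hr (by linarith)]

include h T hχ in
/-- The image of `E` under the flow is bounded by the stretched sheets. -/
lemma fillsBox_image (hχ0 : χ 0 = 0) (ha : Admissible χ M m H t c) (hr : 0 < r) (hrm : r ≤ m)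
    (hL : ∀ a c, |vertCut r a - vertCut r c| ≤ L * |a - c|) (hcL : |c| * L < 1) {f : R3 → R3}
    (hf : ∀ q, f (chart p b q) = chart p b (flowMap χ ζ u1 r H c t q))
    (hinj : Function.Injective f) (hsurj : Function.Surjective f)
    (hfC : ∀ x ∉ closedBox p b (R / 2) (H / 2), f x = x) :
    FillsBox p b R H s (f '' E) (upperSheet u1 ζ χ c t) (lowerSheet u2 χ t) := by
  have hR := h.disk1.pos
  have hH := h.height_pos
  have n1 := measure_graph_eq_zero (T.contDiff_upperSheet hχ ha.time ha.sign c).continuous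
  have n2 := measure_graph_eq_zero (T.contDiff_lowerSheet hχ ha.time ha.sign).continuous
  filter_upwards [measure_eq_zero_iff_ae_notMem.1 n1, measure_eq_zero_iff_ae_notMem.1 n2]
    with q' h1 h2 hq'
  obtain ⟨x, hx⟩ := hsurj (chart p b q')
  obtain ⟨q, rfl⟩ : ∃ q, x = chart p b q := ⟨_, (chart_chartInv p b x).symm⟩
  rw [hf] at hx
  obtain rfl := chart_injective p b hx
  have hsub := closedBox_subset_openBox p b (show R / 2 < R by linarith) (show H / 2 < H by linarith)
  have hbox := apply_mem_iff_of_eq_off hinj (C := openBox p b R H)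
    (fun x hx => hfC x fun hC => hx (hsub hC)) (chart p b q)
  have hq : q ∈ ball (0 : ℂ) R ×ˢ Ioo (-H) H := by
    have : chart p b q ∈ openBox p b R H := hbox.1 (by rw [hf]; exact ⟨_, hq', rfl⟩)
    rwa [openBox, mem_image_chart, chartInv_chart] at this
  obtain ⟨c1, c2⟩ := h.cmp_flowMap T hχ hχ0 ha hr hrm hL hcL (by simpa using hq.1 : ‖q.1‖ < R)
  rw [← hf, hinj.mem_set_image, h.fill q hq (fun e => h1 ((eq_iff_eq_of_cmp_eq_cmp c1).1 e))
    (fun e => h2 ((eq_iff_eq_of_cmp_eq_cmp c2).1 e))]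
  refine iff_congr (and_congr ?_ (lt_iff_lt_of_cmp_eq_cmp c1)) Iff.rfl
  exact lt_iff_lt_of_cmp_eq_cmp (by rw [← cmp_swap, c2, cmp_swap])

include h T hχ in
/-- Stationarity of `E` yields stationarity of the stretched energy for profiles vanishing at
the contact point. -/
theorem hasDerivWithinAt_stretchedEnergy_zero (hχ0 : χ 0 = 0)
    (hk : Continuous k) (hgk : ∀ q ∈ closedBall (0 : ℂ) (R / 2) ×ˢ Icc (-(H / 2)) (H / 2),
      g (chart p b q) = k q) (hg : IntegrableOn g U) (hper : perimeter U E ≠ ⊤)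
    (hE : MeasurableSet E) (hstat : IsAmbientStationary g U E) :
    HasDerivWithinAt (stretchedEnergy k (boolSign s) u1 u2 ζ (R / 4) (R / 2) χ) 0 (Ici 0) 0 := by
  have hR := h.disk1.pos
  have hH := h.height_pos
  set C := closedBox p b (R / 2) (H / 2) with hC
  set r := min m (H / 4) with hr_def
  have hr : 0 < r := lt_min T.gap_pos (by linarith)
  obtain ⟨L, hL0, hL⟩ := exists_lipschitz_vertCut hr
  set c := correction u1 u2 ζ (R / 4) (R / 2) χ with hc
  have hCbox : C ⊆ openBox p b R H := closedBox_subset_openBox p b (by linarith) (by linarith)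
  have hXC : ∀ x ∉ C, stretchField p b χ H x = 0 := fun x hx => h.stretchField_eq_zero hχ hx
  have hYC : ∀ x ∉ C, liftField p b ζ u1 r x = 0 := fun x hx =>
    h.liftField_eq_zero T hr (min_le_right _ _) hx
  obtain ⟨ε₀, hε₀, hdef⟩ := exists_isAmbientDeformation (contDiff_stretchField hχ hχ0)
    (contDiff_liftField (T.smooth_bump.of_le (mod_cast le_top))
      T.contDiff.1)
    (contDiff_correction (n := 1) : ContDiff ℝ 1 c) correction_zero
    (isCompact_closedBox p b (R / 2) (H / 2)) (hCbox.trans h.box_subset) hXC hYC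
  have hcL : ∀ᶠ t in 𝓝 (0 : ℝ), |c t| * L < 1 := by
    have hcc : Continuous fun t => |c t| * L :=
      ((contDiff_correction (n := 0) : ContDiff ℝ 0 c).continuous.abs).mul continuous_const
    have := hcc.tendsto 0
    rw [hc, correction_zero, abs_zero, zero_mul] at this
    exact this.eventually_lt_const one_pos
  obtain ⟨ε1, hε1, hsmall⟩ := Metric.eventually_nhds_iff_ball.1
    ((eventually_admissible (u1 := u1) (u2 := u2) (ζ := ζ) (χ := χ) (R1 := R / 4) (R' := R / 2)
      (M := M) T.gap_pos hH).and hcL)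
  set ε := min ε₀ ε1 with hε_def
  have hε : 0 < ε := lt_min hε₀ hε1
  have hdef' := hdef ε hε (min_le_left _ _)
  set ψ := displace (stretchField p b χ H) (liftField p b ζ u1 r) c with hψ
  have hψC : ∀ t, ∀ x ∉ C, ψ t x = x := fun t x hx => by simp [hψ, displace, hXC x hx, hYC x hx]
  have hbij : ∀ t ∈ Ioo (-ε) ε, Function.Injective (ψ t) ∧ Function.Surjective (ψ t) := by
    intro t ht
    obtain ⟨σ, -, h1, h2⟩ := hdef'.diffeo t ht
    exact ⟨h1.injective, h2.surjective⟩
  have hadm : ∀ t ∈ Ioo (-ε) ε, Admissible χ M m H t (c t) ∧ |c t| * L < 1 := by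
    intro t ht
    have := hsmall t (by
      rw [mem_ball_zero_iff, Real.norm_eq_abs]
      exact (abs_lt.2 ht).trans_le (min_le_right _ _))
    exact ⟨this.1 (by simp [hχ0]), this.2⟩
  have hfill : ∀ t ∈ Ioo (-ε) ε,
      FillsBox p b R H s (ψ t '' E) (upperSheet u1 ζ χ (c t) t) (lowerSheet u2 χ t) :=
    fun t ht => h.fillsBox_image T hχ hχ0 (hadm t ht).1 hr (min_le_left _ _) hL (hadm t ht).2
      (fun q => displace_chart p b χ ζ u1 r H c t q) (hbij t ht).1 (hbij t ht).2 (hψC t)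
  have hmeas : ∀ t ∈ Ioo (-ε) ε, MeasurableSet (ψ t '' E) := by
    intro t ht
    have hcont : Continuous (ψ t) := by
      have h1 := (contDiff_stretchField (p := p) (b := b) (H := H) hχ hχ0).continuous
      have h2 := (contDiff_liftField (p := p) (b := b) (r := r)
        (T.smooth_bump.of_le (mod_cast le_top) : ContDiff ℝ 1 ζ)
        T.contDiff.1).continuous
      exact continuous_id.add ((h1.const_smul t).add (h2.const_smul (c t)))
    exact (hcont.measurableEmbedding (hbij t ht).1).measurableSet_image' hE
  have hvol : AmbientVolumePreserving U E ε ψ := by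
    intro t ht x hx
    set Q := connectedComponentIn (closure E ∩ U) x with hQ
    obtain ⟨S, hS, hSU, hES⟩ := h.exists_preconnected
    have hCm : MeasurableSet C := (isClosed_closedBox p b (R / 2) (H / 2)).measurableSet
    rw [← measure_inter_add_sdiff (ψ t '' (E ∩ Q)) hCm, ← measure_inter_add_sdiff (E ∩ Q) hCm,
      image_sdiff_of_eq_off (hbij t ht).1 (hψC t)]
    congr 1
    rw [image_inter_of_eq_off (hbij t ht).1 (hψC t)]
    by_cases hmeet : (S ∩ Q).Nonempty
    · obtain ⟨z, hzS, hzQ⟩ := hmeet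
      have hsub : S ⊆ Q := by
        rw [hQ, connectedComponentIn_eq hzQ]
        exact hS.subset_connectedComponentIn hzS hSU
      have he : E ∩ Q ∩ C = E ∩ C := by
        ext z
        constructor
        · rintro ⟨⟨h1, h2⟩, h3⟩
          exact ⟨h1, h3⟩
        · rintro ⟨h1, h3⟩
          exact ⟨⟨h1, hsub (hES ⟨h1, hCbox h3⟩)⟩, h3⟩
      rw [he, ← image_inter_of_eq_off (hbij t ht).1 (hψC t)]
      exact h.volume_eq T hχ hE (hmeas t ht) (hadm t ht).1 (hfill t ht)
    · have he : E ∩ Q ∩ C = ∅ := by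
        ext z
        simp only [mem_inter_iff, mem_empty_iff_false, iff_false]
        rintro ⟨⟨h1, h2⟩, h3⟩
        exact hmeet ⟨z, hES ⟨h1, hCbox h3⟩, h2⟩
      rw [he, image_empty]
  have hder := (hstat ε ψ hdef' hvol).hasDerivWithinAt (s := Ici 0)
  have heq : ∀ t ∈ Ioo (-ε) ε, energy g U (ψ t '' E) = energyOutside g U E C s +
      stretchedEnergy k (boolSign s) u1 u2 ζ (R / 4) (R / 2) χ t := fun t ht =>
    h.energy_eq T hχ hk hgk hg hper hE (hmeas t ht) (hadm t ht).1 (hfill t ht)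
      (image_sdiff_of_eq_off (hbij t ht).1 (hψC t))
  have h0 : (0 : ℝ) ∈ Ioo (-ε) ε := ⟨by linarith, hε⟩
  have hev : (fun t => stretchedEnergy k (boolSign s) u1 u2 ζ (R / 4) (R / 2) χ t) =ᶠ[𝓝[Ici 0] 0]
      fun t => energy g U (ψ t '' E) - energyOutside g U E C s := by
    filter_upwards [nhdsWithin_le_nhds (Ioo_mem_nhds h0.1 h0.2)] with t ht
    rw [heq t ht]
    ring
  exact (hder.sub_const _).congr_of_eventuallyEq hev (by rw [heq 0 h0]; ring)

end LocalModel


/-! ### The collar coordinate -/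

/-- The function `(z⁺)² / (1 - z²)`, which maps `[0, 1)` onto `[0, ∞)`. -/
def collar (z : ℝ) : ℝ := max z 0 ^ 2 / (1 - z ^ 2)

lemma contDiff_posPart_sq : ContDiff ℝ 1 fun z : ℝ => max z 0 ^ 2 := by
  have h : ∀ z : ℝ, HasDerivAt (fun z : ℝ => max z 0 ^ 2) (2 * max z 0) z := by
    intro z
    rcases lt_trichotomy z 0 with hz | rfl | hz
    · rw [max_eq_right hz.le, mul_zero]
      refine (hasDerivAt_const z (0 : ℝ)).congr_of_eventuallyEq ?_
      filter_upwards [Iio_mem_nhds hz] with y hy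
      simp [max_eq_right (mem_Iio.1 hy).le]
    · rw [max_self, mul_zero, hasDerivAt_iff_isLittleO_nhds_zero]
      have hb : (fun y : ℝ => max (0 + y) 0 ^ 2 - max 0 0 ^ 2 - y • 0) =O[𝓝 0] fun y : ℝ => y ^ 2 := by
        refine Asymptotics.IsBigO.of_bound 1 (Eventually.of_forall fun y => ?_)
        simp only [zero_add, max_self, smul_zero, sub_zero, norm_pow, one_mul, Real.norm_eq_abs]
        rw [zero_pow two_ne_zero, sub_zero, abs_pow]
        refine pow_le_pow_left₀ (abs_nonneg _) ?_ 2
        rw [abs_of_nonneg (le_max_right _ _)]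
        exact max_le (le_abs_self y) (abs_nonneg y)
      exact hb.trans_isLittleO (by
        simpa using Asymptotics.isLittleO_pow_pow (𝕜 := ℝ) (show 1 < 2 by norm_num))
    · rw [max_eq_left hz.le]
      refine ((hasDerivAt_pow 2 z).congr_deriv (by simp)).congr_of_eventuallyEq ?_
      filter_upwards [Ioi_mem_nhds hz] with y hy
      rw [max_eq_left (le_of_lt hy)]
  rw [contDiff_one_iff_deriv]
  refine ⟨fun z => (h z).differentiableAt, ?_⟩
  rw [funext fun z => (h z).deriv]
  fun_prop

lemma one_sub_sq_pos {z : ℝ} (hz : z ∈ Ioo (-1 : ℝ) 1) : 0 < 1 - z ^ 2 := by nlinarith [hz.1, hz.2]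

lemma neg_mem_Ioo {z : ℝ} (hz : z ∈ Ioo (-1 : ℝ) 1) : -z ∈ Ioo (-1 : ℝ) 1 :=
  ⟨by linarith [hz.2], by linarith [hz.1]⟩

lemma contDiffOn_collar : ContDiffOn ℝ 1 collar (Ioo (-1) 1) :=
  contDiff_posPart_sq.contDiffOn.div (contDiff_const.sub (contDiff_id.pow 2)).contDiffOn
    fun _ hz => (one_sub_sq_pos hz).ne'

lemma collar_of_nonpos {z : ℝ} (hz : z ≤ 0) : collar z = 0 := by simp [collar, max_eq_right hz]

lemma collar_of_nonneg {z : ℝ} (hz : 0 ≤ z) : collar z = z ^ 2 / (1 - z ^ 2) := by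
  rw [collar, max_eq_left hz]

lemma collar_nonneg {z : ℝ} (hz : z ∈ Ioo (-1 : ℝ) 1) : 0 ≤ collar z :=
  div_nonneg (by positivity) (one_sub_sq_pos hz).le

lemma collar_pos {z : ℝ} (hz : z ∈ Ioo (0 : ℝ) 1) : 0 < collar z := by
  rw [collar_of_nonneg hz.1.le]
  exact div_pos (pow_pos hz.1 2) (one_sub_sq_pos ⟨by linarith [hz.1], hz.2⟩)

lemma exists_hasDerivAt_collar {z : ℝ} (hz : z ∈ Ioo (0 : ℝ) 1) :
    ∃ d, 0 < d ∧ HasDerivAt collar d z := by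
  have hpos := one_sub_sq_pos (z := z) ⟨by linarith [hz.1], hz.2⟩
  refine ⟨2 * z / (1 - z ^ 2) ^ 2, div_pos (by linarith [hz.1]) (by positivity), ?_⟩
  have h := (hasDerivAt_pow 2 z).div ((hasDerivAt_pow 2 z).const_sub 1) hpos.ne'
  refine (h.congr_deriv ?_).congr_of_eventuallyEq ?_
  · congr 1
    simp
    ring
  · filter_upwards [Ioi_mem_nhds hz.1] with y hy using collar_of_nonneg (le_of_lt hy)

lemma sq_eq_of_collar {z : ℝ} (hz : 0 ≤ z) (hz1 : z < 1) : z ^ 2 = collar z / (1 + collar z) := by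
  have hpos := one_sub_sq_pos (z := z) ⟨by linarith, hz1⟩
  rw [collar_of_nonneg hz]
  field_simp
  ring

lemma collar_injOn : InjOn collar (Ico 0 1) := by
  intro a ha c hc h
  have h1 := sq_eq_of_collar ha.1 ha.2
  rw [h, ← sq_eq_of_collar hc.1 hc.2] at h1
  exact (pow_left_inj₀ ha.1 hc.1 two_ne_zero).1 h1

lemma exists_collar_eq {ρ : ℝ} (hρ : 0 ≤ ρ) : ∃ z ∈ Ico (0 : ℝ) 1, collar z = ρ := by
  have h1 : ρ / (1 + ρ) < 1 := by rw [div_lt_one (by positivity)]; linarith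
  refine ⟨√(ρ / (1 + ρ)), ⟨Real.sqrt_nonneg _, by rwa [Real.sqrt_lt' one_pos, one_pow]⟩, ?_⟩
  rw [collar_of_nonneg (Real.sqrt_nonneg _), Real.sq_sqrt (by positivity)]
  field_simp
  ring

lemma exists_bound_of_collar_le (B : ℝ) : ∃ β < 1, ∀ z ∈ Ioo (-1 : ℝ) 1, collar z ≤ B → z ≤ β := by
  obtain ⟨β, hβ, hβB⟩ := exists_collar_eq (abs_nonneg B)
  refine ⟨β, hβ.2, fun z hz hzB => ?_⟩
  rcases le_or_gt z 0 with h0 | h0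
  · exact h0.trans hβ.1
  have h1 := sq_eq_of_collar h0.le hz.2
  have h2 := sq_eq_of_collar hβ.1 hβ.2
  rw [hβB] at h2
  refine (sq_le_sq₀ h0.le hβ.1).1 ?_
  rw [h1, h2, div_le_div_iff₀ (by linarith [collar_nonneg hz]) (by positivity)]
  nlinarith [le_abs_self B]

/-- An injective continuous map is an embedding if each point of its image has a neighbourhood
with compact preimage. -/
lemma isEmbedding_of_compact_preimage {X Y : Type*} [TopologicalSpace X] [TopologicalSpace Y]
    [T2Space Y] {f : X → Y} (hf : Continuous f) (hinj : Function.Injective f)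
    (hN : ∀ x, ∃ N ∈ 𝓝 (f x), IsCompact (f ⁻¹' N)) : IsEmbedding f := by
  refine ⟨isInducing_iff_nhds.2 fun x => le_antisymm (hf.tendsto x).le_comap ?_, hinj⟩
  obtain ⟨N, hN, hc⟩ := hN x
  refine hc.le_nhds_of_unique_clusterPt (preimage_mem_comap hN) fun x' _ hx' => hinj ?_
  have h1 : ClusterPt (f x') (𝓝 (f x)) := hx'.map hf.continuousAt tendsto_comap
  exact eq_of_nhds_neBot h1


/-! ### Disks moved in a box -/

/-- The disk `ϕ` with its part in the box replaced by the graph of `W`. -/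
def movedDisk (p : R3) (b : Frame) (R : ℝ) (ϕ : ℂ → R3) (W : ℂ → ℝ)
    (y : ℂ) : R3 := if ‖y‖ < R then chart p b (y, W y) else ϕ y

/-- The graph of `W` fits together with the disk `ϕ` outside a smaller box. -/
structure IsSheet (p : R3) (b : Frame) (ϕ : ℂ → R3) (u W : ℂ → ℝ)
    (R H K : ℝ) : Prop where
  disk : GraphDisk p b (range ϕ) ϕ u R K
  outside : ∀ y, R ≤ ‖y‖ → ϕ y ∉ openBox p b R H
  contDiff : ContDiff ℝ 1 W
  eq : ∀ y, R / 2 ≤ ‖y‖ → W y = u y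
  lt : ∀ y, ‖y‖ < R → |W y| < H

namespace IsSheet

variable {p : R3} {b : Frame} {ϕ : ℂ → R3} {u W ζ : ℂ → ℝ} {R H K M t c : ℝ} {χ : ℝ → ℝ}

lemma movedDisk_of_lt {y : ℂ} (hy : ‖y‖ < R) : movedDisk p b R ϕ W y = chart p b (y, W y) :=
  if_pos hy

lemma movedDisk_of_ge (h : IsSheet p b ϕ u W R H K) {y : ℂ} (hy : R / 2 ≤ ‖y‖) :
    movedDisk p b R ϕ W y = ϕ y := by
  rw [movedDisk]
  split_ifs with h1
  · rw [h.eq y hy, h.disk.graph y h1]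
  · rfl

lemma movedDisk_mem_openBox (h : IsSheet p b ϕ u W R H K) {y : ℂ} :
    movedDisk p b R ϕ W y ∈ openBox p b R H ↔ ‖y‖ < R := by
  rw [movedDisk]
  split_ifs with h1
  · rw [chart_mem_openBox]
    exact ⟨fun h => h.1, fun h' => ⟨h', (abs_lt.1 (h.lt y h'))⟩⟩
  · exact iff_of_false (h.outside y (not_lt.1 h1)) h1

lemma injective_movedDisk (h : IsSheet p b ϕ u W R H K) :
    Function.Injective (movedDisk p b R ϕ W) := by
  intro y y' hyy
  have hiff : ‖y‖ < R ↔ ‖y'‖ < R := by rw [← h.movedDisk_mem_openBox, hyy, h.movedDisk_mem_openBox]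
  have hR := h.disk.pos
  rcases lt_or_ge ‖y‖ R with h1 | h1
  · rw [movedDisk_of_lt h1, movedDisk_of_lt (hiff.1 h1)] at hyy
    exact (Prod.ext_iff.1 (chart_injective p b hyy)).1
  · have h2 : R ≤ ‖y'‖ := not_lt.1 fun h2 => not_lt.2 h1 (hiff.2 h2)
    rw [h.movedDisk_of_ge (by linarith), h.movedDisk_of_ge (by linarith)] at hyy
    exact h.disk.embedding.injective hyy

/-- The moved disk is a `C¹` immersion. -/
lemma exists_hasStrictFDerivAt_movedDisk (h : IsSheet p b ϕ u W R H K) (y : ℂ) :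
    ∃ L : ℂ →L[ℝ] R3, Function.Injective L ∧ HasFDerivAt (movedDisk p b R ϕ W) L y := by
  have hR := h.disk.pos
  rcases lt_or_ge ‖y‖ R with hy | hy
  · have hW := (h.contDiff.differentiable one_ne_zero y).hasFDerivAt
    refine ⟨(frameMap b).comp ((ContinuousLinearMap.id ℝ ℂ).prod (fderiv ℝ W y)), ?_, ?_⟩
    · rw [injective_iff_map_eq_zero]
      intro v hv
      have h1 := norm_frameMap_sq b (v, fderiv ℝ W y v)
      have h2 : frameMap b (v, fderiv ℝ W y v) = 0 := hv
      rw [h2, norm_zero] at h1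
      have h3 : ‖v‖ ^ 2 = 0 := by
        have := sq_nonneg (fderiv ℝ W y v)
        have := sq_nonneg ‖v‖
        simp only at h1
        linarith
      exact norm_eq_zero.1 (pow_eq_zero_iff two_ne_zero |>.1 h3)
    · refine ((hasFDerivAt_chart p b (y, W y)).comp y
        ((hasFDerivAt_id y).prodMk hW)).congr_of_eventuallyEq ?_
      filter_upwards [(isOpen_lt continuous_norm continuous_const).mem_nhds hy] with z hz
        using movedDisk_of_lt hz
  · refine ⟨fderiv ℝ ϕ y, h.disk.immersion y, ?_⟩
    refine (h.disk.smooth.differentiable (by simp) y).hasFDerivAt.congr_of_eventuallyEq ?_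
    filter_upwards [(isOpen_lt continuous_const continuous_norm).mem_nhds
      (show R / 2 < ‖y‖ by linarith)] with z hz using h.movedDisk_of_ge (le_of_lt hz)

/-- The moved disk in stretched polar coordinates. -/
lemma movedDisk_stretch (h : IsSheet p b ϕ u (upperSheet u ζ χ c t) R H K)
    (hχ : IsProfile χ (R / 4) M) (ht : |t| * M ≤ 1 / 2) (h0 : 0 ≤ t * χ 0)
    (hin : ∀ y, ‖y‖ ≤ R / 4 → ζ y = 0) (hout : ∀ y, R / 2 ≤ ‖y‖ → ζ y = 0) {ρ : ℝ} (hρ : 0 ≤ ρ)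
    {w : ℂ} (hw : ‖w‖ = 1) :
    movedDisk p b R ϕ (upperSheet u ζ χ c t) (stretch χ t ρ • w) =
      ϕ (ρ • w) + (t • frameMap b (χ ρ • w, 0) + c • frameMap b (0, ζ (ρ • w))) := by
  have hR := h.disk.pos
  have hn : ‖ρ • w‖ = ρ := by rw [norm_smul, hw, mul_one, Real.norm_of_nonneg hρ]
  have hs := hχ.stretch_pos ht h0 hρ
  have hns : ‖stretch χ t ρ • w‖ = stretch χ t ρ := by
    rw [norm_smul, hw, mul_one, Real.norm_of_nonneg (by linarith)]
  rcases lt_or_ge ρ R with h1 | h1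
  · have h2 : stretch χ t ρ < R := by
      rw [← hχ.stretch_of_ge t (show R / 4 ≤ R by linarith)]
      exact hχ.strictMono ht h1
    have hζ : ζ (stretch χ t ρ • w) = ζ (ρ • w) := by
      rcases le_total ρ (R / 4) with h3 | h3
      · rw [hin (ρ • w) (by rwa [hn]), hin]
        rw [hns, ← hχ.stretch_of_ge t le_rfl]
        exact (hχ.strictMono ht).monotone h3
      · rw [hχ.stretch_of_ge t h3]
    rw [movedDisk_of_lt (by rwa [hns]), h.disk.graph _ (by rwa [hn]), upperSheet,
      collapse_stretch hχ ht h0 hρ hw, hζ, chart_eq, chart_eq, ← map_smul, ← map_smul, ← map_add,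
      add_assoc, ← map_add]
    congr 2
    ext <;> simp [stretch]
    ring
  · have hst : stretch χ t ρ = ρ := hχ.stretch_of_ge t (by linarith)
    rw [hst, h.movedDisk_of_ge (by rw [hn]; linarith), hχ.eq_zero ρ (by linarith),
      hout _ (by rw [hn]; linarith)]
    simp [frameMap_apply]

end IsSheet

lemma lowerSheet_eq (u : ℂ → ℝ) (χ : ℝ → ℝ) (t : ℝ) :
    lowerSheet u χ t = upperSheet u (fun _ => 0) χ 0 t := by
  ext y
  simp [lowerSheet, upperSheet]

/-! ### The neck map -/

/-- The two disks, parametrized by the cylinder. -/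
def neckBase (p : R3) (ϕ1 ϕ2 : ℂ → R3) (x : Circle × ℝ) : R3 :=
  ϕ1 (collar x.2 • (x.1 : ℂ)) + ϕ2 (collar (-x.2) • (x.1 : ℂ)) - p

/-- The horizontal speed of the neck opening. -/
def neckSpeed (b : Frame) (χ : ℝ → ℝ) (x : Circle × ℝ) : R3 :=
  frameMap b (χ (collar x.2 + collar (-x.2)) • (x.1 : ℂ), 0)

/-- The vertical correction of the upper disk. -/
def neckLift (b : Frame) (ζ : ℂ → ℝ) (x : Circle × ℝ) : R3 :=
  frameMap b (0, ζ (collar x.2 • (x.1 : ℂ)))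

/-- The two disks, opened along the profile `χ` and corrected by `c ζ`. -/
def neckMap (p : R3) (b : Frame) (ϕ1 ϕ2 : ℂ → R3) (ζ : ℂ → ℝ) (χ : ℝ → ℝ)
    (c t : ℝ) (x : Circle × ℝ) : R3 :=
  neckBase p ϕ1 ϕ2 x + (t • neckSpeed b χ x + c • neckLift b ζ x)

section Regularity

variable {p : R3} {b : Frame} {ϕ1 ϕ2 : ℂ → R3} {ζ : ℂ → ℝ} {χ : ℝ → ℝ} {c t : ℝ}

lemma contDiffOn_collar_smul (σ : ℝ → ℝ) (hσ : ContDiff ℝ 1 σ)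
    (hσ' : MapsTo σ (Ioo (-1) 1) (Ioo (-1) 1)) :
    ContDiffOn ℝ 1 (fun q : ℝ × ℝ => collar (σ q.2) • ((Circle.exp q.1 : Circle) : ℂ))
      (univ ×ˢ Ioo (-1) 1) := by
  have h1 : ContDiffOn ℝ 1 (fun q : ℝ × ℝ => collar (σ q.2)) (univ ×ˢ Ioo (-1) 1) :=
    contDiffOn_collar.comp (hσ.comp contDiff_snd).contDiffOn fun q hq => hσ' hq.2
  have h2 : ContDiff ℝ 1 (fun q : ℝ × ℝ => ((Circle.exp q.1 : Circle) : ℂ)) := by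
    simp only [Circle.coe_exp]
    exact contDiff_dir.comp contDiff_fst
  exact h1.smul h2.contDiffOn

lemma contDiffOn_neckBase (h1 : ContDiff ℝ 1 ϕ1) (h2 : ContDiff ℝ 1 ϕ2) :
    ContDiffOn ℝ 1 (cylLift (neckBase p ϕ1 ϕ2)) (univ ×ˢ Ioo (-1) 1) :=
  ((h1.comp_contDiffOn (contDiffOn_collar_smul id contDiff_id (mapsTo_id _))).add
    (h2.comp_contDiffOn (contDiffOn_collar_smul Neg.neg contDiff_neg fun _ hz => neg_mem_Ioo hz))).sub
    contDiffOn_const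

lemma contDiffOn_neckSpeed (h : ContDiff ℝ 1 χ) :
    ContDiffOn ℝ 1 (cylLift (neckSpeed b χ)) (univ ×ˢ Ioo (-1) 1) := by
  have h1 : ContDiffOn ℝ 1 (fun q : ℝ × ℝ => χ (collar q.2 + collar (-q.2)))
      (univ ×ˢ Ioo (-1) 1) :=
    h.comp_contDiffOn ((contDiffOn_collar.comp contDiff_snd.contDiffOn fun q hq => hq.2).add
      (contDiffOn_collar.comp contDiff_snd.neg.contDiffOn fun q hq => neg_mem_Ioo hq.2))
  have h2 : ContDiff ℝ 1 (fun q : ℝ × ℝ => ((Circle.exp q.1 : Circle) : ℂ)) := by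
    simp only [Circle.coe_exp]
    exact contDiff_dir.comp contDiff_fst
  exact (frameMap b).contDiff.comp_contDiffOn ((h1.smul h2.contDiffOn).prodMk contDiffOn_const)

lemma contDiffOn_neckLift (h : ContDiff ℝ 1 ζ) :
    ContDiffOn ℝ 1 (cylLift (neckLift b ζ)) (univ ×ˢ Ioo (-1) 1) :=
  (frameMap b).contDiff.comp_contDiffOn (contDiffOn_const.prodMk
    (h.comp_contDiffOn (contDiffOn_collar_smul id contDiff_id (mapsTo_id _))))

lemma continuousOn_neckMap (h1 : Continuous ϕ1) (h2 : Continuous ϕ2) (hχ : Continuous χ)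
    (hζ : Continuous ζ) : ContinuousOn (neckMap p b ϕ1 ϕ2 ζ χ c t) openCyl := by
  have hc : ContinuousOn (fun x : Circle × ℝ => collar x.2) openCyl :=
    contDiffOn_collar.continuousOn.comp continuous_snd.continuousOn fun x hx => hx.2
  have hc' : ContinuousOn (fun x : Circle × ℝ => collar (-x.2)) openCyl :=
    contDiffOn_collar.continuousOn.comp continuous_snd.neg.continuousOn fun x hx => neg_mem_Ioo hx.2
  have hw : Continuous fun x : Circle × ℝ => (x.1 : ℂ) := by fun_prop
  have hb := (frameMap b).continuous
  refine (((h1.comp_continuousOn (hc.smul hw.continuousOn)).add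
    (h2.comp_continuousOn (hc'.smul hw.continuousOn))).sub continuousOn_const).add
    ((ContinuousOn.const_smul ?_ t).add (ContinuousOn.const_smul ?_ c))
  · exact hb.comp_continuousOn (((hχ.comp_continuousOn (hc.add hc')).smul hw.continuousOn).prodMk
      continuousOn_const)
  · exact hb.comp_continuousOn (continuousOn_const.prodMk
      (hζ.comp_continuousOn (hc.smul hw.continuousOn)))

/-- The derivative of polar coordinates is injective. -/
lemma exists_hasFDerivAt_polar {r : ℝ → ℝ} {z d θ : ℝ} (hr : HasDerivAt r d z) (hd : d ≠ 0)
    (hz : r z ≠ 0) : ∃ L : ℝ × ℝ →L[ℝ] ℂ, Function.Injective L ∧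
      HasFDerivAt (fun q : ℝ × ℝ => r q.2 • ((Circle.exp q.1 : Circle) : ℂ)) L (θ, z) := by
  have h1 : HasFDerivAt (fun q : ℝ × ℝ => r q.2)
      (d • ContinuousLinearMap.snd ℝ ℝ ℝ) (θ, z) := hr.comp_hasFDerivAt (θ, z) hasFDerivAt_snd
  have h2 : HasDerivAt dir (Complex.I * dir θ) θ := by
    have := ((hasDerivAt_id (θ : ℂ)).mul_const Complex.I).cexp.comp_ofReal
    refine this.congr_deriv ?_
    simp [dir, mul_comm]
  have h3 : HasFDerivAt (fun q : ℝ × ℝ => dir q.1)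
      ((ContinuousLinearMap.fst ℝ ℝ ℝ).smulRight (Complex.I * dir θ)) (θ, z) := by
    have := h2.hasFDerivAt.comp (θ, z) (hasFDerivAt_fst (𝕜 := ℝ) (p := (θ, z)))
    refine this.congr_fderiv ?_
    ext <;> simp
  simp only [Circle.coe_exp]
  refine ⟨_, ?_, h1.smul h3⟩
  rw [injective_iff_map_eq_zero]
  intro v hv
  have hne : dir θ ≠ 0 := norm_ne_zero_iff.1 (by rw [norm_dir]; exact one_ne_zero)
  have h4 : ((r z * v.1 : ℝ) * Complex.I + (d * v.2 : ℝ) : ℂ) * dir θ = 0 := by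
    rw [← hv]
    simp [dir]
    ring
  have h5 := (mul_eq_zero.1 h4).resolve_right hne
  have h6 := congrArg Complex.re h5
  have h7 := congrArg Complex.im h5
  simp at h6 h7
  exact Prod.ext (h7.resolve_left hz) (h6.resolve_left hd)

end Regularity


lemma exists_stretch_smul_eq {χ : ℝ → ℝ} {R M t : ℝ} (hχ : IsProfile χ R M)
    (ht : |t| * M ≤ 1 / 2) {y : ℂ} (hy : t * χ 0 ≤ ‖y‖) :
    ∃ ρ : ℝ, 0 ≤ ρ ∧ ∃ w : Circle, y = stretch χ t ρ • (w : ℂ) := by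
  refine ⟨shrink χ t ‖y‖, ?_, Circle.exp y.arg, ?_⟩
  · rw [← (hχ.strictMono ht).le_iff_le, hχ.stretch_shrink ht]
    simpa [stretch] using hy
  · rw [hχ.stretch_shrink ht, Circle.coe_exp, Complex.real_smul, Complex.norm_mul_exp_arg_mul_I]

namespace LocalModel

include h T hχ ha in
lemma isSheet1 : IsSheet p b ϕ1 u1 (upperSheet u1 ζ χ c t) R H K where
  disk := h.disk1
  outside := h.outside1
  contDiff := T.contDiff_upperSheet hχ ha.time ha.sign c
  eq y hy := by
    have := h.disk1.pos
    rw [upperSheet, collapse_of_ge hχ ha.time (by linarith), T.bump_outer y hy, mul_zero, add_zero]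
  lt y hy := (h.abs_upperSheet_lt T hχ ha hy).trans (by linarith [h.height_pos])

include h T hχ ha in
lemma isSheet2 : IsSheet p b ϕ2 u2 (lowerSheet u2 χ t) R H K where
  disk := h.disk2
  outside := h.outside2
  contDiff := T.contDiff_lowerSheet hχ ha.time ha.sign
  eq y hy := by
    have := h.disk1.pos
    rw [lowerSheet, collapse_of_ge hχ ha.time (by linarith)]
  lt y hy := (h.abs_lowerSheet_lt hχ ha.time hy).trans (by linarith [h.height_pos])

include h T hχ ha in
lemma neckMap_of_nonneg (w : Circle) {z : ℝ} (hz : z ∈ Ico (0 : ℝ) 1) :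
    neckMap p b ϕ1 ϕ2 ζ χ c t (w, z) =
      movedDisk p b R ϕ1 (upperSheet u1 ζ χ c t) (stretch χ t (collar z) • (w : ℂ)) := by
  rw [(h.isSheet1 T hχ ha).movedDisk_stretch hχ ha.time ha.sign T.bump_inner T.bump_outer
    (collar_nonneg ⟨by linarith [hz.1], hz.2⟩) w.norm_coe, neckMap, neckBase, neckSpeed, neckLift]
  simp only [collar_of_nonpos (neg_nonpos.2 hz.1), zero_smul, add_zero, h.disk2.apply_zero,
    add_sub_cancel_right]

include h T hχ ha in
lemma neckMap_of_nonpos (w : Circle) {z : ℝ} (hz : z ∈ Ioc (-1 : ℝ) 0) :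
    neckMap p b ϕ1 ϕ2 ζ χ c t (w, z) =
      movedDisk p b R ϕ2 (lowerSheet u2 χ t) (stretch χ t (collar (-z)) • (w : ℂ)) := by
  have hs := h.isSheet2 T hχ ha
  rw [lowerSheet_eq] at hs ⊢
  rw [hs.movedDisk_stretch hχ ha.time ha.sign (fun _ _ => rfl) (fun _ _ => rfl)
    (collar_nonneg ⟨by linarith [hz.2], by linarith [hz.1]⟩) w.norm_coe, neckMap, neckBase,
    neckSpeed, neckLift]
  have hR := h.disk1.pos
  simp only [collar_of_nonpos hz.2, zero_smul, zero_add, h.disk1.apply_zero, add_sub_cancel_left,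
    T.bump_inner 0 (by simp; positivity)]
  simp [frameMap_apply]

include h T hχ ha in
/-- The image of the neck map. -/
lemma mem_image_neckMap {x : R3} : x ∈ neckMap p b ϕ1 ϕ2 ζ χ c t '' openCyl ↔
      ∃ y : ℂ, t * χ 0 ≤ ‖y‖ ∧ (x = movedDisk p b R ϕ1 (upperSheet u1 ζ χ c t) y ∨
        x = movedDisk p b R ϕ2 (lowerSheet u2 χ t) y) := by
  have hs0 : stretch χ t 0 = t * χ 0 := by simp [stretch]
  have hnorm : ∀ (ρ : ℝ) (w : Circle), 0 ≤ ρ → t * χ 0 ≤ ‖stretch χ t ρ • (w : ℂ)‖ := by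
    intro ρ w hρ
    rw [norm_smul, w.norm_coe, mul_one, ← hs0]
    exact ((hχ.strictMono ha.time).monotone hρ).trans (le_abs_self _)
  constructor
  · rintro ⟨⟨w, z⟩, ⟨-, hz⟩, rfl⟩
    rcases le_total 0 z with h0 | h0
    · exact ⟨_, hnorm _ w (collar_nonneg hz), Or.inl (h.neckMap_of_nonneg T hχ ha w ⟨h0, hz.2⟩)⟩
    · exact ⟨_, hnorm _ w (collar_nonneg (neg_mem_Ioo hz)),
        Or.inr (h.neckMap_of_nonpos T hχ ha w ⟨hz.1, h0⟩)⟩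
  · rintro ⟨y, hy, hx⟩
    obtain ⟨ρ, hρ, w, rfl⟩ := exists_stretch_smul_eq hχ ha.time hy
    obtain ⟨z, hz, rfl⟩ := exists_collar_eq hρ
    rcases hx with rfl | rfl
    · exact ⟨(w, z), ⟨mem_univ _, by linarith [hz.1], hz.2⟩, h.neckMap_of_nonneg T hχ ha w hz⟩
    · refine ⟨(w, -z), ⟨mem_univ _, by simp only; linarith [hz.2], by simp only; linarith [hz.1]⟩, ?_⟩
      rw [h.neckMap_of_nonpos T hχ ha w ⟨by linarith [hz.2], by linarith [hz.1]⟩, neg_neg]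

lemma neckMap_zero {x : Circle × ℝ} : neckMap p b ϕ1 ϕ2 ζ χ 0 0 x = neckBase p ϕ1 ϕ2 x := by
  simp [neckMap]

include h in
lemma image_neckBase : neckBase p ϕ1 ϕ2 '' openCyl = range ϕ1 ∪ range ϕ2 := by
  ext x
  constructor
  · rintro ⟨⟨w, z⟩, -, rfl⟩
    rcases le_total 0 z with h0 | h0
    · refine Or.inl ⟨collar z • (w : ℂ), ?_⟩
      simp [neckBase, collar_of_nonpos (neg_nonpos.2 h0), h.disk2.apply_zero]
    · refine Or.inr ⟨collar (-z) • (w : ℂ), ?_⟩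
      simp [neckBase, collar_of_nonpos h0, h.disk1.apply_zero]
  · have hpol : ∀ y : ℂ, ∃ z ∈ Ico (0 : ℝ) 1, ∃ w : Circle, y = collar z • (w : ℂ) := by
      intro y
      obtain ⟨z, hz, hzy⟩ := exists_collar_eq (norm_nonneg y)
      refine ⟨z, hz, Circle.exp y.arg, ?_⟩
      rw [hzy, Circle.coe_exp, Complex.real_smul, Complex.norm_mul_exp_arg_mul_I]
    rintro (⟨y, rfl⟩ | ⟨y, rfl⟩) <;> obtain ⟨z, hz, w, rfl⟩ := hpol y
    · refine ⟨(w, z), ⟨mem_univ _, by linarith [hz.1], hz.2⟩, ?_⟩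
      simp [neckBase, collar_of_nonpos (neg_nonpos.2 hz.1), h.disk2.apply_zero]
    · refine ⟨(w, -z), ⟨mem_univ _, by simp only; linarith [hz.2], by simp only; linarith [hz.1]⟩, ?_⟩
      simp [neckBase, collar_of_nonpos (neg_nonpos.2 hz.1), h.disk1.apply_zero]

include T hχ in
/-- Away from the contact point the neck map is stationary. -/
lemma neckMap_of_ge {x : Circle × ℝ} (hx : R / 2 ≤ collar x.2 + collar (-x.2)) :
    neckMap p b ϕ1 ϕ2 ζ χ c t x = neckBase p ϕ1 ϕ2 x := by
  have hR := T.pos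
  have hζ : ζ (collar x.2 • (x.1 : ℂ)) = 0 := by
    rcases le_total x.2 0 with h0 | h0
    · rw [collar_of_nonpos h0, zero_smul]
      exact T.bump_inner 0 (by simpa using hR.le)
    · rw [collar_of_nonpos (neg_nonpos.2 h0), add_zero] at hx
      refine T.bump_outer _ ?_
      rwa [norm_smul, x.1.norm_coe, mul_one, Real.norm_of_nonneg (by linarith)]
  rw [neckMap, neckSpeed, neckLift, hζ,
    hχ.eq_zero _ (by linarith : R / 4 ≤ collar x.2 + collar (-x.2))]
  simp [frameMap_apply]

include h T hχ ha in
lemma neckMap_mem_closedBox {x : Circle × ℝ} (hx : x ∈ openCyl)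
    (hxR : collar x.2 + collar (-x.2) < R / 2) :
    neckMap p b ϕ1 ϕ2 ζ χ c t x ∈ closedBox p b (R / 2) (H / 2) := by
  have hR := h.disk1.pos
  have hH := h.height_pos
  have key : ∀ ρ : ℝ, 0 ≤ ρ → ρ < R / 2 → ‖stretch χ t ρ • (x.1 : ℂ)‖ < R / 2 := by
    intro ρ hρ hρR
    rw [norm_smul, x.1.norm_coe, mul_one, Real.norm_of_nonneg
      (by linarith [hχ.stretch_pos ha.time ha.sign hρ]),
      ← hχ.stretch_of_ge t (show R / 4 ≤ R / 2 by linarith)]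
    exact hχ.strictMono ha.time hρR
  obtain ⟨w, z⟩ := x
  simp only at hxR key
  have hz : z ∈ Ioo (-1 : ℝ) 1 := hx.2
  rcases le_total 0 z with h0 | h0
  · rw [collar_of_nonpos (neg_nonpos.2 h0), add_zero] at hxR
    have hn := key _ (collar_nonneg hz) hxR
    rw [h.neckMap_of_nonneg T hχ ha w ⟨h0, hz.2⟩, IsSheet.movedDisk_of_lt (hn.trans (by linarith))]
    exact ⟨_, ⟨mem_closedBall_zero_iff.2 hn.le,
      abs_le.1 (h.abs_upperSheet_lt T hχ ha (hn.trans (by linarith))).le⟩, rfl⟩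
  · rw [collar_of_nonpos h0, zero_add] at hxR
    have hn := key _ (collar_nonneg (neg_mem_Ioo hz)) hxR
    rw [h.neckMap_of_nonpos T hχ ha w ⟨hz.1, h0⟩, IsSheet.movedDisk_of_lt (hn.trans (by linarith))]
    refine ⟨_, ⟨mem_closedBall_zero_iff.2 hn.le, abs_le.1 ?_⟩, rfl⟩
    linarith [h.abs_lowerSheet_lt hχ ha.time (hn.trans (show R / 2 < R by linarith))]

include h in
lemma closedBox_subset : closedBox p b (R / 2) (H / 2) ⊆ openBox p b R H :=
  closedBox_subset_openBox p b (by linarith [h.disk1.pos]) (by linarith [h.height_pos])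

include h T hχ ha in
lemma mapsTo_neckMap : MapsTo (neckMap p b ϕ1 ϕ2 ζ χ c t) openCyl U := by
  intro x hx
  rcases lt_or_ge (collar x.2 + collar (-x.2)) (R / 2) with h1 | h1
  · exact h.box_subset (h.closedBox_subset (h.neckMap_mem_closedBox T hχ ha hx h1))
  · rw [neckMap_of_ge T hχ h1]
    have : neckBase p ϕ1 ϕ2 x ∈ range ϕ1 ∪ range ϕ2 := h.image_neckBase ▸ mem_image_of_mem _ hx
    rw [← h.frontier_eq] at this
    exact this.2

include h T hχ in
/-- The neck map is proper as a map to `U`. -/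
lemma isCompact_preimage_neckMap {Q : Set R3} (hQU : Q ⊆ U) (hQ : IsCompact Q) :
    IsCompact (openCyl ∩ neckMap p b ϕ1 ϕ2 ζ χ c t ⁻¹' Q) := by
  have hcont := continuousOn_neckMap (p := p) (b := b) (c := c) (t := t)
    h.disk1.smooth.continuous h.disk2.smooth.continuous hχ.smooth.continuous T.smooth_bump.continuous
  obtain ⟨B1, hB1⟩ := (h.proper1 Q hQU hQ).isBounded.exists_norm_le
  obtain ⟨B2, hB2⟩ := (h.proper2 Q hQU hQ).isBounded.exists_norm_le
  set B := max (R / 2) (max B1 B2)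
  obtain ⟨β, hβ, hβB⟩ := exists_bound_of_collar_le B
  have hsub : openCyl ∩ neckMap p b ϕ1 ϕ2 ζ χ c t ⁻¹' Q ⊆ univ ×ˢ Icc (-β) β := by
    rintro ⟨w, z⟩ ⟨⟨-, hz⟩, hx⟩
    have hz : z ∈ Ioo (-1 : ℝ) 1 := hz
    have hle : collar z ≤ B ∧ collar (-z) ≤ B := by
      have p1 := collar_nonneg hz
      have p2 := collar_nonneg (neg_mem_Ioo hz)
      rcases lt_or_ge (collar z + collar (-z)) (R / 2) with h1 | h1
      · exact ⟨by linarith [le_max_left (R / 2) (max B1 B2)],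
          by linarith [le_max_left (R / 2) (max B1 B2)]⟩
      rw [mem_preimage, neckMap_of_ge T hχ h1] at hx
      have hB : 0 ≤ B := by linarith [le_max_left (R / 2) (max B1 B2), h.disk1.pos]
      rcases le_total 0 z with h0 | h0
      · have e : collar (-z) = 0 := collar_of_nonpos (neg_nonpos.2 h0)
        refine ⟨?_, e ▸ hB⟩
        simp only [neckBase, e, zero_smul, h.disk2.apply_zero, add_sub_cancel_right] at hx
        have := hB1 _ hx
        rw [norm_smul, w.norm_coe, mul_one, Real.norm_of_nonneg p1] at this
        exact this.trans ((le_max_left _ _).trans (le_max_right _ _))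
      · have e : collar z = 0 := collar_of_nonpos h0
        refine ⟨e ▸ hB, ?_⟩
        simp only [neckBase, e, zero_smul, h.disk1.apply_zero, add_sub_cancel_left] at hx
        have := hB2 _ hx
        rw [norm_smul, w.norm_coe, mul_one, Real.norm_of_nonneg p2] at this
        exact this.trans ((le_max_right _ _).trans (le_max_right _ _))
    exact ⟨mem_univ _, by simp only; linarith [hβB _ (neg_mem_Ioo hz) hle.2], hβB _ hz hle.1⟩
  have hcyl : (univ : Set Circle) ×ˢ Icc (-β) β ⊆ openCyl :=
    prod_mono Subset.rfl (Icc_subset_Ioo (by linarith) hβ)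
  have heq : openCyl ∩ neckMap p b ϕ1 ϕ2 ζ χ c t ⁻¹' Q =
      (univ ×ˢ Icc (-β) β) ∩ neckMap p b ϕ1 ϕ2 ζ χ c t ⁻¹' Q :=
    Subset.antisymm (fun x hx => ⟨hsub hx, hx.2⟩) fun x hx => ⟨hcyl hx.1, hx.2⟩
  rw [heq]
  exact (isCompact_univ.prod isCompact_Icc).of_isClosed_subset
    ((hcont.mono hcyl).preimage_isClosed_of_isClosed (isClosed_univ.prod isClosed_Icc) hQ.isClosed)
    inter_subset_left

end LocalModel


lemma mem_Ioo_of_punctured {z : ℝ} (hz : z ∈ Ioo (-1 : ℝ) 0 ∪ Ioo 0 1) : z ∈ Ioo (-1 : ℝ) 1 := by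
  rcases hz with hz | hz
  · exact ⟨hz.1, by linarith [hz.2]⟩
  · exact ⟨by linarith [hz.1], hz.2⟩

lemma puncturedCyl_subset : puncturedCyl ⊆ openCyl :=
  prod_mono Subset.rfl fun _ hz => mem_Ioo_of_punctured hz

namespace LocalModel

include h T hχ ha in
/-- The two moved disks do not meet outside the closed neck. -/
lemma movedDisk_ne {y y' : ℂ} (hy : t * χ 0 < ‖y‖) :
    movedDisk p b R ϕ1 (upperSheet u1 ζ χ c t) y ≠ movedDisk p b R ϕ2 (lowerSheet u2 χ t) y' := by
  intro heq
  have hR := h.disk1.pos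
  have s1 := h.isSheet1 T hχ ha
  have s2 := h.isSheet2 T hχ ha
  have hiff : ‖y‖ < R ↔ ‖y'‖ < R := by
    rw [← s1.movedDisk_mem_openBox, heq, s2.movedDisk_mem_openBox]
  rcases lt_or_ge ‖y‖ R with h1 | h1
  · rw [IsSheet.movedDisk_of_lt h1, IsSheet.movedDisk_of_lt (hiff.1 h1)] at heq
    obtain ⟨rfl, h2⟩ := Prod.mk.inj (chart_injective p b heq)
    exact (T.lowerSheet_lt_upperSheet hχ ha.time ha.sign ha.lt_gap hy h1).ne' h2
  · have h2 : R ≤ ‖y'‖ := not_lt.1 fun h2 => not_lt.2 h1 (hiff.2 h2)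
    rw [s1.movedDisk_of_ge (by linarith), s2.movedDisk_of_ge (by linarith)] at heq
    rw [(h.inter _ _ heq).1, norm_zero] at h1
    linarith

include hχ ha in
lemma norm_stretch_smul {ρ : ℝ}
    (hρ : 0 ≤ ρ) (w : Circle) : ‖stretch χ t ρ • (w : ℂ)‖ = stretch χ t ρ := by
  rw [norm_smul, w.norm_coe, mul_one, Real.norm_of_nonneg
    (by linarith [hχ.stretch_pos ha.time ha.sign hρ])]

include hχ ha in
lemma lt_stretch {ρ : ℝ} (hρ : 0 < ρ) : t * χ 0 < stretch χ t ρ := by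
  have hs0 : stretch χ t 0 = t * χ 0 := by simp [stretch]
  rw [← hs0]
  exact hχ.strictMono ha.time hρ

include hχ ha in
lemma stretch_smul_injective
    {z z' : ℝ} (hz : z ∈ Ioo (0 : ℝ) 1) (hz' : z' ∈ Ioo (0 : ℝ) 1) {w w' : Circle}
    (h : stretch χ t (collar z) • (w : ℂ) = stretch χ t (collar z') • (w' : ℂ)) :
    w = w' ∧ z = z' := by
  have h1 := congrArg norm h
  rw [norm_stretch_smul hχ ha (collar_pos hz).le, norm_stretch_smul hχ ha (collar_pos hz').le] at h1
  have h2 := lt_stretch hχ ha (collar_pos hz')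
  rw [h1] at h
  refine ⟨Circle.ext (smul_right_injective ℂ (by linarith [ha.sign] :
    stretch χ t (collar z') ≠ 0) h), collar_injOn ⟨hz.1.le, hz.2⟩ ⟨hz'.1.le, hz'.2⟩
    ((hχ.strictMono ha.time).injective h1)⟩

include h T hχ ha in
lemma injOn_neckMap : InjOn (neckMap p b ϕ1 ϕ2 ζ χ c t) puncturedCyl := by
  have s1 := h.isSheet1 T hχ ha
  have s2 := h.isSheet2 T hχ ha
  have e1 := fun (w : Circle) {z : ℝ} (hz : z ∈ Ioo (0 : ℝ) 1) =>
    h.neckMap_of_nonneg T hχ ha w ⟨hz.1.le, hz.2⟩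
  have e2 := fun (w : Circle) {z : ℝ} (hz : z ∈ Ioo (-1 : ℝ) 0) =>
    h.neckMap_of_nonpos T hχ ha w ⟨hz.1, hz.2.le⟩
  have hneg : ∀ {z : ℝ}, z ∈ Ioo (-1 : ℝ) 0 → -z ∈ Ioo (0 : ℝ) 1 := fun hz =>
    ⟨by linarith [hz.2], by linarith [hz.1]⟩
  have hlt : ∀ (w : Circle) {z : ℝ}, z ∈ Ioo (0 : ℝ) 1 →
      t * χ 0 < ‖stretch χ t (collar z) • (w : ℂ)‖ := fun w z hz => by
    rw [norm_stretch_smul hχ ha (collar_pos hz).le]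
    exact lt_stretch hχ ha (collar_pos hz)
  rintro ⟨w, z⟩ ⟨-, hz⟩ ⟨w', z'⟩ ⟨-, hz'⟩ heq
  simp only at hz hz'
  rcases hz with hz | hz <;> rcases hz' with hz' | hz'
  · rw [e2 w hz, e2 w' hz'] at heq
    obtain ⟨rfl, h2⟩ := stretch_smul_injective hχ ha (hneg hz) (hneg hz') (s2.injective_movedDisk heq)
    rw [neg_injective h2]
  · rw [e2 w hz, e1 w' hz'] at heq
    exact absurd heq.symm (h.movedDisk_ne T hχ ha (hlt w' hz'))
  · rw [e1 w hz, e2 w' hz'] at heq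
    exact absurd heq (h.movedDisk_ne T hχ ha (hlt w hz))
  · rw [e1 w hz, e1 w' hz'] at heq
    obtain ⟨rfl, rfl⟩ := stretch_smul_injective hχ ha hz hz' (s1.injective_movedDisk heq)
    rfl

include h T hχ ha in
/-- Points of the punctured cylinder are not mapped to the image of the central circle. -/
lemma neckMap_ne_circle {x : Circle × ℝ} (hx : x ∈ puncturedCyl) (w : Circle) :
    neckMap p b ϕ1 ϕ2 ζ χ c t x ≠ neckMap p b ϕ1 ϕ2 ζ χ c t (w, 0) := by
  have hc0 : collar 0 = 0 := collar_of_nonpos le_rfl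
  have hcirc : ‖stretch χ t (collar 0) • (w : ℂ)‖ = t * χ 0 := by
    rw [norm_stretch_smul hχ ha (by rw [hc0]), hc0]
    simp [stretch]
  have hne : ∀ (v : Circle) {z : ℝ}, z ∈ Ioo (0 : ℝ) 1 →
      stretch χ t (collar z) • (v : ℂ) ≠ stretch χ t (collar 0) • (w : ℂ) := by
    intro v z hz heq
    have h1 := congrArg norm heq
    rw [hcirc, norm_stretch_smul hχ ha (collar_pos hz).le] at h1
    exact (lt_stretch hχ ha (collar_pos hz)).ne' h1
  obtain ⟨v, z⟩ := x
  rcases hx.2 with hz | hz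
  · have hz' : -z ∈ Ioo (0 : ℝ) 1 := ⟨by linarith [hz.2], by linarith [hz.1]⟩
    rw [h.neckMap_of_nonpos T hχ ha v ⟨hz.1, hz.2.le⟩,
      h.neckMap_of_nonpos T hχ ha w ⟨by norm_num, le_rfl⟩, neg_zero]
    exact fun heq => hne v hz' ((h.isSheet2 T hχ ha).injective_movedDisk heq)
  · rw [h.neckMap_of_nonneg T hχ ha v ⟨hz.1.le, hz.2⟩,
      h.neckMap_of_nonneg T hχ ha w ⟨le_rfl, by norm_num⟩]
    exact fun heq => hne v hz ((h.isSheet1 T hχ ha).injective_movedDisk heq)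

include h in
lemma isEmbedding_neckMap (hU : IsOpen U)
    (T : TwoSheets u1 u2 ζ (R / 4) (R / 2) R K m) (hχ : IsProfile χ (R / 4) M)
    (ha : Admissible χ M m H t c) :
    IsEmbedding (puncturedCyl.domRestrict (neckMap p b ϕ1 ϕ2 ζ χ c t)) := by
  have hcont := continuousOn_neckMap (p := p) (b := b) (c := c) (t := t)
    h.disk1.smooth.continuous h.disk2.smooth.continuous hχ.smooth.continuous T.smooth_bump.continuous
  set f := neckMap p b ϕ1 ϕ2 ζ χ c t with hf
  have hcirc : IsClosed (f '' (univ ×ˢ {0})) := by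
    refine ((isCompact_univ.prod isCompact_singleton).image_of_continuousOn (hcont.mono ?_)).isClosed
    exact prod_mono Subset.rfl (by simp)
  refine isEmbedding_of_compact_preimage (continuousOn_iff_continuous_domRestrict.1
    (hcont.mono puncturedCyl_subset)) (injOn_iff_injective.1 (h.injOn_neckMap T hχ ha)) fun x => ?_
  have hx : f x ∈ U \ f '' (univ ×ˢ {0}) := by
    refine ⟨h.mapsTo_neckMap T hχ ha (puncturedCyl_subset x.2), ?_⟩
    rintro ⟨⟨w, z⟩, ⟨-, hz⟩, heq⟩
    obtain rfl : z = 0 := hz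
    exact h.neckMap_ne_circle T hχ ha x.2 w heq.symm
  obtain ⟨N, hN, hNsub, hNc⟩ := local_compact_nhds ((hU.sdiff hcirc).mem_nhds hx)
  refine ⟨N, hN, ?_⟩
  rw [Subtype.isCompact_iff]
  have heq : Subtype.val '' (puncturedCyl.domRestrict f ⁻¹' N) = openCyl ∩ f ⁻¹' N := by
    ext ⟨w, z⟩
    constructor
    · rintro ⟨x, hx, hxw⟩
      rw [← hxw]
      exact ⟨puncturedCyl_subset x.2, hx⟩
    · rintro ⟨hx, hxN⟩
      have hz0 : z ≠ 0 := by
        rintro rfl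
        exact (hNsub hxN).2 ⟨(w, 0), ⟨mem_univ _, rfl⟩, rfl⟩
      have hz : z ∈ Ioo (-1 : ℝ) 1 := hx.2
      refine ⟨⟨(w, z), mem_univ _, ?_⟩, hxN, rfl⟩
      rcases lt_or_gt_of_ne hz0 with h0 | h0
      · exact Or.inl ⟨hz.1, h0⟩
      · exact Or.inr ⟨h0, hz.2⟩
  rw [heq]
  exact h.isCompact_preimage_neckMap T hχ (hNsub.trans sdiff_subset) hNc

include h T hχ ha in
lemma injective_fderiv_neckMap (θ : ℝ) {z : ℝ} (hz : z ∈ Ioo (-1 : ℝ) 0 ∪ Ioo 0 1) :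
    Function.Injective (fderiv ℝ (cylLift (neckMap p b ϕ1 ϕ2 ζ χ c t)) (θ, z)) := by
  have key : ∀ {ϕ u W} {r : ℝ → ℝ} {d : ℝ}, IsSheet p b ϕ u W R H K → HasDerivAt r d z → d ≠ 0 →
      0 < r z → (cylLift (neckMap p b ϕ1 ϕ2 ζ χ c t)) =ᶠ[𝓝 (θ, z)] (fun q =>
        movedDisk p b R ϕ W (stretch χ t (r q.2) • ((Circle.exp q.1 : Circle) : ℂ))) →
      Function.Injective (fderiv ℝ (cylLift (neckMap p b ϕ1 ϕ2 ζ χ c t)) (θ, z)) := by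
    intro ϕ u W r d hs hr hd hpos hev
    obtain ⟨L, hL, hL'⟩ := exists_hasFDerivAt_polar (θ := θ)
      ((hχ.hasDerivAt_stretch t (r z)).comp z hr)
      (mul_ne_zero (by linarith [hχ.half_le ha.time (r z)]) hd)
      (by linarith [hχ.stretch_pos ha.time ha.sign hpos.le] : stretch χ t (r z) ≠ 0)
    obtain ⟨L', hLi, hLi'⟩ := hs.exists_hasStrictFDerivAt_movedDisk
      (stretch χ t (r z) • ((Circle.exp θ : Circle) : ℂ))
    have := (HasFDerivAt.comp (θ, z) (g := movedDisk p b R ϕ W) hLi' hL').congr_of_eventuallyEq hev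
    rw [this.fderiv]
    exact hLi.comp hL
  rcases hz with hz | hz
  · obtain ⟨d, hd, hd'⟩ := exists_hasDerivAt_collar (z := -z) ⟨by linarith [hz.2], by linarith [hz.1]⟩
    refine key (h.isSheet2 T hχ ha) (r := fun z => collar (-z)) (hd'.comp z (hasDerivAt_neg z))
      (by simpa using hd.ne') (collar_pos ⟨by linarith [hz.2], by linarith [hz.1]⟩) ?_
    filter_upwards [(isOpen_Ioo.preimage continuous_snd).mem_nhds
      (show (θ, z) ∈ Prod.snd ⁻¹' Ioo (-1 : ℝ) 0 from hz)] with q hq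
    exact h.neckMap_of_nonpos T hχ ha _ ⟨hq.1, le_of_lt hq.2⟩
  · obtain ⟨d, hd, hd'⟩ := exists_hasDerivAt_collar hz
    refine key (h.isSheet1 T hχ ha) (r := collar) hd' hd.ne' (collar_pos hz) ?_
    filter_upwards [(isOpen_Ioo.preimage continuous_snd).mem_nhds
      (show (θ, z) ∈ Prod.snd ⁻¹' Ioo (0 : ℝ) 1 from hz)] with q hq
    exact h.neckMap_of_nonneg T hχ ha _ ⟨le_of_lt hq.1, hq.2⟩

end LocalModel


/-! ### The deformed sets -/

section Frontier

variable {A B : Set (ℂ × ℝ)} {W1 W2 : ℂ → ℝ} {s : Bool}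

/-- Membership in the region between two graphs is stable under convergence of the graphs. -/
lemma eventually_mem_midRegion_iff {α : Type*} {l : Filter α} {W1 W2 : α → ℂ → ℝ}
    {V1 V2 : ℂ → ℝ} {f : α → ℂ × ℝ} {q : ℂ × ℝ} (hf : Tendsto (fun t => (f t).2) l (𝓝 q.2))
    (h1 : Tendsto (fun t => W1 t (f t).1) l (𝓝 (V1 q.1)))
    (h2 : Tendsto (fun t => W2 t (f t).1) l (𝓝 (V2 q.1))) (hq1 : q.2 ≠ V1 q.1) (hq2 : q.2 ≠ V2 q.1) :
    ∀ᶠ t in l, (f t ∈ midRegion (W1 t) (W2 t) ↔ q ∈ midRegion V1 V2) := by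
  rcases lt_or_gt_of_ne hq2 with k | k
  · filter_upwards [hf.eventually_lt h2 k] with t ht
    exact iff_of_false (fun h => lt_asymm h.1 ht) fun h => lt_asymm h.1 k
  rcases lt_or_gt_of_ne hq1 with k' | k'
  · filter_upwards [h2.eventually_lt hf k, hf.eventually_lt h1 k'] with t a1 a2
    exact iff_of_true ⟨a1, a2⟩ ⟨k, k'⟩
  · filter_upwards [h1.eventually_lt hf k'] with t ht
    exact iff_of_false (fun h => lt_asymm h.2 ht) fun h => lt_asymm h.2 k'

lemma notMem_frontier_of_fills (hB : IsOpen B) (hW1 : Continuous W1) (hW2 : Continuous W2)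
    (hA : ∀ q ∈ B, q.2 ≠ W1 q.1 → q.2 ≠ W2 q.1 → (q ∈ A ↔ (q ∈ midRegion W1 W2 ↔ s = true)))
    {q : ℂ × ℝ} (hq : q ∈ B) (g1 : q.2 ≠ W1 q.1) (g2 : q.2 ≠ W2 q.1) : q ∉ frontier A := by
  have c1 := hW1.comp (continuous_fst (X := ℂ) (Y := ℝ))
  have c2 := hW2.comp (continuous_fst (X := ℂ) (Y := ℝ))
  have hmid : ∀ᶠ q' in 𝓝 q, q' ∈ midRegion W1 W2 ↔ q ∈ midRegion W1 W2 :=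
    eventually_mem_midRegion_iff (continuous_snd.tendsto q) (c1.tendsto q) (c2.tendsto q) g1 g2
  have hev : ∀ᶠ q' in 𝓝 q, q' ∈ A ↔ q ∈ A := by
    filter_upwards [hmid, hB.mem_nhds hq, (isOpen_ne_fun continuous_snd c1).mem_nhds g1,
      (isOpen_ne_fun continuous_snd c2).mem_nhds g2] with q' a1 a2 a3 a4
    rw [hA q' a2 a3 a4, hA q hq g1 g2, a1]
  rw [frontier_eq_closure_inter_closure]
  rintro ⟨k1, k2⟩
  by_cases hqA : q ∈ A
  · exact mem_closure_iff_frequently.1 k2 (hev.mono fun q' h h' => h' (h.2 hqA))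
  · exact mem_closure_iff_frequently.1 k1 (hev.mono fun q' h h' => hqA (h.1 h'))

lemma mem_frontier_of_fills (hB : IsOpen B)
    (hA : ∀ q ∈ B, q.2 ≠ W1 q.1 → q.2 ≠ W2 q.1 → (q ∈ A ↔ (q ∈ midRegion W1 W2 ↔ s = true)))
    {q : ℂ × ℝ} (hq : q ∈ B) (h : q.2 = W1 q.1 ∨ q.2 = W2 q.1) (hlt : W2 q.1 < W1 q.1) :
    q ∈ frontier A := by
  have htend : ∀ σ : ℝ, Tendsto (fun δ : ℝ => (q.1, q.2 + σ * δ)) (𝓝[>] 0) (𝓝 q) := by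
    intro σ
    have : Continuous fun δ : ℝ => (q.1, q.2 + σ * δ) := by fun_prop
    simpa using (this.tendsto 0).mono_left nhdsWithin_le_nhds
  have hsmall : ∀ᶠ δ in 𝓝[>] (0 : ℝ), 0 < δ ∧ δ < W1 q.1 - W2 q.1 := by
    filter_upwards [self_mem_nhdsWithin, nhdsWithin_le_nhds (Iio_mem_nhds (sub_pos.2 hlt))]
      with δ a1 a2 using ⟨a1, a2⟩
  have hin : ∃ σ : ℝ, ∀ᶠ δ in 𝓝[>] (0 : ℝ), (q.1, q.2 + σ * δ) ∈ A ↔ s = true := by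
    refine ⟨if q.2 = W1 q.1 then -1 else 1, ?_⟩
    filter_upwards [hsmall, (htend _).eventually (hB.mem_nhds hq)] with δ a1 a2
    have hm : W2 q.1 < q.2 + (if q.2 = W1 q.1 then -1 else 1) * δ ∧
        q.2 + (if q.2 = W1 q.1 then -1 else 1) * δ < W1 q.1 := by
      split_ifs with h1
      · constructor <;> linarith
      · have := h.resolve_left h1
        constructor <;> linarith
    rw [hA _ a2 hm.2.ne hm.1.ne']
    exact ⟨fun hh => hh.1 hm, fun hh => iff_of_true hm hh⟩
  have hout : ∃ σ : ℝ, ∀ᶠ δ in 𝓝[>] (0 : ℝ), (q.1, q.2 + σ * δ) ∈ A ↔ ¬ s = true := by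
    refine ⟨if q.2 = W1 q.1 then 1 else -1, ?_⟩
    filter_upwards [hsmall, (htend _).eventually (hB.mem_nhds hq)] with δ a1 a2
    have hm : W1 q.1 < q.2 + (if q.2 = W1 q.1 then 1 else -1) * δ ∨
        q.2 + (if q.2 = W1 q.1 then 1 else -1) * δ < W2 q.1 := by
      split_ifs with h1
      · left; linarith
      · right; linarith [h.resolve_left h1]
    have hne : ¬ (q.1, q.2 + (if q.2 = W1 q.1 then 1 else -1) * δ) ∈ midRegion W1 W2 := fun hh =>
      hm.elim (fun k => lt_asymm k hh.2) fun k => lt_asymm k hh.1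
    rw [hA _ a2 (by rcases hm with k | k <;> simp only <;> [exact k.ne'; linarith])
      (by rcases hm with k | k <;> simp only <;> [linarith; exact k.ne])]
    exact ⟨fun hh hs => hne (hh.2 hs), fun hh => iff_of_false hne hh⟩
  obtain ⟨σ, hσ⟩ := hin
  obtain ⟨τ, hτ⟩ := hout
  rw [frontier_eq_closure_inter_closure]
  by_cases hs : s = true
  · exact ⟨mem_closure_of_tendsto (htend σ) (hσ.mono fun _ h => h.2 hs),
      mem_closure_of_tendsto (htend τ) (hτ.mono fun _ h hA => h.1 hA hs)⟩
  · exact ⟨mem_closure_of_tendsto (htend τ) (hτ.mono fun _ h => h.2 hs),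
      mem_closure_of_tendsto (htend σ) (hσ.mono fun _ h hA => hs (h.1 hA))⟩

end Frontier

/-- The set `E` with its part in the closed set `C` replaced by the region between two graphs,
or its complement. -/
def deformedSet (E C : Set R3) (p : R3) (b : Frame) (s : Bool) (W1 W2 : ℂ → ℝ) : Set R3 :=
  E \ C ∪ C ∩ chart p b '' {q | q ∈ midRegion W1 W2 ↔ s = true}

section

variable {E C : Set R3} {p : R3} {b : Frame} {s : Bool} {W1 W2 : ℂ → ℝ}

lemma deformedSet_sdiff : deformedSet E C p b s W1 W2 \ C = E \ C := by
  ext x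
  simp only [deformedSet, Set.mem_sdiff, mem_union, mem_inter_iff]
  tauto

lemma chart_mem_deformedSet {q : ℂ × ℝ} (hq : chart p b q ∈ C) :
    chart p b q ∈ deformedSet E C p b s W1 W2 ↔ (q ∈ midRegion W1 W2 ↔ s = true) := by
  simp only [deformedSet, mem_union, Set.mem_sdiff, hq, not_true_eq_false, and_false, mem_inter_iff,
    true_and, false_or, mem_image_chart, chartInv_chart]
  rfl

lemma measurableSet_deformedSet (hE : MeasurableSet E) (hC : MeasurableSet C)
    (hW1 : Continuous W1) (hW2 : Continuous W2) :
    MeasurableSet (deformedSet E C p b s W1 W2) := by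
  have hm := measurableSet_midRegion hW1 hW2
  refine (hE.diff hC).union (hC.inter ((measurableEmbedding_chart p b).measurableSet_image' ?_))
  by_cases hs : s = true
  · rwa [show {q | q ∈ midRegion W1 W2 ↔ s = true} = midRegion W1 W2 by ext; simp [hs]]
  · rw [show {q | q ∈ midRegion W1 W2 ↔ s = true} = (midRegion W1 W2)ᶜ by ext; simp [hs]]
    exact hm.compl

end

namespace LocalModel

include h T hχ ha in
lemma chart_mem_deformedSet_iff {q : ℂ × ℝ} (hq : q ∈ ball (0 : ℂ) R ×ˢ Ioo (-H) H)
    (h1 : q.2 ≠ upperSheet u1 ζ χ c t q.1) (h2 : q.2 ≠ lowerSheet u2 χ t q.1) :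
    chart p b q ∈ deformedSet E (closedBox p b (R / 2) (H / 2)) p b s (upperSheet u1 ζ χ c t)
      (lowerSheet u2 χ t) ↔
        (q ∈ midRegion (upperSheet u1 ζ χ c t) (lowerSheet u2 χ t) ↔ s = true) := by
  have hH := h.height_pos
  by_cases hqC : chart p b q ∈ closedBox p b (R / 2) (H / 2)
  · exact chart_mem_deformedSet hqC
  have hqE : chart p b q ∈ deformedSet E (closedBox p b (R / 2) (H / 2)) p b s
      (upperSheet u1 ζ χ c t) (lowerSheet u2 χ t) ↔ chart p b q ∈ E := by
    simp [deformedSet, hqC]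
  rw [hqE]
  have hqR : ‖q.1‖ < R := by simpa using hq.1
  rcases le_or_gt (R / 2) ‖q.1‖ with h3 | h3
  · have e1 := (h.isSheet1 T hχ ha).eq _ h3
    have e2 := (h.isSheet2 T hχ ha).eq _ h3
    rw [e1] at h1
    rw [e2] at h2
    rw [h.fill q hq h1 h2, midRegion, midRegion, mem_ofPred_eq, mem_ofPred_eq, e1, e2]
  · rw [closedBox, mem_image_chart, chartInv_chart, mem_prod, not_and_or, mem_closedBall_zero_iff,
      mem_Icc, ← abs_le, not_le, not_le] at hqC
    have hq2 := hqC.resolve_left (not_lt.2 h3.le)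
    have a1 := abs_lt.1 (h.abs_height_lt1 hqR)
    have a2 := abs_lt.1 (h.abs_height_lt2 hqR)
    have a3 := abs_lt.1 (h.abs_upperSheet_lt T hχ ha hqR)
    have a4 := abs_lt.1 (h.abs_lowerSheet_lt hχ ha.time hqR)
    rcases lt_abs.1 hq2 with k | k
    · rw [h.fill q hq (by linarith) (by linarith)]
      exact iff_congr (iff_of_false (fun hm => by linarith [hm.2]) fun hm => by linarith [hm.2])
        Iff.rfl
    · rw [h.fill q hq (by linarith) (by linarith)]
      exact iff_congr (iff_of_false (fun hm => by linarith [hm.1]) fun hm => by linarith [hm.1])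
        Iff.rfl

include h T hχ ha in
lemma fillsBox_deformedSet : FillsBox p b R H s (deformedSet E (closedBox p b (R / 2) (H / 2))
      p b s (upperSheet u1 ζ χ c t) (lowerSheet u2 χ t))
      (upperSheet u1 ζ χ c t) (lowerSheet u2 χ t) := by
  have n1 := measure_graph_eq_zero (T.contDiff_upperSheet hχ ha.time ha.sign c).continuous
  have n2 := measure_graph_eq_zero (T.contDiff_lowerSheet hχ ha.time ha.sign).continuous
  filter_upwards [measure_eq_zero_iff_ae_notMem.1 n1, measure_eq_zero_iff_ae_notMem.1 n2]
    with q h1 h2 hq using h.chart_mem_deformedSet_iff T hχ ha hq h1 h2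

include h T hχ ha in
/-- The boundary of the deformed set is the image of the neck map. -/
theorem frontier_deformedSet (hpos : 0 < t * χ 0) :
    frontier (deformedSet E (closedBox p b (R / 2) (H / 2)) p b s (upperSheet u1 ζ χ c t)
      (lowerSheet u2 χ t)) ∩ U = neckMap p b ϕ1 ϕ2 ζ χ c t '' openCyl := by
  have hR := h.disk1.pos
  have hH := h.height_pos
  set W1 := upperSheet u1 ζ χ c t with hW1
  set W2 := lowerSheet u2 χ t with hW2
  set C := closedBox p b (R / 2) (H / 2) with hC
  set F := deformedSet E C p b s W1 W2 with hF
  have hc1 : Continuous W1 := (T.contDiff_upperSheet hχ ha.time ha.sign c).continuous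
  have hc2 : Continuous W2 := (T.contDiff_lowerSheet hχ ha.time ha.sign).continuous
  have s1 := h.isSheet1 T hχ ha
  have s2 := h.isSheet2 T hχ ha
  have hopen : IsOpen (ball (0 : ℂ) R ×ˢ Ioo (-H) H) := isOpen_ball.prod isOpen_Ioo
  have hA : ∀ q ∈ ball (0 : ℂ) R ×ˢ Ioo (-H) H, q.2 ≠ W1 q.1 → q.2 ≠ W2 q.1 →
      (q ∈ chart p b ⁻¹' F ↔ (q ∈ midRegion W1 W2 ↔ s = true)) := fun q hq h1 h2 =>
    h.chart_mem_deformedSet_iff T hχ ha hq h1 h2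
  ext x
  by_cases hxC : x ∈ C
  · obtain ⟨q, rfl⟩ : ∃ q, x = chart p b q := ⟨_, (chart_chartInv p b x).symm⟩
    have hxbox : chart p b q ∈ openBox p b R H := h.closedBox_subset hxC
    have hqB : q ∈ ball (0 : ℂ) R ×ˢ Ioo (-H) H := by
      rwa [openBox, mem_image_chart, chartInv_chart] at hxbox
    have hqR : ‖q.1‖ < R := by simpa using hqB.1
    have hfr : chart p b q ∈ frontier F ↔ q ∈ frontier (chart p b ⁻¹' F) :=
      Set.ext_iff.1 ((chartHomeo p b).preimage_frontier F) q
    have him : chart p b q ∈ neckMap p b ϕ1 ϕ2 ζ χ c t '' openCyl ↔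
        t * χ 0 ≤ ‖q.1‖ ∧ (q.2 = W1 q.1 ∨ q.2 = W2 q.1) := by
      rw [h.mem_image_neckMap T hχ ha]
      constructor
      · rintro ⟨y, hy, hx | hx⟩
        · rw [hx, s1.movedDisk_mem_openBox] at hxbox
          rw [IsSheet.movedDisk_of_lt hxbox] at hx
          obtain rfl := chart_injective p b hx
          exact ⟨hy, Or.inl rfl⟩
        · rw [hx, s2.movedDisk_mem_openBox] at hxbox
          rw [IsSheet.movedDisk_of_lt hxbox] at hx
          obtain rfl := chart_injective p b hx
          exact ⟨hy, Or.inr rfl⟩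
      · rintro ⟨hy, hx⟩
        refine ⟨q.1, hy, hx.imp (fun hx => ?_) fun hx => ?_⟩ <;>
        · rw [IsSheet.movedDisk_of_lt hqR]
          exact congrArg _ (Prod.ext rfl hx)
    rw [him, mem_inter_iff, hfr, and_iff_left (h.box_subset hxbox)]
    constructor
    · intro hq
      have hgr : q.2 = W1 q.1 ∨ q.2 = W2 q.1 := by
        by_contra hcon
        rw [not_or] at hcon
        exact notMem_frontier_of_fills hopen hc1 hc2 hA hqB hcon.1 hcon.2 hq
      refine ⟨not_lt.1 fun hlt => ?_, hgr⟩
      have hrad := TwoSheets.radius_lt hχ ha.time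
      have heq : ∀ y : ℂ, ‖y‖ < t * χ 0 → W1 y = 0 ∧ W2 y = 0 := fun y hy =>
        ⟨T.upperSheet_of_le hχ ha.time hy.le, T.lowerSheet_of_le hχ ha.time hy.le⟩
      have hq2 : q.2 = 0 := by
        rcases hgr with e | e <;> rw [e]
        exacts [(heq _ hlt).1, (heq _ hlt).2]
      have hev : ∀ᶠ q' in 𝓝 q, q' ∈ chart p b ⁻¹' F ↔ ¬ s = true := by
        filter_upwards [(isOpen_lt continuous_fst.norm continuous_const).mem_nhds hlt,
          (isOpen_lt continuous_snd.abs continuous_const).mem_nhds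
            (show |q.2| < H / 2 by rw [hq2, abs_zero]; linarith)] with q' a1 a2
        have hq'C : chart p b q' ∈ C :=
          ⟨q', ⟨mem_closedBall_zero_iff.2 (by linarith), abs_le.1 (le_of_lt a2)⟩, rfl⟩
        have hnm : q' ∉ midRegion W1 W2 := fun hm => by
          have := hm.1.trans hm.2
          rw [(heq _ a1).1, (heq _ a1).2] at this
          exact lt_irrefl _ this
        rw [mem_preimage, hF, chart_mem_deformedSet hq'C]
        simp [hnm]
      rw [frontier_eq_closure_inter_closure] at hq
      by_cases hs : s = true
      · exact mem_closure_iff_frequently.1 hq.1 (hev.mono fun q' h h' => h.1 h' hs)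
      · exact mem_closure_iff_frequently.1 hq.2 (hev.mono fun q' h h' => h' (h.2 hs))
    · rintro ⟨hle, hgr⟩
      have hstrict : ∀ q' ∈ ball (0 : ℂ) R ×ˢ Ioo (-H) H, t * χ 0 < ‖q'.1‖ →
          (q'.2 = W1 q'.1 ∨ q'.2 = W2 q'.1) → q' ∈ frontier (chart p b ⁻¹' F) :=
        fun q' hq' hlt hg => mem_frontier_of_fills hopen hA hq' hg
          (T.lowerSheet_lt_upperSheet hχ ha.time ha.sign ha.lt_gap hlt (by simpa using hq'.1))
      have hlim : ∀ W : ℂ → ℝ, Continuous W → q.2 = W q.1 →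
          (∀ q' : ℂ × ℝ, q'.2 = W q'.1 → q'.2 = W1 q'.1 ∨ q'.2 = W2 q'.1) →
          q ∈ frontier (chart p b ⁻¹' F) := by
        intro W hW hqW hWg
        have hcont : Continuous fun δ : ℝ =>
            ((1 + δ) • q.1, W ((1 + δ) • q.1)) := by fun_prop
        have htend : Tendsto (fun δ : ℝ => ((1 + δ) • q.1, W ((1 + δ) • q.1))) (𝓝[>] 0) (𝓝 q) := by
          have := (hcont.tendsto 0).mono_left (nhdsWithin_le_nhds (s := Ioi 0))
          rwa [add_zero, one_smul, ← hqW] at this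
        refine isClosed_frontier.mem_of_tendsto htend ?_
        filter_upwards [self_mem_nhdsWithin, htend.eventually (hopen.mem_nhds hqB)] with δ hδ hB
        refine hstrict _ hB ?_ (hWg _ rfl)
        have hδ : 0 < δ := hδ
        simp only [norm_smul, Real.norm_of_nonneg (by linarith : 0 ≤ 1 + δ)]
        nlinarith
      rcases hgr with e | e
      · exact hlim W1 hc1 e fun _ h => Or.inl h
      · exact hlim W2 hc2 e fun _ h => Or.inr h
  · have hCo : IsOpen Cᶜ := (isClosed_closedBox p b (R / 2) (H / 2)).isOpen_compl
    have hfr : x ∈ frontier F ↔ x ∈ frontier E := by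
      have h1 := frontier_inter_open_inter (s := F) hCo
      have h2 := frontier_inter_open_inter (s := E) hCo
      have e : F ∩ Cᶜ = E ∩ Cᶜ := by
        rw [← Set.sdiff_eq, ← Set.sdiff_eq]
        exact deformedSet_sdiff
      rw [e, h2] at h1
      have := Set.ext_iff.1 h1 x
      simpa [hxC] using this.symm
    have hsame : ∀ y ∈ openCyl, (neckMap p b ϕ1 ϕ2 ζ χ c t y = x ↔ neckBase p ϕ1 ϕ2 y = x) := by
      intro y hy
      rcases lt_or_ge (collar y.2 + collar (-y.2)) (R / 2) with h1 | h1
      · have k1 := h.neckMap_mem_closedBox T hχ ha hy h1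
        have k2 := h.neckMap_mem_closedBox T hχ (admissible_zero T.gap_pos hH) hy h1
        rw [neckMap_zero] at k2
        exact iff_of_false (fun e => hxC (e ▸ k1)) fun e => hxC (e ▸ k2)
      · rw [neckMap_of_ge T hχ h1]
    rw [mem_inter_iff, hfr, ← mem_inter_iff, h.frontier_eq, ← h.image_neckBase]
    exact ⟨fun ⟨y, hy, e⟩ => ⟨y, hy, (hsame y hy).2 e⟩, fun ⟨y, hy, e⟩ => ⟨y, hy, (hsame y hy).1 e⟩⟩

end LocalModel


lemma IsProfile.abs_shrink_sub_le {χ : ℝ → ℝ} {R M t t₀ : ℝ} (h : IsProfile χ R M)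
    (ht : |t| * M ≤ 1 / 2) (ht₀ : |t₀| * M ≤ 1 / 2) (r : ℝ) :
    |shrink χ t r - shrink χ t₀ r| ≤ 2 * (|t - t₀| * M) := by
  set a := shrink χ t r
  set d := shrink χ t₀ r
  have h1 : stretch χ t a = r := h.stretch_shrink ht r
  have h2 : stretch χ t₀ d = r := h.stretch_shrink ht₀ r
  have h3 : |(t - t₀) * χ d| ≤ |t - t₀| * M := by
    rw [abs_mul]
    exact mul_le_mul_of_nonneg_left (h.bound d) (abs_nonneg _)
  have h4 := abs_le.1 h3
  have h5 : stretch χ t d - stretch χ t a = (t - t₀) * χ d := by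
    rw [h1, ← h2, stretch, stretch]
    ring
  rw [abs_le]
  rcases le_total a d with had | had
  · have := h.stretch_sub_le ht had
    constructor <;> linarith [h4.1]
  · have := h.stretch_sub_le ht had
    constructor <;> linarith [h4.2]

lemma tendsto_collapse {χ : ℝ → ℝ} {R M t₀ : ℝ} (h : IsProfile χ R M) {S : Set ℝ}
    (hS : ∀ t ∈ S, |t| * M ≤ 1 / 2) (ht₀ : t₀ ∈ S) (y : ℂ) :
    Tendsto (fun t => collapse χ t y) (𝓝[S] t₀) (𝓝 (collapse χ t₀ y)) := by
  have h1 : Tendsto (fun t => shrink χ t ‖y‖) (𝓝[S] t₀) (𝓝 (shrink χ t₀ ‖y‖)) := by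
    rw [tendsto_iff_dist_tendsto_zero]
    have h2 : Tendsto (fun t => 2 * (|t - t₀| * M)) (𝓝[S] t₀) (𝓝 0) := by
      have : Continuous fun t : ℝ => 2 * (|t - t₀| * M) := by fun_prop
      simpa using (this.tendsto t₀).mono_left nhdsWithin_le_nhds
    refine squeeze_zero' (Eventually.of_forall fun _ => dist_nonneg) ?_ h2
    filter_upwards [self_mem_nhdsWithin] with t ht
    exact h.abs_shrink_sub_le (hS t ht) (hS t₀ ht₀) _
  exact ((h1.max tendsto_const_nhds).div_const _).smul_const y

namespace LocalModel

/-- The family of sets bounded by the opened neck. -/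
def neckSets (E : Set R3) (p : R3) (b : Frame) (u1 u2 ζ : ℂ → ℝ) (R H : ℝ)
    (s : Bool) (χ : ℝ → ℝ) (ε t : ℝ) : Set R3 :=
  open Classical in
  if t ∈ Ioo 0 ε then deformedSet E (closedBox p b (R / 2) (H / 2)) p b s
    (upperSheet u1 ζ χ (correction u1 u2 ζ (R / 4) (R / 2) χ t) t) (lowerSheet u2 χ t) else E

lemma neckSets_zero : neckSets E p b u1 u2 ζ R H s χ ε 0 = E := if_neg fun h => lt_irrefl _ h.1

lemma neckSets_of_mem (ht : t ∈ Ioo 0 ε) : neckSets E p b u1 u2 ζ R H s χ ε t =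
    deformedSet E (closedBox p b (R / 2) (H / 2)) p b s
      (upperSheet u1 ζ χ (correction u1 u2 ζ (R / 4) (R / 2) χ t) t) (lowerSheet u2 χ t) := if_pos ht

lemma neckSets_sdiff : neckSets E p b u1 u2 ζ R H s χ ε t \ closedBox p b (R / 2) (H / 2) =
    E \ closedBox p b (R / 2) (H / 2) := by
  rw [neckSets]
  split_ifs
  · exact deformedSet_sdiff
  · rfl

section

variable (had : ∀ t ∈ Ico 0 ε, Admissible χ M m H t (correction u1 u2 ζ (R / 4) (R / 2) χ t))

include T hχ had in
lemma measurableSet_neckSets (hE : MeasurableSet E) (t : ℝ) :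
    MeasurableSet (neckSets E p b u1 u2 ζ R H s χ ε t) := by
  rw [neckSets]
  split_ifs with ht
  · have := had t ⟨ht.1.le, ht.2⟩
    exact measurableSet_deformedSet hE (isClosed_closedBox p b _ _).measurableSet
      (T.contDiff_upperSheet hχ this.time this.sign _).continuous
      (T.contDiff_lowerSheet hχ this.time this.sign).continuous
  · exact hE

include h T hχ had in
lemma fillsBox_neckSets (ht : t ∈ Ico 0 ε) : FillsBox p b R H s (neckSets E p b u1 u2 ζ R H s χ ε t)
      (upperSheet u1 ζ χ (correction u1 u2 ζ (R / 4) (R / 2) χ t) t) (lowerSheet u2 χ t) := by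
  rcases ht.1.eq_or_lt with rfl | h0
  · rw [neckSets_zero, correction_zero]
    exact h.fillsBox_self hχ
  · rw [neckSets_of_mem ⟨h0, ht.2⟩]
    exact h.fillsBox_deformedSet T hχ (had t ht)

include h hχ in
lemma chart_mem_neckSets (ht : t ∈ Ico 0 ε) {q : ℂ × ℝ}
    (hq : chart p b q ∈ closedBox p b (R / 2) (H / 2)) (h1 : q.2 ≠ u1 q.1) (h2 : q.2 ≠ u2 q.1) :
    chart p b q ∈ neckSets E p b u1 u2 ζ R H s χ ε t ↔
      (q ∈ midRegion (upperSheet u1 ζ χ (correction u1 u2 ζ (R / 4) (R / 2) χ t) t)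
        (lowerSheet u2 χ t) ↔ s = true) := by
  rcases ht.1.eq_or_lt with rfl | h0
  · have hqB := h.closedBox_subset hq
    rw [openBox, mem_image_chart, chartInv_chart] at hqB
    rw [neckSets_zero, correction_zero, h.fill q hqB h1 h2, midRegion, midRegion, mem_ofPred_eq,
      mem_ofPred_eq, upperSheet, lowerSheet, collapse_zero_time hχ, zero_mul, add_zero]
  · rw [neckSets_of_mem ⟨h0, ht.2⟩, chart_mem_deformedSet hq]

include h T hχ had in
/-- The sets bounded by the opened neck vary continuously in `L¹`. -/
lemma tendsto_volume_symmDiff_neckSets (hU : IsOpen U) (hE : MeasurableSet E) {t₀ : ℝ}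
    (ht₀ : t₀ ∈ Ico 0 ε) :
    Tendsto (fun t => volume (symmDiff (neckSets E p b u1 u2 ζ R H s χ ε t)
      (neckSets E p b u1 u2 ζ R H s χ ε t₀) ∩ U)) (𝓝[Ico 0 ε] t₀) (𝓝 0) := by
  set C := closedBox p b (R / 2) (H / 2) with hC
  set F := neckSets E p b u1 u2 ζ R H s χ ε with hF
  have hFm := measurableSet_neckSets (E := E) (p := p) (b := b) (s := s) T hχ had hE
  have hoff : ∀ t x, x ∉ C → (x ∈ F t ↔ x ∈ E) := fun t x hx => by
    have : x ∈ F t \ C ↔ x ∈ E \ C := by rw [hF, neckSets_sdiff]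
    simpa [Set.mem_sdiff, hx] using this
  have ha₀ := had t₀ ht₀
  have hgraph : ∀ {W : ℂ → ℝ}, Continuous W →
      ∀ᵐ x : R3, (chartInv p b x).2 ≠ W (chartInv p b x).1 := fun {W} hW => by
    have hz := measure_graph_eq_zero hW
    rw [← volume_image_chart p b] at hz
    filter_upwards [measure_eq_zero_iff_ae_notMem.1 hz] with x hx
    rwa [mem_image_chart] at hx
  rw [← measure_empty (μ := (volume : Measure R3))]
  refine tendsto_measure_of_ae_tendsto_indicator _ MeasurableSet.empty
    (fun t => (MeasurableSet.symmDiff (hFm t) (hFm t₀)).inter hU.measurableSet) (B := C)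
    (isClosed_closedBox p b _ _).measurableSet (isCompact_closedBox p b _ _).measure_lt_top.ne
    (Eventually.of_forall fun t x hx => ?_) ?_
  · by_contra hxC
    rcases hx.1 with k | k
    · exact k.2 ((hoff t₀ x hxC).2 ((hoff t x hxC).1 k.1))
    · exact k.2 ((hoff t x hxC).2 ((hoff t₀ x hxC).1 k.1))
  · filter_upwards [hgraph T.smooth1.continuous, hgraph T.smooth2.continuous,
      hgraph (T.contDiff_upperSheet hχ ha₀.time ha₀.sign
        (correction u1 u2 ζ (R / 4) (R / 2) χ t₀)).continuous,
      hgraph (T.contDiff_lowerSheet hχ ha₀.time ha₀.sign).continuous] with x g1 g2 g3 g4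
    obtain ⟨q, rfl⟩ : ∃ q, x = chart p b q := ⟨_, (chart_chartInv p b x).symm⟩
    rw [chartInv_chart] at g1 g2 g3 g4
    have hcol := tendsto_collapse hχ (fun t ht => (had t ht).time) ht₀ q.1
    have hcor : Tendsto (correction u1 u2 ζ (R / 4) (R / 2) χ) (𝓝[Ico 0 ε] t₀)
        (𝓝 (correction u1 u2 ζ (R / 4) (R / 2) χ t₀)) :=
      ((contDiff_correction (n := 0)).continuous.tendsto t₀).mono_left nhdsWithin_le_nhds
    have hev := eventually_mem_midRegion_iff (q := q) (f := fun _ => q)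
      (W1 := fun t => upperSheet u1 ζ χ (correction u1 u2 ζ (R / 4) (R / 2) χ t) t)
      (W2 := fun t => lowerSheet u2 χ t)
      (V1 := upperSheet u1 ζ χ (correction u1 u2 ζ (R / 4) (R / 2) χ t₀) t₀)
      (V2 := lowerSheet u2 χ t₀) tendsto_const_nhds
      (((T.smooth1.continuous.tendsto _).comp hcol).add (hcor.mul_const (ζ q.1)))
      ((T.smooth2.continuous.tendsto _).comp hcol) g3 g4
    filter_upwards [hev, self_mem_nhdsWithin] with t hmid ht
    have hiff : chart p b q ∈ F t ↔ chart p b q ∈ F t₀ := by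
      by_cases hqC : chart p b q ∈ C
      · rw [hF, h.chart_mem_neckSets hχ ht hqC g1 g2, h.chart_mem_neckSets hχ ht₀ hqC g1 g2, hmid]
      · rw [hoff t _ hqC, hoff t₀ _ hqC]
    simp only [mem_inter_iff, mem_symmDiff, mem_empty_iff_false, iff_false]
    tauto

end

end LocalModel


namespace LocalModel

variable (had : ∀ t ∈ Ico 0 ε, Admissible χ M m H t (correction u1 u2 ζ (R / 4) (R / 2) χ t))

include T hχ in
/-- The neck map has a bounded `C¹` initial speed. -/
lemma exists_neckMap_speed : ∃ v : Circle × ℝ → R3,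
    (∀ x ∈ openCyl, HasDerivWithinAt (fun t => neckMap p b ϕ1 ϕ2 ζ χ
      (correction u1 u2 ζ (R / 4) (R / 2) χ t) t x) (v x) (Ici 0) 0) ∧
    ContDiffOn ℝ 1 (cylLift v) (univ ×ˢ Ioo (-1) 1) ∧ ∃ C : ℝ, ∀ x ∈ openCyl, ‖v x‖ ≤ C := by
  set d := deriv (correction u1 u2 ζ (R / 4) (R / 2) χ) 0 with hd
  have hcor : HasDerivAt (correction u1 u2 ζ (R / 4) (R / 2) χ) d 0 :=
    ((contDiff_correction (n := 1)).differentiable one_ne_zero 0).hasDerivAt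
  refine ⟨fun x => neckSpeed b χ x + d • neckLift b ζ x, fun x _ => ?_, ?_,
    ‖frameMap b‖ * M + |d| * ‖frameMap b‖, fun x _ => ?_⟩
  · have h1 := ((hasDerivAt_id (0 : ℝ)).smul_const (neckSpeed b χ x)).add
      (hcor.smul_const (neckLift b ζ x))
    rw [one_smul] at h1
    exact (h1.const_add (neckBase p ϕ1 ϕ2 x)).hasDerivWithinAt
  · exact (contDiffOn_neckSpeed (hχ.smooth.of_le (mod_cast le_top))).add
      ((contDiffOn_neckLift (T.smooth_bump.of_le (mod_cast le_top))).const_smul d)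
  · refine (norm_add_le _ _).trans (add_le_add ?_ ?_)
    · refine ((frameMap b).le_opNorm _).trans (mul_le_mul_of_nonneg_left ?_ (norm_nonneg _))
      rw [Prod.norm_def]
      refine max_le ?_ (by simpa using hχ.nonneg_bound)
      rw [norm_smul, x.1.norm_coe, mul_one]
      exact hχ.bound _
    · rw [norm_smul, Real.norm_eq_abs]
      refine mul_le_mul_of_nonneg_left (((frameMap b).le_opNorm _).trans
        (mul_le_of_le_one_right (norm_nonneg _) ?_)) (abs_nonneg _)
      rw [Prod.norm_def]
      exact max_le (by simp) (T.bump_le _)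

include h T hχ had in
/-- Opening a neck at the contact point is a coalescence deformation. -/
theorem isCoalescence_neckMap (hU : IsOpen U) (hE : IsCaccioppoli E) (hε : 0 < ε) (hχ0 : χ 0 = 1) :
    IsCoalescence U E p ε
      (fun t => neckMap p b ϕ1 ϕ2 ζ χ (correction u1 u2 ζ (R / 4) (R / 2) χ t) t)
      (neckSets E p b u1 u2 ζ R H s χ ε) where
  pos := hε
  mapsTo t ht := h.mapsTo_neckMap T hχ (had t ht)
  contDiffOn := by
    have hm : MapsTo (Prod.snd : ℝ × (ℝ × ℝ) → ℝ × ℝ) (Ico 0 ε ×ˢ (univ ×ˢ Ioo (-1) 1))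
      (univ ×ˢ Ioo (-1) 1) := fun q hq => hq.2
    have hs : ContDiffOn ℝ 1 (Prod.snd : ℝ × (ℝ × ℝ) → ℝ × ℝ) (Ico 0 ε ×ˢ (univ ×ˢ Ioo (-1) 1)) :=
      contDiff_snd.contDiffOn
    have h1 := (contDiffOn_neckBase (p := p) (h.disk1.smooth.of_le (mod_cast le_top))
      (h.disk2.smooth.of_le (mod_cast le_top))).comp hs hm
    have h2 := (contDiffOn_neckSpeed (b := b)
      (hχ.smooth.of_le (mod_cast le_top))).comp hs hm
    have h3 := (contDiffOn_neckLift (b := b)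
      (T.smooth_bump.of_le (mod_cast le_top))).comp hs hm
    exact h1.add ((contDiff_fst.contDiffOn.smul h2).add
      ((contDiff_correction.comp contDiff_fst).contDiffOn.smul h3))
  contDiffOn_time x _ := (contDiff_const.add ((contDiff_id.smul contDiff_const).add
      (contDiff_correction.smul contDiff_const))).contDiffOn
  proper_zero Q hQU hQ := h.isCompact_preimage_neckMap T hχ hQU hQ
  image_zero := by
    rw [h.frontier_eq, ← h.image_neckBase, correction_zero]
    exact image_congr fun x _ => neckMap_zero
  circle_zero w := by
    rw [correction_zero, neckMap_zero]
    simp [neckBase, collar_of_nonpos le_rfl, h.disk1.apply_zero, h.disk2.apply_zero]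
  embedding t ht := h.isEmbedding_neckMap hU T hχ (had t ht)
  immersion t ht θ z hz := h.injective_fderiv_neckMap T hχ (had t ht) θ hz
  localized := by
    have hR := h.disk1.pos
    have hH := h.height_pos
    refine ⟨p, 3 * H / 4, h.closedBall_subset, mem_ball_self (by linarith), fun t _ x hx hxb => ?_⟩
    rcases lt_or_ge (collar x.2 + collar (-x.2)) (R / 2) with h1 | h1
    · refine absurd ?_ hxb
      have hmem := h.neckMap_mem_closedBox T hχ (had 0 ⟨le_rfl, hε⟩) hx h1
      obtain ⟨q, hq, hqx⟩ := hmem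
      rw [← hqx, mem_ball]
      have hd := dist_chart_sq p b q 0
      rw [chart_zero] at hd
      simp only [Prod.fst_zero, Prod.snd_zero, sub_zero] at hd
      have a1 : ‖q.1‖ ≤ H / 4 := by
        have := mem_closedBall_zero_iff.1 hq.1
        linarith [h.le_half_height]
      have a2 : q.2 ^ 2 ≤ (H / 2) ^ 2 := sq_le_sq' hq.2.1 hq.2.2
      refine lt_of_pow_lt_pow_left₀ 2 (by linarith) ?_
      nlinarith [norm_nonneg q.1]
    · simp only [neckMap_of_ge T hχ h1]
  speed := exists_neckMap_speed T hχ
  set_zero := neckSets_zero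
  set_outside t _ := by
    ext x
    have hCU : x ∈ closedBox p b (R / 2) (H / 2) → x ∈ U := fun hx =>
      h.box_subset (h.closedBox_subset hx)
    have := Set.ext_iff.1 (neckSets_sdiff (E := E) (p := p) (b := b) (u1 := u1) (u2 := u2) (ζ := ζ)
      (R := R) (H := H) (s := s) (χ := χ) (ε := ε) (t := t)) x
    simp only [Set.mem_sdiff] at this ⊢
    tauto
  caccioppoli t ht := by
    have hR := h.disk1.pos
    have hH := h.height_pos
    exact isCaccioppoli_of_fillsBox hE (measurableSet_neckSets T hχ had hE.1 t)
      (h.fillsBox_neckSets T hχ had ht) (T.contDiff_upperSheet hχ (had t ht).time (had t ht).sign _)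
      (T.contDiff_lowerSheet hχ (had t ht).time (had t ht).sign)
      (fun y hy => T.lowerSheet_le_upperSheet hχ (had t ht).time (had t ht).sign (had t ht).lt_gap
        (by simpa using hy)) (show H / 2 < H by linarith) (show R / 2 < R by linarith) neckSets_sdiff
  frontier_eq t ht := by
    rcases ht.1.eq_or_lt with rfl | h0
    · rw [neckSets_zero, h.frontier_eq, ← h.image_neckBase, correction_zero]
      exact image_congr fun x _ => neckMap_zero.symm
    · rw [neckSets_of_mem ⟨h0, ht.2⟩]
      exact h.frontier_deformedSet T hχ (had t ht) (by rwa [hχ0, mul_one])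
  continuous_L1 t₀ ht₀ := h.tendsto_volume_symmDiff_neckSets T hχ had hU hE.1 ht₀

include h T hχ had in
lemma isVolumePreserving_neckSets (hE : MeasurableSet E) :
    IsVolumePreserving U ε (neckSets E p b u1 u2 ζ R H s χ ε) := by
  intro t ht
  have hC : MeasurableSet (closedBox p b (R / 2) (H / 2)) :=
    (isClosed_closedBox p b _ _).measurableSet
  have hCU := h.closedBox_subset.trans h.box_subset
  have hin : ∀ A : Set R3, A ∩ U ∩ closedBox p b (R / 2) (H / 2) =
      A ∩ closedBox p b (R / 2) (H / 2) := fun A => by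
    rw [inter_assoc, inter_eq_right.2 hCU]
  rw [neckSets_zero, ← measure_inter_add_sdiff _ hC, ← measure_inter_add_sdiff (E ∩ U) hC, hin, hin,
    inter_sdiff_congr neckSets_sdiff, h.volume_eq T hχ hE (measurableSet_neckSets T hχ had hE t)
      (had t ht) (h.fillsBox_neckSets T hχ had ht)]

include h T hχ in
lemma isRadialNeckOpening_neckMap (hχ0 : χ 0 = 1) (h0 : b 0 ∈ P) (h1 : b 1 ∈ P) (h2 : b 2 ∈ Pᗮ) :
    IsRadialNeckOpening p P ε
      (fun t => neckMap p b ϕ1 ϕ2 ζ χ (correction u1 u2 ζ (R / 4) (R / 2) χ t) t) := by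
  have hR := h.disk1.pos
  obtain ⟨ρ₀, hρ₀, hconst⟩ := hχ.const_near
  refine ⟨b 0, h0, b 1, h1, b.norm_eq_one 0, b.norm_eq_one 1, by simp [b.inner_eq_ite], ?_⟩
  have hev : ∀ᶠ z in 𝓝 (0 : ℝ), z ∈ Ioo (-1 : ℝ) 1 ∧
      collar z + collar (-z) < min ρ₀ (R / 4) := by
    have hn : Ioo (-1 : ℝ) 1 ∈ 𝓝 (0 : ℝ) := Ioo_mem_nhds (by norm_num) (by norm_num)
    have hc : ContinuousAt collar 0 := contDiffOn_collar.continuousOn.continuousAt hn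
    have hc' : ContinuousAt (fun z => collar (-z)) 0 :=
      hc.comp_of_eq continuous_neg.continuousAt neg_zero
    have hsum : ContinuousAt (fun z : ℝ => collar z + collar (-z)) 0 := hc.add hc'
    have := hsum.tendsto
    simp only [neg_zero, collar_of_nonpos le_rfl, add_zero] at this
    exact (eventually_mem_set.2 hn).and (this.eventually_lt_const (lt_min hρ₀ (by linarith)))
  obtain ⟨δ, hδ, hsmall⟩ := Metric.eventually_nhds_iff_ball.1 hev
  refine ⟨δ, hδ, fun w z hz => ?_⟩
  obtain ⟨hz1, hlt⟩ := hsmall z (by simpa using hz)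
  have p1 := collar_nonneg hz1
  have p2 := collar_nonneg (neg_mem_Ioo hz1)
  have hn : ∀ ρ : ℝ, 0 ≤ ρ → ‖ρ • (w : ℂ)‖ = ρ := fun ρ hρ => by
    rw [norm_smul, w.norm_coe, mul_one, Real.norm_of_nonneg hρ]
  have hlt₀ := hlt.trans_le (min_le_left _ _)
  have hlt1 := hlt.trans_le (min_le_right _ _)
  refine ⟨⟨collar z + collar (-z), by positivity, ?_⟩, fun t _ => ?_⟩
  · simp only [correction_zero, neckMap_zero, neckBase]
    have key : ∀ {ϕ u} {ρ : ℝ}, GraphDisk p b (range ϕ) ϕ u R K → 0 ≤ ρ → ρ < R →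
        ϕ (ρ • (w : ℂ)) - p - ρ • ((w : ℂ).re • b 0 + (w : ℂ).im • b 1) ∈ Pᗮ := by
      intro ϕ u ρ D hρ hρR
      rw [D.graph _ (by rwa [hn ρ hρ]), chart]
      have : p + ((ρ • (w : ℂ)).re • b 0 + (ρ • (w : ℂ)).im • b 1 + u (ρ • (w : ℂ)) • b 2) - p -
          ρ • ((w : ℂ).re • b 0 + (w : ℂ).im • b 1) = u (ρ • (w : ℂ)) • b 2 := by
        rw [Complex.real_smul, Complex.re_ofReal_mul, Complex.im_ofReal_mul]
        module
      simp only at this ⊢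
      rw [this]
      exact Pᗮ.smul_mem _ h2
    rcases le_total 0 z with k | k
    · simp only [collar_of_nonpos (neg_nonpos.2 k), zero_smul, h.disk2.apply_zero, add_zero,
        add_sub_cancel_right]
      exact key h.disk1 p1 (by linarith)
    · simp only [collar_of_nonpos k, zero_smul, h.disk1.apply_zero, zero_add, add_sub_cancel_left]
      exact key h.disk2 p2 (by linarith)
  · have hζ : ζ (collar z • (w : ℂ)) = 0 := T.bump_inner _ (by rw [hn _ p1]; linarith)
    simp only [correction_zero, neckMap, neckSpeed, neckLift, hζ, hconst _ hlt₀.le, hχ0, one_smul]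
    simp [frameMap_apply]

end LocalModel

lemma HasSecondRightDeriv.congr_const_add {f e : ℝ → ℝ} {a d ε : ℝ} (hf : HasSecondRightDeriv f d)
    (hε : 0 < ε) (he : ∀ t ∈ Ico 0 ε, e t = a + f t) : HasSecondRightDeriv e d := by
  obtain ⟨f', h1, h2⟩ := hf
  refine ⟨f', ?_, h2⟩
  filter_upwards [h1, Ico_mem_nhdsGE hε] with t ht hte
  refine (ht.const_add a).congr_of_eventuallyEq ?_ (he t hte)
  filter_upwards [self_mem_nhdsWithin, nhdsWithin_le_nhds (Iio_mem_nhds hte.2)] with x hx hx'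
  exact he x ⟨hx, hx'⟩

/-- A smooth function on an open set containing the box agrees on a smaller box with a globally
smooth function. -/
lemma exists_smooth_density {Ω U : Set R3} {g : R3 → ℝ} {p : R3}
    {b : Frame} {R H : ℝ} (hΩ : IsOpen Ω) (hg : ContDiffOn ℝ ∞ g Ω)
    (hUΩ : U ⊆ Ω) (hbox : openBox p b R H ⊆ U) (hR : 0 < R) (hH : 0 < H) :
    ∃ k : ℂ × ℝ → ℝ, ContDiff ℝ ∞ k ∧
      ∀ q ∈ closedBall (0 : ℂ) (R / 2) ×ˢ Icc (-(H / 2)) (H / 2), g (chart p b q) = k q := by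
  set D := closedBox p b (3 * R / 4) (3 * H / 4) with hD
  have hCD : closedBox p b (R / 2) (H / 2) ⊆ interior D :=
    (closedBox_subset_openBox p b (by linarith) (by linarith)).trans
      ((isOpen_openBox p b _ _).subset_interior_iff.2 (openBox_subset_closedBox p b _ _))
  have hDΩ : D ⊆ Ω := ((closedBox_subset_openBox p b (by linarith) (by linarith)).trans hbox).trans hUΩ
  obtain ⟨κ, hκ, ⟨N, -, hCN, hN⟩, hκ0, -⟩ := exists_cutoff (isClosed_closedBox p b _ _) hCD
  have hs : ContDiff ℝ ∞ fun x => κ x * g x := by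
    rw [contDiff_iff_contDiffAt]
    intro x
    by_cases hx : x ∈ Ω
    · exact hκ.contDiffAt.mul (hg.contDiffAt (hΩ.mem_nhds hx))
    · refine (contDiffAt_const (c := (0 : ℝ))).congr_of_eventuallyEq ?_
      filter_upwards [(isClosed_closedBox p b _ _).isOpen_compl.mem_nhds
        (fun hxD => hx (hDΩ hxD) : x ∈ Dᶜ)] with y hy
      rw [hκ0 y hy, zero_mul]
  refine ⟨fun q => κ (chart p b q) * g (chart p b q), hs.comp (contDiff_chart p b), fun q hq => ?_⟩
  simp only [hN _ (hCN ⟨q, hq, rfl⟩), one_mul]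

end

theorem proposition1 (Ω U E : Set R3) (g : R3 → ℝ) (p : R3) (P : Submodule ℝ R3)
    (hΩ : IsOpen Ω) (hg : ContDiffOn ℝ ∞ g Ω)
    (hU : IsOpen U) (hUc : IsCompact (closure U)) (hUΩ : closure U ⊆ Ω)
    (hE : IsCaccioppoli E) (hEL : IsLebesgueRepresentative E)
    (hdisks : IsTouchingDisks U (frontier E ∩ U) p P)
    (hstat : IsAmbientStationary g U E) :
    ¬ IsCoalescenceStable g U E p ∧
      ∀ η : ℝ, 0 < η → ∃ (ε : ℝ) (Ψ : ℝ → Circle × ℝ → R3) (F : ℝ → Set R3),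
        IsCoalescence U E p ε Ψ F ∧ IsVolumePreserving U ε F ∧
        IsRadialNeckOpening p P ε Ψ ∧
        HasDerivWithinAt (fun t => energy g U (F t)) 0 (Ici 0) 0 ∧
        ∃ d : ℝ, HasSecondRightDeriv (fun t => energy g U (F t)) d ∧
          |d + 4 * Real.pi| < η := by
  have main : ∀ η : ℝ, 0 < η → ∃ (ε : ℝ) (Ψ : ℝ → Circle × ℝ → R3) (F : ℝ → Set R3),
      IsCoalescence U E p ε Ψ F ∧ IsVolumePreserving U ε F ∧ IsRadialNeckOpening p P ε Ψ ∧
      HasDerivWithinAt (fun t => energy g U (F t)) 0 (Ici 0) 0 ∧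
      ∃ d : ℝ, HasSecondRightDeriv (fun t => energy g U (F t)) d ∧ |d + 4 * Real.pi| < η := by
    intro η hη
    obtain ⟨b, ϕ1, ϕ2, u1, u2, R, H, K, s, hb0, hb1, hb2, h⟩ := exists_localModel hU hEL hdisks
    obtain ⟨ζ, m, T⟩ := h.exists_twoSheets
    have hH := h.height_pos
    have hUΩ' : U ⊆ Ω := subset_closure.trans hUΩ
    obtain ⟨k, hk, hgk⟩ := exists_smooth_density hΩ hg hUΩ' h.box_subset h.disk1.pos hH
    have hgU : IntegrableOn g U :=
      ((hg.continuousOn.mono hUΩ).integrableOn_compact hUc).mono_set subset_closure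
    have hper : perimeter U E ≠ ⊤ := hE.2 U hU (hUc.isBounded.subset subset_closure)
    have hσ : |boolSign s| ≤ 1 := by cases s <;> simp [boolSign]
    obtain ⟨χ, M, hχ, hχ0, hd1, d, hd2, hdη⟩ := T.exists_profile (hk.of_le two_le_infty) hσ
      (fun χ M hχ hχ0 => h.hasDerivWithinAt_stretchedEnergy_zero T hχ hχ0 hk.continuous hgk hgU hper
        hE.1 hstat) hη
    obtain ⟨ε, hε, hadm⟩ := Metric.eventually_nhds_iff_ball.1 (eventually_admissible (u1 := u1)
      (u2 := u2) (ζ := ζ) (χ := χ) (R1 := R / 4) (R' := R / 2) (M := M) T.gap_pos hH)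
    have had : ∀ t ∈ Ico 0 ε, Admissible χ M m H t (correction u1 u2 ζ (R / 4) (R / 2) χ t) :=
      fun t ht => hadm t (by rw [mem_ball_zero_iff, Real.norm_of_nonneg ht.1]; exact ht.2)
        (by rw [hχ0, mul_one]; exact ht.1)
    have henergy : ∀ t ∈ Ico 0 ε, energy g U (LocalModel.neckSets E p b u1 u2 ζ R H s χ ε t) =
        energyOutside g U E (closedBox p b (R / 2) (H / 2)) s +
          stretchedEnergy k (boolSign s) u1 u2 ζ (R / 4) (R / 2) χ t := fun t ht =>
      h.energy_eq T hχ hk.continuous hgk hgU hper hE.1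
        (LocalModel.measurableSet_neckSets T hχ had hE.1 t) (had t ht)
        (h.fillsBox_neckSets T hχ had ht) LocalModel.neckSets_sdiff
    refine ⟨ε, _, _, h.isCoalescence_neckMap T hχ had hU hE hε hχ0,
      h.isVolumePreserving_neckSets T hχ had hE.1, h.isRadialNeckOpening_neckMap T hχ hχ0 hb0 hb1 hb2,
      ?_, d, hd2.congr_const_add hε henergy, hdη⟩
    refine (hd1.const_add _).congr_of_eventuallyEq ?_ (henergy 0 ⟨le_rfl, hε⟩)
    filter_upwards [Ico_mem_nhdsGE hε] with t ht using henergy t ht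
  refine ⟨fun hstable => ?_, main⟩
  obtain ⟨ε, Ψ, F, h1, h2, -, h4, d, h5, h6⟩ := main 1 one_pos
  have h7 := hstable ε Ψ F h1 h2 h4 d h5
  have := (abs_lt.1 h6).2
  linarith [Real.pi_gt_three]
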